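/- Let $k$ be a field of characteristic zero, and write $V[n]^i=V^{i-n}$ for shifts of graded objects. **Notions.** $\mathrm{dgca}(k)$ is the category of non-positively graded (cohomological) differential graded-commutative $k$-algebras $A$; $L$ is a dg $A$-module, called graded-flat if its underlying graded module is flat, i.e. $-\otimes_A L$ is exact on graded $A$-modules. A finite graded $A$-module is one of the form $A\otimes_k V$ with $\dim_k V<\infty$; a pro-finite module is an inverse system $M=(M_\alpha)$, over a directed set, of finite modules, and it is dual to a graded module $K$, written $M=K^*$, if $K$ is identified with $\varinjlim_\alpha M_\alpha^*$. In particular $L^*[1]=(L[-1])^*$. $\widehat{\mathrm{Sym}}_A(M)$ is the pro-graded algebra $(\mathrm{Sym}_A(M_\alpha)/\mathrm{Sym}_A^{>n}(M_\alpha))_{(\alpha,n)}$, with projection $\pi_M$ to $A$. A derivation of a pro-graded algebra $(X_i)$ is an element of $\varprojlim_j\varinjlim_{i\ge j}\mathrm{Der}_{p_{ij}}(X_i,X_j)$ (derivations of degree one over the transition maps $p_{ij}$), and a differential is a derivation of square zero in the pro-category of vector spaces. The category $\mathrm{fcdga}(k)$ has as objects morphisms $X\to A$ of differential pro-graded commutative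 algebras, with $A\in\mathrm{dgca}(k)$, that are represented by a compatible family of surjections $X_i\to A$ with nilpotent kernels, and as morphisms commutative squares. $\mathrm{CE}(k)$ is its full subcategory on the Chevalley–Eilenberg complexes $((\widehat{\mathrm{Sym}}_A(M),d),A)$, where $A\in\mathrm{dgca}(k)$, $M$ is pro-finite, and $d$ is a differential intertwined by $\pi_M$ with the differential $d_A$ of $A$. The linear part $d^l$ of $d$ is the induced differential of $M$ (the restriction of $d$ to $M$ modulo weight $\ge2$). A strong homotopy (SH) Lie–Rinehart structure on $(A,L)$ consists of graded symmetric $k$-multilinear maps $X_l:\mathrm{Sym}_k^{l+1}(L[-1])\to L[-1]$ and $A$-linear maps $\sigma_l:\mathrm{Sym}^l_A(L[-1])\to\mathrm{Der}(A)$ ($l\ge0$), all of degree one, with $X_0=d_L$, $\sigma_0=d_A$, with $$X_l(m_1,\dots,m_l,a m_{l+1})=\sigma_l(m_1,\dots,m_l)(a)\,m_{l+1}+(-1)^{|a|(1+|m_1|+\dots+|m_l|)}a\,X_l(m_1,\dots,m_{l+1}),$$ and with square zero: for all $n$ and all homogeneous $m_i$, with Koszul signs $\pm$ of the unshuffles,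 $$\sum_{i+l=n}\ \sum_{\tau\in \mathrm{Sh}(l+1,i)}\pm X_i(X_l(m_{\tau(1)},\dots,m_{\tau(l+1)}),m_{\tau(l+2)},\dots,m_{\tau(n+1)})=0,$$ $$\sum_{i+l=n}\Big(\sum_{\tau\in \mathrm{Sh}(l+1,i-1)}\pm \sigma_i(X_l(m_{\tau(1)},\dots,m_{\tau(l+1)}),\dots,m_{\tau(n)})+\sum_{\tau\in \mathrm{Sh}(l,i)}\pm(-1)^{|m_{\tau(1)}|+\dots+|m_{\tau(l)}|}\sigma_l(m_{\tau(1)},\dots,m_{\tau(l)})\,\sigma_i(m_{\tau(l+1)},\dots,m_{\tau(n)})\Big)=0,$$ where the first inner sum of the second identity is present only for $i\ge1$. For $x\in M_\alpha^*$ let $\iota_x$ be the $A$-linear derivation of degree $|x|$ of the symmetric algebra with $\iota_x(m)=x(m)$. If $M=L^*[1]$, a multiderivation $(X_l,\sigma_l)_l$ of $L[-1]$ and a differential $d$ on $\widehat{\mathrm{Sym}}_A(M)$ as above *correspond* to each other if, for all $l$ and all homogeneous $x_i$ in some $M_\alpha^*$ (regarded also as elements of $L[-1]$), the weight $-1$ part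 of the iterated graded commutator $[\cdots[[d,\iota_{x_1}],\iota_{x_2}],\cdots,\iota_{x_{l+1}}]$ is $\iota_{X_l(x_1,\dots,x_{l+1})}$, and the weight $0$ part of $[\cdots[d,\iota_{x_1}],\cdots,\iota_{x_l}]$ restricts on $A$ to $\sigma_l(x_1,\dots,x_l)$. **Theorem.** 1. Let $A\in\mathrm{dgca}(k)$ and let $L$ be a graded-flat dg $A$-module. Then there is a pro-finite module $M=L^*[1]$ dual to $L[-1]$. For every such $M$, the correspondence is a bijection between the SH Lie–Rinehart structures on $(A,L)$ and the Chevalley–Eilenberg complexes $((\widehat{\mathrm{Sym}}_A(L^*[1]),d),A)$ whose linear part is dual to $L$, i.e. $d_L x=d_A\circ x-(-1)^{|x|}x\circ d^l$ for homogeneous $x\in M_\alpha^*$. Moreover every $d$ that corresponds to an SH Lie–Rinehart structure on $(A,L)$ has linear part dual to $L$. 2. Call $((\widehat{\mathrm{Sym}}_A(M),d),A)$ a Chevalley–Eilenberg complex of a flat SH Lie–Rinehart pair $(A,L,X)$ (one with $L$ graded-flat) if $M$ is dual to $L[-1]$ and $d$ corresponds to $X$. Every flat SH Lie–Rinehart pair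 has a Chevalley–Eilenberg complex, any two of these are isomorphic in $\mathrm{CE}(k)$, and every object of $\mathrm{CE}(k)$ is a Chevalley–Eilenberg complex of a flat SH Lie–Rinehart pair. Consequently, for every choice of a Chevalley–Eilenberg complex $\mathrm{CE}(P)$ for each flat SH Lie–Rinehart pair $P$, with morphisms $P\to Q$ of flat SH Lie–Rinehart pairs defined as morphisms $\mathrm{CE}(Q)\to\mathrm{CE}(P)$ in $\mathrm{CE}(k)$, the assignment $P\mapsto \mathrm{CE}(P)$ is an equivalence from the category of flat SH Lie–Rinehart pairs to $\mathrm{CE}(k)^{\mathrm{op}}$; and $\mathrm{CE}(k)\to\mathrm{fcdga}(k)$ is full and faithful. -/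

import Mathlib

universe u

namespace SHLieRinehart

noncomputable section

open CategoryTheory

/-- The Koszul sign `(-1)^n`. -/
def sgn (n : ℤ) : ℤ := (n.negOnePow : ℤ)

theorem sgn_add (m n : ℤ) : sgn (m + n) = sgn m * sgn n := by
  simp [sgn, Int.negOnePow_add]

theorem sgn_zero : sgn 0 = 1 := by simp [sgn]

theorem sgn_mul_self (n : ℤ) : sgn n * sgn n = 1 := by
  rw [sgn, ← Units.val_mul, Int.units_mul_self]; rfl

section Graded

variable {k : Type u} [Field k] {V : Type u} [AddCommGroup V] [Module k V]

theorem graded_induction {gr : ℤ → Submodule k V} (h : DirectSum.IsInternal gr)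
    {P : V → Prop} (v : V) (hom : ∀ i, ∀ x ∈ gr i, P x)
    (add : ∀ x y, P x → P y → P (x + y)) : P v := by
  have hv : v ∈ iSup gr := by rw [h.submodule_iSup_eq_top]; trivial
  refine Submodule.iSup_induction gr (motive := P) hv hom ?_ add
  exact hom 0 0 (Submodule.zero_mem _)

/-- The linear operator multiplying the elements of degree `i` by the scalar `c i`. -/
def scale {gr : ℤ → Submodule k V} (h : DirectSum.IsInternal gr) (c : ℤ → k) : V →ₗ[k] V :=
  (DirectSum.toModule k ℤ V (fun i => c i • (gr i).subtype)) ∘ₗ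
    (LinearEquiv.ofBijective (DirectSum.coeLinearMap gr) h).symm.toLinearMap

theorem scale_of_mem {gr : ℤ → Submodule k V} (h : DirectSum.IsInternal gr) (c : ℤ → k)
    {i : ℤ} {v : V} (hv : v ∈ gr i) : scale h c v = c i • v := by
  have : (LinearEquiv.ofBijective (DirectSum.coeLinearMap gr) h).symm v
      = DirectSum.lof k ℤ (fun i => gr i) i ⟨v, hv⟩ := by
    rw [LinearEquiv.symm_apply_eq]
    exact (DirectSum.coeLinearMap_lof gr i (⟨v, hv⟩ : gr i)).symm
  simp [scale, this]

theorem isInternal_reindex {gr : ℤ → Submodule k V} (h : DirectSum.IsInternal gr) (e : ℤ ≃ ℤ) :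
    DirectSum.IsInternal (fun i => gr (e i)) := by
  rw [DirectSum.isInternal_submodule_iff_iSupIndep_and_iSup_eq_top] at h ⊢
  exact ⟨h.1.comp e.injective, by rw [← h.2]; exact e.iSup_comp (g := gr)⟩

theorem isInternal_of_scale [CharZero k] {gr : ℤ → Submodule k V} (φ : V →ₗ[k] V)
    (hφ : ∀ i, ∀ v ∈ gr i, φ v = ((2 : k) ^ i) • v) (htop : iSup gr = ⊤) :
    DirectSum.IsInternal gr := by
  rw [DirectSum.isInternal_submodule_iff_iSupIndep_and_iSup_eq_top]
  refine ⟨?_, htop⟩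
  have h1 := (Module.End.eigenspaces_iSupIndep (φ : Module.End k V)).comp
    (f := fun i : ℤ => (2 : k) ^ i) (by
      intro i j hij
      have : ((2 : ℚ) ^ i : ℚ) = 2 ^ j := by
        have := hij
        simp only at this
        exact_mod_cast (Rat.cast_injective (α := k) (by push_cast; exact this))
      exact zpow_right_injective₀ (by norm_num) (by norm_num) this)
  refine h1.mono fun i v hv => ?_
  exact Module.End.mem_eigenspace_iff.2 (hφ i v hv)

end Graded

/-- `ℤ`-graded graded-commutative `k`-algebras: the objects of `gca_ℤ(k)`. -/
structure GAlg (k : Type u) [Field k] where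
  carrier : Type u
  [ring : Ring carrier]
  [algebra : Algebra k carrier]
  gr : ℤ → Submodule k carrier
  internal : DirectSum.IsInternal gr
  one_mem : (1 : carrier) ∈ gr 0
  mul_mem : ∀ {i j : ℤ} {a b : carrier}, a ∈ gr i → b ∈ gr j → a * b ∈ gr (i + j)
  comm : ∀ {i j : ℤ} {a b : carrier}, a ∈ gr i → b ∈ gr j → a * b = sgn (i * j) • (b * a)

attribute [instance] GAlg.ring GAlg.algebra

instance (k : Type u) [Field k] : CoeSort (GAlg k) (Type u) := ⟨GAlg.carrier⟩

/-- Morphisms of graded algebras: algebra homomorphisms of degree zero. -/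
@[ext]
structure GAlg.Hom {k : Type u} [Field k] (A B : GAlg k) where
  toAlgHom : A →ₐ[k] B
  map_mem : ∀ (i : ℤ) (a : A), a ∈ A.gr i → toAlgHom a ∈ B.gr i

instance (k : Type u) [Field k] : Category (GAlg k) where
  Hom := GAlg.Hom
  id A := ⟨AlgHom.id k A, fun _ _ h => h⟩
  comp f g := ⟨g.toAlgHom.comp f.toAlgHom, fun i a h => g.map_mem i _ (f.map_mem i a h)⟩

/-- The underlying vector space functor. -/
def GAlg.forget (k : Type u) [Field k] : GAlg k ⥤ ModuleCat.{u} k where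
  obj A := ModuleCat.of k A
  map f := ModuleCat.ofHom f.toAlgHom.toLinearMap

/-- `ℤ`-graded (left) modules over a graded-commutative algebra: the objects of `Mod(A)`. -/
structure GMod {k : Type u} [Field k] (A : GAlg k) where
  carrier : Type u
  [addCommGroup : AddCommGroup carrier]
  [moduleBase : Module k carrier]
  [module : Module A carrier]
  [tower : IsScalarTower k A carrier]
  gr : ℤ → Submodule k carrier
  internal : DirectSum.IsInternal gr
  smul_mem : ∀ {i j : ℤ} {a : A} {m : carrier}, a ∈ A.gr i → m ∈ gr j → a • m ∈ gr (i + j)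

attribute [instance] GMod.addCommGroup GMod.moduleBase GMod.module GMod.tower

instance {k : Type u} [Field k] (A : GAlg k) : CoeSort (GMod A) (Type u) := ⟨GMod.carrier⟩

/-- Morphisms of graded modules: linear maps of degree zero. -/
@[ext]
structure GMod.Hom {k : Type u} [Field k] {A : GAlg k} (M N : GMod A) where
  toLin : M →ₗ[A] N
  map_mem : ∀ (i : ℤ) (m : M), m ∈ M.gr i → toLin m ∈ N.gr i

instance {k : Type u} [Field k] (A : GAlg k) : Category (GMod A) where
  Hom := GMod.Hom
  id M := ⟨LinearMap.id, fun _ _ h => h⟩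
  comp f g := ⟨g.toLin.comp f.toLin, fun i a h => g.map_mem i _ (f.map_mem i a h)⟩

/-- The underlying vector space functor. -/
def GMod.forget {k : Type u} [Field k] (A : GAlg k) : GMod A ⥤ ModuleCat.{u} k where
  obj M := ModuleCat.of k M
  map f := ModuleCat.ofHom (f.toLin.restrictScalars k)

/-- The shift `M[-1]`, with `M[-1]^i = M^{i+1}`. -/
@[reducible] def GMod.shift {k : Type u} [Field k] {A : GAlg k} (M : GMod A) : GMod A where
  carrier := M
  gr i := M.gr (i + 1)
  internal := isInternal_reindex M.internal (Equiv.addRight 1)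
  smul_mem := by
    intro i j a m ha hm
    have := M.smul_mem ha hm
    rwa [← add_assoc] at this

/-- Free finite modules `A ⊗ V` (`V` of finite total dimension), i.e. modules with a finite basis
of homogeneous elements. -/
def GMod.IsFinite {k : Type u} [Field k] {A : GAlg k} (M : GMod A) : Prop :=
  ∃ (n : ℕ) (b : Module.Basis (Fin n) A M), ∀ i, ∃ d : ℤ, b i ∈ M.gr d

section Tensor

open TensorProduct

variable {k : Type u} [Field k] {A : GAlg k}

/-- The subspace of `N ⊗ M` spanned by the elements `n·a ⊗ m - n ⊗ a·m`, where the right action on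
`N` is `n·a = (-1)^{|a||n|} a·n`. -/
def tensorRel (N M : GMod A) : Submodule k (N ⊗[k] M) :=
  Submodule.span k {t | ∃ (i j : ℤ) (a : A) (n : N) (m : M), a ∈ A.gr i ∧ n ∈ N.gr j ∧
    t = (sgn (i * j) • (a • n)) ⊗ₜ[k] m - n ⊗ₜ[k] (a • m)}

/-- The (underlying space of the) tensor product `N ⊗_A M`. -/
abbrev GTensor (N M : GMod A) : Type u := (N ⊗[k] M) ⧸ tensorRel N M

/-- The map `f ⊗_A M` induced by a morphism `f`. -/
def GTensor.map {N N' : GMod A} (f : N ⟶ N') (M : GMod A) : GTensor N M →ₗ[k] GTensor N' M :=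
  (tensorRel N M).mapQ (tensorRel N' M)
    (TensorProduct.map (f.toLin.restrictScalars k) LinearMap.id) (by
      rw [tensorRel, Submodule.span_le]
      rintro _ ⟨i, j, a, n, m, ha, hn, rfl⟩
      refine Submodule.subset_span ⟨i, j, a, f.toLin n, m, ha, f.map_mem _ _ hn, ?_⟩
      simp)

/-- A graded module `M` is flat if the functor `- ⊗_A M` is exact. -/
def GMod.IsFlat (M : GMod A) : Prop :=
  ∀ (N₁ N₂ N₃ : GMod A) (f : N₁ ⟶ N₂) (g : N₂ ⟶ N₃),
    Function.Exact f.toLin g.toLin → Function.Exact (GTensor.map f M) (GTensor.map g M)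

/-- The degree `p` part of the dual `M^* = Hom_A(M, A)`: the `k`-linear maps `x : M → A` of degree
`p` with `x(a·m) = (-1)^{p|a|} a·x(m)`. -/
def GMod.dual (M : GMod A) (p : ℤ) : Submodule k (M →ₗ[k] A) where
  carrier := {x | (∀ (i : ℤ) (m : M), m ∈ M.gr i → x m ∈ A.gr (i + p)) ∧
    ∀ (i : ℤ) (a : A) (m : M), a ∈ A.gr i → x (a • m) = sgn (p * i) • (a * x m)}
  zero_mem' := ⟨fun _ _ _ => Submodule.zero_mem _, fun _ _ _ _ => by simp⟩
  add_mem' := by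
    rintro x y ⟨hx, hx'⟩ ⟨hy, hy'⟩
    refine ⟨fun i m hm => Submodule.add_mem _ (hx i m hm) (hy i m hm), fun i a m ha => ?_⟩
    simp [hx' i a m ha, hy' i a m ha, mul_add]
  smul_mem' := by
    rintro c x ⟨hx, hx'⟩
    refine ⟨fun i m hm => Submodule.smul_mem _ _ (hx i m hm), fun i a m ha => ?_⟩
    simp only [LinearMap.smul_apply, hx' i a m ha, Algebra.mul_smul_comm]
    rw [smul_comm]

/-- The transpose `x ↦ x ∘ f`. -/
def GMod.dualMap {M N : GMod A} (f : M ⟶ N) (p : ℤ) (x : N.dual p) : M.dual p :=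
  ⟨x.1 ∘ₗ f.toLin.restrictScalars k, fun i m hm => x.2.1 i _ (f.map_mem i m hm),
    fun i a m ha => by simp [x.2.2 i a _ ha]⟩

end Tensor

theorem GMod.dual_smul {k : Type u} [Field k] {A : GAlg k} {M : GMod A} {p : ℤ} (x : M.dual p)
    (a : A) (m : M) : x.1 (a • m) = scale A.internal (fun i => (sgn (p * i) : k)) a * x.1 m := by
  refine graded_induction A.internal (P := fun a => x.1 (a • m) = scale A.internal _ a * x.1 m) a
    (fun i b hb => ?_) (fun b c hb hc => ?_)
  · rw [x.2.2 i b m hb, scale_of_mem _ _ hb, smul_mul_assoc, Int.cast_smul_eq_zsmul]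
  · simp only [add_smul, map_add, add_mul, hb, hc]

/-- A multiplicative function of the degree induces an algebra endomorphism. -/
def GAlg.scaleHom {k : Type u} [Field k] (A : GAlg k) (c : ℤ → k) (h0 : c 0 = 1)
    (hadd : ∀ i j, c (i + j) = c i * c j) : A →ₐ[k] A :=
  AlgHom.ofLinearMap (scale A.internal c) (by rw [scale_of_mem _ _ A.one_mem, h0, one_smul]) (by
    intro a b
    induction a using graded_induction A.internal with
    | add x y hx hy => simp only [add_mul, map_add, hx, hy]
    | hom i a ha =>
      induction b using graded_induction A.internal with
      | add x y hx hy => simp only [mul_add, map_add, hx, hy]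
      | hom j b hb =>
        rw [scale_of_mem _ _ ha, scale_of_mem _ _ hb, scale_of_mem _ _ (A.mul_mem ha hb), hadd]
        simp [smul_smul, mul_comm])

/-- The parity automorphism `a ↦ (-1)^{p|a|} a`. -/
def GAlg.parity {k : Type u} [Field k] (A : GAlg k) (p : ℤ) : A →ₐ[k] A :=
  A.scaleHom (fun i => (sgn (p * i) : k)) (by simp [sgn_zero])
    (by intro i j; rw [mul_add, sgn_add]; push_cast; rfl)

theorem GAlg.parity_apply {k : Type u} [Field k] (A : GAlg k) (p : ℤ) (a : A) :
    A.parity p a = scale A.internal (fun i => (sgn (p * i) : k)) a := rfl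

theorem GAlg.parity_of_mem {k : Type u} [Field k] (A : GAlg k) (p : ℤ) {i : ℤ} {a : A}
    (ha : a ∈ A.gr i) : A.parity p a = sgn (p * i) • a := by
  rw [GAlg.parity_apply, scale_of_mem _ _ ha, Int.cast_smul_eq_zsmul]

section Sym

set_option linter.unusedSectionVars false

variable {k : Type u} [Field k] [CharZero k] {A : GAlg k} (M : GMod A) (N : ℕ∞)

/-- The tensor algebra over `k` on `A × M`, of which the symmetric algebra is a quotient. -/
abbrev SymPre : Type u := TensorAlgebra k (A × M)

variable {M} in
/-- The generator given by an element of `A`. -/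
def preA (a : A) : SymPre M := TensorAlgebra.ι k (a, 0)

variable {M} in
/-- The generator given by an element of `M`. -/
def preM (m : M) : SymPre M := TensorAlgebra.ι k (0, m)

/-- The defining relations of `Sym_A(M) / Sym_A^{>N}(M)`: the first three make the algebra an
`A`-algebra generated by the `A`-module `M`, the next two are graded commutativity, and the last
one kills the elements of weight larger than `N` (and is void for `N = ⊤`). -/
inductive SymRel : SymPre M → SymPre M → Prop
  | one : SymRel (preA 1) 1
  | mul (a b : A) : SymRel (preA (a * b)) (preA a * preA b)
  | smul (a : A) (m : M) : SymRel (preM (a • m)) (preA a * preM m)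
  | comm_MA (i j : ℤ) (m : M) (a : A) (hm : m ∈ M.gr i) (ha : a ∈ A.gr j) :
      SymRel (preM m * preA a) (sgn (i * j) • (preA a * preM m))
  | comm_MM (i j : ℤ) (m m' : M) (hm : m ∈ M.gr i) (hm' : m' ∈ M.gr j) :
      SymRel (preM m * preM m') (sgn (i * j) • (preM m' * preM m))
  | trunc (l : List M) (hl : N < l.length) : SymRel (l.map preM).prod 0

/-- The underlying `k`-algebra of `Sym_A(M) / Sym_A^{>N}(M)`; for `N = ⊤` this is `Sym_A(M)`. -/
def SymAlg : Type u := RingQuot (SymRel M N)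

instance : Ring (SymAlg M N) := inferInstanceAs (Ring (RingQuot (SymRel M N)))

instance : Algebra k (SymAlg M N) := inferInstanceAs (Algebra k (RingQuot (SymRel M N)))

namespace SymAlg

/-- The quotient map from the tensor algebra. -/
def mk : SymPre M →ₐ[k] SymAlg M N := RingQuot.mkAlgHom k (SymRel M N)

variable {M N} in
theorem mk_rel {x y : SymPre M} (h : SymRel M N x y) : mk M N x = mk M N y :=
  RingQuot.mkAlgHom_rel k h

/-- The inclusion of `A`. -/
def ofA : A →ₐ[k] SymAlg M N :=
  AlgHom.ofLinearMap
    ((mk M N).toLinearMap ∘ₗ TensorAlgebra.ι k ∘ₗ LinearMap.inl k A M)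
    (by
      have := mk_rel (SymRel.one (M := M) (N := N))
      rw [map_one] at this; exact this)
    (by
      intro a b
      have := mk_rel (SymRel.mul (M := M) (N := N) a b)
      rw [map_mul] at this; exact this)

/-- The inclusion of `M` (in weight one). -/
def ofM : M →ₗ[k] SymAlg M N :=
  (mk M N).toLinearMap ∘ₗ TensorAlgebra.ι k ∘ₗ LinearMap.inr k A M

theorem mk_preA (a : A) : mk M N (preA a) = ofA M N a := rfl

theorem mk_preM (m : M) : mk M N (preM m) = ofM M N m := rfl

theorem ofM_smul (a : A) (m : M) : ofM M N (a • m) = ofA M N a * ofM M N m := by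
  have := mk_rel (SymRel.smul (M := M) (N := N) a m)
  rwa [map_mul] at this

theorem comm_MA {i j : ℤ} {m : M} {a : A} (hm : m ∈ M.gr i) (ha : a ∈ A.gr j) :
    ofM M N m * ofA M N a = sgn (i * j) • (ofA M N a * ofM M N m) := by
  have := mk_rel (SymRel.comm_MA (M := M) (N := N) i j m a hm ha)
  rwa [map_mul, map_zsmul, map_mul] at this

theorem comm_MM {i j : ℤ} {m m' : M} (hm : m ∈ M.gr i) (hm' : m' ∈ M.gr j) :
    ofM M N m * ofM M N m' = sgn (i * j) • (ofM M N m' * ofM M N m) := by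
  have := mk_rel (SymRel.comm_MM (M := M) (N := N) i j m m' hm hm')
  rwa [map_mul, map_zsmul, map_mul] at this

theorem trunc (l : List M) (hl : N < l.length) : (l.map (ofM M N)).prod = 0 := by
  have := mk_rel (SymRel.trunc (M := M) (N := N) l hl)
  rw [map_zero, map_list_prod, List.map_map] at this
  exact this

variable {M N}

/-- The universal property. -/
def lift {B : Type u} [Ring B] [Algebra k B] (fA : A →ₐ[k] B) (fM : M →ₗ[k] B)
    (hsmul : ∀ (a : A) (m : M), fM (a • m) = fA a * fM m)
    (hMA : ∀ (i j : ℤ) (m : M) (a : A), m ∈ M.gr i → a ∈ A.gr j →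
      fM m * fA a = sgn (i * j) • (fA a * fM m))
    (hMM : ∀ (i j : ℤ) (m m' : M), m ∈ M.gr i → m' ∈ M.gr j →
      fM m * fM m' = sgn (i * j) • (fM m' * fM m))
    (htrunc : ∀ l : List M, N < l.length → (l.map fM).prod = 0) : SymAlg M N →ₐ[k] B :=
  RingQuot.liftAlgHom k ⟨TensorAlgebra.lift k (LinearMap.coprod fA.toLinearMap fM), by
    have hA : ∀ a : A, TensorAlgebra.lift k (LinearMap.coprod fA.toLinearMap fM) (preA a) = fA a :=
      fun a => by simp [preA]
    have hM : ∀ m : M, TensorAlgebra.lift k (LinearMap.coprod fA.toLinearMap fM) (preM m) = fM m :=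
      fun m => by simp [preM]
    intro x y h
    cases h with
    | one => rw [hA, map_one, map_one]
    | mul a b => rw [map_mul, hA, hA, hA, map_mul]
    | smul a m => rw [map_mul, hA, hM, hM, hsmul]
    | comm_MA i j m a hm ha => rw [map_zsmul, map_mul, map_mul, hA, hM, hMA i j m a hm ha]
    | comm_MM i j m m' hm hm' => rw [map_zsmul, map_mul, map_mul, hM, hM, hMM i j m m' hm hm']
    | trunc l hl =>
      rw [map_zero, map_list_prod, List.map_map, ← htrunc l hl]
      congr 2
      funext m
      exact hM m⟩

section

variable {B : Type u} [Ring B] [Algebra k B] (fA : A →ₐ[k] B) (fM : M →ₗ[k] B)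
    (hsmul : ∀ (a : A) (m : M), fM (a • m) = fA a * fM m)
    (hMA : ∀ (i j : ℤ) (m : M) (a : A), m ∈ M.gr i → a ∈ A.gr j →
      fM m * fA a = sgn (i * j) • (fA a * fM m))
    (hMM : ∀ (i j : ℤ) (m m' : M), m ∈ M.gr i → m' ∈ M.gr j →
      fM m * fM m' = sgn (i * j) • (fM m' * fM m))
    (htrunc : ∀ l : List M, N < l.length → (l.map fM).prod = 0)

@[simp] theorem lift_ofA (a : A) : lift fA fM hsmul hMA hMM htrunc (ofA M N a) = fA a := by
  refine (RingQuot.liftAlgHom_mkAlgHom_apply k _ _ (preA a)).trans ?_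
  simp [preA]

@[simp] theorem lift_ofM (m : M) : lift fA fM hsmul hMA hMM htrunc (ofM M N m) = fM m := by
  refine (RingQuot.liftAlgHom_mkAlgHom_apply k _ _ (preM m)).trans ?_
  simp [preM]

end

theorem mul_induction {P : SymAlg M N → Prop} (one : P 1) (add : ∀ s t, P s → P t → P (s + t))
    (base : ∀ (c : k) (s), P s → P (c • s))
    (mulA : ∀ (a : A) (s), P s → P (ofA M N a * s))
    (mulM : ∀ (m : M) (s), P s → P (ofM M N m * s)) (s : SymAlg M N) : P s := by
  obtain ⟨t, rfl⟩ := RingQuot.mkAlgHom_surjective k (SymRel M N) s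
  change P (mk M N t)
  have key : ∀ s, P s → P (mk M N t * s) := by
    induction t using TensorAlgebra.induction with
    | algebraMap r =>
      intro s hs
      rw [AlgHom.commutes, ← Algebra.smul_def]
      exact base r s hs
    | ι x =>
      intro s hs
      have : mk M N (TensorAlgebra.ι k x)
          = ofA M N x.1 + ofM M N x.2 := by
        rw [← mk_preA, ← mk_preM, ← map_add, preA, preM, ← map_add]
        simp
      rw [this, add_mul]
      exact add _ _ (mulA _ _ hs) (mulM _ _ hs)
    | mul a b ha hb =>
      intro s hs
      rw [map_mul, mul_assoc]
      exact ha _ (hb _ hs)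
    | add a b ha hb =>
      intro s hs
      rw [map_add, add_mul]
      exact add _ _ (ha _ hs) (hb _ hs)
  simpa using key 1 one

theorem hom_ext {B : Type u} [Ring B] [Algebra k B] {f g : SymAlg M N →ₐ[k] B}
    (hA : ∀ a, f (ofA M N a) = g (ofA M N a)) (hM : ∀ m, f (ofM M N m) = g (ofM M N m)) :
    f = g := by
  refine AlgHom.ext fun s => ?_
  induction s using mul_induction with
  | one => simp
  | add s t hs ht => simp [hs, ht]
  | base c s hs => simp [hs]
  | mulA a s hs => simp [hs, hA]
  | mulM m s hs => simp [hs, hM]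

variable (M N)

/-- Products of homogeneous generators, indexed by their degree. -/
inductive Monomial : ℤ → SymAlg M N → Prop
  | one : Monomial 0 1
  | mulA {i j : ℤ} {a : A} {s : SymAlg M N} (ha : a ∈ A.gr i) (hs : Monomial j s) :
      Monomial (i + j) (ofA M N a * s)
  | mulM {i j : ℤ} {m : M} {s : SymAlg M N} (hm : m ∈ M.gr i) (hs : Monomial j s) :
      Monomial (i + j) (ofM M N m * s)

/-- The degree `n` part of the symmetric algebra. -/
def gr (n : ℤ) : Submodule k (SymAlg M N) := Submodule.span k {s | Monomial M N n s}

variable {M N}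

theorem one_mem_gr : (1 : SymAlg M N) ∈ gr M N 0 := Submodule.subset_span Monomial.one

theorem ofA_mul_mem {i j : ℤ} {a : A} {s : SymAlg M N} (ha : a ∈ A.gr i) (hs : s ∈ gr M N j) :
    ofA M N a * s ∈ gr M N (i + j) := by
  induction hs using Submodule.span_induction with
  | mem s hs => exact Submodule.subset_span (Monomial.mulA ha hs)
  | zero => simp
  | add s t _ _ hs ht => rw [mul_add]; exact Submodule.add_mem _ hs ht
  | smul c s _ hs => rw [mul_smul_comm]; exact Submodule.smul_mem _ _ hs

theorem ofM_mul_mem {i j : ℤ} {m : M} {s : SymAlg M N} (hm : m ∈ M.gr i) (hs : s ∈ gr M N j) :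
    ofM M N m * s ∈ gr M N (i + j) := by
  induction hs using Submodule.span_induction with
  | mem s hs => exact Submodule.subset_span (Monomial.mulM hm hs)
  | zero => simp
  | add s t _ _ hs ht => rw [mul_add]; exact Submodule.add_mem _ hs ht
  | smul c s _ hs => rw [mul_smul_comm]; exact Submodule.smul_mem _ _ hs

theorem ofA_mem {i : ℤ} {a : A} (ha : a ∈ A.gr i) : ofA M N a ∈ gr M N i := by
  simpa using ofA_mul_mem ha one_mem_gr

theorem ofM_mem {i : ℤ} {m : M} (hm : m ∈ M.gr i) : ofM M N m ∈ gr M N i := by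
  simpa using ofM_mul_mem hm one_mem_gr

theorem mul_mem {i j : ℤ} {s t : SymAlg M N} (hs : s ∈ gr M N i) (ht : t ∈ gr M N j) :
    s * t ∈ gr M N (i + j) := by
  induction hs using Submodule.span_induction with
  | mem s hs =>
    induction hs with
    | one => simpa using ht
    | mulA ha _ ih => rw [mul_assoc, add_assoc]; exact ofA_mul_mem ha ih
    | mulM hm _ ih => rw [mul_assoc, add_assoc]; exact ofM_mul_mem hm ih
  | zero => simp
  | add s t _ _ hs ht => rw [add_mul]; exact Submodule.add_mem _ hs ht
  | smul c s _ hs => rw [smul_mul_assoc]; exact Submodule.smul_mem _ _ hs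

theorem mem_iSup_gr (s : SymAlg M N) : s ∈ iSup (gr M N) := by
  induction s using mul_induction with
  | one => exact Submodule.mem_iSup_of_mem 0 one_mem_gr
  | add s t hs ht => exact Submodule.add_mem _ hs ht
  | base c s hs => exact Submodule.smul_mem _ _ hs
  | mulA a s hs =>
    induction hs using Submodule.iSup_induction' with
    | zero => simp
    | add s t _ _ hs ht => rw [mul_add]; exact Submodule.add_mem _ hs ht
    | mem j s hs =>
      induction a using graded_induction A.internal with
      | hom i a ha => exact Submodule.mem_iSup_of_mem _ (ofA_mul_mem ha hs)
      | add a b ha hb => rw [map_add, add_mul]; exact Submodule.add_mem _ ha hb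
  | mulM m s hs =>
    induction hs using Submodule.iSup_induction' with
    | zero => simp
    | add s t _ _ hs ht => rw [mul_add]; exact Submodule.add_mem _ hs ht
    | mem j s hs =>
      induction m using graded_induction M.internal with
      | hom i m hm => exact Submodule.mem_iSup_of_mem _ (ofM_mul_mem hm hs)
      | add a b ha hb => rw [map_add, add_mul]; exact Submodule.add_mem _ ha hb

theorem two_zpow_add (i j : ℤ) : (2 : k) ^ (i + j) = 2 ^ i * 2 ^ j :=
  zpow_add₀ two_ne_zero i j

theorem scale_smul (a : A) (m : M) : scale M.internal (fun i => (2 : k) ^ i) (a • m)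
    = A.scaleHom (fun i => (2 : k) ^ i) (by simp) two_zpow_add a
      • scale M.internal (fun i => (2 : k) ^ i) m := by
  change _ = scale A.internal (fun i => (2 : k) ^ i) a • scale M.internal (fun i => (2 : k) ^ i) m
  induction a using graded_induction A.internal with
  | add x y hx hy => simp only [add_smul, map_add, hx, hy]
  | hom i a ha =>
    induction m using graded_induction M.internal with
    | add x y hx hy => simp only [smul_add, map_add, hx, hy]
    | hom j m hm =>
      rw [scale_of_mem _ _ ha, scale_of_mem _ _ hm, scale_of_mem _ _ (M.smul_mem ha hm),
        two_zpow_add, ← smul_smul, smul_assoc]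
      congr 1
      exact (smul_algebra_smul_comm _ _ _).symm

variable (M N) in
/-- The automorphism multiplying elements of degree `i` by `2^i`, used to separate degrees. -/
def dilation : SymAlg M N →ₐ[k] SymAlg M N :=
  lift ((ofA M N).comp (A.scaleHom (fun i => (2 : k) ^ i) (by simp) two_zpow_add))
    (ofM M N ∘ₗ scale M.internal (fun i => (2 : k) ^ i))
    (fun a m => by
      simp only [LinearMap.comp_apply, AlgHom.comp_apply, scale_smul, ofM_smul])
    (fun i j m a hm ha => by
      have : A.scaleHom (fun i => (2 : k) ^ i) (by simp) two_zpow_add a = (2 : k) ^ j • a :=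
        scale_of_mem _ _ ha
      simp only [LinearMap.comp_apply, AlgHom.comp_apply, scale_of_mem _ _ hm, this, map_smul,
        smul_mul_smul_comm, comm_MA M N hm ha]
      rw [smul_comm, mul_comm ((2 : k) ^ i)])
    (fun i j m m' hm hm' => by
      simp only [LinearMap.comp_apply, scale_of_mem _ _ hm, scale_of_mem _ _ hm', map_smul,
        smul_mul_smul_comm, comm_MM M N hm hm']
      rw [smul_comm, mul_comm ((2 : k) ^ i)])
    (fun l hl => by
      have := trunc M N (l.map (scale M.internal (fun i => (2 : k) ^ i))) (by simpa using hl)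
      rw [List.map_map] at this
      exact this)

theorem dilation_of_mem {i : ℤ} {s : SymAlg M N} (hs : s ∈ gr M N i) :
    dilation M N s = (2 : k) ^ i • s := by
  induction hs using Submodule.span_induction with
  | mem s hs =>
    induction hs with
    | one => simp
    | mulA ha _ ih =>
      have h1 := scale_of_mem A.internal (fun i => (2 : k) ^ i) ha
      rw [map_mul, ih, two_zpow_add, ← smul_mul_smul_comm, ← map_smul, ← h1]
      congr 1
      exact lift_ofA _ _ _ _ _ _ _
    | mulM hm _ ih =>
      have h1 := scale_of_mem M.internal (fun i => (2 : k) ^ i) hm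
      rw [map_mul, ih, two_zpow_add, ← smul_mul_smul_comm, ← map_smul, ← h1]
      congr 1
      exact lift_ofM _ _ _ _ _ _ _
  | zero => simp
  | add s t _ _ hs ht => rw [map_add, smul_add, hs, ht]
  | smul c s _ hs => rw [map_smul, hs, smul_comm]

theorem internal : DirectSum.IsInternal (gr M N) :=
  isInternal_of_scale (dilation M N).toLinearMap (fun _ _ h => dilation_of_mem h)
    (eq_top_iff.2 fun s _ => mem_iSup_gr s)

theorem comm_ofA {i j : ℤ} {a : A} {t : SymAlg M N} (ha : a ∈ A.gr i) (ht : t ∈ gr M N j) :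
    ofA M N a * t = sgn (i * j) • (t * ofA M N a) := by
  induction ht using Submodule.span_induction with
  | mem t ht =>
    induction ht with
    | one => simp [sgn_zero]
    | @mulA i' j' b s hb hs ih =>
      rw [← mul_assoc, ← map_mul, A.comm ha hb, map_zsmul, map_mul, smul_mul_assoc, mul_assoc, ih,
        mul_smul_comm, smul_smul, ← sgn_add, mul_add, mul_assoc]
    | @mulM i' j' m s hm hs ih =>
      have h := comm_MA M N hm ha
      have h' : ofA M N a * ofM M N m = sgn (i * i') • (ofM M N m * ofA M N a) := by
        rw [h, smul_smul, mul_comm i' i, sgn_mul_self, one_smul]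
      rw [← mul_assoc, h', smul_mul_assoc, mul_assoc, ih, mul_smul_comm, smul_smul, ← sgn_add,
        mul_add, mul_assoc]
  | zero => simp
  | add s t _ _ hs ht => rw [mul_add, add_mul, smul_add, hs, ht]
  | smul c s _ hs => rw [mul_smul_comm, smul_mul_assoc, hs, smul_comm]

theorem comm_ofM {i j : ℤ} {m : M} {t : SymAlg M N} (hm : m ∈ M.gr i) (ht : t ∈ gr M N j) :
    ofM M N m * t = sgn (i * j) • (t * ofM M N m) := by
  induction ht using Submodule.span_induction with
  | mem t ht =>
    induction ht with
    | one => simp [sgn_zero]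
    | @mulA i' j' b s hb hs ih =>
      rw [← mul_assoc, comm_MA M N hm hb, smul_mul_assoc, mul_assoc, ih,
        mul_smul_comm, smul_smul, ← sgn_add, mul_add, mul_assoc]
    | @mulM i' j' m' s hm' hs ih =>
      rw [← mul_assoc, comm_MM M N hm hm', smul_mul_assoc, mul_assoc, ih, mul_smul_comm, smul_smul,
        ← sgn_add, mul_add, mul_assoc]
  | zero => simp
  | add s t _ _ hs ht => rw [mul_add, add_mul, smul_add, hs, ht]
  | smul c s _ hs => rw [mul_smul_comm, smul_mul_assoc, hs, smul_comm]

theorem comm {i j : ℤ} {s t : SymAlg M N} (hs : s ∈ gr M N i) (ht : t ∈ gr M N j) :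
    s * t = sgn (i * j) • (t * s) := by
  induction hs using Submodule.span_induction with
  | mem s hs =>
    induction hs with
    | one => simp [sgn_zero]
    | mulA ha _ ih =>
      rw [mul_assoc, ih, mul_smul_comm, ← mul_assoc, comm_ofA ha ht, smul_mul_assoc, smul_smul,
        ← sgn_add, mul_assoc, add_mul, add_comm]
    | mulM hm _ ih =>
      rw [mul_assoc, ih, mul_smul_comm, ← mul_assoc, comm_ofM hm ht, smul_mul_assoc, smul_smul,
        ← sgn_add, mul_assoc, add_mul, add_comm]
  | zero => simp
  | add s t _ _ hs ht => rw [mul_add, add_mul, smul_add, hs, ht]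
  | smul c s _ hs => rw [mul_smul_comm, smul_mul_assoc, hs, smul_comm]

end SymAlg

/-- The graded algebra `Sym_A(M) / Sym_A^{>N}(M)`; for `N = ⊤` this is `Sym_A(M)`. -/
@[reducible] def Sym : GAlg k where
  carrier := SymAlg M N
  gr := SymAlg.gr M N
  internal := SymAlg.internal
  one_mem := SymAlg.one_mem_gr
  mul_mem := SymAlg.mul_mem
  comm := SymAlg.comm

namespace SymAlg

variable {M N}

/-- Functoriality in `M` and `N`, for `N' ≤ N`. -/
def map {M' : GMod A} (f : M ⟶ M') {N' : ℕ∞} (h : N' ≤ N) : SymAlg M N →ₐ[k] SymAlg M' N' :=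
  lift (ofA M' N') (ofM M' N' ∘ₗ f.toLin.restrictScalars k)
    (fun a m => by simp [ofM_smul])
    (fun _ _ m _ hm ha => by simpa using comm_MA M' N' (f.map_mem _ m hm) ha)
    (fun _ _ m m' hm hm' => by simpa using comm_MM M' N' (f.map_mem _ m hm) (f.map_mem _ m' hm'))
    (fun l hl => by
      have := trunc M' N' (l.map f.toLin) (by simpa using h.trans_lt hl)
      rw [List.map_map] at this
      exact this)

@[simp] theorem map_ofA {M' : GMod A} (f : M ⟶ M') {N' : ℕ∞} (h : N' ≤ N) (a : A) :
    map f h (ofA M N a) = ofA M' N' a := lift_ofA _ _ _ _ _ _ _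

@[simp] theorem map_ofM {M' : GMod A} (f : M ⟶ M') {N' : ℕ∞} (h : N' ≤ N) (m : M) :
    map f h (ofM M N m) = ofM M' N' (f.toLin m) := lift_ofM _ _ _ _ _ _ _

/-- The projection onto `A`, killing `M`. -/
def proj (M : GMod A) (N : ℕ∞) : SymAlg M N →ₐ[k] A :=
  lift (AlgHom.id k A) 0 (by simp) (by simp) (by simp) (fun l hl => by
    cases l with
    | nil => simp at hl
    | cons => simp)

@[simp] theorem proj_ofA (a : A) : proj M N (ofA M N a) = a := lift_ofA _ _ _ _ _ _ _

@[simp] theorem proj_ofM (m : M) : proj M N (ofM M N m) = 0 := lift_ofM _ _ _ _ _ _ _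

theorem hom_mem {B : GAlg k} (f : SymAlg M N →ₐ[k] B)
    (hA : ∀ i a, a ∈ A.gr i → f (ofA M N a) ∈ B.gr i)
    (hM : ∀ i m, m ∈ M.gr i → f (ofM M N m) ∈ B.gr i) (i : ℤ) (s : SymAlg M N)
    (hs : s ∈ gr M N i) : f s ∈ B.gr i := by
  induction hs using Submodule.span_induction with
  | mem s hs =>
    induction hs with
    | one => rw [map_one]; exact B.one_mem
    | mulA ha _ ih => rw [map_mul]; exact B.mul_mem (hA _ _ ha) ih
    | mulM hm _ ih => rw [map_mul]; exact B.mul_mem (hM _ _ hm) ih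
  | zero => rw [map_zero]; exact Submodule.zero_mem _
  | add s t _ _ hs ht => rw [map_add]; exact Submodule.add_mem _ hs ht
  | smul c s _ hs => rw [map_smul]; exact Submodule.smul_mem _ _ hs

end SymAlg

/-- Functoriality of the truncated symmetric algebra. -/
def Sym.map {M M' : GMod A} (f : M ⟶ M') {N N' : ℕ∞} (h : N' ≤ N) : Sym M N ⟶ Sym M' N' :=
  ⟨SymAlg.map f h, SymAlg.hom_mem (B := Sym M' N') _
    (fun i a ha => by rw [SymAlg.map_ofA]; exact SymAlg.ofA_mem ha)
    (fun i m hm => by rw [SymAlg.map_ofM]; exact SymAlg.ofM_mem (f.map_mem i m hm))⟩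

theorem Sym.map_id (M : GMod A) (N : ℕ∞) : Sym.map (𝟙 M) (le_refl N) = 𝟙 (Sym M N) :=
  GAlg.Hom.ext (SymAlg.hom_ext (fun a => SymAlg.map_ofA (𝟙 M) (le_refl N) a)
    (fun m => SymAlg.map_ofM (𝟙 M) (le_refl N) m))

theorem Sym.map_comp {M M' M'' : GMod A} (f : M ⟶ M') (g : M' ⟶ M'') {N N' N'' : ℕ∞}
    (h : N' ≤ N) (h' : N'' ≤ N') :
    Sym.map f h ≫ Sym.map g h' = Sym.map (f ≫ g) (h'.trans h) := by
  refine GAlg.Hom.ext (SymAlg.hom_ext (fun a => ?_) (fun m => ?_))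
  · change SymAlg.map g h' (SymAlg.map f h (SymAlg.ofA M N a))
      = SymAlg.map (f ≫ g) (h'.trans h) (SymAlg.ofA M N a)
    rw [SymAlg.map_ofA, SymAlg.map_ofA, SymAlg.map_ofA]
  · change SymAlg.map g h' (SymAlg.map f h (SymAlg.ofM M N m))
      = SymAlg.map (f ≫ g) (h'.trans h) (SymAlg.ofM M N m)
    rw [SymAlg.map_ofM, SymAlg.map_ofM, SymAlg.map_ofM]
    rfl

/-- The projection `Sym_A(M) / Sym_A^{>N}(M) → A`. -/
def Sym.proj (M : GMod A) (N : ℕ∞) : Sym M N ⟶ A :=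
  ⟨SymAlg.proj M N, SymAlg.hom_mem (B := A) _
    (fun i a ha => by rwa [SymAlg.proj_ofA])
    (fun i m hm => by rw [SymAlg.proj_ofM]; exact Submodule.zero_mem _)⟩

theorem Sym.map_proj {M M' : GMod A} (f : M ⟶ M') {N N' : ℕ∞} (h : N' ≤ N) :
    Sym.map f h ≫ Sym.proj M' N' = Sym.proj M N := by
  refine GAlg.Hom.ext (SymAlg.hom_ext (fun a => ?_) (fun m => ?_))
  · change SymAlg.proj M' N' (SymAlg.map f h (SymAlg.ofA M N a)) = SymAlg.proj M N _
    rw [SymAlg.map_ofA, SymAlg.proj_ofA, SymAlg.proj_ofA]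
  · change SymAlg.proj M' N' (SymAlg.map f h (SymAlg.ofM M N m)) = SymAlg.proj M N _
    rw [SymAlg.map_ofM, SymAlg.proj_ofM, SymAlg.proj_ofM]

namespace SymAlg

variable {M N}

variable (M N) in
/-- The subspace spanned by the products of an element of `A` with at least `j` elements of `M`. -/
def weightGE (j : ℕ) : Submodule k (SymAlg M N) :=
  Submodule.span k {s | ∃ (a : A) (l : List M), j ≤ l.length ∧ s = ofA M N a * (l.map (ofM M N)).prod}

theorem weightGE_mono {i j : ℕ} (h : i ≤ j) : weightGE M N j ≤ weightGE M N i :=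
  Submodule.span_mono fun _ ⟨a, l, hl, e⟩ => ⟨a, l, h.trans hl, e⟩

theorem weightGE_eq_zero {j : ℕ} (h : N < j) {s : SymAlg M N} (hs : s ∈ weightGE M N j) :
    s = 0 := by
  have : weightGE M N j ≤ ⊥ := by
    rw [weightGE, Submodule.span_le]
    rintro _ ⟨a, l, hl, rfl⟩
    have h2 : N < (l.length : ℕ∞) := h.trans_le (by exact_mod_cast hl)
    simp [trunc M N l h2]
  simpa using this hs

theorem ofA_mul_weightGE (a : A) {j : ℕ} {s : SymAlg M N} (hs : s ∈ weightGE M N j) :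
    ofA M N a * s ∈ weightGE M N j := by
  induction hs using Submodule.span_induction with
  | mem s hs =>
    obtain ⟨b, l, hl, rfl⟩ := hs
    exact Submodule.subset_span ⟨a * b, l, hl, by rw [map_mul, mul_assoc]⟩
  | zero => simp
  | add s t _ _ hs ht => rw [mul_add]; exact Submodule.add_mem _ hs ht
  | smul c s _ hs => rw [mul_smul_comm]; exact Submodule.smul_mem _ _ hs

theorem ofM_mul_weightGE (m : M) {j : ℕ} {s : SymAlg M N} (hs : s ∈ weightGE M N j) :
    ofM M N m * s ∈ weightGE M N (j + 1) := by
  induction hs using Submodule.span_induction with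
  | mem s hs =>
    obtain ⟨b, l, hl, rfl⟩ := hs
    clear * - hl
    induction b using graded_induction A.internal with
    | add x y hx hy => rw [map_add, add_mul, mul_add]; exact Submodule.add_mem _ hx hy
    | hom i b hb =>
      induction m using graded_induction M.internal with
      | add x y hx hy => rw [map_add, add_mul]; exact Submodule.add_mem _ hx hy
      | hom i' m hm =>
        rw [← mul_assoc, comm_MA M N hm hb, smul_mul_assoc]
        have : ofA M N b * ofM M N m * (l.map (ofM M N)).prod ∈ weightGE M N (j + 1) :=
          Submodule.subset_span ⟨b, m :: l, by simpa using hl, by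
            rw [List.map_cons, List.prod_cons, mul_assoc]⟩
        exact zsmul_mem this _
  | zero => simp
  | add s t _ _ hs ht => rw [mul_add]; exact Submodule.add_mem _ hs ht
  | smul c s _ hs => rw [mul_smul_comm]; exact Submodule.smul_mem _ _ hs

theorem mul_weightGE {i j : ℕ} {s t : SymAlg M N} (hs : s ∈ weightGE M N i)
    (ht : t ∈ weightGE M N j) : s * t ∈ weightGE M N (i + j) := by
  induction hs using Submodule.span_induction with
  | mem s hs =>
    obtain ⟨b, l, hl, rfl⟩ := hs
    rw [mul_assoc]
    refine ofA_mul_weightGE b (weightGE_mono (Nat.add_le_add_right hl j) ?_)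
    clear hl
    induction l with
    | nil => simpa using ht
    | cons m l ih =>
      rw [List.map_cons, List.prod_cons, mul_assoc, List.length_cons, add_right_comm]
      exact ofM_mul_weightGE m ih
  | zero => simp
  | add s t _ _ hs ht => rw [add_mul]; exact Submodule.add_mem _ hs ht
  | smul c s _ hs => rw [smul_mul_assoc]; exact Submodule.smul_mem _ _ hs

theorem sub_mem_weightGE (s : SymAlg M N) : s - ofA M N (proj M N s) ∈ weightGE M N 1 := by
  have h0 : ∀ s : SymAlg M N, s ∈ weightGE M N 0 := by
    intro s
    induction s using mul_induction with
    | one => exact Submodule.subset_span ⟨1, [], le_refl _, by simp⟩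
    | add s t hs ht => exact Submodule.add_mem _ hs ht
    | base c s hs => exact Submodule.smul_mem _ _ hs
    | mulA a s hs => exact ofA_mul_weightGE a hs
    | mulM m s hs => exact weightGE_mono (Nat.zero_le _) (ofM_mul_weightGE m hs)
  induction s using mul_induction with
  | one => simp
  | add s t hs ht =>
    rw [map_add, map_add, add_sub_add_comm]
    exact Submodule.add_mem _ hs ht
  | base c s hs => rw [map_smul, map_smul, ← smul_sub]; exact Submodule.smul_mem _ _ hs
  | mulA a s hs =>
    rw [map_mul, proj_ofA, map_mul, ← mul_sub]
    exact ofA_mul_weightGE a hs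
  | mulM m s hs =>
    rw [map_mul, proj_ofM, zero_mul, map_zero, sub_zero]
    exact ofM_mul_weightGE m (h0 s)

theorem prod_ker_eq_zero {n : ℕ} (l : List (SymAlg M n)) (hl : n < l.length)
    (h : ∀ s ∈ l, proj M n s = 0) : l.prod = 0 := by
  have key : ∀ l : List (SymAlg M n), (∀ s ∈ l, proj M n s = 0) →
      l.prod ∈ weightGE M n l.length := by
    intro l
    induction l with
    | nil => intro _; exact Submodule.subset_span ⟨1, [], le_refl _, by simp⟩
    | cons s l ih =>
      intro h
      rw [List.prod_cons, List.length_cons, add_comm]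
      refine mul_weightGE ?_ (ih fun s hs => h s (List.mem_cons_of_mem _ hs))
      have := sub_mem_weightGE s
      rwa [h s List.mem_cons_self, map_zero, sub_zero] at this
  exact weightGE_eq_zero (by exact_mod_cast hl) (key l h)

end SymAlg

end Sym

section Contraction

set_option linter.unusedSectionVars false

namespace SymAlg

variable {k : Type u} [Field k] [CharZero k] {A : GAlg k} {M : GMod A} {N N' : ℕ∞}

theorem parity_ofA (p : ℤ) (a : A) :
    (Sym M N).parity p (ofA M N a) = ofA M N (A.parity p a) := by
  induction a using graded_induction A.internal with
  | add x y hx hy => simp only [map_add, hx, hy]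
  | hom i a ha =>
    rw [A.parity_of_mem p ha, map_zsmul]
    exact (Sym M N).parity_of_mem p (ofA_mem ha)

theorem parity_ofM (p : ℤ) {i : ℤ} {m : M} (hm : m ∈ M.gr i) :
    (Sym M N).parity p (ofM M N m) = sgn (p * i) • ofM M N m :=
  (Sym M N).parity_of_mem p (ofM_mem hm)

/-- The diagonal matrix `diag((-1)^{p|a|} a, a)`. -/
def contrA (p : ℤ) : A →ₐ[k] Matrix (Fin 2) (Fin 2) (SymAlg M N') :=
  AlgHom.ofLinearMap
    { toFun := fun a => !![(Sym M N').parity p (ofA M N' a), 0; 0, ofA M N' a]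
      map_add' := fun a b => by
        ext i j; fin_cases i <;> fin_cases j <;> simp
      map_smul' := fun c a => by
        ext i j; fin_cases i <;> fin_cases j <;> simp }
    (by ext i j; fin_cases i <;> fin_cases j <;> simp)
    (fun a b => by
      simp only [LinearMap.coe_mk, AddHom.coe_mk, Matrix.mul_fin_two]
      simp)

/-- The matrix `((-1)^{p|m|} m, x(m); 0, m)`. -/
def contrM {p : ℤ} (x : M.dual p) : M →ₗ[k] Matrix (Fin 2) (Fin 2) (SymAlg M N') where
  toFun m := !![(Sym M N').parity p (ofM M N' m), ofA M N' (x.1 m); 0, ofM M N' m]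
  map_add' := fun a b => by
    ext i j; fin_cases i <;> fin_cases j <;> simp
  map_smul' := fun c a => by
    ext i j; fin_cases i <;> fin_cases j <;> simp

theorem contrM_prod {p : ℤ} (x : M.dual p) (l : List M) :
    ∃ c ∈ weightGE M N' (l.length - 1), (l.map (contrM (N' := N') x)).prod
      = !![(Sym M N').parity p (l.map (ofM M N')).prod, c; 0, (l.map (ofM M N')).prod] := by
  induction l with
  | nil =>
    refine ⟨0, Submodule.zero_mem _, ?_⟩
    ext i j; fin_cases i <;> fin_cases j <;> simp
  | cons m l ih =>
    obtain ⟨c, hc, e⟩ := ih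
    have hP : ∀ m : M, ∃ m' : M, (Sym M N').parity p (ofM M N' m) = ofM M N' m' := by
      intro m
      induction m using graded_induction M.internal with
      | hom i m hm => exact ⟨sgn (p * i) • m, by rw [parity_ofM p hm, map_zsmul]⟩
      | add a b ha hb =>
        obtain ⟨a', ha⟩ := ha
        obtain ⟨b', hb⟩ := hb
        exact ⟨a' + b', by rw [map_add, map_add, map_add, ha, hb]⟩
    obtain ⟨m', hm'⟩ := hP m
    refine ⟨ofM M N' m' * c + ofA M N' (x.1 m) * (l.map (ofM M N')).prod, ?_, ?_⟩
    · refine Submodule.add_mem _ (weightGE_mono (by simp; omega) (ofM_mul_weightGE m' hc)) ?_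
      exact Submodule.subset_span ⟨x.1 m, l, by simp, rfl⟩
    · rw [List.map_cons, List.prod_cons, e, List.map_cons, List.prod_cons, contrM]
      simp only [LinearMap.coe_mk, AddHom.coe_mk, Matrix.mul_fin_two, hm', map_mul]
      simp

/-- The algebra homomorphism `s ↦ ((-1)^{p|s|} s, ι_x s; 0, s)`. -/
def contrHom {p : ℤ} (x : M.dual p) (h : N' + 1 ≤ N) :
    SymAlg M N →ₐ[k] Matrix (Fin 2) (Fin 2) (SymAlg M N') :=
  lift (contrA p) (contrM x)
    (fun a m => by
      have h1 : x.1 (a • m) = A.parity p a * x.1 m := GMod.dual_smul x a m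
      simp only [contrA, contrM, AlgHom.ofLinearMap_apply, LinearMap.coe_mk, AddHom.coe_mk,
        Matrix.mul_fin_two, h1, ofM_smul, map_mul]
      have h2 : (Sym M N').parity p (ofA M N' a) = ofA M N' (A.parity p a) := parity_ofA p a
      simp [h2])
    (fun i j m a hm ha => by
      have hx : x.1 m ∈ A.gr (i + p) := x.2.1 i m hm
      have h1 : ofA M N' (x.1 m) * ofA M N' a
          = sgn (i * j) • ((Sym M N').parity p (ofA M N' a) * ofA M N' (x.1 m)) := by
        rw [parity_ofA, A.parity_of_mem p ha, ← map_mul, ← map_mul, smul_mul_assoc, map_zsmul,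
          A.comm hx ha, map_zsmul, smul_smul, ← sgn_add, add_mul]
      have h2 := comm_MA M N' hm ha
      have h3 := congrArg ((Sym M N').parity p) h2
      simp only [map_mul, map_zsmul] at h3
      simp only [contrA, contrM, AlgHom.ofLinearMap_apply, LinearMap.coe_mk, AddHom.coe_mk,
        Matrix.mul_fin_two]
      ext i j; fin_cases i <;> fin_cases j <;> simp [h1, h2, h3])
    (fun i j m m' hm hm' => by
      have hx : x.1 m ∈ A.gr (i + p) := x.2.1 i m hm
      have hx' : x.1 m' ∈ A.gr (j + p) := x.2.1 j m' hm'
      have h1 : (Sym M N').parity p (ofM M N' m) * ofA M N' (x.1 m')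
          + ofA M N' (x.1 m) * ofM M N' m' = sgn (i * j) •
          ((Sym M N').parity p (ofM M N' m') * ofA M N' (x.1 m)
            + ofA M N' (x.1 m') * ofM M N' m) := by
        rw [parity_ofM p hm, parity_ofM p hm', smul_mul_assoc, smul_mul_assoc, zsmul_add,
          comm_MA M N' hm hx', comm_MA M N' hm' hx, smul_smul, smul_smul, smul_smul, ← sgn_add,
          ← sgn_add, ← sgn_add, add_comm]
        congr 2
        · have : i * j + p * j + j * (i + p) = 0 + ((i * j + p * j) + (i * j + p * j)) := by ring
          rw [this, sgn_add, sgn_add _ (i * j + p * j), sgn_mul_self, sgn_zero]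
          simp
        · have : p * i + i * (j + p) = i * j + (p * i + p * i) := by ring
          rw [this, sgn_add, sgn_add (p * i), sgn_mul_self, mul_one]
      have h2 := comm_MM M N' hm hm'
      have h3 := congrArg ((Sym M N').parity p) h2
      simp only [map_mul, map_zsmul] at h3
      simp only [contrM, LinearMap.coe_mk, AddHom.coe_mk, Matrix.mul_fin_two]
      ext i j; fin_cases i <;> fin_cases j <;> simp [h1, h2, h3])
    (fun l hl => by
      obtain ⟨c, hc, e⟩ := contrM_prod (N' := N') x l
      have hl1 : N' + 1 < (l.length : ℕ∞) := h.trans_lt hl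
      have hN : N' < ((l.length - 1 : ℕ) : ℕ∞) := by
        cases N' with
        | top => simp at hl1
        | coe n =>
          have : n + 1 < l.length := by exact_mod_cast hl1
          exact_mod_cast (by omega : n < l.length - 1)
      have h0 : N' < (l.length : ℕ∞) := hN.trans_le (by exact_mod_cast Nat.sub_le _ _)
      rw [e, weightGE_eq_zero hN hc, trunc M N' l h0, map_zero]
      ext i j; fin_cases i <;> fin_cases j <;> simp)

/-- The contraction `ι_x : Sym_A(M) / Sym_A^{>N}(M) → Sym_A(M) / Sym_A^{>N'}(M)` with an element
`x ∈ M^*` of degree `p`. It is the unique derivation of degree `p` (over the projection) with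
`ι_x(a) = 0` for `a ∈ A` and `ι_x(m) = x(m)` for `m ∈ M`. -/
def contr {p : ℤ} (x : M.dual p) (h : N' + 1 ≤ N) : SymAlg M N →ₗ[k] SymAlg M N' :=
  Matrix.entryLinearMap k (SymAlg M N') (0 : Fin 2) (1 : Fin 2) ∘ₗ (contrHom x h).toLinearMap

theorem contr_ofA {p : ℤ} (x : M.dual p) (h : N' + 1 ≤ N) (a : A) :
    contr x h (ofA M N a) = 0 := by
  simp [contr, contrHom, contrA]

theorem contr_ofM {p : ℤ} (x : M.dual p) (h : N' + 1 ≤ N) (m : M) :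
    contr x h (ofM M N m) = ofA M N' (x.1 m) := by
  simp [contr, contrHom, contrM]

theorem contrHom_apply {p : ℤ} (x : M.dual p) (h : N' + 1 ≤ N) (s : SymAlg M N) :
    contrHom x h s = !![(Sym M N').parity p (map (𝟙 M) (le_self_add.trans h) s), contr x h s;
      0, map (𝟙 M) (le_self_add.trans h) s] := by
  induction s using mul_induction with
  | one =>
    ext i j; fin_cases i <;> fin_cases j <;> simp [contr]
  | add s t hs ht =>
    rw [map_add, hs, ht]
    ext i j; fin_cases i <;> fin_cases j <;> simp
  | base c s hs =>
    rw [map_smul, hs]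
    ext i j; fin_cases i <;> fin_cases j <;> simp
  | mulA a s hs =>
    rw [map_mul, hs, contr]
    simp only [LinearMap.comp_apply, AlgHom.toLinearMap_apply, Matrix.entryLinearMap_apply,
      map_mul, hs, map_ofA]
    simp only [contrHom, lift_ofA, contrA, AlgHom.ofLinearMap_apply, LinearMap.coe_mk,
      AddHom.coe_mk, Matrix.mul_fin_two]
    simp
  | mulM m s hs =>
    rw [map_mul, hs, contr]
    simp only [LinearMap.comp_apply, AlgHom.toLinearMap_apply, Matrix.entryLinearMap_apply,
      map_mul, hs, map_ofM]
    simp only [contrHom, lift_ofM, contrM, LinearMap.coe_mk,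
      AddHom.coe_mk, Matrix.mul_fin_two]
    ext i j; fin_cases i <;> fin_cases j <;> simp <;> rfl

theorem contr_mul {p : ℤ} (x : M.dual p) (h : N' + 1 ≤ N) {i : ℤ} {s : SymAlg M N}
    (hs : s ∈ gr M N i) (t : SymAlg M N) :
    contr x h (s * t) = contr x h s * map (𝟙 M) (le_self_add.trans h) t
      + sgn (p * i) • (map (𝟙 M) (le_self_add.trans h) s * contr x h t) := by
  have hs' : map (𝟙 M) (le_self_add.trans h) s ∈ gr M N' i :=
    (Sym.map (𝟙 M) (le_self_add.trans h)).map_mem i s hs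
  have h1 := contrHom_apply x h (s * t)
  rw [map_mul, contrHom_apply, contrHom_apply, Matrix.mul_fin_two] at h1
  have h2 := congrFun (congrFun h1 0) 1
  have h3 := (Sym M N').parity_of_mem p hs'
  simp only [Matrix.of_apply, Matrix.cons_val_zero, Matrix.cons_val_one] at h2
  rw [h3, smul_mul_assoc] at h2
  rw [add_comm, ← h2]

end SymAlg

end Contraction

section Pro

variable (C : Type (u + 1)) [Category.{u} C]

/-- Inverse systems in `C` indexed by (non-empty) directed sets. -/
structure ProObj where
  I : Type u
  [preorder : Preorder I]
  [directed : IsDirectedOrder I]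
  [nonempty : Nonempty I]
  X : I → C
  map : ∀ {i j : I}, i ≤ j → (X j ⟶ X i)
  map_id : ∀ i, map (le_refl i) = 𝟙 (X i)
  map_comp : ∀ {i j l : I} (h : i ≤ j) (h' : j ≤ l), map h' ≫ map h = map (h.trans h')

attribute [instance] ProObj.preorder ProObj.directed ProObj.nonempty

variable {C}

/-- Morphisms of inverse systems. -/
structure PreHom (X Y : ProObj C) where
  φ : Y.I → X.I
  f : ∀ j, X.X (φ j) ⟶ Y.X j
  compat : ∀ {j' j : Y.I} (h : j' ≤ j), ∃ (i : X.I) (h1 : φ j ≤ i) (h2 : φ j' ≤ i),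
    X.map h1 ≫ f j ≫ Y.map h = X.map h2 ≫ f j'

/-- Equivalence of morphisms of inverse systems. -/
instance PreHom.setoid (X Y : ProObj C) : Setoid (PreHom X Y) where
  r F G := ∀ j, ∃ (i : X.I) (h1 : F.φ j ≤ i) (h2 : G.φ j ≤ i), X.map h1 ≫ F.f j = X.map h2 ≫ G.f j
  iseqv := by
    refine ⟨fun F j => ⟨F.φ j, le_refl _, le_refl _, rfl⟩, fun h j => ?_, fun {F G H} h h' j => ?_⟩
    · obtain ⟨i, h1, h2, e⟩ := h j
      exact ⟨i, h2, h1, e.symm⟩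
    · obtain ⟨i, h1, h2, e⟩ := h j
      obtain ⟨i', h1', h2', e'⟩ := h' j
      obtain ⟨l, hl, hl'⟩ := exists_ge_ge i i'
      refine ⟨l, h1.trans hl, h2'.trans hl', ?_⟩
      rw [← X.map_comp h1 hl, ← X.map_comp h2' hl', Category.assoc, Category.assoc, e, ← e',
        ← Category.assoc, ← Category.assoc, X.map_comp, X.map_comp]

/-- Composition of morphisms of inverse systems. -/
def PreHom.comp {X Y Z : ProObj C} (F : PreHom X Y) (G : PreHom Y Z) : PreHom X Z where
  φ j := F.φ (G.φ j)
  f j := F.f (G.φ j) ≫ G.f j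
  compat := by
    intro j' j h
    obtain ⟨b, hb, hb', e⟩ := G.compat h
    obtain ⟨i1, p1, q1, e1⟩ := F.compat hb
    obtain ⟨i2, p2, q2, e2⟩ := F.compat hb'
    obtain ⟨i, hi1, hi2⟩ := exists_ge_ge i1 i2
    refine ⟨i, q1.trans hi1, q2.trans hi2, ?_⟩
    rw [← X.map_comp q1 hi1, ← X.map_comp q2 hi2]
    simp only [Category.assoc]
    rw [← reassoc_of% e1, ← reassoc_of% e2, e, ← Category.assoc (X.map hi1), X.map_comp,
      ← Category.assoc (X.map hi2), X.map_comp]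

/-- Morphisms in the pro-category are equivalence classes of morphisms of inverse systems. -/
instance : Category (ProObj C) where
  Hom X Y := Quotient (PreHom.setoid X Y)
  id X := Quotient.mk _ ⟨id, fun _ => 𝟙 _, fun {j' j} h => ⟨j, le_refl _, h, by
    simp [X.map_id]⟩⟩
  comp {X Y Z} := Quotient.map₂ PreHom.comp (by
    intro F F' hF G G' hG j
    obtain ⟨b, hb, hb', e⟩ := hG j
    obtain ⟨i1, p1, q1, e1⟩ := F.compat hb
    obtain ⟨i2, p2, q2, e2⟩ := F'.compat hb'
    obtain ⟨i3, p3, q3, e3⟩ := hF b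
    obtain ⟨i0, h1, h2⟩ := exists_ge_ge i1 i2
    obtain ⟨i, h0, h3⟩ := exists_ge_ge i0 i3
    refine ⟨i, q1.trans (h1.trans h0), q2.trans (h2.trans h0), ?_⟩
    change X.map _ ≫ F.f _ ≫ G.f _ = X.map _ ≫ F'.f _ ≫ G'.f _
    rw [← X.map_comp q1 (h1.trans h0), ← X.map_comp q2 (h2.trans h0)]
    simp only [Category.assoc]
    rw [← reassoc_of% e1, ← reassoc_of% e2, e, ← Category.assoc, X.map_comp,
      ← Category.assoc (X.map _) (X.map _), X.map_comp, ← X.map_comp p3 h3, ← X.map_comp q3 h3]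
    simp only [Category.assoc]
    rw [reassoc_of% e3])
  id_comp := by
    rintro X Y ⟨F⟩
    refine congrArg (Quotient.mk _) ?_
    cases F
    simp [PreHom.comp]
  comp_id := by
    rintro X Y ⟨F⟩
    refine congrArg (Quotient.mk _) ?_
    cases F
    simp [PreHom.comp]
  assoc := by
    rintro W X Y Z ⟨F⟩ ⟨G⟩ ⟨H⟩
    refine congrArg (Quotient.mk _) ?_
    simp [PreHom.comp]

/-- The class of a morphism of inverse systems. -/
def PreHom.toHom {X Y : ProObj C} (F : PreHom X Y) : X ⟶ Y := Quotient.mk (PreHom.setoid X Y) F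

/-- `g : X_i → Y_j` belongs to the maximal representing family of the pro-morphism `F`. -/
def Represents {X Y : ProObj C} (F : X ⟶ Y) (i : X.I) (j : Y.I) (g : X.X i ⟶ Y.X j) : Prop :=
  ∃ r : PreHom X Y, r.toHom = F ∧ ∃ (i' : X.I) (h : i ≤ i') (h' : r.φ j ≤ i'),
    X.map h ≫ g = X.map h' ≫ r.f j

/-- Pro-objects are functorial in the category. -/
def proFunctor {D : Type (u + 1)} [Category.{u} D] (T : C ⥤ D) : ProObj C ⥤ ProObj D where
  obj X :=
    { I := X.I
      X := fun i => T.obj (X.X i)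
      map := fun h => T.map (X.map h)
      map_id := fun i => by rw [X.map_id, T.map_id]
      map_comp := fun h h' => by rw [← T.map_comp, X.map_comp] }
  map {X Y} := Quotient.map
    (fun F => ⟨F.φ, fun j => T.map (F.f j), fun h => by
      obtain ⟨i, h1, h2, e⟩ := F.compat h
      exact ⟨i, h1, h2, by simp only [← T.map_comp, e]⟩⟩)
    (fun F G h j => by
      obtain ⟨i, h1, h2, e⟩ := h j
      exact ⟨i, h1, h2, by
        change T.map _ ≫ T.map _ = T.map _ ≫ T.map _
        simp only [← T.map_comp, e]⟩)
  map_id X := by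
    refine congrArg (Quotient.mk _) ?_
    simp
  map_comp := by
    rintro X Y Z ⟨F⟩ ⟨G⟩
    refine congrArg (Quotient.mk _) ?_
    simp [PreHom.comp]

/-- Constant inverse systems. -/
def proConst (C : Type (u + 1)) [Category.{u} C] : C ⥤ ProObj C where
  obj B :=
    { I := PUnit.{u + 1}
      X := fun _ => B
      map := fun _ => 𝟙 B
      map_id := fun _ => rfl
      map_comp := fun _ _ => Category.comp_id _ }
  map f := PreHom.toHom ⟨id, fun _ => f, fun _ => ⟨_, le_refl _, le_refl _, by simp⟩⟩
  map_comp f g := rfl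
  map_id B := rfl

/-- The pro-morphism to a constant system represented by a map `X_i → B`. -/
def toConst (X : ProObj C) {B : C} (i : X.I) (f : X.X i ⟶ B) : X ⟶ (proConst C).obj B :=
  PreHom.toHom ⟨fun _ => i, fun _ => f, fun _ => ⟨i, le_refl _, le_refl _, by
    change X.map _ ≫ f ≫ 𝟙 _ = X.map _ ≫ f
    rw [Category.comp_id]⟩⟩

theorem toConst_eq (X : ProObj C) {B : C} (f : ∀ i, X.X i ⟶ B)
    (hf : ∀ {i j : X.I} (h : i ≤ j), X.map h ≫ f i = f j) (i j : X.I) :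
    toConst X i (f i) = toConst X j (f j) := by
  refine Quotient.sound fun _ => ?_
  obtain ⟨l, h1, h2⟩ := exists_ge_ge i j
  exact ⟨l, h1, h2, (hf h1).trans (hf h2).symm⟩

/-- The zero pro-morphism. -/
def proZero [Limits.HasZeroMorphisms C] (X Y : ProObj C) : X ⟶ Y :=
  PreHom.toHom ⟨fun _ => Classical.arbitrary _, fun _ => 0, fun _ => ⟨_, le_refl _, le_refl _, by
    simp⟩⟩

end Pro

section Dg

variable (k : Type u) [Field k]

variable {k} in
/-- `D` is a derivation of degree `1` over the morphism of graded algebras `f`. -/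
def IsDerivationOver {A B : GAlg k} (f : A ⟶ B) (D : A →ₗ[k] B) : Prop :=
  (∀ (i : ℤ) (a : A), a ∈ A.gr i → D a ∈ B.gr (i + 1)) ∧
  ∀ (i : ℤ) (a b : A), a ∈ A.gr i →
    D (a * b) = D a * f.toAlgHom b + sgn i • (f.toAlgHom a * D b)

/-- Non-positively graded differential graded-commutative algebras: the objects of `dgca(k)`. -/
structure DGCA extends GAlg k where
  nonpos : ∀ i : ℤ, 0 < i → gr i = ⊥
  d : carrier →ₗ[k] carrier
  der : IsDerivationOver (𝟙 toGAlg) d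
  d_d : ∀ a, d (d a) = 0

/-- Morphisms of differential graded-commutative algebras. -/
@[ext]
structure DGCA.Hom {k : Type u} [Field k] (A B : DGCA k) where
  toHom : A.toGAlg ⟶ B.toGAlg
  comm : ∀ a : A.carrier, toHom.toAlgHom (A.d a) = B.d (toHom.toAlgHom a)

instance : Category (DGCA k) where
  Hom := DGCA.Hom
  id A := ⟨𝟙 A.toGAlg, fun _ => rfl⟩
  comp f g := ⟨f.toHom ≫ g.toHom, fun a =>
    (congrArg g.toHom.toAlgHom (f.comm a)).trans (g.comm _)⟩

/-- The underlying pro-vector space of a pro-graded algebra. -/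
abbrev toProMod : ProObj (GAlg k) ⥤ ProObj (ModuleCat.{u} k) := proFunctor (GAlg.forget k)

variable {k} in
/-- An endomorphism `d` of the underlying pro-vector space is a (degree `1`) derivation of the
pro-graded algebra `X`, i.e. belongs to `lim_j colim_{i ≥ j} Der_{p_{ij}}(X_i, X_j)`. -/
def IsProDerivation (X : ProObj (GAlg k))
    (d : (toProMod k).obj X ⟶ (toProMod k).obj X) : Prop :=
  ∃ (φ : X.I → X.I) (hφ : ∀ j, j ≤ φ j) (D : ∀ j, X.X (φ j) →ₗ[k] X.X j),
    (∀ j, IsDerivationOver (X.map (hφ j)) (D j)) ∧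
    ∀ j, Represents d (φ j) j (ModuleCat.ofHom (D j))

/-- Differential pro-graded commutative algebras. -/
structure DProAlg where
  X : ProObj (GAlg k)
  d : (toProMod k).obj X ⟶ (toProMod k).obj X
  der : IsProDerivation X d
  sq : d ≫ d = proZero _ _

/-- Morphisms of differential pro-graded commutative algebras. -/
@[ext]
structure DProAlg.Hom {k : Type u} [Field k] (X Y : DProAlg k) where
  toHom : X.X ⟶ Y.X
  comm : (toProMod k).map toHom ≫ Y.d = X.d ≫ (toProMod k).map toHom

instance : Category (DProAlg k) where
  Hom := DProAlg.Hom
  id X := ⟨𝟙 X.X, by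
    rw [CategoryTheory.Functor.map_id, Category.id_comp, Category.comp_id]⟩
  comp f g := ⟨f.toHom ≫ g.toHom, by
    rw [Functor.map_comp, Category.assoc, g.comm, ← Category.assoc, f.comm, Category.assoc]⟩

/-- The differential of `A`, on the constant pro-vector space. -/
def DGCA.proD {k : Type u} [Field k] (A : DGCA k) :
    (toProMod k).obj ((proConst _).obj A.toGAlg) ⟶ (toProMod k).obj ((proConst _).obj A.toGAlg) :=
  (proConst (ModuleCat.{u} k)).map (ModuleCat.ofHom A.d)

/-- A dgca is a (constant) differential pro-graded commutative algebra. -/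
def DGCA.toPro : DGCA k ⥤ DProAlg k where
  obj A :=
    { X := (proConst _).obj A.toGAlg
      d := A.proD
      der := ⟨id, fun _ => le_refl _, fun _ => A.d, fun _ => A.der,
        fun _ => ⟨_, rfl, PUnit.unit, le_refl _, le_refl _, rfl⟩⟩
      sq := by
        refine Quotient.sound fun _ => ⟨PUnit.unit, le_refl _, le_refl _, ?_⟩
        ext a
        exact A.d_d a }
  map {A B} f := ⟨(proConst _).map f.toHom, by
    refine Quotient.sound fun _ => ⟨PUnit.unit, le_refl _, le_refl _, ?_⟩
    ext a
    exact (f.comm a).symm⟩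
  map_id _ := rfl
  map_comp _ _ := rfl

variable {k} in
/-- The morphism `π` is represented by a compatible family of surjections with nilpotent kernels. -/
def IsProNilpotentExtension (X : ProObj (GAlg k)) (B : GAlg k)
    (π : X ⟶ (proConst _).obj B) : Prop :=
  ∃ f : ∀ i, X.X i ⟶ B,
    (∀ {i j : X.I} (h : i ≤ j), X.map h ≫ f i = f j) ∧
    (∀ i, π = toConst X i (f i)) ∧
    (∀ i, Function.Surjective (f i).toAlgHom) ∧
    ∀ i, ∃ n : ℕ, ∀ l : List (X.X i), n < l.length → (∀ s ∈ l, (f i).toAlgHom s = 0) → l.prod = 0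

/-- The category `fcdga(k)` of pro-nilpotently extended dgca-s: the full subcategory of the category
of arrows `A ⟶ A₀` (with `A` a differential pro-graded commutative algebra and `A₀` a dgca) on the
pro-nilpotent extensions. -/
abbrev Fcdga : Type (u + 1) :=
  ObjectProperty.FullSubcategory
    (fun X : Comma (𝟭 (DProAlg k)) (DGCA.toPro k) =>
      IsProNilpotentExtension X.left.X X.right.toGAlg X.hom.toHom)

/-- Dg modules over a dgca. -/
structure DGMod {k : Type u} [Field k] (A : DGCA k) extends GMod A.toGAlg where
  d : carrier →ₗ[k] carrier
  d_mem : ∀ (i : ℤ) (m : carrier), m ∈ gr i → d m ∈ gr (i + 1)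
  leibniz : ∀ (i : ℤ) (a : A.carrier) (m : carrier), a ∈ A.gr i →
    d (a • m) = A.d a • m + sgn i • (a • d m)
  d_d : ∀ m, d (d m) = 0

end Dg

section Main

variable {k : Type u} [Field k]

/-! Multiderivations and strong homotopy Lie-Rinehart structures. -/

/-- The `(p, N - p)`-unshuffles. -/
def unshuffles (p N : ℕ) : Finset (Equiv.Perm (Fin N)) :=
  Finset.univ.filter fun τ =>
    ∀ i j : Fin N, i < j → ((j : ℕ) < p ∨ p ≤ (i : ℕ)) → τ i < τ j

/-- The sign with `m_{τ(1)} ⊙ ⋯ ⊙ m_{τ(N)} = ± m_1 ⊙ ⋯ ⊙ m_N`, for `m_i` of degree `d i`. -/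
def koszul {N : ℕ} (d : Fin N → ℤ) (τ : Equiv.Perm (Fin N)) : ℤ :=
  ∏ i : Fin N, ∏ j : Fin N, if i < j ∧ τ j < τ i then sgn (d (τ i) * d (τ j)) else 1

/-- Inhomogeneous multiderivations `∏_l mDer^l(L, L)` over the identity of a graded `A`-module `L`.
The maps `Sym_k^{l+1}(L) → L` of degree one and the `A`-linear maps `Sym_A^l(L) → Der(A)` of degree
one are given by graded symmetric multilinear maps. -/
structure MultiDer {A : GAlg k} (L : GMod A) where
  X : ∀ l : ℕ, MultilinearMap k (fun _ : Fin (l + 1) => L) L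
  σ : ∀ l : ℕ, MultilinearMap k (fun _ : Fin l => L) (A →ₗ[k] A)
  X_mem : ∀ (l : ℕ) (d : Fin (l + 1) → ℤ) (m : Fin (l + 1) → L), (∀ i, m i ∈ L.gr (d i)) →
    X l m ∈ L.gr (1 + ∑ i, d i)
  X_symm : ∀ (l : ℕ) (d : Fin (l + 1) → ℤ) (m : Fin (l + 1) → L), (∀ i, m i ∈ L.gr (d i)) →
    ∀ τ : Equiv.Perm (Fin (l + 1)), X l (fun i => m (τ i)) = koszul d τ • X l m
  σ_mem : ∀ (l : ℕ) (d : Fin l → ℤ) (m : Fin l → L), (∀ i, m i ∈ L.gr (d i)) →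
    ∀ (j : ℤ) (a : A), a ∈ A.gr j → σ l m a ∈ A.gr (j + (1 + ∑ i, d i))
  σ_der : ∀ (l : ℕ) (d : Fin l → ℤ) (m : Fin l → L), (∀ i, m i ∈ L.gr (d i)) →
    ∀ (j : ℤ) (a b : A), a ∈ A.gr j →
      σ l m (a * b) = σ l m a * b + sgn ((1 + ∑ i, d i) * j) • (a * σ l m b)
  σ_symm : ∀ (l : ℕ) (d : Fin l → ℤ) (m : Fin l → L), (∀ i, m i ∈ L.gr (d i)) →
    ∀ τ : Equiv.Perm (Fin l), σ l (fun i => m (τ i)) = koszul d τ • σ l m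
  σ_smul : ∀ (l : ℕ) (d : Fin l → ℤ) (m : Fin l → L), (∀ i, m i ∈ L.gr (d i)) →
    ∀ (j : ℤ) (a : A), a ∈ A.gr j → ∀ (i : Fin l) (b : A),
      σ l (Function.update m i (a • m i)) b
        = sgn (j * (1 + ∑ i' ∈ Finset.univ.filter (· < i), d i')) • (a * σ l m b)
  leibniz : ∀ (l : ℕ) (d : Fin l → ℤ) (m : Fin l → L), (∀ i, m i ∈ L.gr (d i)) →
    ∀ (j : ℤ) (a : A), a ∈ A.gr j → ∀ x : L,
      X l (Fin.snoc (α := fun _ => L) m (a • x)) = σ l m a • x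
        + sgn (j * (1 + ∑ i, d i)) • (a • X l (Fin.snoc (α := fun _ => L) m x))

namespace MultiDer

variable {A : GAlg k} {L : GMod A} (X : MultiDer L)

/-- `∑_{i + l = n} ∑_τ ± X_i(X_l(m_{τ(1)}, …, m_{τ(l+1)}), m_{τ(l+2)}, …, m_{τ(n+1)})`. -/
def jacobiator (n : ℕ) (d : Fin (n + 1) → ℤ) (m : Fin (n + 1) → L) : L :=
  ∑ l : Fin (n + 1), ∑ τ ∈ unshuffles (l + 1) (n + 1), koszul d τ •
    X.X (n - l) (Fin.cons (α := fun _ => L)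
      (X.X l (fun i : Fin (l + 1) => m (τ ⟨i, by omega⟩)))
      (fun i : Fin (n - l) => m (τ ⟨l + 1 + i, by omega⟩)))

/-- The sum over `i + l = n` of
`∑_τ ± σ_i(X_l(m_{τ(1)}, …, m_{τ(l+1)}), m_{τ(l+2)}, …, m_{τ(n)})` (for `i ≥ 1`) and
`∑_τ ± σ_l(m_{τ(1)}, …, m_{τ(l)}) σ_i(m_{τ(l+1)}, …, m_{τ(n)})`. -/
def anchorJacobiator (n : ℕ) (d : Fin n → ℤ) (m : Fin n → L) : A →ₗ[k] A :=
  (∑ l : Fin n, ∑ τ ∈ unshuffles (l + 1) n, koszul d τ •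
    X.σ (n - 1 - l + 1) (Fin.cons (α := fun _ => L)
      (X.X l (fun i : Fin (l + 1) => m (τ ⟨i, by omega⟩)))
      (fun i : Fin (n - 1 - l) => m (τ ⟨l + 1 + i, by omega⟩))))
  + ∑ l : Fin (n + 1), ∑ τ ∈ unshuffles l n,
    (koszul d τ * sgn (∑ i : Fin l, d (τ ⟨i, by omega⟩))) •
      (X.σ l (fun i : Fin l => m (τ ⟨i, by omega⟩))
        ∘ₗ X.σ (n - l) (fun i : Fin (n - l) => m (τ ⟨l + i, by omega⟩)))

/-- The multiderivation `X` squares to zero. -/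
def SquareZero : Prop :=
  (∀ (n : ℕ) (d : Fin (n + 1) → ℤ) (m : Fin (n + 1) → L), (∀ i, m i ∈ L.gr (d i)) →
    X.jacobiator n d m = 0) ∧
  ∀ (n : ℕ) (d : Fin n → ℤ) (m : Fin n → L), (∀ i, m i ∈ L.gr (d i)) →
    X.anchorJacobiator n d m = 0

end MultiDer

/-- A dg module is graded-flat if its underlying graded module is flat. -/
def DGMod.IsGradedFlat {A : DGCA k} (L : DGMod A) : Prop := L.toGMod.IsFlat

/-- Strong homotopy Lie-Rinehart structures on the pair `(A, L)`: square-zero multiderivations of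
the graded `A`-module `L[-1]` whose weight zero part is the differential of `L`, with anchor the
differential of `A`. -/
structure SHLR (A : DGCA k) (L : DGMod A) extends MultiDer L.toGMod.shift where
  X_zero : ∀ m : L.carrier, X 0 (fun _ => m) = L.d m
  σ_zero : σ 0 Fin.elim0 = A.d
  squareZero : toMultiDer.SquareZero

/-- Flat strong homotopy Lie-Rinehart pairs. -/
structure FlatSHLR (k : Type u) [Field k] where
  A : DGCA k
  L : DGMod A
  flat : L.IsGradedFlat
  str : SHLR A L

/-! Pro-finite modules and duality. -/

variable {A : GAlg k}

/-- Pro-finite `A`-modules: inverse systems of free finite graded `A`-modules. -/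
def IsProFinite (M : ProObj (GMod A)) : Prop := ∀ i, (M.X i).IsFinite

/-- A duality between the pro-graded module `M = (M_α)` and the graded module `L`: a cocone
exhibiting `L` as the direct limit of the duals `M_α^*`. For `M` pro-finite it exhibits `M` as the
pro-finite dual `L^*`; in particular a duality between `M` and `L[-1]` exhibits `M` as
`(L[-1])^* = L^*[1]`. -/
structure Duality (M : ProObj (GMod A)) (L : GMod A) where
  j : ∀ (α : M.I) (p : ℤ), (M.X α).dual p →ₗ[k] L
  j_mem : ∀ α p x, j α p x ∈ L.gr p
  j_smul : ∀ (α : M.I) (i p : ℤ) (a : A), a ∈ A.gr i → ∀ (x : (M.X α).dual p)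
    (y : (M.X α).dual (i + p)), (∀ m, y.1 m = a * x.1 m) → j α (i + p) y = a • j α p x
  compat : ∀ {α β : M.I} (h : α ≤ β) (p : ℤ) (x : (M.X α).dual p),
    j β p (GMod.dualMap (M.map h) p x) = j α p x
  surj : ∀ (p : ℤ) (z : L), z ∈ L.gr p → ∃ (α : M.I) (x : (M.X α).dual p), j α p x = z
  inj : ∀ (α : M.I) (p : ℤ) (x : (M.X α).dual p), j α p x = 0 →
    ∃ (β : M.I) (h : α ≤ β), GMod.dualMap (M.map h) p x = 0

variable [CharZero k]

/-- The completed symmetric algebra: the inverse system `Sym_A(M_α) / Sym_A^{>n}(M_α)`. -/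
@[reducible] def symPro (M : ProObj (GMod A)) : ProObj (GAlg k) where
  I := M.I × ℕ
  preorder := inferInstanceAs (Preorder (M.I × ℕ))
  nonempty := inferInstanceAs (Nonempty (M.I × ℕ))
  directed := ⟨fun a b => by
    obtain ⟨c, h1, h2⟩ := exists_ge_ge a.1 b.1
    exact ⟨(c, max a.2 b.2), ⟨h1, le_max_left _ _⟩, ⟨h2, le_max_right _ _⟩⟩⟩
  X i := Sym (M.X i.1) i.2
  map {i j} h := Sym.map (M.map (Prod.le_def.1 h).1) (by exact_mod_cast (Prod.le_def.1 h).2)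
  map_id i := by rw [M.map_id, Sym.map_id]
  map_comp h h' := by rw [Sym.map_comp, M.map_comp]

/-- The canonical projection of the completed symmetric algebra to `A`. -/
def symProj (M : ProObj (GMod A)) : symPro M ⟶ (proConst _).obj A :=
  toConst (symPro M) (Classical.arbitrary _) (Sym.proj _ _)

theorem symProj_isProNilpotentExtension (M : ProObj (GMod A)) :
    IsProNilpotentExtension (symPro M) A (symProj M) := by
  refine ⟨fun i => Sym.proj (M.X i.1) i.2, fun h => Sym.map_proj _ _, fun i => ?_, fun i a => ?_,
    fun i => ?_⟩
  · exact toConst_eq (symPro M) (fun i => Sym.proj (M.X i.1) i.2) (fun h => Sym.map_proj _ _) _ i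
  · exact ⟨SymAlg.ofA _ _ a, SymAlg.proj_ofA a⟩
  · exact ⟨i.2, fun l hl h => SymAlg.prod_ker_eq_zero l hl h⟩

/-- Differentials on the completed symmetric algebra of `M`, intertwined by the projection with the
differential of `A`. -/
structure CEDiff (A : DGCA k) (M : ProObj (GMod A.toGAlg)) where
  d : (toProMod k).obj (symPro M) ⟶ (toProMod k).obj (symPro M)
  der : IsProDerivation (symPro M) d
  sq : d ≫ d = proZero _ _
  comm : (toProMod k).map (symProj M) ≫ A.proD = d ≫ (toProMod k).map (symProj M)

/-- Chevalley-Eilenberg complexes. -/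
structure CEObj (k : Type u) [Field k] [CharZero k] where
  A : DGCA k
  M : ProObj (GMod A.toGAlg)
  fin : IsProFinite M
  diff : CEDiff A M

/-- The Chevalley-Eilenberg complex as an object of `fcdga(k)`. -/
def CEObj.toFcdga (C : CEObj k) : Fcdga k where
  obj :=
    { left := ⟨symPro C.M, C.diff.d, C.diff.der, C.diff.sq⟩
      right := C.A
      hom := ⟨symProj C.M, C.diff.comm⟩ }
  property := symProj_isProNilpotentExtension C.M

/-- The Chevalley-Eilenberg category `CE(k)`: the full subcategory of `fcdga(k)` on the
Chevalley-Eilenberg complexes. -/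
abbrev CE (k : Type u) [Field k] [CharZero k] : Type (u + 1) :=
  InducedCategory (Fcdga k) (CEObj.toFcdga (k := k))

/-- The underlying pro-vector space of a pro-graded module. -/
abbrev modToProMod (A : GAlg k) : ProObj (GMod A) ⥤ ProObj (ModuleCat.{u} k) :=
  proFunctor (GMod.forget A)

/-- `dl` is the linear part of `d`: modulo weight `≥ 2`, the restriction of `d` to `M` is `dl`. -/
def CEDiff.IsLinearPart {A : DGCA k} {M : ProObj (GMod A.toGAlg)} (d : CEDiff A M)
    (dl : (modToProMod A.toGAlg).obj M ⟶ (modToProMod A.toGAlg).obj M) : Prop :=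
  ∀ α : M.I, ∃ (β : M.I) (n : ℕ) (D : SymAlg (M.X β) n →ₗ[k] SymAlg (M.X α) (1 : ℕ))
    (E : M.X β →ₗ[k] M.X α),
    Represents d.d (β, n) (α, 1) (ModuleCat.ofHom D) ∧
    Represents dl β α (ModuleCat.ofHom E) ∧
    ∀ ψ, D (SymAlg.ofM _ _ ψ) = SymAlg.ofM _ _ (E ψ)

/-- The differential `dl` of the pro-graded module `M` and the differential `dL` of the graded
module `L` in duality with `M` are dual to each other:
`dL(x) = d_A ∘ x - (-1)^{|x|} x ∘ dl` for `x ∈ M_α^*`. -/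
def Duality.IsDualDiff {A : DGCA k} {M : ProObj (GMod A.toGAlg)} {L : GMod A.toGAlg}
    (J : Duality M L) (dl : (modToProMod A.toGAlg).obj M ⟶ (modToProMod A.toGAlg).obj M)
    (dL : L →ₗ[k] L) : Prop :=
  ∀ (α : M.I) (p : ℤ) (x : (M.X α).dual p), ∃ (β : M.I) (h : α ≤ β) (E : M.X β →ₗ[k] M.X α)
    (y : (M.X β).dual (p + 1)), Represents dl β α (ModuleCat.ofHom E) ∧
    (∀ ψ, y.1 ψ = A.d (x.1 ((M.map h).toLin ψ)) - sgn p • x.1 (E ψ)) ∧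
    dL (J.j α p x) = J.j β (p + 1) y

/-- The iterated graded commutator `[⋯[[D, ι_{x_1}], ι_{x_2}], ⋯, ι_{x_l}]` of an operator `D` of
degree `e`, where `[D, ι_x] = D ι_x - (-1)^{|D||x|} ι_x D`. Here the `x_i` are in the dual of the
target module `M'` and are pulled back to `M` along `f`. -/
def iteratedCommutator {M M' : GMod A} (f : M ⟶ M') : (l : ℕ) → (e : ℤ) → (p : Fin l → ℤ) →
    (∀ i, M'.dual (p i)) → (SymAlg M ⊤ →ₗ[k] SymAlg M' (l : ℕ)) →
    (SymAlg M ⊤ →ₗ[k] SymAlg M' (0 : ℕ))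
  | 0, _, _, _, D => D
  | l + 1, e, p, x, D =>
    iteratedCommutator f l (e + p 0) (fun i => p i.succ) (fun i => x i.succ)
      ((SymAlg.map (𝟙 M') (by exact_mod_cast Nat.le_succ l)).toLinearMap ∘ₗ D ∘ₗ
          SymAlg.contr (GMod.dualMap f (p 0) (x 0)) le_top
        - sgn (e * p 0) • (SymAlg.contr (x 0) (by norm_cast) ∘ₗ D))

/-- The multiderivation `X` of `L` corresponds to the differential `d` on the completed symmetric
algebra of `M` (in duality with `L`): the weight `-1` part of `[⋯[d, ι_{x_1}], ⋯, ι_{x_{l+1}}]` is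
`ι_{X(x_1, …, x_{l+1})}`, and `[⋯[d, ι_{x_1}], ⋯, ι_{x_l}]` acts on `A`, modulo positive weight, as
`σ(x_1, …, x_l)`. -/
def Corresponds {A : DGCA k} {M : ProObj (GMod A.toGAlg)} {L : GMod A.toGAlg}
    (J : Duality M L) (X : MultiDer L) (d : CEDiff A M) : Prop :=
  (∀ (α : M.I) (l : ℕ), ∃ (β : M.I) (h : α ≤ β) (n : ℕ)
    (D : SymAlg (M.X β) n →ₗ[k] SymAlg (M.X α) (l : ℕ)),
    Represents d.d (β, n) (α, l) (ModuleCat.ofHom D) ∧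
    ∀ (p : Fin l → ℤ) (x : ∀ i, (M.X α).dual (p i)) (a : A.carrier),
      SymAlg.proj _ _ (iteratedCommutator (M.map h) l 1 p x
        (D ∘ₗ (SymAlg.map (𝟙 _) le_top).toLinearMap) (SymAlg.ofA _ _ a))
        = X.σ l (fun i => J.j α (p i) (x i)) a) ∧
  (∀ (α : M.I) (l : ℕ), ∃ (β : M.I) (h : α ≤ β) (n : ℕ)
    (D : SymAlg (M.X β) n →ₗ[k] SymAlg (M.X α) (l + 1 : ℕ)),
    Represents d.d (β, n) (α, l + 1) (ModuleCat.ofHom D) ∧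
    ∀ (p : Fin (l + 1) → ℤ) (x : ∀ i, (M.X α).dual (p i)),
      ∃ y : (M.X β).dual (1 + ∑ i, p i),
        J.j β _ y = X.X l (fun i => J.j α (p i) (x i)) ∧
        ∀ ψ, SymAlg.proj _ _ (iteratedCommutator (M.map h) (l + 1) 1 p x
          (D ∘ₗ (SymAlg.map (𝟙 _) le_top).toLinearMap) (SymAlg.ofM _ _ ψ)) = y.1 ψ)

/-- The flat strong homotopy Lie-Rinehart pair `P` is encoded by the Chevalley-Eilenberg
complex `C`. -/
inductive Encodes : FlatSHLR k → CEObj k → Prop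
  | intro (A : DGCA k) (L : DGMod A) (hL : L.IsGradedFlat) (X : SHLR A L)
      (M : ProObj (GMod A.toGAlg)) (hM : IsProFinite M) (d : CEDiff A M)
      (J : Duality M L.toGMod.shift) (h : Corresponds J X.toMultiDer d) :
      Encodes ⟨A, L, hL, X⟩ ⟨A, M, hM, d⟩

end Main

end

end SHLieRinehart

open SHLieRinehart CategoryTheory

namespace SHLieRinehart

noncomputable section

open CategoryTheory

/-! Write V = L[-1], the direct limit of the duals M_α^*. Everything is transposed: `Wfun M` is the
direct limit of the spaces of k-linear maps Sym_A(M_α) → A that vanish in large weight, and a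
pro-linear endomorphism F of the completed symmetric algebra acts on it by `act F`. Elements of V
act by contraction (`ctrW`), endomorphisms of A by postcomposition (`postW`), and the projection π
becomes a vector `projW`. A derivation over π with values in A is of the form π ι_v + θ π
(`eq_of_isDerOver_proj`). This vector is `kap J v θ`, and it determines v and θ (`kap_injective`).
The correspondence thereby turns into a single family of equations, `Star`: for all x_1, …, x_l, the
iterated bracket of `act d` with ι_{x_1}, …, ι_{x_l}, applied to π, is `kap` of the pair (X(x_1, …,
x_l), σ(x_1, …, x_l)). See `Star.corresponds` and `Corresponds.star`.

From d to X: iterated commutators of a derivation with contractions are derivations, so their values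
at π lie in the image of `kap`. Graded symmetry holds because contractions commute up to sign, and
the Leibniz rule because π ι_{am} = a π ι_m while θ differentiates a (`brP_concat_smul`).

Uniqueness rests on a Taylor formula. Over a finite homogeneous basis, an element of Sym has weight
> N as soon as all its contractions with at most N vectors of the dual basis project to zero
(`mem_weightGE_of_word`); the proof uses the Euler operator and characteristic zero. Hence a
pro-morphism is determined by its transpose on the words π ι_{x_1}⋯ι_{x_l} (`rep_hom_ext`), and
these values are determined by the brackets at π (`word_brL_eq_zero`).

From X to d: at a stage (α, N) the values of X on words in a dual basis lift to a common stage β and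
give derivations Sym(M_β) → Sym(M_α) that commute with the contractions. A series with coefficients
1/l! built from them has the prescribed iterated commutators (`exists_local_derivation`); the
passage from words in the basis to arbitrary words uses symmetry and the Leibniz rule
(`starM_of_basis`). By uniqueness the local pieces agree after the source is enlarged, so they form
a pro-morphism (`exists_star_act`).

The brackets of d∘d at π are the Jacobi expressions of X (`Star.square`), so d² = 0 if and only if X
squares to zero. The statement on linear parts is the case of a single letter
(`Corresponds.isDualDiff_iff`).

That flat modules are the modules dual to pro-finite ones is a graded form of Lazard's theorem
(`Duality.isFlat`, `GMod.IsFlat.exists_duality`). Two pro-finite duals of the same V give isomorphic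
completed symmetric algebras, and the isomorphism respects the differentials because both satisfy
`Star` for the same X (`SymOver.comm`). The equivalence of categories is then formal. -/

theorem sgn_even {n : ℤ} (h : Even n) : sgn n = 1 := by simp [sgn, Int.negOnePow_even n h]

theorem sgn_odd {n : ℤ} (h : Odd n) : sgn n = -1 := by simp [sgn, Int.negOnePow_odd n h]

theorem sgn_one : sgn 1 = -1 := sgn_odd odd_one

theorem sgn_neg (n : ℤ) : sgn (-n) = sgn n := by simp [sgn, Int.negOnePow_neg]

theorem sgn_congr {m n : ℤ} (h : Even (m - n)) : sgn m = sgn n := by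
  have := sgn_add (m - n) n
  rwa [sub_add_cancel, sgn_even h, one_mul] at this

theorem sgn_eq_or (n : ℤ) : sgn n = 1 ∨ sgn n = -1 := by
  rcases Int.even_or_odd n with h | h
  · exact Or.inl (sgn_even h)
  · exact Or.inr (sgn_odd h)

theorem sgn_smul_sgn_smul {G : Type*} [AddCommGroup G] (n : ℤ) (x : G) : sgn n • sgn n • x = x := by
  rw [smul_smul, sgn_mul_self, one_smul]

/-! ### Iterated graded commutators along words -/

section Brackets

variable {k : Type u} [Field k] {Λ : Type*} (deg : Λ → ℤ)

/-- The total degree of a word. -/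
def wdeg (w : List Λ) : ℤ := (w.map deg).sum

@[simp] theorem wdeg_nil : wdeg deg [] = 0 := rfl

@[simp] theorem wdeg_cons (x : Λ) (w : List Λ) : wdeg deg (x :: w) = deg x + wdeg deg w := by
  simp [wdeg]

@[simp] theorem wdeg_append (v w : List Λ) : wdeg deg (v ++ w) = wdeg deg v + wdeg deg w := by
  simp [wdeg]

variable {W₁ W₂ W₃ : Type*} [AddCommGroup W₁] [Module k W₁] [AddCommGroup W₂] [Module k W₂]
  [AddCommGroup W₃] [Module k W₃]

/-- The graded commutator of an operator `Q` of degree `e` with operators `I₁`, `I₂` of degree `p`;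
operators act from the right. -/
def brk (e p : ℤ) (I₁ : W₁ →ₗ[k] W₁) (I₂ : W₂ →ₗ[k] W₂) (Q : W₁ →ₗ[k] W₂) : W₁ →ₗ[k] W₂ :=
  I₂ ∘ₗ Q - sgn (e * p) • (Q ∘ₗ I₁)

theorem brk_apply (e p : ℤ) (I₁ : W₁ →ₗ[k] W₁) (I₂ : W₂ →ₗ[k] W₂) (Q : W₁ →ₗ[k] W₂) (s : W₁) :
    brk e p I₁ I₂ Q s = I₂ (Q s) - sgn (e * p) • Q (I₁ s) := rfl

variable (ι₁ : Λ → W₁ →ₗ[k] W₁) (ι₂ : Λ → W₂ →ₗ[k] W₂) (ι₃ : Λ → W₃ →ₗ[k] W₃)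

/-- The iterated graded commutator of `Q` with the letters of a word. -/
def brL : ℤ → (W₁ →ₗ[k] W₂) → List Λ → (W₁ →ₗ[k] W₂)
  | _, Q, [] => Q
  | e, Q, x :: w => brL (e + deg x) (brk e (deg x) (ι₁ x) (ι₂ x) Q) w

@[simp] theorem brL_nil (e : ℤ) (Q : W₁ →ₗ[k] W₂) : brL deg ι₁ ι₂ e Q [] = Q := rfl

theorem brL_cons (e : ℤ) (Q : W₁ →ₗ[k] W₂) (x : Λ) (w : List Λ) : brL deg ι₁ ι₂ e Q (x :: w)
    = brL deg ι₁ ι₂ (e + deg x) (brk e (deg x) (ι₁ x) (ι₂ x) Q) w := rfl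

theorem brL_append (e : ℤ) (Q : W₁ →ₗ[k] W₂) (v w : List Λ) : brL deg ι₁ ι₂ e Q (v ++ w)
    = brL deg ι₁ ι₂ (e + wdeg deg v) (brL deg ι₁ ι₂ e Q v) w := by
  induction v generalizing e Q with
  | nil => simp
  | cons x v ih =>
    rw [List.cons_append, brL_cons, ih, brL_cons, wdeg_cons, add_assoc]

theorem brL_concat (e : ℤ) (Q : W₁ →ₗ[k] W₂) (v : List Λ) (x : Λ) :
    brL deg ι₁ ι₂ e Q (v ++ [x])
    = brk (e + wdeg deg v) (deg x) (ι₁ x) (ι₂ x) (brL deg ι₁ ι₂ e Q v) := by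
  rw [brL_append]; rfl

theorem brk_sub (e p : ℤ) (I₁ : W₁ →ₗ[k] W₁) (I₂ : W₂ →ₗ[k] W₂) (Q Q' : W₁ →ₗ[k] W₂) :
    brk e p I₁ I₂ (Q - Q') = brk e p I₁ I₂ Q - brk e p I₁ I₂ Q' := by
  ext s; simp only [brk_apply, LinearMap.sub_apply, map_sub, smul_sub]; abel

theorem brL_sub (e : ℤ) (Q Q' : W₁ →ₗ[k] W₂) (w : List Λ) :
    brL deg ι₁ ι₂ e (Q - Q') w = brL deg ι₁ ι₂ e Q w - brL deg ι₁ ι₂ e Q' w := by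
  induction w generalizing e Q Q' with
  | nil => rfl
  | cons x w ih => simp only [brL_cons, brk_sub, ih]

theorem brk_add (e p : ℤ) (I₁ : W₁ →ₗ[k] W₁) (I₂ : W₂ →ₗ[k] W₂) (Q Q' : W₁ →ₗ[k] W₂) :
    brk e p I₁ I₂ (Q + Q') = brk e p I₁ I₂ Q + brk e p I₁ I₂ Q' := by
  ext s; simp only [brk_apply, LinearMap.add_apply, map_add, smul_add]; abel

theorem brk_zsmul (e p : ℤ) (I₁ : W₁ →ₗ[k] W₁) (I₂ : W₂ →ₗ[k] W₂) (n : ℤ) (Q : W₁ →ₗ[k] W₂) :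
    brk e p I₁ I₂ (n • Q) = n • brk e p I₁ I₂ Q := by
  ext s
  simp only [brk_apply, LinearMap.smul_apply, map_zsmul, smul_sub, smul_comm n]

theorem brL_add (e : ℤ) (Q Q' : W₁ →ₗ[k] W₂) (w : List Λ) :
    brL deg ι₁ ι₂ e (Q + Q') w = brL deg ι₁ ι₂ e Q w + brL deg ι₁ ι₂ e Q' w := by
  induction w generalizing e Q Q' with
  | nil => rfl
  | cons x w ih => simp only [brL_cons, brk_add, ih]

theorem brL_zsmul (e : ℤ) (n : ℤ) (Q : W₁ →ₗ[k] W₂) (w : List Λ) :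
    brL deg ι₁ ι₂ e (n • Q) w = n • brL deg ι₁ ι₂ e Q w := by
  induction w generalizing e Q with
  | nil => rfl
  | cons x w ih => simp only [brL_cons, brk_zsmul, ih]

/-- Graded commutativity of a family of operators. -/
def GComm (ι₁ : Λ → W₁ →ₗ[k] W₁) : Prop :=
  ∀ x y s, ι₁ x (ι₁ y s) = sgn (deg x * deg y) • ι₁ y (ι₁ x s)

variable {ι₁ ι₂ deg}

/-- This is the graded Jacobi identity: the term with the commutator of the two operators I vanishes
by graded commutativity, so only the Koszul sign of the exchange remains. -/
theorem brk_brk (h₁ : GComm deg ι₁) (h₂ : GComm deg ι₂) (e : ℤ) (Q : W₁ →ₗ[k] W₂) (x y : Λ) :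
    brk (e + deg x) (deg y) (ι₁ y) (ι₂ y) (brk e (deg x) (ι₁ x) (ι₂ x) Q)
    = sgn (deg x * deg y) •
      brk (e + deg y) (deg x) (ι₁ x) (ι₂ x) (brk e (deg y) (ι₁ y) (ι₂ y) Q) := by
  ext s
  simp only [brk_apply, LinearMap.smul_apply, map_sub, map_zsmul, smul_sub, h₂ y x, h₁ y x,
    smul_smul, ← sgn_add]
  have e1 : sgn (deg y * deg x) = sgn (deg x * deg y) := by rw [mul_comm]
  have e2 : sgn (deg x * deg y + e * deg y)
    = sgn ((e + deg x) * deg y) := by congr 1; ring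
  have e3 : sgn (deg x * deg y + (e + deg y) * deg x) = sgn (e * deg x) := by
    apply sgn_congr; exact ⟨deg x * deg y, by ring⟩
  have e4 : sgn (deg x * deg y + ((e + deg y) * deg x + (e * deg y + deg y * deg x)))
      = sgn ((e + deg x) * deg y + e * deg x) := by
    apply sgn_congr; exact ⟨deg x * deg y, by ring⟩
  rw [e1, e2, e3, e4]
  abel

theorem brL_swap (h₁ : GComm deg ι₁) (h₂ : GComm deg ι₂) (e : ℤ) (Q : W₁ →ₗ[k] W₂) (v : List Λ)
    (x y : Λ) (w : List Λ) : brL deg ι₁ ι₂ e Q (v ++ x :: y :: w)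
    = sgn (deg x * deg y) • brL deg ι₁ ι₂ e Q (v ++ y :: x :: w) := by
  rw [brL_append, brL_append, brL_cons, brL_cons, brL_cons, brL_cons, brk_brk h₁ h₂, brL_zsmul,
    add_right_comm]

/-- The words ending with the iterated brackets of `Q` vanish if the iterated brackets do. -/
theorem word_brL_eq_zero (S : Set Λ) (N : ℕ) (π : W₁) (e : ℤ) (Q : W₁ →ₗ[k] W₂)
    (h : ∀ w : List Λ, (∀ x ∈ w, x ∈ S) → w.length ≤ N → brL deg ι₁ ι₂ e Q w π = 0)
    (u w : List Λ) (hu : ∀ x ∈ u, x ∈ S) (hw : ∀ x ∈ w, x ∈ S) (hl : u.length + w.length ≤ N) :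
    brL deg ι₁ ι₂ e Q w (u.foldr (fun x s => ι₁ x s) π) = 0 := by
  induction u generalizing w with
  | nil => exact h w hw (by simpa using hl)
  | cons x u ih =>
    -- The outer letter x is moved from the vector into the bracket: [Q, w, x](s) = ι_x [Q, w](s) -
    -- ± [Q, w](ι_x s). The left side and the first term on the right vanish by induction, since `u`
    -- is shorter.
    have h1 := ih w (fun y hy => hu y (List.mem_cons_of_mem _ hy)) hw
      (by simp at hl; omega)
    have h2 := ih (w ++ [x]) (fun y hy => hu y (List.mem_cons_of_mem _ hy))
      (by
        intro y hy
        rcases List.mem_append.1 hy with hy | hy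
        · exact hw y hy
        · rw [List.mem_singleton.1 hy]; exact hu x List.mem_cons_self)
      (by simp at hl ⊢; omega)
    rw [brL_concat, brk_apply, h1, map_zero, zero_sub, neg_eq_zero] at h2
    have h3 := congrArg (fun t => sgn ((e + wdeg deg w) * deg x) • t) h2
    rw [sgn_smul_sgn_smul, smul_zero] at h3
    exact h3

end Brackets

/-! ### Signed sums over the splittings of a word -/

section ShuffleSums

variable {Λ : Type*} (deg : Λ → ℤ) {G : Type*} [AddCommGroup G]

/-- The signed sum of `F a b` over all ways of splitting a word into two subwords `a`, `b`. -/
def shSum : List Λ → (List Λ → List Λ → G) → G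
  | [], F => F [] []
  | x :: w, F => shSum w (fun a b => F (x :: a) b)
      + shSum w (fun a b => sgn (deg x * wdeg deg a) • F a (x :: b))

theorem shSum_add (w : List Λ) (F F' : List Λ → List Λ → G) :
    shSum deg w (fun a b => F a b + F' a b) = shSum deg w F + shSum deg w F' := by
  induction w generalizing F F' with
  | nil => rfl
  | cons x w ih => simp only [shSum, smul_add, ih]; abel

theorem shSum_map {G' : Type*} [AddCommGroup G'] (φ : G →+ G') (w : List Λ)
    (F : List Λ → List Λ → G) : φ (shSum deg w F) = shSum deg w (fun a b => φ (F a b)) := by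
  induction w generalizing F with
  | nil => rfl
  | cons x w ih => simp only [shSum, map_add, ih, map_zsmul]

/-- Splittings come in pairs (a, b) and (b, a), whose shuffle signs differ by (-1)^{|a||b|}. This
serves to cancel symmetric terms in the square of an operator. -/
theorem shSum_swap (w : List Λ) (F : List Λ → List Λ → G) :
    shSum deg w F = shSum deg w (fun a b => sgn (wdeg deg a * wdeg deg b) • F b a) := by
  induction w generalizing F with
  | nil => simp [shSum, sgn_zero]
  | cons x w ih =>
    rw [shSum, ih, ih (fun a b => sgn (deg x * wdeg deg a) • F a (x :: b)), add_comm, shSum]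
    congr 2
    · funext a b
      rw [smul_smul, ← sgn_add, wdeg_cons]
      congr 2; ring
    · funext a b
      rw [smul_smul, ← sgn_add, wdeg_cons]
      congr 1
      apply sgn_congr
      exact ⟨-(deg x * wdeg deg a), by ring⟩

theorem shSum_neg (w : List Λ) (F : List Λ → List Λ → G) :
    shSum deg w (fun a b => - F a b) = - shSum deg w F :=
  (shSum_map deg (-AddMonoidHom.id G) w F).symm

theorem shSum_zsmul (n : ℤ) (w : List Λ) (F : List Λ → List Λ → G) :
    n • shSum deg w F = shSum deg w (fun a b => n • F a b) :=
  shSum_map deg (zsmulAddGroupHom n) w F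

end ShuffleSums

/-! ### Brackets of a product of operators -/

section Product

variable {k : Type u} [Field k] {Λ : Type*} {deg : Λ → ℤ}
variable {W₁ W₂ W₃ : Type*} [AddCommGroup W₁] [Module k W₁] [AddCommGroup W₂] [Module k W₂]
  [AddCommGroup W₃] [Module k W₃]
variable (ι₁ : Λ → W₁ →ₗ[k] W₁) (ι₂ : Λ → W₂ →ₗ[k] W₂) (ι₃ : Λ → W₃ →ₗ[k] W₃)

/-- The iterated bracket of the product of `Q₁` and `Q₂` (acting from the right, `Q₁` first). -/
theorem brL_comp (e₁ e₂ : ℤ) (Q₁ : W₁ →ₗ[k] W₂) (Q₂ : W₂ →ₗ[k] W₃) (w : List Λ) :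
    brL deg ι₁ ι₃ (e₁ + e₂) (Q₂ ∘ₗ Q₁) w = shSum deg w (fun a b =>
      sgn (e₂ * wdeg deg a) • (brL deg ι₂ ι₃ e₂ Q₂ b ∘ₗ brL deg ι₁ ι₂ e₁ Q₁ a)) := by
  induction w generalizing e₁ e₂ Q₁ Q₂ with
  | nil => simp [shSum, sgn_zero]
  | cons x w ih =>
    -- The graded Leibniz rule for commutators: the letter goes either to Q₂ or to Q₁. These are the
    -- two summands of `shSum`, in the opposite order.
    have h : brk (e₁ + e₂) (deg x) (ι₁ x) (ι₃ x) (Q₂ ∘ₗ Q₁)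
        = brk e₂ (deg x) (ι₂ x) (ι₃ x) Q₂ ∘ₗ Q₁
          + sgn (e₂ * deg x) • (Q₂ ∘ₗ brk e₁ (deg x) (ι₁ x) (ι₂ x) Q₁) := by
      ext s
      simp only [brk_apply, LinearMap.comp_apply, LinearMap.add_apply, LinearMap.smul_apply,
        map_sub, map_zsmul, smul_sub, smul_smul, ← sgn_add]
      have : e₂ * deg x + e₁ * deg x = (e₁ + e₂) * deg x := by ring
      rw [this]; abel
    rw [brL_cons, h, brL_add, brL_zsmul, add_assoc, ih, add_comm, shSum]
    congr 1
    · rw [← add_assoc, add_right_comm, ih]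
      rw [shSum_zsmul]
      congr 1
      funext a b
      simp only [smul_smul, ← sgn_add, wdeg_cons, brL_cons]
      congr 2; ring
    · congr 1
      funext a b
      rw [smul_smul, ← sgn_add, brL_cons]
      congr 2; ring

end Product

/-! ### Unshuffles, and their agreement with the recursive sums -/

section Unshuffles

variable {n : ℕ}

/-- The permutation of `Fin (n + 1)` with `a ↦ 0` which induces `τ` on the remaining elements. -/
def insPerm (a : Fin (n + 1)) (τ : Equiv.Perm (Fin n)) : Equiv.Perm (Fin (n + 1)) :=
  (finSuccEquiv' a).trans ((Equiv.optionCongr τ).trans (finSuccEquiv n).symm)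

@[simp] theorem insPerm_self (a : Fin (n + 1)) (τ : Equiv.Perm (Fin n)) : insPerm a τ a = 0 := by
  simp [insPerm]

@[simp] theorem insPerm_succAbove (a : Fin (n + 1)) (τ : Equiv.Perm (Fin n)) (i : Fin n) :
    insPerm a τ (a.succAbove i) = (τ i).succ := by
  simp [insPerm]

theorem insPerm_bijective : Function.Bijective
    (fun x : Fin (n + 1) × Equiv.Perm (Fin n) => insPerm x.1 x.2) := by
  rw [Fintype.bijective_iff_injective_and_card]
  refine ⟨?_, by simp [Fintype.card_perm, Nat.factorial_succ]⟩
  rintro ⟨a, τ⟩ ⟨a', τ'⟩ h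
  have h : insPerm a τ = insPerm a' τ' := h
  have ha : a = a' := by
    apply (insPerm a τ).injective
    conv_rhs => rw [h]
    simp
  subst ha
  congr
  ext i
  have := DFunLike.congr_fun h (a.succAbove i)
  simp only [insPerm_succAbove, Fin.succ_inj] at this
  rw [this]

theorem sum_perm_eq {G : Type*} [AddCommMonoid G] (F : Equiv.Perm (Fin (n + 1)) → G) :
    ∑ ρ, F ρ = ∑ a, ∑ τ, F (insPerm a τ) := by
  rw [← Fintype.sum_prod_type']
  exact (Function.Bijective.sum_comp insPerm_bijective F).symm

/-- The value 0 is attained at position `a`, so its inversions are exactly those with the positions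
before `a`; all others are inversions of `τ`. -/
theorem koszul_insPerm (d : Fin (n + 1) → ℤ) (a : Fin (n + 1)) (τ : Equiv.Perm (Fin n)) :
    koszul d (insPerm a τ) = (∏ i : Fin n, if (i : ℕ) < a then sgn (d 0 * d (τ i).succ) else 1)
      * koszul (fun i => d i.succ) τ := by
  unfold koszul
  rw [Fin.prod_univ_succAbove _ a, Finset.prod_eq_one, one_mul, ← Finset.prod_mul_distrib]
  · refine Finset.prod_congr rfl fun i _ => ?_
    rw [Fin.prod_univ_succAbove _ a]
    simp only [insPerm_self, insPerm_succAbove, Fin.succ_pos, and_true, Fin.succ_lt_succ_iff,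
      Fin.succAbove_lt_succAbove_iff]
    congr 1
    have : a.succAbove i < a ↔ (i : ℕ) < a := by
      rw [Fin.succAbove_lt_iff_castSucc_lt]; rfl
    rw [mul_comm (d 0)]
    simp only [this]
  · intro i _
    rw [if_neg]
    simp

theorem insPerm_mem_zero (a : Fin (n + 1)) (τ : Equiv.Perm (Fin n)) :
    insPerm a τ ∈ unshuffles 0 (n + 1) ↔ a = 0 ∧ τ ∈ unshuffles 0 n := by
  simp only [unshuffles, Finset.mem_filter, Finset.mem_univ, true_and, Nat.not_lt_zero, false_or,
    Nat.zero_le, forall_true_left]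
  constructor
  · intro h
    have ha : a = 0 := by
      by_contra ha
      have := h 0 a (Fin.pos_of_ne_zero ha)
      simp at this
    subst ha
    refine ⟨rfl, fun i j hij => ?_⟩
    have := h ((0 : Fin (n + 1)).succAbove i) ((0 : Fin (n + 1)).succAbove j)
      (Fin.succAbove_lt_succAbove_iff.2 hij)
    simpa only [insPerm_succAbove, Fin.succ_lt_succ_iff] using this
  · rintro ⟨rfl, h⟩ i j hij
    induction j using Fin.succAboveCases (0 : Fin (n + 1)) with
    | x => simp at hij
    | p j =>
      induction i using Fin.succAboveCases (0 : Fin (n + 1)) with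
      | x => simp only [insPerm_self, insPerm_succAbove, Fin.succ_pos]
      | p i =>
        simp only [insPerm_succAbove, Fin.succ_lt_succ_iff]
        exact h i j (Fin.succAbove_lt_succAbove_iff.1 hij)

/-- Both blocks of an unshuffle are increasing, so the smallest value opens a block. It sits at
position 0, leaving q entries in the first block, or at position q + 1, the start of the second. -/
theorem insPerm_mem_succ (q : ℕ) (a : Fin (n + 1)) (τ : Equiv.Perm (Fin n)) :
    insPerm a τ ∈ unshuffles (q + 1) (n + 1)
      ↔ (a = 0 ∧ τ ∈ unshuffles q n) ∨ ((a : ℕ) = q + 1 ∧ τ ∈ unshuffles (q + 1) n) := by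
  simp only [unshuffles, Finset.mem_filter, Finset.mem_univ, true_and]
  have hval : ∀ i : Fin n, ((a.succAbove i : Fin (n + 1)) : ℕ)
      = if (i : ℕ) < a then (i : ℕ) else i + 1 := by
    intro i
    rw [Fin.succAbove]
    simp only [Fin.lt_def, Fin.val_castSucc]
    split_ifs <;> rfl
  constructor
  · intro h
    have ha : a = 0 ∨ (a : ℕ) = q + 1 := by
      by_contra! ha
      have hpos : 0 < (a : ℕ) := Fin.pos_of_ne_zero ha.1
      rcases lt_or_gt_of_ne ha.2 with h1 | h1
      · have := h 0 a (Fin.pos_of_ne_zero ha.1) (Or.inl h1)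
        simp at this
      · have := h ⟨q + 1, by omega⟩ a (by rw [Fin.lt_def]; exact h1) (Or.inr (le_refl _))
        simp at this
    rcases ha with ha | ha
    · refine Or.inl ⟨ha, fun i j hij hc => ?_⟩
      have ha0 : (a : ℕ) = 0 := by rw [ha]; rfl
      have := h (a.succAbove i) (a.succAbove j) (Fin.succAbove_lt_succAbove_iff.2 hij) (by
        rw [hval, hval, ha0]; simp; omega)
      simpa only [insPerm_succAbove, Fin.succ_lt_succ_iff] using this
    · refine Or.inr ⟨ha, fun i j hij hc => ?_⟩
      have := h (a.succAbove i) (a.succAbove j) (Fin.succAbove_lt_succAbove_iff.2 hij) (by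
        rw [hval, hval, ha]; split_ifs <;> omega)
      simpa only [insPerm_succAbove, Fin.succ_lt_succ_iff] using this
  · rintro (⟨rfl, h⟩ | ⟨ha, h⟩) i j hij hc
    · induction j using Fin.succAboveCases (0 : Fin (n + 1)) with
      | x => simp at hij
      | p j =>
        induction i using Fin.succAboveCases (0 : Fin (n + 1)) with
        | x => simp only [insPerm_self, insPerm_succAbove, Fin.succ_pos]
        | p i =>
          simp only [insPerm_succAbove, Fin.succ_lt_succ_iff]
          refine h i j (Fin.succAbove_lt_succAbove_iff.1 hij) ?_
          rw [hval, hval] at hc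
          simp at hc
          omega
    · induction j using Fin.succAboveCases a with
      | x =>
        rw [ha] at hc
        have := Fin.lt_def.1 hij
        omega
      | p j =>
        induction i using Fin.succAboveCases a with
        | x => simp only [insPerm_self, insPerm_succAbove, Fin.succ_pos]
        | p i =>
          simp only [insPerm_succAbove, Fin.succ_lt_succ_iff]
          refine h i j (Fin.succAbove_lt_succAbove_iff.1 hij) ?_
          rw [hval, hval, ha] at hc
          split_ifs at hc <;> omega

variable {Λ : Type*} {deg : Λ → ℤ} {G : Type*} [AddCommGroup G]

theorem wdeg_take_ofFn (p : ℕ) (v : Fin n → Λ) :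
    wdeg deg ((List.ofFn v).take p) = ∑ i : Fin n, if (i : ℕ) < p then deg (v i) else 0 := by
  induction n generalizing p with
  | zero => simp
  | succ n ih =>
    cases p with
    | zero => simp
    | succ p => rw [List.ofFn_succ, List.take_succ_cons, wdeg_cons, ih, Fin.sum_univ_succ]; simp

theorem prod_sgn_ite (p : ℕ) (c : ℤ) (f : Fin n → ℤ) :
    (∏ i : Fin n, if (i : ℕ) < p then sgn (c * f i) else 1)
      = sgn (c * ∑ i : Fin n, if (i : ℕ) < p then f i else 0) := by
  rw [Finset.mul_sum]
  induction n with
  | zero => simp [sgn_zero]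
  | succ n ih => 
    rw [Fin.prod_univ_castSucc, Fin.sum_univ_castSucc, sgn_add]
    refine congrArg₂ _ (ih fun i => f i.castSucc) ?_
    split_ifs <;> simp [sgn_zero]

/-- The letter x has index 0 in `Fin.cons x w`, and the permutation takes the value 0 at position
`a`; so x appears there, with the permuted word w around it. -/
theorem ofFn_insPerm (x : Λ) (w : Fin n → Λ) (a : Fin (n + 1)) (τ : Equiv.Perm (Fin n)) :
    List.ofFn (fun i => (Fin.cons x w : Fin (n + 1) → Λ) (insPerm a τ i))
      = (List.ofFn (fun i => w (τ i))).take a ++ x :: (List.ofFn (fun i => w (τ i))).drop a := by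
  have ha := a.2
  refine List.ext_getElem (by simp; omega) fun i h1 h2 => ?_
  rw [List.getElem_ofFn]
  have hi : i < n + 1 := by simpa using h1
  have key : ∀ j : Fin (n + 1), (Fin.cons x w : Fin (n + 1) → Λ) (insPerm a τ j)
      = if h : (j : ℕ) < a then w (τ ⟨j, by omega⟩) else
        if h' : (j : ℕ) = a then x else w (τ ⟨j - 1, by omega⟩) := by
    intro j
    induction j using Fin.succAboveCases a with
    | x => simp
    | p j =>
      rw [insPerm_succAbove, Fin.cons_succ]
      have hv : ((a.succAbove j : Fin (n + 1)) : ℕ) = if (j : ℕ) < a then (j : ℕ) else j + 1 := by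
        rw [Fin.succAbove]
        simp only [Fin.lt_def, Fin.val_castSucc]
        split_ifs <;> rfl
      simp only [hv]
      by_cases hj : (j : ℕ) < a
      · simp [hj]
      · simp only [hj, if_false]
        rw [dif_neg (by omega), dif_neg (by omega)]
        rfl
  rw [key ⟨i, hi⟩]
  simp only
  have hlen : ((List.ofFn (fun i => w (τ i))).take a).length = a := by simp; omega
  by_cases h : i < a
  · rw [dif_pos h, List.getElem_append_left (by omega)]
    simp
  · rw [dif_neg h, List.getElem_append_right (by omega)]
    simp only [hlen]
    by_cases h' : i = a
    · rw [dif_pos h']; simp [h']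
    · rw [dif_neg h']
      obtain ⟨c, hc⟩ : ∃ c, i - (a : ℕ) = c + 1 := ⟨i - a - 1, by omega⟩
      simp only [hc, List.getElem_cons_succ, List.getElem_drop, List.getElem_ofFn]
      congr 3
      omega

theorem sum_mem_eq_ite {ι : Type*} [Fintype ι] [DecidableEq ι] (s : Finset ι) (F : ι → G) :
    ∑ i ∈ s, F i = ∑ i, if i ∈ s then F i else 0 := by
  simp [Finset.sum_ite_mem]

/-- Sorting the unshuffles by the block that contains the smallest element reproduces the recursion
of `shSum`, which sends the first letter to one of the two subwords. -/
theorem sum_unshuffles_succ (F : ℕ → Equiv.Perm (Fin (n + 1)) → G) :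
    ∑ p ∈ Finset.range (n + 2), ∑ τ ∈ unshuffles p (n + 1), F p τ
      = ∑ p : Fin (n + 1), ∑ τ ∈ unshuffles p n, (F (p + 1) (insPerm 0 τ) + F p (insPerm p τ)) := by
  have h0 : ∑ τ ∈ unshuffles 0 (n + 1), F 0 τ = ∑ τ ∈ unshuffles 0 n, F 0 (insPerm 0 τ) := by
    rw [sum_mem_eq_ite, sum_perm_eq, Finset.sum_eq_single 0]
    · rw [sum_mem_eq_ite (unshuffles _ n)]
      simp [insPerm_mem_zero]
    · intro a _ ha
      exact Finset.sum_eq_zero fun τ _ => by simp [insPerm_mem_zero, ha]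
    · simp
  -- For `q ≥ n` there is no position `q + 1`: the second block is empty and cannot begin with the
  -- smallest element. Hence the conditional.
  have h1 : ∀ q, ∑ τ ∈ unshuffles (q + 1) (n + 1), F (q + 1) τ
      = ∑ τ ∈ unshuffles q n, F (q + 1) (insPerm 0 τ)
        + if h : q + 1 < n + 1 then ∑ τ ∈ unshuffles (q + 1) n, F (q + 1) (insPerm ⟨q + 1, h⟩ τ)
          else 0 := by
    intro q
    rw [sum_mem_eq_ite, sum_perm_eq, Fin.sum_univ_succ]
    congr 1
    · rw [sum_mem_eq_ite (unshuffles _ n)]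
      refine Finset.sum_congr rfl fun τ _ => ?_
      simp [insPerm_mem_succ]
    · have : ∀ i : Fin n, ∀ τ, (insPerm i.succ τ ∈ unshuffles (q + 1) (n + 1)
          ↔ (i : ℕ) = q ∧ τ ∈ unshuffles (q + 1) n) := by
        intro i τ
        simp [insPerm_mem_succ]
      simp only [this]
      split_ifs with h
      · rw [Finset.sum_eq_single ⟨q, by omega⟩]
        · rw [sum_mem_eq_ite (unshuffles _ n)]
          refine Finset.sum_congr rfl fun τ _ => ?_
          simp
        · intro i _ hi
          refine Finset.sum_eq_zero fun τ _ => if_neg ?_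
          rintro ⟨h1, -⟩
          exact hi (Fin.ext h1)
        · simp
      · refine Finset.sum_eq_zero fun i _ => Finset.sum_eq_zero fun τ _ => if_neg ?_
        rintro ⟨h1, -⟩
        omega
  rw [Finset.sum_range_succ', h0]
  simp only [h1, Finset.sum_add_distrib]
  rw [Finset.sum_range fun q => ∑ τ ∈ unshuffles q n, F (q + 1) (insPerm 0 τ), add_assoc]
  congr 1
  rw [Finset.sum_range_succ, dif_neg (by omega), add_zero, Finset.sum_range, Fin.sum_univ_succ,
    add_comm]
  congr 1
  refine Finset.sum_congr rfl fun i _ => ?_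
  rw [dif_pos (by omega)]
  rfl

/-- This identifies the recursive sums with the sums over unshuffles in the definition of a
square-zero multiderivation; the computations are done with the recursive form. -/
theorem shSum_ofFn (w : Fin n → Λ) (F : List Λ → List Λ → G) :
    shSum deg (List.ofFn w) F = ∑ p ∈ Finset.range (n + 1), ∑ τ ∈ unshuffles p n,
      koszul (fun i => deg (w i)) τ • F ((List.ofFn fun i => w (τ i)).take p)
        ((List.ofFn fun i => w (τ i)).drop p) := by
  induction n generalizing F with
  | zero =>
    have : unshuffles 0 0 = {1} := by
      ext τ; simp [unshuffles, Subsingleton.elim τ 1]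
    simp [shSum, this, koszul]
  | succ n ih =>
    obtain ⟨x, w, rfl⟩ : ∃ x v, w = Fin.cons x v := ⟨w 0, Fin.tail w, (Fin.cons_self_tail w).symm⟩
    rw [sum_unshuffles_succ, List.ofFn_succ, shSum]
    simp only [Fin.cons_zero, Fin.cons_succ, ih, Finset.sum_range, ← Finset.sum_add_distrib]
    refine Finset.sum_congr rfl fun p _ => Finset.sum_congr rfl fun τ _ => ?_
    rw [ofFn_insPerm, ofFn_insPerm, koszul_insPerm, koszul_insPerm]
    congr 1
    · simp
    · have hlen : ((List.ofFn (fun i => w (τ i))).take p).length = p := by simp; omega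
      simp only [Fin.cons_zero, Fin.cons_succ]
      rw [prod_sgn_ite p (deg x) (fun i => deg (w (τ i))), List.take_left' hlen,
        List.drop_left' hlen, wdeg_take_ofFn, smul_smul, mul_comm]

end Unshuffles

/-! ### Homogeneous components -/

section Components

variable {k : Type u} [Field k] {V : Type u} [AddCommGroup V] [Module k V]
  {gr : ℤ → Submodule k V}

/-- The projection onto the homogeneous component of degree `j`. -/
def component (h : DirectSum.IsInternal gr) (j : ℤ) : V →ₗ[k] V :=
  scale h (fun i => if i = j then 1 else 0)

theorem component_of_mem (h : DirectSum.IsInternal gr) {j : ℤ} {v : V} (hv : v ∈ gr j) :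
    component h j v = v := by
  rw [component, scale_of_mem h _ hv, if_pos rfl, one_smul]

theorem component_of_mem_ne (h : DirectSum.IsInternal gr) {i j : ℤ} (hij : i ≠ j) {v : V}
    (hv : v ∈ gr i) : component h j v = 0 := by
  rw [component, scale_of_mem h _ hv, if_neg hij, zero_smul]

theorem component_mem (h : DirectSum.IsInternal gr) (j : ℤ) (v : V) : component h j v ∈ gr j := by
  induction v using graded_induction h with
  | add x y hx hy => rw [map_add]; exact Submodule.add_mem _ hx hy
  | hom i x hx =>
    by_cases hij : i = j
    · subst hij; rwa [component_of_mem h hx]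
    · rw [component_of_mem_ne h hij hx]; exact Submodule.zero_mem _

end Components

/-! ### Graded derivations over a morphism -/

section Derivations

variable {k : Type u} [Field k]

/-- `D` is a derivation of degree `e` over the morphism of graded algebras `φ`. -/
def IsDerOver {X Y : GAlg k} (e : ℤ) (φ : X ⟶ Y) (D : X →ₗ[k] Y) : Prop :=
  (∀ (i : ℤ) (a : X), a ∈ X.gr i → D a ∈ Y.gr (i + e)) ∧
  ∀ (i : ℤ) (a b : X), a ∈ X.gr i →
    D (a * b) = D a * φ.toAlgHom b + sgn (e * i) • (φ.toAlgHom a * D b)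

theorem isDerivationOver_iff {X Y : GAlg k} {φ : X ⟶ Y} {D : X →ₗ[k] Y} :
    IsDerivationOver φ D ↔ IsDerOver 1 φ D := by
  simp only [IsDerivationOver, IsDerOver, one_mul]

namespace IsDerOver

variable {X Y Z : GAlg k} {e p : ℤ} {φ : X ⟶ Y} {D D' : X →ₗ[k] Y}

theorem map_one (h : IsDerOver e φ D) : D 1 = 0 := by
  have := h.2 0 1 1 X.one_mem
  simpa [sgn_zero] using this

theorem zero : IsDerOver e φ (0 : X →ₗ[k] Y) :=
  ⟨fun _ _ _ => Submodule.zero_mem _, fun _ _ _ _ => by simp⟩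

theorem add (h : IsDerOver e φ D) (h' : IsDerOver e φ D') : IsDerOver e φ (D + D') :=
  ⟨fun i a ha => Submodule.add_mem _ (h.1 i a ha) (h'.1 i a ha), fun i a b ha => by
    simp only [LinearMap.add_apply, h.2 i a b ha, h'.2 i a b ha, add_mul, mul_add, smul_add]
    abel⟩

theorem smul (c : k) (h : IsDerOver e φ D) : IsDerOver e φ (c • D) :=
  ⟨fun i a ha => Submodule.smul_mem _ c (h.1 i a ha), fun i a b ha => by
    simp only [LinearMap.smul_apply, h.2 i a b ha, smul_add, smul_mul_assoc, mul_smul_comm,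
      smul_comm c]⟩

theorem zsmul (n : ℤ) (h : IsDerOver e φ D) : IsDerOver e φ (n • D) := by
  have h1 := h.smul (n : k)
  have h2 : (n : k) • D = n • D := by
    ext s
    rw [LinearMap.smul_apply, LinearMap.smul_apply, Int.cast_smul_eq_zsmul]
  rwa [h2] at h1

theorem sum {ι : Type*} (s : Finset ι) {D : ι → X →ₗ[k] Y} (h : ∀ i ∈ s, IsDerOver e φ (D i)) :
    IsDerOver e φ (∑ i ∈ s, D i) := by
  classical
  induction s using Finset.induction_on with
  | empty => simpa using zero
  | insert i s hi ih =>
    rw [Finset.sum_insert hi]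
    exact (h i (Finset.mem_insert_self i s)).add
      (ih fun j hj => h j (Finset.mem_insert_of_mem hj))

theorem mul_left {j : ℤ} {y : Y} (hy : y ∈ Y.gr j) (h : IsDerOver e φ D) :
    IsDerOver (e + j) φ (LinearMap.mulLeft k y ∘ₗ D) :=
  ⟨fun i a ha => by
    have := Y.mul_mem hy (h.1 i a ha)
    rwa [add_comm j, add_assoc] at this,
   fun i a b ha => by
    have h1 := Y.comm hy (φ.map_mem i a ha)
    simp only [LinearMap.comp_apply, LinearMap.mulLeft_apply, h.2 i a b ha, mul_add,
      mul_smul_comm, mul_assoc]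
    rw [← mul_assoc y (φ.toAlgHom a), h1, smul_mul_assoc, smul_smul, ← sgn_add, mul_assoc,
      add_mul]⟩

theorem comp_right (h : IsDerOver e φ D) (ψ : Z ⟶ X) :
    IsDerOver e (ψ ≫ φ) (D ∘ₗ ψ.toAlgHom.toLinearMap) :=
  ⟨fun i a ha => h.1 i _ (ψ.map_mem i a ha), fun i a b ha => by
    simp only [LinearMap.comp_apply, AlgHom.toLinearMap_apply, map_mul,
      h.2 i _ _ (ψ.map_mem i a ha)]
    rfl⟩

theorem comp_left (h : IsDerOver e φ D) (ψ : Y ⟶ Z) :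
    IsDerOver e (φ ≫ ψ) (ψ.toAlgHom.toLinearMap ∘ₗ D) :=
  ⟨fun i a ha => ψ.map_mem _ _ (h.1 i a ha), fun i a b ha => by
    simp only [LinearMap.comp_apply, AlgHom.toLinearMap_apply, h.2 i a b ha, map_add, map_mul,
      map_zsmul]
    rfl⟩

/-- In the expansion on a product the mixed terms cancel, because `hIJ` makes J correspond to I
under φ. For a single algebra this is the usual fact on commutators of derivations. -/
theorem commutator {ψ : Y ⟶ Z} {I : X →ₗ[k] X} {J : Y →ₗ[k] Z} (hD : IsDerOver e φ D)
    (hI : IsDerOver p (𝟙 X) I) (hJ : IsDerOver p ψ J)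
    (hIJ : ∀ s, J (φ.toAlgHom s) = ψ.toAlgHom (φ.toAlgHom (I s))) :
    IsDerOver (e + p) (φ ≫ ψ) (ψ.toAlgHom.toLinearMap ∘ₗ D ∘ₗ I - sgn (e * p) • (J ∘ₗ D)) := by
  refine ⟨fun i a ha => ?_, fun i a b ha => ?_⟩
  · refine Submodule.sub_mem _ ?_ (zsmul_mem ?_ _)
    · have := ψ.map_mem _ _ (hD.1 _ _ (hI.1 i a ha))
      rwa [add_assoc, add_comm p e] at this
    · have := hJ.1 _ _ (hD.1 i a ha)
      rwa [add_assoc] at this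
  · have e1 := hI.2 i a b ha
    have e2 := hD.2 _ _ b (hI.1 i a ha)
    have e3 := hD.2 i a (I b) ha
    have e4 := hD.2 i a b ha
    have e5 := hJ.2 _ _ (φ.toAlgHom b) (hD.1 i a ha)
    have e6 := hJ.2 _ _ (D b) (φ.map_mem i a ha)
    have hc : ∀ s, (φ ≫ ψ).toAlgHom s = ψ.toAlgHom (φ.toAlgHom s) := fun _ => rfl
    have hid : ∀ s, (𝟙 X : X ⟶ X).toAlgHom s = s := fun _ => rfl
    simp only [LinearMap.sub_apply, LinearMap.smul_apply, LinearMap.comp_apply,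
      AlgHom.toLinearMap_apply, e1, hid, map_add, map_zsmul, e2, e3, e4, e5, e6, hIJ, hc, map_mul]
    have s1 : sgn (e * (i + p)) = sgn (e * p) * sgn (e * i) := by
      rw [← sgn_add]; congr 1; ring
    have s2 : sgn (p * (i + e)) = sgn (e * p) * sgn (p * i) := by
      rw [← sgn_add]; congr 1; ring
    have s3 : sgn ((e + p) * i) = sgn (e * i) * sgn (p * i) := by
      rw [← sgn_add]; congr 1; ring
    rw [s1, s2, s3]
    simp only [sub_mul, mul_sub, smul_add, smul_sub, smul_smul, smul_mul_assoc, mul_smul_comm]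
    have s4 : sgn (e * p) * (sgn (e * p) * sgn (p * i)) = sgn (p * i) := by
      rw [← mul_assoc, sgn_mul_self, one_mul]
    have s5 : sgn (p * i) * sgn (e * i) = sgn (e * i) * sgn (p * i) := mul_comm _ _
    have s6 : sgn (e * i) * sgn (p * i) * sgn (e * p) = sgn (e * p) * (sgn (e * i) * sgn (p * i)) :=
      mul_comm _ _
    rw [s4, s5, s6]
    abel

variable [CharZero k] {A : GAlg k} {M : GMod A} {N : ℕ∞}

/-- Products of generators span the algebra, and the Leibniz rule propagates equality along them.
This is the standard tool for identities between derivations. -/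
theorem ext_sym {φ : Sym M N ⟶ Y} {D D' : SymAlg M N →ₗ[k] Y} (h : IsDerOver e φ D)
    (h' : IsDerOver e φ D') (hA : ∀ a, D (SymAlg.ofA M N a) = D' (SymAlg.ofA M N a))
    (hM : ∀ m, D (SymAlg.ofM M N m) = D' (SymAlg.ofM M N m)) : D = D' := by
  ext s
  induction s using SymAlg.mul_induction with
  | one => exact h.map_one.trans h'.map_one.symm
  | add s t hs ht => rw [map_add, map_add, hs, ht]
  | base c s hs => rw [map_smul, map_smul, hs]
  | mulA a s hs =>
    induction a using graded_induction A.internal with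
    | add x y hx hy => rw [map_add, add_mul, map_add, map_add, hx, hy]
    | hom i a ha =>
      rw [h.2 i _ s (SymAlg.ofA_mem ha), h'.2 i _ s (SymAlg.ofA_mem ha), hs, hA]
  | mulM m s hs =>
    induction m using graded_induction M.internal with
    | add x y hx hy => rw [map_add, add_mul, map_add, map_add, hx, hy]
    | hom i m hm =>
      rw [h.2 i _ s (SymAlg.ofM_mem hm), h'.2 i _ s (SymAlg.ofM_mem hm), hs, hM]

end IsDerOver

end Derivations

/-! ### Contractions, truncations and weights -/

namespace SymAlg

variable {k : Type u} [Field k] [CharZero k] {A : GAlg k} {M M' : GMod A} {N N' : ℕ∞}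

theorem isDerOver_contr {p : ℤ} (x : M.dual p) (h : N' + 1 ≤ N) :
    IsDerOver p (Sym.map (𝟙 M) (le_self_add.trans h)) (contr x h) := by
  refine ⟨fun i s hs => ?_, fun i s t hs => contr_mul x h hs t⟩
  change contr x h s ∈ gr M N' (i + p)
  have h1 : contr x h 1 = 0 := by
    have := contr_ofA x h 1
    rwa [map_one] at this
  induction hs using Submodule.span_induction with
  | mem s hs =>
    induction hs with
    | one => rw [h1]; exact Submodule.zero_mem _
    | @mulA i j a s ha hs ih =>
      rw [contr_mul x h (ofA_mem ha), contr_ofA, zero_mul, zero_add, map_ofA, add_assoc]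
      exact zsmul_mem (ofA_mul_mem ha ih) _
    | @mulM i j m s hm hs ih =>
      rw [contr_mul x h (ofM_mem hm), contr_ofM, map_ofM]
      refine Submodule.add_mem _ ?_ (zsmul_mem ?_ _)
      · rw [add_right_comm]
        exact ofA_mul_mem (x.2.1 _ _ hm)
          ((Sym.map (𝟙 M) (le_self_add.trans h)).map_mem j s (Submodule.subset_span hs))
      · rw [add_assoc]
        exact ofM_mul_mem hm ih
  | zero => rw [map_zero]; exact Submodule.zero_mem _
  | add s t _ _ hs ht => rw [map_add]; exact Submodule.add_mem _ hs ht
  | smul c s _ hs => rw [map_smul]; exact Submodule.smul_mem _ _ hs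

theorem map_map {M'' : GMod A} {N'' : ℕ∞} (f : M ⟶ M') (g : M' ⟶ M'') (h : N' ≤ N) (h' : N'' ≤ N')
    (s : SymAlg M N) : map g h' (map f h s) = map (f ≫ g) (h'.trans h) s :=
  DFunLike.congr_fun (congrArg GAlg.Hom.toAlgHom (Sym.map_comp f g h h')) s

theorem map_id_apply (s : SymAlg M N) : map (𝟙 M) (le_refl N) s = s :=
  DFunLike.congr_fun (congrArg GAlg.Hom.toAlgHom (Sym.map_id M N)) s

theorem proj_map (f : M ⟶ M') (h : N' ≤ N) (s : SymAlg M N) : proj M' N' (map f h s) = proj M N s :=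
  DFunLike.congr_fun (congrArg GAlg.Hom.toAlgHom (Sym.map_proj f h)) s

/-- Both sides are derivations over the same morphism, so they need only be compared on A and on M.
The same argument gives the other identities between contractions. -/
theorem contr_map {N₁ N₁' : ℕ∞} {p : ℤ} (x : M'.dual p) (f : M ⟶ M') (h : N₁ ≤ N)
    (hx : N₁' + 1 ≤ N₁) (hx' : N' + 1 ≤ N) (h' : N₁' ≤ N') (s : SymAlg M N) :
    contr x hx (map f h s) = map f h' (contr (GMod.dualMap f p x) hx' s) := by
  have d1 := (isDerOver_contr x hx).comp_right (Sym.map f h)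
  have d2 := (isDerOver_contr (GMod.dualMap f p x) hx').comp_left (Sym.map f h')
  have e : Sym.map f h ≫ Sym.map (𝟙 M') (le_self_add.trans hx)
      = Sym.map (𝟙 M) (le_self_add.trans hx') ≫ Sym.map f h' := by
    rw [Sym.map_comp, Sym.map_comp, Category.comp_id, Category.id_comp]
  rw [e] at d1
  refine DFunLike.congr_fun (d1.ext_sym d2 (fun a => ?_) (fun m => ?_)) s
  · change contr x hx (map f h (ofA M N a)) = map f h' (contr _ hx' (ofA M N a))
    rw [map_ofA, contr_ofA, contr_ofA, map_zero]
  · change contr x hx (map f h (ofM M N m)) = map f h' (contr _ hx' (ofM M N m))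
    rw [map_ofM, contr_ofM, contr_ofM, map_ofA]
    rfl

theorem contr_add {p : ℤ} (x y : M.dual p) (h : N' + 1 ≤ N) :
    contr (x + y) h = contr x h + contr y h :=
  (isDerOver_contr (x + y) h).ext_sym ((isDerOver_contr x h).add (isDerOver_contr y h))
    (fun a => by
      change contr _ _ _ = contr _ _ _ + contr _ _ _
      simp only [contr_ofA, add_zero])
    (fun m => by
      change contr _ _ _ = contr _ _ _ + contr _ _ _
      simp only [contr_ofM]
      rw [← map_add]
      rfl)

theorem contr_smul {p : ℤ} (c : k) (x : M.dual p) (h : N' + 1 ≤ N) :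
    contr (c • x) h = c • contr x h :=
  (isDerOver_contr (c • x) h).ext_sym ((isDerOver_contr x h).smul c)
    (fun a => by
      change contr (c • x) h (ofA M N a) = c • contr x h (ofA M N a)
      simp only [contr_ofA, smul_zero])
    (fun m => by
      change contr (c • x) h (ofM M N m) = c • contr x h (ofM M N m)
      simp only [contr_ofM]
      rw [← map_smul]
      rfl)

theorem contr_mul_left {p p' i : ℤ} (x : M.dual p) (y : M.dual p') {a : A} (ha : a ∈ A.gr i)
    (hp : p + i = p') (hy : ∀ m, y.1 m = a * x.1 m) (h : N' + 1 ≤ N) (s : SymAlg M N) :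
    contr y h s = ofA M N' a * contr x h s := by
  subst hp
  refine DFunLike.congr_fun ((isDerOver_contr y h).ext_sym
    ((isDerOver_contr x h).mul_left (Y := Sym M N') (ofA_mem ha)) (fun b => ?_) (fun m => ?_)) s
  · change contr y h (ofA M N b) = ofA M N' a * contr x h (ofA M N b)
    rw [contr_ofA, contr_ofA, mul_zero]
  · change contr y h (ofM M N m) = ofA M N' a * contr x h (ofM M N m)
    rw [contr_ofM, contr_ofM, hy, map_mul]

/-- The contraction on the full symmetric algebra. -/
abbrev ctr {p : ℤ} (x : M.dual p) : SymAlg M ⊤ →ₗ[k] SymAlg M ⊤ := contr x le_top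

theorem isDerOver_ctr {p : ℤ} (x : M.dual p) : IsDerOver p (𝟙 (Sym M ⊤)) (ctr x) := by
  have := isDerOver_contr (N := ⊤) (N' := ⊤) x le_top
  rwa [Sym.map_id] at this

/-- The graded commutator of two contractions is a derivation, and it kills all generators because
it lowers the weight by two. -/
theorem ctr_comm {p q : ℤ} (x : M.dual p) (y : M.dual q) (s : SymAlg M ⊤) :
    ctr x (ctr y s) = sgn (p * q) • ctr y (ctr x s) := by
  have h := (isDerOver_ctr x).commutator (isDerOver_ctr y) (isDerOver_ctr y) (fun _ => rfl)
  have h0 := h.ext_sym IsDerOver.zero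
    (fun a => by
      change ctr x (ctr y (ofA M ⊤ a)) - sgn (p * q) • ctr y (ctr x (ofA M ⊤ a)) = 0
      simp [contr_ofA])
    (fun m => by
      change ctr x (ctr y (ofM M ⊤ m)) - sgn (p * q) • ctr y (ctr x (ofM M ⊤ m)) = 0
      simp [contr_ofA, contr_ofM])
  exact sub_eq_zero.1 (DFunLike.congr_fun h0 s)

/-- The truncation of the symmetric algebra. -/
abbrev trc (M : GMod A) (n : ℕ∞) : SymAlg M ⊤ →ₐ[k] SymAlg M n := map (𝟙 M) le_top

theorem map_surjective (h : N' ≤ N) : Function.Surjective (map (𝟙 M) h) := by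
  intro s
  induction s using mul_induction with
  | one => exact ⟨1, map_one _⟩
  | add s t hs ht =>
    obtain ⟨s, rfl⟩ := hs
    obtain ⟨t, rfl⟩ := ht
    exact ⟨s + t, map_add _ _ _⟩
  | base c s hs =>
    obtain ⟨s, rfl⟩ := hs
    exact ⟨c • s, map_smul _ _ _⟩
  | mulA a s hs =>
    obtain ⟨s, rfl⟩ := hs
    exact ⟨ofA M N a * s, by rw [map_mul, map_ofA]⟩
  | mulM m s hs =>
    obtain ⟨s, rfl⟩ := hs
    exact ⟨ofM M N m * s, by rw [map_mul, map_ofM]; rfl⟩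

theorem mem_weightGE_zero (s : SymAlg M N) : s ∈ weightGE M N 0 := by
  induction s using mul_induction with
  | one => exact Submodule.subset_span ⟨1, [], le_refl _, by simp⟩
  | add s t hs ht => exact Submodule.add_mem _ hs ht
  | base c s hs => exact Submodule.smul_mem _ _ hs
  | mulA a s hs => exact ofA_mul_weightGE a hs
  | mulM m s hs => exact weightGE_mono (Nat.zero_le _) (ofM_mul_weightGE m hs)

theorem map_mem_weightGE (f : M ⟶ M') (h : N' ≤ N) {j : ℕ} {s : SymAlg M N}
    (hs : s ∈ weightGE M N j) : map f h s ∈ weightGE M' N' j := by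
  induction hs using Submodule.span_induction with
  | mem s hs =>
    obtain ⟨a, l, hl, rfl⟩ := hs
    refine Submodule.subset_span ⟨a, l.map f.toLin, by simpa using hl, ?_⟩
    rw [map_mul, map_ofA, map_list_prod, List.map_map, List.map_map]
    congr 3
    funext m
    simp
  | zero => simp
  | add s t _ _ hs ht => rw [map_add]; exact Submodule.add_mem _ hs ht
  | smul c s _ hs => rw [map_smul]; exact Submodule.smul_mem _ _ hs

/-- The two-sided ideal of elements of weight at least `j`. -/
def weightIdeal (M : GMod A) (N : ℕ∞) (j : ℕ) : Ideal (SymAlg M N) where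
  carrier := weightGE M N j
  add_mem' := Submodule.add_mem _
  zero_mem' := Submodule.zero_mem _
  smul_mem' s t (ht : t ∈ weightGE M N j) := by
    have := mul_weightGE (mem_weightGE_zero s) ht
    rwa [zero_add] at this

instance (M : GMod A) (N : ℕ∞) (j : ℕ) : (weightIdeal M N j).IsTwoSided :=
  ⟨fun t hs => mul_weightGE (j := 0) hs (mem_weightGE_zero t)⟩

/-- The truncated algebra is given by generators and relations, so the kernel of the truncation is
not visible directly. The quotient of Sym by the ideal of weight > n satisfies the same relations
and hence receives a map from the truncated algebra; an element killed by the truncation therefore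
dies in this quotient. -/
theorem trc_eq_zero_iff (n : ℕ) (s : SymAlg M ⊤) :
    trc M n s = 0 ↔ s ∈ weightGE M ⊤ (n + 1) := by
  constructor
  · intro h
    let q : SymAlg M ⊤ →ₐ[k] SymAlg M ⊤ ⧸ weightIdeal M ⊤ (n + 1) :=
      Ideal.Quotient.mkₐ k (weightIdeal M ⊤ (n + 1))
    let r : SymAlg M n →ₐ[k] SymAlg M ⊤ ⧸ weightIdeal M ⊤ (n + 1) :=
      lift (q.comp (ofA M ⊤)) (q.toLinearMap ∘ₗ ofM M ⊤)
        (fun a m => by simp [ofM_smul])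
        (fun i j m a hm ha => by
          have := congrArg q (comm_MA M ⊤ hm ha)
          simpa using this)
        (fun i j m a hm ha => by
          have := congrArg q (comm_MM M ⊤ hm ha)
          simpa using this)
        (fun l hl => by
          have h1 : (l.map (q.toLinearMap ∘ₗ ofM M ⊤)).prod = q (l.map (ofM M ⊤)).prod := by
            rw [map_list_prod, List.map_map]; rfl
          rw [h1]
          refine Ideal.Quotient.eq_zero_iff_mem.2 ?_
          exact Submodule.subset_span ⟨1, l, by exact_mod_cast hl, by simp⟩)
    have hrq : r.comp (trc M n) = q := hom_ext
      (fun a => by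
        change r (trc M n (ofA M ⊤ a)) = _
        rw [map_ofA]; exact lift_ofA _ _ _ _ _ _ _)
      (fun m => by
        change r (trc M n (ofM M ⊤ m)) = _
        rw [map_ofM]; exact lift_ofM _ _ _ _ _ _ _)
    have h2 : q s = 0 := by
      rw [← hrq, AlgHom.comp_apply, h, map_zero]
    exact Ideal.Quotient.eq_zero_iff_mem.1 h2
  · intro h
    exact weightGE_eq_zero (by exact_mod_cast Nat.lt_succ_self n) (map_mem_weightGE _ _ h)

end SymAlg

/-! ### Homogeneous bases and dual bases -/

section Dual

variable {k : Type u} [Field k] {A : GAlg k} {M M' : GMod A}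

theorem GMod.dual_cast_apply {p p' : ℤ} (h : p = p') (x : M.dual p) (m : M) :
    (h ▸ x : M.dual p').1 m = x.1 m := by subst h; rfl

/-- The product of a homogeneous element of `A` and an element of the dual. -/
def GMod.dualMul {i p p' : ℤ} {a : A} (ha : a ∈ A.gr i) (h : i + p = p') (x : M.dual p) :
    M.dual p' :=
  ⟨LinearMap.mulLeft k a ∘ₗ x.1, by
    subst h
    refine ⟨fun j m hm => ?_, fun j c m hc => ?_⟩
    · have := A.mul_mem ha (x.2.1 j m hm)
      rwa [add_left_comm] at this
    · simp only [LinearMap.comp_apply, LinearMap.mulLeft_apply, x.2.2 j c m hc, mul_smul_comm]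
      rw [← mul_assoc, A.comm ha hc, smul_mul_assoc, smul_smul, ← sgn_add, mul_assoc, ← add_mul,
        add_comm p]⟩

@[simp] theorem GMod.dualMul_apply {i p p' : ℤ} {a : A} (ha : a ∈ A.gr i) (h : i + p = p')
    (x : M.dual p) (m : M) : (GMod.dualMul ha h x).1 m = a * x.1 m := rfl

theorem GMod.dual_ext {p : ℤ} {x y : M.dual p} (h : ∀ m, x.1 m = y.1 m) : x = y :=
  Subtype.ext (LinearMap.ext h)

@[simp] theorem GMod.dualMap_apply (f : M ⟶ M') (p : ℤ) (x : M'.dual p) (m : M) :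
    (GMod.dualMap f p x).1 m = x.1 (f.toLin m) := rfl

/-- A finite basis of homogeneous elements. -/
structure HBasis (M : GMod A) where
  n : ℕ
  b : Module.Basis (Fin n) A M
  q : Fin n → ℤ
  mem : ∀ i, b i ∈ M.gr (q i)

theorem GMod.IsFinite.nonempty_hbasis (h : M.IsFinite) : Nonempty (HBasis M) := by
  obtain ⟨n, b, hb⟩ := h
  choose q hq using hb
  exact ⟨⟨n, b, q, hq⟩⟩

namespace HBasis

variable (B : HBasis M)

theorem sum_repr (m : M) : ∑ i, B.b.repr m i • B.b i = m := B.b.sum_repr m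

theorem component_smul {q : ℤ} {v : M} (hv : v ∈ M.gr q) (j : ℤ) (c : A) :
    component M.internal j (c • v) = component A.internal (j - q) c • v := by
  induction c using graded_induction A.internal with
  | add x y hx hy => simp only [add_smul, map_add, hx, hy]
  | hom i a ha =>
    by_cases h : i = j - q
    · have h' : a • v ∈ M.gr j := by
        have := M.smul_mem ha hv
        rwa [h, sub_add_cancel] at this
      rw [component_of_mem _ h', component_of_mem _ (h ▸ ha)]
    · rw [component_of_mem_ne A.internal h ha, zero_smul,
        component_of_mem_ne M.internal (i := i + q) (by omega) (M.smul_mem ha hv)]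

/-- Taking homogeneous components is compatible with the expansion in a homogeneous basis, and
coordinates are unique. -/
theorem repr_mem {j : ℤ} {m : M} (hm : m ∈ M.gr j) (i : Fin B.n) :
    B.b.repr m i ∈ A.gr (j - B.q i) := by
  have h : m = ∑ i, component A.internal (j - B.q i) (B.b.repr m i) • B.b i := by
    conv_lhs => rw [← component_of_mem M.internal hm, ← B.sum_repr m, map_sum]
    exact Finset.sum_congr rfl fun i _ => component_smul (B.mem i) j _
  have h2 : B.b.repr m i = component A.internal (j - B.q i) (B.b.repr m i) := by
    conv_lhs => rw [h, B.b.repr_sum_self]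
  rw [h2]
  exact component_mem _ _ _

theorem parity_mem (p : ℤ) {i : ℤ} {a : A} (ha : a ∈ A.gr i) : A.parity p a ∈ A.gr i := by
  rw [A.parity_of_mem p ha]
  exact zsmul_mem ha _

/-- The dual basis. -/
def ε (i : Fin B.n) : M.dual (- B.q i) :=
  -- The parity twist turns an A-linear coordinate into a functional that obeys the sign rule x(am)
  -- = (-1)^{|x||a|} a x(m) of the dual.
  ⟨(A.parity (B.q i)).toLinearMap ∘ₗ (B.b.coord i).restrictScalars k, by
    refine ⟨fun j m hm => ?_, fun j a m ha => ?_⟩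
    · exact parity_mem _ (B.repr_mem hm i)
    · simp only [LinearMap.comp_apply, LinearMap.coe_restrictScalars, Module.Basis.coord_apply,
        map_smul, smul_eq_mul, AlgHom.toLinearMap_apply, map_mul,
        A.parity_of_mem _ ha, smul_mul_assoc]
      rw [neg_mul, sgn_neg]⟩

theorem ε_apply (i : Fin B.n) (m : M) : (B.ε i).1 m = A.parity (B.q i) (B.b.repr m i) := rfl

theorem ε_b [DecidableEq (Fin B.n)] (i j : Fin B.n) : (B.ε i).1 (B.b j) = if i = j then 1 else 0 := by
  rw [ε_apply, B.b.repr_self, Finsupp.single_apply]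
  by_cases h : i = j
  · subst h; simp
  · rw [if_neg (fun e => h e.symm), if_neg h, map_zero]

theorem dual_ext {p : ℤ} {x y : M.dual p} (h : ∀ i, x.1 (B.b i) = y.1 (B.b i)) : x = y := by
  refine GMod.dual_ext fun m => ?_
  rw [← B.sum_repr m, map_sum, map_sum]
  refine Finset.sum_congr rfl fun i _ => ?_
  rw [GMod.dual_smul, GMod.dual_smul, h]

theorem dual_eq_sum {p : ℤ} (x : M.dual p) : x = ∑ i, GMod.dualMul (x.2.1 _ _ (B.mem i))
    (by ring : (B.q i + p) + - B.q i = p) (B.ε i) := by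
  classical
  refine B.dual_ext fun j => ?_
  rw [AddSubmonoidClass.coe_finsetSum, LinearMap.sum_apply]
  simp only [GMod.dualMul_apply, B.ε_b, mul_ite, mul_one, mul_zero]
  simp

end HBasis

end Dual

/-! ### The Euler operator and the Taylor formula in the symmetric algebra -/

namespace HBasis

open SHLieRinehart.SymAlg

variable {k : Type u} [Field k] [CharZero k] {A : GAlg k} {M : GMod A} (B : HBasis M)

/-- The Euler operator. -/
def euler : SymAlg M ⊤ →ₗ[k] SymAlg M ⊤ :=
  ∑ i, LinearMap.mulLeft k (ofM M ⊤ (B.b i)) ∘ₗ ctr (B.ε i)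

theorem euler_apply (s : SymAlg M ⊤) : B.euler s = ∑ i, ofM M ⊤ (B.b i) * ctr (B.ε i) s := by
  simp [euler]

theorem isDerOver_euler : IsDerOver 0 (𝟙 (Sym M ⊤)) B.euler := by
  refine IsDerOver.sum _ fun i _ => ?_
  have := (isDerOver_ctr (B.ε i)).mul_left (Y := Sym M ⊤) (ofM_mem (B.mem i))
  rwa [neg_add_cancel] at this

theorem euler_mul (s t : SymAlg M ⊤) : B.euler (s * t) = B.euler s * t + s * B.euler t := by
  induction s using graded_induction (Sym M ⊤).internal with
  | add x y hx hy => simp only [add_mul, map_add, hx, hy]; abel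
  | hom i s hs =>
    have := B.isDerOver_euler.2 i s t hs
    rw [zero_mul, sgn_zero, one_smul] at this
    exact this

theorem euler_ofA (a : A) : B.euler (ofA M ⊤ a) = 0 := by
  simp [euler_apply, contr_ofA]

/-- The sign in the dual basis and the sign from commuting b_i past its coefficient cancel; what
remains is the expansion of m in the basis. -/
theorem euler_ofM (m : M) : B.euler (ofM M ⊤ m) = ofM M ⊤ m := by
  have h : ∀ i, ofM M ⊤ (B.b i) * ctr (B.ε i) (ofM M ⊤ m) = ofM M ⊤ (B.b.repr m i • B.b i) := by
    intro i
    rw [contr_ofM, B.ε_apply, ofM_smul]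
    generalize B.b.repr m i = c
    induction c using graded_induction A.internal with
    | add x y hx hy => simp only [map_add, mul_add, add_mul, hx, hy]
    | hom j c hc =>
      rw [comm_MA M ⊤ (B.mem i) (parity_mem _ hc), A.parity_of_mem _ hc, map_zsmul, smul_mul_assoc,
        sgn_smul_sgn_smul]
  rw [euler_apply, Finset.sum_congr rfl fun i _ => h i, ← map_sum, B.sum_repr]

theorem euler_prod (a : A) (l : List M) : B.euler (ofA M ⊤ a * (l.map (ofM M ⊤)).prod)
    = (l.length : k) • (ofA M ⊤ a * (l.map (ofM M ⊤)).prod) := by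
  have h : B.euler (l.map (ofM M ⊤)).prod = (l.length : k) • (l.map (ofM M ⊤)).prod := by
    induction l with
    | nil => simp [B.isDerOver_euler.map_one]
    | cons m l ih =>
      rw [List.map_cons, List.prod_cons, euler_mul, ih, euler_ofM, List.length_cons, Nat.cast_succ,
        add_smul, one_smul, mul_smul_comm, add_comm]
  rw [euler_mul, euler_ofA, zero_mul, zero_add, h, mul_smul_comm]

/-- In weight exactly j the Euler operator is multiplication by j, and products with more factors
lie in the next step of the filtration anyway. -/
theorem euler_sub_mem {j : ℕ} {s : SymAlg M ⊤} (hs : s ∈ weightGE M ⊤ j) :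
    B.euler s - (j : k) • s ∈ weightGE M ⊤ (j + 1) := by
  induction hs using Submodule.span_induction with
  | mem s hs =>
    obtain ⟨a, l, hl, rfl⟩ := hs
    rw [euler_prod, ← sub_smul]
    rcases hl.eq_or_lt with h | h
    · rw [h, sub_self, zero_smul]; exact Submodule.zero_mem _
    · exact Submodule.smul_mem _ _ (Submodule.subset_span ⟨a, l, h, rfl⟩)
  | zero => simp
  | add s t _ _ hs ht =>
    rw [map_add, smul_add, add_sub_add_comm]; exact Submodule.add_mem _ hs ht
  | smul c s _ hs =>
    rw [map_smul, smul_comm, ← smul_sub]; exact Submodule.smul_mem _ _ hs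

/-- In weight j + 1 the Euler operator is multiplication by j + 1 modulo higher weight, which is
invertible in characteristic zero. So the weight of s can be raised one step at a time. -/
theorem mem_weightGE_of_euler {N : ℕ} {s : SymAlg M ⊤} (h1 : s ∈ weightGE M ⊤ 1)
    (h : B.euler s ∈ weightGE M ⊤ (N + 1)) : s ∈ weightGE M ⊤ (N + 1) := by
  have key : ∀ j, j ≤ N → s ∈ weightGE M ⊤ (j + 1) := by
    intro j
    induction j with
    | zero => intro _; exact h1
    | succ j ih =>
      intro hj
      have h2 := B.euler_sub_mem (ih (by omega))
      have h3 : ((j + 1 : ℕ) : k) • s ∈ weightGE M ⊤ (j + 1 + 1) := by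
        have := Submodule.sub_mem _ (weightGE_mono (by omega) h) h2
        rwa [sub_sub_cancel] at this
      have h4 := Submodule.smul_mem _ (((j + 1 : ℕ) : k)⁻¹) h3
      rwa [smul_smul, inv_mul_cancel₀ (Nat.cast_ne_zero.2 (Nat.succ_ne_zero j)), one_smul] at h4
  exact key N (le_refl N)

/-- The operator reconstructing the weight `l` part (up to the factor `l!`) from the iterated
contractions. -/
def recon : ℕ → SymAlg M ⊤ →ₗ[k] SymAlg M ⊤
  | 0 => (ofA M ⊤).toLinearMap ∘ₗ (proj M ⊤).toLinearMap
  | l + 1 => ∑ i, LinearMap.mulLeft k (ofM M ⊤ (B.b i)) ∘ₗ recon l ∘ₗ ctr (B.ε i)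

theorem recon_zero_apply (s : SymAlg M ⊤) : B.recon 0 s = ofA M ⊤ (proj M ⊤ s) := rfl

theorem recon_succ_apply (l : ℕ) (s : SymAlg M ⊤) :
    B.recon (l + 1) s = ∑ i, ofM M ⊤ (B.b i) * B.recon l (ctr (B.ε i) s) := by
  simp [recon]

theorem ctr_b_mul (i j : Fin B.n) (s : SymAlg M ⊤) :
    ctr (B.ε j) (ofM M ⊤ (B.b i) * s) = (if i = j then s else 0)
      + sgn (B.q i * B.q j) • (ofM M ⊤ (B.b i) * ctr (B.ε j) s) := by
  have := (isDerOver_ctr (B.ε j)).2 _ _ s (ofM_mem (B.mem i))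
  refine this.trans ?_
  rw [contr_ofM, B.ε_b]
  congr 1
  · change _ * s = _
    by_cases h : i = j
    · rw [if_pos h, if_pos h.symm, map_one, one_mul]
    · rw [if_neg h, if_neg (fun e => h e.symm), map_zero, zero_mul]
  · rw [neg_mul, sgn_neg, mul_comm (B.q i)]
    rfl

/-- `recon l` has the shape ∑ b_{i_1}⋯b_{i_l} π∂_{i_l}⋯∂_{i_1}. A contraction removes one of the l
factors b, and all l choices give the same result because contractions commute up to sign. -/
theorem ctr_recon (l : ℕ) (j : Fin B.n) (s : SymAlg M ⊤) :
    ctr (B.ε j) (B.recon l s) = (l : k) • B.recon (l - 1) (ctr (B.ε j) s) := by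
  induction l generalizing s with
  | zero => simp [recon_zero_apply, contr_ofA]
  | succ l ih =>
    rw [recon_succ_apply, map_sum]
    simp only [ctr_b_mul, Finset.sum_add_distrib, Finset.sum_ite_eq', Finset.mem_univ, if_true]
    rw [Nat.add_sub_cancel, Nat.cast_succ, add_smul, one_smul, add_comm]
    congr 1
    simp only [ih]
    cases l with
    | zero => simp
    | succ l =>
      rw [recon_succ_apply, Finset.smul_sum]
      refine Finset.sum_congr rfl fun i _ => ?_
      have h := ctr_comm (B.ε j) (B.ε i) s
      rw [Nat.add_sub_cancel, h, map_zsmul, neg_mul_neg, mul_comm (B.q j), mul_smul_comm,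
        mul_smul_comm, smul_comm _ (sgn _), sgn_smul_sgn_smul]

theorem proj_recon_succ (l : ℕ) (s : SymAlg M ⊤) : proj M ⊤ (B.recon (l + 1) s) = 0 := by
  simp [recon_succ_apply]

/-- The Taylor polynomial of order `N`. -/
def taylor (N : ℕ) : SymAlg M ⊤ →ₗ[k] SymAlg M ⊤ :=
  ∑ l ∈ Finset.range (N + 1), (l.factorial : k)⁻¹ • B.recon l

theorem taylor_apply (N : ℕ) (s : SymAlg M ⊤) :
    B.taylor N s = ∑ l ∈ Finset.range (N + 1), (l.factorial : k)⁻¹ • B.recon l s := by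
  simp [taylor]

theorem proj_taylor (N : ℕ) (s : SymAlg M ⊤) : proj M ⊤ (B.taylor N s) = proj M ⊤ s := by
  rw [taylor_apply, map_sum, Finset.sum_range_succ']
  simp only [map_smul, proj_recon_succ, smul_zero, Finset.sum_const_zero, zero_add, recon_zero_apply,
    proj_ofA]
  simp

/-- As for ordinary Taylor polynomials, the factor l of `ctr_recon` turns 1/l! into 1/(l-1)!. -/
theorem ctr_taylor (N : ℕ) (j : Fin B.n) (s : SymAlg M ⊤) :
    ctr (B.ε j) (B.taylor (N + 1) s) = B.taylor N (ctr (B.ε j) s) := by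
  have h0 : ctr (B.ε j) (B.recon 0 s) = 0 := by rw [ctr_recon, Nat.cast_zero, zero_smul]
  rw [taylor_apply, map_sum, Finset.sum_range_succ', map_smul, h0, smul_zero, add_zero,
    taylor_apply]
  refine Finset.sum_congr rfl fun l _ => ?_
  rw [map_smul, ctr_recon, Nat.add_sub_cancel, smul_smul]
  congr 1
  have h1 : ((l + 1 : ℕ) : k) ≠ 0 := Nat.cast_ne_zero.2 (Nat.succ_ne_zero l)
  rw [Nat.factorial_succ, Nat.cast_mul, mul_inv, mul_comm, ← mul_assoc, mul_inv_cancel₀ h1, one_mul]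

/-- The remainder has no constant term, and its Euler derivative is the sum of the b_i times the
remainders, of one order less, of the contractions of s. These are known by induction, and
`mem_weightGE_of_euler` gives the weight of the remainder itself. -/
theorem sub_taylor_mem (N : ℕ) (s : SymAlg M ⊤) : s - B.taylor N s ∈ weightGE M ⊤ (N + 1) := by
  induction N generalizing s with
  | zero =>
    have : B.taylor 0 s = ofA M ⊤ (proj M ⊤ s) := by simp [taylor_apply, recon_zero_apply]
    rw [this]
    exact sub_mem_weightGE s
  | succ N ih =>
    refine B.mem_weightGE_of_euler ?_ ?_
    · have := sub_mem_weightGE (s - B.taylor (N + 1) s)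
      rwa [map_sub (proj M ⊤), proj_taylor, sub_self, map_zero, sub_zero] at this
    · rw [euler_apply]
      refine Submodule.sum_mem _ fun i _ => ofM_mul_weightGE _ ?_
      rw [map_sub, ctr_taylor]
      exact ih _

/-- The iterated contraction with elements of the dual basis, followed by the projection. -/
def word (u : List (Fin B.n)) : SymAlg M ⊤ →ₗ[k] A :=
  u.foldr (fun i g => g ∘ₗ ctr (B.ε i)) (proj M ⊤).toLinearMap

theorem recon_eq_zero (l : ℕ) (s : SymAlg M ⊤)
    (h : ∀ u : List (Fin B.n), u.length = l → B.word u s = 0) : B.recon l s = 0 := by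
  induction l generalizing s with
  | zero =>
    have := h [] rfl
    rw [recon_zero_apply]
    exact (congrArg _ this).trans (map_zero _)
  | succ l ih =>
    rw [recon_succ_apply]
    refine Finset.sum_eq_zero fun i _ => ?_
    rw [ih _ (fun u hu => h (i :: u) (by simpa using hu)), mul_zero]

/-- If all contraction words of length ≤ N vanish on s, so does its Taylor polynomial, and only the
remainder is left. Words in the dual basis thus separate the elements of the truncated symmetric
algebra. -/
theorem mem_weightGE_of_word (N : ℕ) (s : SymAlg M ⊤)
    (h : ∀ u : List (Fin B.n), u.length ≤ N → B.word u s = 0) : s ∈ weightGE M ⊤ (N + 1) := by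
  have h0 : B.taylor N s = 0 := by
    rw [taylor_apply]
    refine Finset.sum_eq_zero fun l hl => ?_
    rw [B.recon_eq_zero l s (fun u hu => h u (by rw [hu]; exact Nat.lt_succ_iff.1 (Finset.mem_range.1 hl))),
      smul_zero]
  have := B.sub_taylor_mem N s
  rwa [h0, sub_zero] at this

end HBasis

/-! ### Transposes, and the universal property of the direct limit of the duals -/

section DualMap

variable {k : Type u} [Field k] {A : GAlg k} {M M' M'' : GMod A}

theorem GMod.dualMap_comp (f : M ⟶ M') (g : M' ⟶ M'') (p : ℤ) (x : M''.dual p) :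
    GMod.dualMap f p (GMod.dualMap g p x) = GMod.dualMap (f ≫ g) p x := rfl

theorem GMod.dualMap_id (p : ℤ) (x : M.dual p) : GMod.dualMap (𝟙 M) p x = x := rfl

/-- The transpose as a linear map. -/
def GMod.dualMapₗ (f : M ⟶ M') (p : ℤ) : M'.dual p →ₗ[k] M.dual p where
  toFun := GMod.dualMap f p
  map_add' _ _ := rfl
  map_smul' _ _ := rfl

end DualMap

section Desc

variable {k : Type u} [Field k] {A : GAlg k} {M : ProObj (GMod A)} {V : GMod A}

theorem Duality.common (J : Duality M V) {p q : ℤ} {v w : V} (hv : v ∈ V.gr p) (hw : w ∈ V.gr q) :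
    ∃ (α : M.I) (x : (M.X α).dual p) (y : (M.X α).dual q), J.j α p x = v ∧ J.j α q y = w := by
  obtain ⟨α, x, rfl⟩ := J.surj p v hv
  obtain ⟨β, y, rfl⟩ := J.surj q w hw
  obtain ⟨γ, h1, h2⟩ := exists_ge_ge α β
  exact ⟨γ, _, _, J.compat h1 p x, J.compat h2 q y⟩

variable (J : Duality M V) {Z : Type*} [AddCommGroup Z] [Module k Z]
  (F : ∀ (α : M.I) (p : ℤ), (M.X α).dual p →ₗ[k] Z)
  (hF : ∀ {α β : M.I} (h : α ≤ β) (p : ℤ) (x : (M.X α).dual p),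
    F β p (GMod.dualMap (M.map h) p x) = F α p x)

-- By `inj` the difference of two representatives dies at a later stage, and `F` does not see the
-- change of stage.
include hF in
theorem Duality.desc_aux {α β : M.I} {p : ℤ} {x : (M.X α).dual p} {y : (M.X β).dual p}
    (h : J.j α p x = J.j β p y) : F α p x = F β p y := by
  obtain ⟨γ, h1, h2⟩ := exists_ge_ge α β
  have h3 : J.j γ p (GMod.dualMapₗ (M.map h1) p x + (-1 : k) • GMod.dualMapₗ (M.map h2) p y) = 0 := by
    rw [map_add, map_smul]
    have e1 := J.compat h1 p x
    have e2 := J.compat h2 p y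
    change J.j γ p (GMod.dualMap (M.map h1) p x) + (-1 : k) • J.j γ p (GMod.dualMap (M.map h2) p y) = 0
    rw [e1, e2, h, neg_one_smul, add_neg_cancel]
  obtain ⟨δ, h4, h5⟩ := J.inj γ p _ h3
  have h6 := hF h4 p (GMod.dualMapₗ (M.map h1) p x + (-1 : k) • GMod.dualMapₗ (M.map h2) p y)
  rw [h5, map_zero, map_add, map_smul, neg_one_smul, eq_comm, ← sub_eq_add_neg, sub_eq_zero] at h6
  rw [← hF h1, ← hF h2]
  exact h6

/-- The value at a homogeneous element of the map given by the universal property. -/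
def Duality.descFun {p : ℤ} {v : V} (hv : v ∈ V.gr p) : Z :=
  F _ p (J.surj p v hv).choose_spec.choose

include hF in
theorem Duality.descFun_eq {p : ℤ} {v : V} (hv : v ∈ V.gr p) {α : M.I} {x : (M.X α).dual p}
    (hx : J.j α p x = v) : J.descFun F hv = F α p x :=
  J.desc_aux F hF ((J.surj p v hv).choose_spec.choose_spec.trans hx.symm)

/-- The part in degree `p` of the universal property of the colimit. -/
def Duality.descDeg (p : ℤ) : V.gr p →ₗ[k] Z where
  toFun v := J.descFun F v.2
  map_add' v w := by
    obtain ⟨α, x, y, hx, hy⟩ := J.common v.2 w.2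
    rw [J.descFun_eq F hF v.2 hx, J.descFun_eq F hF w.2 hy, ← map_add]
    exact J.descFun_eq F hF (v + w).2 (by rw [map_add, hx, hy]; rfl)
  map_smul' c v := by
    obtain ⟨α, x, hx⟩ := J.surj p v.1 v.2
    rw [J.descFun_eq F hF v.2 hx, RingHom.id_apply, ← map_smul]
    exact J.descFun_eq F hF (c • v).2 (by rw [map_smul, hx]; rfl)

/-- The universal property of the colimit of the duals. -/
def Duality.desc : V →ₗ[k] Z :=
  DirectSum.toModule k ℤ Z (J.descDeg F hF) ∘ₗ
    (LinearEquiv.ofBijective (DirectSum.coeLinearMap V.gr) V.internal).symm.toLinearMap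

theorem Duality.desc_j (α : M.I) (p : ℤ) (x : (M.X α).dual p) :
    J.desc F hF (J.j α p x) = F α p x := by
  have h : (LinearEquiv.ofBijective (DirectSum.coeLinearMap V.gr) V.internal).symm (J.j α p x)
      = DirectSum.lof k ℤ (fun i => V.gr i) p ⟨J.j α p x, J.j_mem α p x⟩ := by
    rw [LinearEquiv.symm_apply_eq]
    exact (DirectSum.coeLinearMap_lof V.gr p (⟨_, J.j_mem α p x⟩ : V.gr p)).symm
  rw [Duality.desc, LinearMap.comp_apply, LinearEquiv.coe_coe, h, DirectSum.toModule_lof]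
  exact J.descFun_eq F hF (J.j_mem α p x) rfl

end Desc

/-! ### Continuous functionals with values in A, at one stage -/

section ContFun

open SHLieRinehart.SymAlg

variable {k : Type u} [Field k] [CharZero k] {A : GAlg k}

/-- A linear map on the symmetric algebra is continuous if it vanishes in large weights. -/
def ContAt {M : GMod A} {B : Type*} [AddCommGroup B] [Module k B] (n : ℕ)
    (g : SymAlg M ⊤ →ₗ[k] B) : Prop := ∀ s ∈ weightGE M ⊤ (n + 1), g s = 0

section

variable {M M' : GMod A} {B : Type*} [AddCommGroup B] [Module k B]

theorem ContAt.mono {n n' : ℕ} (h : n ≤ n') {g : SymAlg M ⊤ →ₗ[k] B} (hg : ContAt n g) :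
    ContAt n' g := fun s hs => hg s (weightGE_mono (by omega) hs)

/-- By `trc_eq_zero_iff`, vanishing in weight > n means vanishing on the kernel of the truncation.
-/
theorem ContAt.factor {n : ℕ} {g : SymAlg M ⊤ →ₗ[k] B} (hg : ContAt n g) :
    ∃ g' : SymAlg M n →ₗ[k] B, g' ∘ₗ (trc M n).toLinearMap = g := by
  have hs : Function.Surjective (trc M n).toLinearMap := map_surjective le_top
  let e := (trc M n).toLinearMap.quotKerEquivOfSurjective hs
  have hk : LinearMap.ker (trc M n).toLinearMap ≤ LinearMap.ker g := fun s hs =>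
    hg s ((trc_eq_zero_iff n s).1 hs)
  refine ⟨(Submodule.liftQ _ g hk) ∘ₗ e.symm.toLinearMap, LinearMap.ext fun s => ?_⟩
  have : e.symm ((trc M n).toLinearMap s) = Submodule.Quotient.mk s := by
    rw [LinearEquiv.symm_apply_eq]; rfl
  rw [LinearMap.comp_apply, LinearMap.comp_apply, LinearEquiv.coe_coe, this]
  rfl

theorem contAt_trc {n : ℕ} (g : SymAlg M n →ₗ[k] B) : ContAt n (g ∘ₗ (trc M n).toLinearMap) := by
  intro s hs
  have h := (trc_eq_zero_iff n s).2 hs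
  rw [LinearMap.comp_apply, AlgHom.toLinearMap_apply, h, map_zero]

theorem contAt_proj : ContAt 0 (proj M ⊤).toLinearMap := by
  intro s hs
  have h := (trc_eq_zero_iff 0 s).2 hs
  have h2 := proj_map (𝟙 M) (N' := (0 : ℕ)) le_top s
  rw [AlgHom.toLinearMap_apply, ← h2]
  exact (congrArg _ h).trans (map_zero _)

theorem ContAt.comp_map {n : ℕ} {g : SymAlg M' ⊤ →ₗ[k] B} (hg : ContAt n g) (f : M ⟶ M') :
    ContAt n (g ∘ₗ (map f (le_refl ⊤)).toLinearMap) :=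
  fun s hs => hg _ (map_mem_weightGE f _ hs)

/-- The contraction descends to a map from the truncation at weight j + 1 to the truncation at
weight j, and the weight of an element is read off from its truncations. -/
theorem ctr_mem_weightGE {p : ℤ} (x : M.dual p) {j : ℕ} {s : SymAlg M ⊤}
    (hs : s ∈ weightGE M ⊤ (j + 1)) : ctr x s ∈ weightGE M ⊤ j := by
  cases j with
  | zero => exact mem_weightGE_zero _
  | succ j =>
    have h1 := (trc_eq_zero_iff (j + 1) s).2 hs
    rw [← trc_eq_zero_iff]
    have h2 := contr_map (N₁ := (j + 1 : ℕ)) (N₁' := (j : ℕ)) x (𝟙 M) le_top (le_refl _) le_top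
      le_top s
    rw [GMod.dualMap_id] at h2
    rw [trc, ← h2]
    exact (congrArg _ h1).trans (map_zero _)

theorem ContAt.comp_ctr {n : ℕ} {g : SymAlg M ⊤ →ₗ[k] B} (hg : ContAt n g) {p : ℤ}
    (x : M.dual p) : ContAt (n + 1) (g ∘ₗ ctr x) :=
  fun _ hs => hg _ (ctr_mem_weightGE x hs)

end

/-- Continuous functionals on the symmetric algebra with values in `A`. -/
def contFun (M : GMod A) : Submodule k (SymAlg M ⊤ →ₗ[k] A) where
  carrier := {g | ∃ n, ContAt n g}
  zero_mem' := ⟨0, fun _ _ => rfl⟩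
  add_mem' := by
    rintro g g' ⟨n, hn⟩ ⟨n', hn'⟩
    refine ⟨max n n', fun s hs => ?_⟩
    rw [LinearMap.add_apply, hn.mono (le_max_left _ _) s hs, hn'.mono (le_max_right _ _) s hs,
      add_zero]
  smul_mem' := by
    rintro c g ⟨n, hn⟩
    exact ⟨n, fun s hs => by rw [LinearMap.smul_apply, hn s hs, smul_zero]⟩

variable {M M' M'' : GMod A}

/-- Restriction of functionals. -/
def cpull (f : M ⟶ M') : contFun M' →ₗ[k] contFun M where
  toFun g := ⟨g.1 ∘ₗ (map f (le_refl ⊤)).toLinearMap, g.2.imp fun _ h => h.comp_map f⟩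
  map_add' _ _ := rfl
  map_smul' _ _ := rfl

@[simp] theorem cpull_apply (f : M ⟶ M') (g : contFun M') (s : SymAlg M ⊤) :
    (cpull f g).1 s = g.1 (map f (le_refl ⊤) s) := rfl

theorem cpull_comp (f : M ⟶ M') (h : M' ⟶ M'') (g : contFun M'') :
    cpull f (cpull h g) = cpull (f ≫ h) g :=
  Subtype.ext (LinearMap.ext fun s => congrArg g.1 (map_map f h (le_refl ⊤) (le_refl ⊤) s))

theorem cpull_id (g : contFun M) : cpull (𝟙 M) g = g :=
  Subtype.ext (LinearMap.ext fun s => congrArg g.1 (map_id_apply s))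

/-- Contraction of functionals. -/
def cctr {p : ℤ} : M.dual p →ₗ[k] contFun M →ₗ[k] contFun M :=
  LinearMap.mk₂ k (fun x g => ⟨g.1 ∘ₗ ctr x, g.2.elim fun n h => ⟨n + 1, h.comp_ctr x⟩⟩)
    (fun x y g => Subtype.ext (LinearMap.ext fun s => by
      change g.1 (ctr (x + y) s) = g.1 (ctr x s) + g.1 (ctr y s)
      rw [ctr, contr_add, LinearMap.add_apply, map_add]))
    (fun c x g => Subtype.ext (LinearMap.ext fun s => by
      change g.1 (ctr (c • x) s) = c • g.1 (ctr x s)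
      rw [ctr, contr_smul, LinearMap.smul_apply, map_smul]))
    (fun _ _ _ => rfl) (fun _ _ _ => rfl)

@[simp] theorem cctr_apply {p : ℤ} (x : M.dual p) (g : contFun M) (s : SymAlg M ⊤) :
    (cctr x g).1 s = g.1 (ctr x s) := rfl

theorem cpull_cctr (f : M ⟶ M') {p : ℤ} (x : M'.dual p) (g : contFun M') :
    cpull f (cctr x g) = cctr (GMod.dualMap f p x) (cpull f g) :=
  Subtype.ext (LinearMap.ext fun s => congrArg g.1
    (contr_map x f (le_refl ⊤) le_top le_top (le_refl ⊤) s))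

/-- Postcomposition with an endomorphism of `A`. -/
def cpost : (A →ₗ[k] A) →ₗ[k] contFun M →ₗ[k] contFun M :=
  LinearMap.mk₂ k (fun θ g => ⟨θ ∘ₗ g.1, g.2.imp fun n h s hs => by
      rw [LinearMap.comp_apply, h s hs, map_zero]⟩)
    (fun _ _ _ => rfl) (fun _ _ _ => rfl)
    (fun θ _ _ => Subtype.ext (LinearMap.ext fun _ => map_add θ _ _))
    (fun c θ _ => Subtype.ext (LinearMap.ext fun _ => map_smul θ c _))

@[simp] theorem cpost_apply (θ : A →ₗ[k] A) (g : contFun M) (s : SymAlg M ⊤) :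
    (cpost θ g).1 s = θ (g.1 s) := rfl

/-- The projection as a functional. -/
def cproj (M : GMod A) : contFun M := ⟨(proj M ⊤).toLinearMap, 0, contAt_proj⟩

@[simp] theorem cproj_apply (s : SymAlg M ⊤) : (cproj M).1 s = proj M ⊤ s := rfl

theorem cpull_cproj (f : M ⟶ M') : cpull f (cproj M') = cproj M :=
  Subtype.ext (LinearMap.ext fun s => proj_map f (le_refl ⊤) s)

end ContFun

/-! ### The space of functionals on the completed symmetric algebra -/

section W

open SHLieRinehart.SymAlg

open scoped Classical

variable {k : Type u} [Field k] [CharZero k] {A : GAlg k} (M : ProObj (GMod A))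

instance : DirectedSystem (fun α => contFun (M.X α)) (fun _ _ h => cpull (M.map h)) where
  map_self i g := by
    rw [M.map_id, cpull_id]
  map_map i j l hij hjl g := by
    rw [cpull_comp, M.map_comp]

/-- Continuous functionals on the completed symmetric algebra with values in `A`. -/
def Wfun : Type u :=
  Module.DirectLimit (R := k) (fun α => contFun (M.X α)) (fun _ _ h => cpull (M.map h))

/-- The additive structure on the space of functionals. -/
@[reducible] def Wfun.addCommMonoid : AddCommMonoid (Wfun M) :=
  Module.DirectLimit.addCommMonoid (R := k) (fun α => contFun (M.X α))
    (fun _ _ h => cpull (M.map h))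

/-- The linear structure on the space of functionals. -/
@[reducible] def Wfun.module : @Module k (Wfun M) _ (Wfun.addCommMonoid M) :=
  Module.DirectLimit.module (R := k) (fun α => contFun (M.X α)) (fun _ _ h => cpull (M.map h))

instance : AddCommGroup (Wfun M) :=
  @Module.addCommMonoidToAddCommGroup k (Wfun M) _ (Wfun.addCommMonoid M) (Wfun.module M)

instance : Module k (Wfun M) := Wfun.module M

/-- The class of a functional. -/
def cls (α : M.I) : contFun (M.X α) →ₗ[k] Wfun M :=
  Module.DirectLimit.of k M.I (fun α => contFun (M.X α)) (fun _ _ h => cpull (M.map h)) α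

variable {M}

theorem cls_cpull {α β : M.I} (h : α ≤ β) (g : contFun (M.X α)) :
    cls M β (cpull (M.map h) g) = cls M α g :=
  Module.DirectLimit.of_f (f := fun _ _ h => cpull (M.map h))

theorem exists_cls (w : Wfun M) : ∃ α g, cls M α g = w := Module.DirectLimit.exists_of w

theorem exists_of_cls_eq_zero {α : M.I} {g : contFun (M.X α)} (h : cls M α g = 0) :
    ∃ (β : M.I) (h : α ≤ β), cpull (M.map h) g = 0 :=
  Module.DirectLimit.of.zero_exact h

/-- The universal property of the space of functionals. -/
def Wfun.lift {P : Type*} [AddCommGroup P] [Module k P] (g : ∀ α, contFun (M.X α) →ₗ[k] P)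
    (hg : ∀ α β (h : α ≤ β) (x : contFun (M.X α)), g β (cpull (M.map h) x) = g α x) :
    Wfun M →ₗ[k] P :=
  Module.DirectLimit.lift k M.I (fun α => contFun (M.X α)) (fun _ _ h => cpull (M.map h)) g hg

@[simp] theorem Wfun.lift_cls {P : Type*} [AddCommGroup P] [Module k P]
    (g : ∀ α, contFun (M.X α) →ₗ[k] P)
    (hg : ∀ α β (h : α ≤ β) (x : contFun (M.X α)), g β (cpull (M.map h) x) = g α x)
    (α : M.I) (x : contFun (M.X α)) : Wfun.lift g hg (cls M α x) = g α x :=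
  Module.DirectLimit.lift_of _ _ _

theorem Wfun.hom_ext {P : Type*} [AddCommGroup P] [Module k P] {F G : Wfun M →ₗ[k] P}
    (h : ∀ α g, F (cls M α g) = G (cls M α g)) : F = G := by
  ext w
  obtain ⟨α, g, rfl⟩ := exists_cls w
  exact h α g

theorem cls_cctr_eq {γ α δ : M.I} {p : ℤ} (x : (M.X γ).dual p) (g : contFun (M.X α)) (h : γ ≤ δ)
    (h' : α ≤ δ) {ε : M.I} (hε : δ ≤ ε) :
    cls M ε (cctr (GMod.dualMap (M.map (h.trans hε)) p x) (cpull (M.map (h'.trans hε)) g))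
      = cls M δ (cctr (GMod.dualMap (M.map h) p x) (cpull (M.map h') g)) := by
  rw [← cls_cpull hε, cpull_cctr, cpull_comp, GMod.dualMap_comp, M.map_comp, M.map_comp]

theorem cls_cctr_indep {γ α δ δ' : M.I} {p : ℤ} (x : (M.X γ).dual p) (g : contFun (M.X α))
    (h : γ ≤ δ) (h' : α ≤ δ) (i : γ ≤ δ') (i' : α ≤ δ') :
    cls M δ (cctr (GMod.dualMap (M.map h) p x) (cpull (M.map h') g))
      = cls M δ' (cctr (GMod.dualMap (M.map i) p x) (cpull (M.map i') g)) := by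
  obtain ⟨ε, h1, h2⟩ := exists_ge_ge δ δ'
  rw [← cls_cctr_eq x g h h' h1, ← cls_cctr_eq x g i i' h2]

/-- Contraction with an element of the dual of `M_γ`. -/
def ctrWAt (γ : M.I) (p : ℤ) : (M.X γ).dual p →ₗ[k] Wfun M →ₗ[k] Wfun M :=
  LinearMap.flip (Wfun.lift (fun α =>
    LinearMap.flip (LinearMap.compl₁₂ cctr (GMod.dualMapₗ (M.map (exists_ge_ge γ α).choose_spec.1) p)
      (cpull (M.map (exists_ge_ge γ α).choose_spec.2)) |>.compr₂ (cls M _)))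
    (fun α β h g => by
      ext x
      obtain ⟨h1, h2⟩ := (exists_ge_ge γ α).choose_spec
      obtain ⟨i1, i2⟩ := (exists_ge_ge γ β).choose_spec
      change cls M _ (cctr (GMod.dualMap (M.map i1) p x) (cpull (M.map i2) (cpull (M.map h) g)))
        = cls M _ (cctr (GMod.dualMap (M.map h1) p x) (cpull (M.map h2) g))
      rw [cpull_comp, M.map_comp]
      exact cls_cctr_indep x g _ _ _ _))

theorem ctrWAt_cls {γ α δ : M.I} {p : ℤ} (x : (M.X γ).dual p) (g : contFun (M.X α)) (h : γ ≤ δ)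
    (h' : α ≤ δ) : ctrWAt γ p x (cls M α g)
      = cls M δ (cctr (GMod.dualMap (M.map h) p x) (cpull (M.map h') g)) := by
  rw [ctrWAt, LinearMap.flip_apply, Wfun.lift_cls]
  exact cls_cctr_indep x g (exists_ge_ge γ α).choose_spec.1 (exists_ge_ge γ α).choose_spec.2 h h'

theorem ctrWAt_compat {γ γ' : M.I} (h : γ ≤ γ') (p : ℤ) (x : (M.X γ).dual p) :
    ctrWAt γ' p (GMod.dualMap (M.map h) p x) = ctrWAt γ p x := by
  refine Wfun.hom_ext fun α g => ?_
  obtain ⟨δ, h1, h2⟩ := exists_ge_ge γ' α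
  rw [ctrWAt_cls _ g h1 h2, ctrWAt_cls x g (h.trans h1) h2, GMod.dualMap_comp, M.map_comp]

variable {V : GMod A} (J : Duality M V)

/-- Contraction of functionals with an element of the module `V` dual to `M`. -/
def ctrW : V →ₗ[k] Wfun M →ₗ[k] Wfun M := J.desc ctrWAt ctrWAt_compat

theorem ctrW_j {γ α δ : M.I} {p : ℤ} (x : (M.X γ).dual p) (g : contFun (M.X α)) (h : γ ≤ δ)
    (h' : α ≤ δ) : ctrW J (J.j γ p x) (cls M α g)
      = cls M δ (cctr (GMod.dualMap (M.map h) p x) (cpull (M.map h') g)) := by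
  rw [ctrW, J.desc_j, ctrWAt_cls x g h h']

theorem ctrW_j_self {α : M.I} {p : ℤ} (x : (M.X α).dual p) (g : contFun (M.X α)) :
    ctrW J (J.j α p x) (cls M α g) = cls M α (cctr x g) := by
  rw [ctrW_j J x g (le_refl α) (le_refl α), M.map_id, cpull_id, GMod.dualMap_id]

theorem ctrW_comm {p q : ℤ} {v w : V} (hv : v ∈ V.gr p) (hw : w ∈ V.gr q) (s : Wfun M) :
    ctrW J v (ctrW J w s) = sgn (p * q) • ctrW J w (ctrW J v s) := by
  obtain ⟨α, x, y, rfl, rfl⟩ := J.common hv hw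
  obtain ⟨β, g, rfl⟩ := exists_cls s
  obtain ⟨δ, h1, h2⟩ := exists_ge_ge α β
  rw [← J.compat h1, ← J.compat h1, ← cls_cpull h2]
  simp only [ctrW_j_self]
  rw [← map_zsmul]
  congr 1
  refine Subtype.ext (LinearMap.ext fun s => ?_)
  generalize cpull (M.map h2) g = g'
  change g'.1 (ctr _ (ctr _ s)) = (sgn (p * q) • (g'.1 ∘ₗ ctr _ ∘ₗ ctr _)) s
  rw [ctr_comm, map_zsmul, mul_comm]
  rfl

variable (M) in
/-- The projection as an element of the space of functionals. -/
def projW : Wfun M := cls M (Classical.arbitrary _) (cproj _)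

theorem cls_cproj (α : M.I) : cls M α (cproj _) = projW M := by
  obtain ⟨δ, h1, h2⟩ := exists_ge_ge α (Classical.arbitrary M.I)
  rw [projW, ← cls_cpull h1, ← cls_cpull h2, cpull_cproj, cpull_cproj]

/-- Postcomposition of functionals with an endomorphism of `A`. -/
def postW : (A →ₗ[k] A) →ₗ[k] Wfun M →ₗ[k] Wfun M :=
  LinearMap.flip (Wfun.lift (fun α => LinearMap.flip (cpost.compr₂ (cls M α)))
    (fun α β h g => by
      ext θ
      exact cls_cpull h (cpost θ g)))

@[simp] theorem postW_cls (θ : A →ₗ[k] A) (α : M.I) (g : contFun (M.X α)) :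
    postW θ (cls M α g) = cls M α (cpost θ g) := by
  rw [postW, LinearMap.flip_apply, Wfun.lift_cls]; rfl

theorem postW_postW (θ θ' : A →ₗ[k] A) (w : Wfun M) :
    postW θ (postW θ' w) = postW (θ ∘ₗ θ') w := by
  obtain ⟨α, g, rfl⟩ := exists_cls w
  simp only [postW_cls]; rfl

theorem ctrW_postW (v : V) (θ : A →ₗ[k] A) (w : Wfun M) :
    ctrW J v (postW θ w) = postW θ (ctrW J v w) := by
  induction v using graded_induction V.internal with
  | add x y hx hy => simp only [map_add, LinearMap.add_apply, hx, hy]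
  | hom p v hv =>
    obtain ⟨α, x, rfl⟩ := J.surj p v hv
    obtain ⟨β, g, rfl⟩ := exists_cls w
    obtain ⟨δ, h1, h2⟩ := exists_ge_ge α β
    rw [postW_cls, ctrW_j J x _ h1 h2, ctrW_j J x _ h1 h2, postW_cls]
    rfl

/-- Restriction of functionals to `A`. -/
def resA : Wfun M →ₗ[k] A →ₗ[k] A :=
  Wfun.lift (fun α => 
    { toFun := fun g => g.1 ∘ₗ (ofA (M.X α) ⊤).toLinearMap
      map_add' := fun _ _ => rfl
      map_smul' := fun _ _ => rfl })
    (fun α β h g => LinearMap.ext fun a => congrArg g.1 (map_ofA (M.map h) (le_refl ⊤) a))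

theorem resA_cls (α : M.I) (g : contFun (M.X α)) (a : A) :
    resA (cls M α g) a = g.1 (ofA (M.X α) ⊤ a) := by
  rw [resA, Wfun.lift_cls]; rfl

/-- The functional `π ι_x + θ π`. -/
def kap (v : V) (θ : A →ₗ[k] A) : Wfun M := ctrW J v (projW M) + postW θ (projW M)

theorem resA_postW_proj (θ : A →ₗ[k] A) : resA (postW θ (projW M)) = θ := by
  ext a
  rw [projW, postW_cls, resA_cls]
  simp

theorem ctrW_j_proj (α : M.I) {p : ℤ} (x : (M.X α).dual p) :
    ctrW J (J.j α p x) (projW M) = cls M α (cctr x (cproj _)) := by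
  rw [← cls_cproj α, ctrW_j_self]

theorem resA_ctrW_proj (v : V) : resA (ctrW J v (projW M)) = 0 := by
  induction v using graded_induction V.internal with
  | add x y hx hy => simp only [map_add, LinearMap.add_apply, hx, hy, add_zero]
  | hom p v hv =>
    obtain ⟨α, x, rfl⟩ := J.surj p v hv
    ext a
    rw [ctrW_j_proj, resA_cls]
    simp [contr_ofA]

theorem resA_kap (v : V) (θ : A →ₗ[k] A) : resA (kap J v θ) = θ := by
  rw [kap, map_add, resA_postW_proj, resA_ctrW_proj, zero_add]

/-- The rescaling of functionals induced by the grading: `s ↦ ∑ (-1)...`; here the functional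
`g` is sent to its component of degree `p`. -/
theorem ctrW_proj_injective {v : V} (h : ctrW J v (projW M) = 0) : v = 0 := by
  -- An arbitrary vector has components in several degrees; they are lifted to one common stage,
  -- where the vanishing can be tested.
  have key : ∀ v : V, ∃ (s : Finset ℤ) (α : M.I) (x : ∀ p, (M.X α).dual p),
      v = ∑ p ∈ s, J.j α p (x p) := by
    intro v
    induction v using graded_induction V.internal with
    | hom p v hv =>
      obtain ⟨α, x, rfl⟩ := J.surj p v hv
      refine ⟨{p}, α, fun q => if e : p = q then e ▸ x else 0, ?_⟩
      simp
    | add v w hv hw =>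
      obtain ⟨s, α, x, rfl⟩ := hv
      obtain ⟨t, β, y, rfl⟩ := hw
      obtain ⟨δ, h1, h2⟩ := exists_ge_ge α β
      refine ⟨s ∪ t, δ, fun p => (if p ∈ s then GMod.dualMapₗ (M.map h1) p (x p) else 0)
        + (if p ∈ t then GMod.dualMapₗ (M.map h2) p (y p) else 0), ?_⟩
      simp only [map_add, Finset.sum_add_distrib]
      congr 1
      · rw [← Finset.sum_subset Finset.subset_union_left (fun p _ hp => by rw [if_neg hp, map_zero])]
        refine Finset.sum_congr rfl fun p hp => ?_
        rw [if_pos hp]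
        exact (J.compat h1 p (x p)).symm
      · rw [← Finset.sum_subset Finset.subset_union_right (fun p _ hp => by rw [if_neg hp, map_zero])]
        refine Finset.sum_congr rfl fun p hp => ?_
        rw [if_pos hp]
        exact (J.compat h2 p (y p)).symm
  obtain ⟨s, α, x, rfl⟩ := key v
  simp only [map_sum, LinearMap.sum_apply, ctrW_j_proj] at h
  rw [← map_sum] at h
  obtain ⟨β, hβ, h1⟩ := exists_of_cls_eq_zero h
  have h2 : ∀ m : M.X β, ∑ p ∈ s, (x p).1 ((M.map hβ).toLin m) = 0 := by
    intro m
    have h3 := DFunLike.congr_fun (congrArg Subtype.val h1) (ofM _ _ m)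
    rw [cpull_apply, map_ofM, AddSubmonoidClass.coe_finsetSum, LinearMap.sum_apply] at h3
    simpa [contr_ofM] using h3
  refine Finset.sum_eq_zero fun p hp => ?_
  rw [← J.compat hβ]
  have h4 : GMod.dualMap (M.map hβ) p (x p) = 0 := by
    refine GMod.dual_ext fun m => ?_
    induction m using graded_induction (M.X β).internal with
    | add m m' hm hm' => rw [map_add, map_add, hm, hm']
    | hom i m hm =>
      -- On a homogeneous m the summands have different degrees, so the component of degree i + p
      -- isolates x_p(m).
      have h5 := congrArg (component A.internal (i + p)) (h2 m)
      rw [map_sum, map_zero, Finset.sum_eq_single p] at h5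
      · rw [component_of_mem] at h5
        · exact h5
        · exact (x p).2.1 _ _ ((M.map hβ).map_mem _ _ hm)
      · intro q _ hq
        exact component_of_mem_ne A.internal (i := i + q) (by omega)
          ((x q).2.1 _ _ ((M.map hβ).map_mem _ _ hm))
      · exact fun hp' => absurd hp hp'
  rw [h4, map_zero]

/-- Restriction to A kills π ι_v and returns θ; the remaining functional π ι_v determines v. So one
vector of `Wfun M` records an operation together with its anchor. -/
theorem kap_injective {v v' : V} {θ θ' : A →ₗ[k] A} (h : kap J v θ = kap J v' θ') :
    v = v' ∧ θ = θ' := by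
  have h1 : θ = θ' := by rw [← resA_kap J v θ, h, resA_kap]
  subst h1
  refine ⟨?_, rfl⟩
  rw [kap, kap, add_left_inj, ← sub_eq_zero, ← LinearMap.sub_apply, ← map_sub] at h
  exact sub_eq_zero.1 (ctrW_proj_injective J h)

theorem kap_add (v v' : V) (θ θ' : A →ₗ[k] A) :
    kap J (v + v') (θ + θ') = kap J v θ + kap J v' θ' := by
  simp only [kap, map_add, LinearMap.add_apply]; abel

theorem kap_smul (c : k) (v : V) (θ : A →ₗ[k] A) : kap J (c • v) (c • θ) = c • kap J v θ := by
  simp only [kap, map_smul, LinearMap.smul_apply, smul_add]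

theorem kap_zsmul (n : ℤ) (v : V) (θ : A →ₗ[k] A) : kap J (n • v) (n • θ) = n • kap J v θ := by
  simp only [kap, map_zsmul, LinearMap.smul_apply, smul_add]

theorem kap_zero : kap J (0 : V) 0 = 0 := by simp [kap]

end W

/-! ### Representatives of pro-morphisms -/

section Represents

variable {C : Type (u + 1)} [Category.{u} C] {X Y Z : ProObj C}

theorem PreHom.toHom_eq_iff {r s : PreHom X Y} : r.toHom = s.toHom ↔
    ∀ j, ∃ (i : X.I) (h1 : r.φ j ≤ i) (h2 : s.φ j ≤ i), X.map h1 ≫ r.f j = X.map h2 ≫ s.f j :=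
  ⟨fun h => Quotient.exact h, fun h => Quotient.sound h⟩

theorem represents_toHom_iff (r : PreHom X Y) {i : X.I} {j : Y.I} {g : X.X i ⟶ Y.X j} :
    Represents r.toHom i j g ↔ ∃ (i' : X.I) (h : i ≤ i') (h' : r.φ j ≤ i'),
      X.map h ≫ g = X.map h' ≫ r.f j := by
  refine ⟨?_, fun h => ⟨r, rfl, h⟩⟩
  rintro ⟨s, hs, i', h, h', e⟩
  obtain ⟨i2, p, q, e2⟩ := PreHom.toHom_eq_iff.1 hs j
  obtain ⟨l, hl, hl'⟩ := exists_ge_ge i' i2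
  refine ⟨l, h.trans hl, q.trans hl', ?_⟩
  rw [← X.map_comp h hl, Category.assoc, e, ← X.map_comp q hl', Category.assoc, ← e2,
    ← Category.assoc, ← Category.assoc, X.map_comp, X.map_comp]

theorem represents_toHom (r : PreHom X Y) (j : Y.I) : Represents r.toHom (r.φ j) j (r.f j) :=
  (represents_toHom_iff r).2 ⟨_, le_refl _, le_refl _, rfl⟩

theorem exists_toHom (F : X ⟶ Y) : ∃ r : PreHom X Y, r.toHom = F := Quotient.exists_rep F

variable {F G : X ⟶ Y}

theorem exists_represents (F : X ⟶ Y) (j : Y.I) : ∃ i g, Represents F i j g := by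
  obtain ⟨r, rfl⟩ := exists_toHom F
  exact ⟨_, _, represents_toHom r j⟩

theorem Represents.restrict {i i' : X.I} {j : Y.I} {g : X.X i ⟶ Y.X j} (hg : Represents F i j g)
    (h : i ≤ i') : Represents F i' j (X.map h ≫ g) := by
  obtain ⟨r, rfl, l, p, q, e⟩ := hg
  obtain ⟨l', hl, hl'⟩ := exists_ge_ge l i'
  refine ⟨r, rfl, l', hl', q.trans hl, ?_⟩
  rw [← X.map_comp q hl, Category.assoc, ← e, ← Category.assoc, X.map_comp, ← Category.assoc,
    X.map_comp]

theorem Represents.eq {i i' : X.I} {j : Y.I} {g : X.X i ⟶ Y.X j} {g' : X.X i' ⟶ Y.X j}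
    (hg : Represents F i j g) (hg' : Represents F i' j g') :
    ∃ (l : X.I) (h : i ≤ l) (h' : i' ≤ l), X.map h ≫ g = X.map h' ≫ g' := by
  obtain ⟨r, rfl⟩ := exists_toHom F
  obtain ⟨l, p, q, e⟩ := (represents_toHom_iff r).1 hg
  obtain ⟨l', p', q', e'⟩ := (represents_toHom_iff r).1 hg'
  obtain ⟨m, hl, hl'⟩ := exists_ge_ge l l'
  refine ⟨m, p.trans hl, p'.trans hl', ?_⟩
  rw [← X.map_comp p hl, ← X.map_comp p' hl', Category.assoc, Category.assoc, e, e',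
    ← Category.assoc, ← Category.assoc, X.map_comp, X.map_comp]

theorem Represents.of_eq {i i' l : X.I} {j : Y.I} {g : X.X i ⟶ Y.X j} {g' : X.X i' ⟶ Y.X j}
    (hg : Represents F i j g) (h : i ≤ l) (h' : i' ≤ l) (e : X.map h ≫ g = X.map h' ≫ g') :
    Represents F i' j g' := by
  obtain ⟨r, rfl, m, p, q, e2⟩ := hg
  obtain ⟨n, hl, hm⟩ := exists_ge_ge l m
  refine ⟨r, rfl, n, h'.trans hl, q.trans hm, ?_⟩
  rw [← X.map_comp h' hl, Category.assoc, ← e, ← X.map_comp q hm, Category.assoc, ← e2,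
    ← Category.assoc, ← Category.assoc, X.map_comp, X.map_comp]

theorem Represents.post {i : X.I} {j j' : Y.I} {g : X.X i ⟶ Y.X j} (hg : Represents F i j g)
    (h : j' ≤ j) : Represents F i j' (g ≫ Y.map h) := by
  obtain ⟨r, rfl, l, p, q, e⟩ := hg
  obtain ⟨m, p', q', e'⟩ := r.compat h
  obtain ⟨n, hl, hm⟩ := exists_ge_ge l m
  refine ⟨r, rfl, n, p.trans hl, q'.trans hm, ?_⟩
  rw [← X.map_comp p hl, ← X.map_comp q' hm, Category.assoc, Category.assoc, ← e', reassoc_of% e,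
    ← Category.assoc, ← Category.assoc (X.map hm), X.map_comp, X.map_comp]

theorem Represents.hom_ext (h : ∀ j, ∃ i g, Represents F i j g ∧ Represents G i j g) : F = G := by
  obtain ⟨r, rfl⟩ := exists_toHom F
  obtain ⟨s, rfl⟩ := exists_toHom G
  refine PreHom.toHom_eq_iff.2 fun j => ?_
  obtain ⟨i, g, hr, hs⟩ := h j
  obtain ⟨l, p, q, e⟩ := (represents_toHom_iff r).1 hr
  obtain ⟨l', p', q', e'⟩ := (represents_toHom_iff s).1 hs
  obtain ⟨m, hl, hl'⟩ := exists_ge_ge l l'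
  refine ⟨m, q.trans hl, q'.trans hl', ?_⟩
  rw [← X.map_comp q hl, ← X.map_comp q' hl', Category.assoc, Category.assoc, ← e, ← e',
    ← Category.assoc, ← Category.assoc, X.map_comp, X.map_comp]

theorem Represents.comp {F : X ⟶ Y} {G : Y ⟶ Z} {i : X.I} {j : Y.I} {l : Z.I} {g : X.X i ⟶ Y.X j}
    {h : Y.X j ⟶ Z.X l} (hg : Represents F i j g) (hh : Represents G j l h) :
    Represents (F ≫ G) i l (g ≫ h) := by
  obtain ⟨r, rfl⟩ := exists_toHom F
  obtain ⟨s, rfl⟩ := exists_toHom G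
  obtain ⟨m, p, q, e⟩ := (represents_toHom_iff s).1 hh
  have h1 : Represents (r.comp s).toHom (r.φ (s.φ l)) l (r.f (s.φ l) ≫ s.f l) :=
    represents_toHom (r.comp s) l
  obtain ⟨c1, c2, c3, e1⟩ := r.compat q
  obtain ⟨d1, d2, d3, e2⟩ := r.compat p
  obtain ⟨b, b1, b2, e3⟩ := (represents_toHom_iff r).1 hg
  obtain ⟨n, n1, n2⟩ := exists_ge_ge c1 d1
  obtain ⟨n', n3, n4⟩ := exists_ge_ge n b
  refine h1.of_eq (l := n') (c3.trans (n1.trans n3)) (b1.trans n4) ?_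
  rw [← X.map_comp c3 (n1.trans n3), ← X.map_comp b1 n4, Category.assoc, ← Category.assoc (X.map c3),
    ← e1, Category.assoc, Category.assoc, Category.assoc, ← e, reassoc_of% e3,
    ← reassoc_of% (X.map_comp b2 n4).symm, ← Category.assoc (X.map (n1.trans n3)), X.map_comp]
  have e4 : X.map (b2.trans n4) ≫ r.f j = X.map (d2.trans (n2.trans n3)) ≫ r.f m ≫ Y.map p := by
    rw [← X.map_comp d2 (n2.trans n3), Category.assoc, e2, ← Category.assoc, X.map_comp]
  rw [← Category.assoc (X.map (b2.trans n4)), e4]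
  simp only [Category.assoc]

theorem represents_id {i j : X.I} (h : j ≤ i) : Represents (𝟙 X) i j (X.map h) := by
  refine ⟨⟨id, fun _ => 𝟙 _, fun {j' j} h => ⟨j, le_refl _, h, by simp [X.map_id]⟩⟩, rfl, i,
    le_refl _, h, ?_⟩
  rw [X.map_id, Category.id_comp]
  exact (Category.comp_id _).symm

theorem represents_proZero [Limits.HasZeroMorphisms C] (i : X.I) (j : Y.I) :
    Represents (proZero X Y) i j 0 := by
  obtain ⟨l, h, h'⟩ := exists_ge_ge i (Classical.arbitrary X.I)
  refine ⟨_, rfl, l, h, h', ?_⟩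
  simp

theorem Represents.map {D : Type (u + 1)} [Category.{u} D] (T : C ⥤ D) {i : X.I} {j : Y.I}
    {g : X.X i ⟶ Y.X j} (hg : Represents F i j g) :
    Represents ((proFunctor T).map F) i j (T.map g) := by
  obtain ⟨r, rfl, l, p, q, e⟩ := hg
  refine ⟨⟨r.φ, fun j => T.map (r.f j), fun h => by
      obtain ⟨i, h1, h2, e⟩ := r.compat h
      exact ⟨i, h1, h2, by
        change T.map _ ≫ T.map _ ≫ T.map _ = T.map _ ≫ T.map _
        simp only [← T.map_comp, e]⟩⟩, rfl, l, p, q, ?_⟩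
  change T.map _ ≫ T.map _ = T.map _ ≫ T.map _
  rw [← T.map_comp, ← T.map_comp, e]

theorem represents_toConst {B : C} (i : X.I) (f : X.X i ⟶ B) (j : ((proConst C).obj B).I) :
    Represents (toConst X i f) i j f :=
  ⟨_, rfl, i, le_refl _, le_refl _, rfl⟩

theorem represents_proConst {B B' : C} (f : B ⟶ B') (i : ((proConst C).obj B).I)
    (j : ((proConst C).obj B').I) : Represents ((proConst C).map f) i j f :=
  ⟨_, rfl, i, le_refl _, le_refl _, rfl⟩

/-- A pro-morphism determined by a family of representatives that are compatible up to enlarging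
the source. -/
theorem exists_hom_of_family (φ : Y.I → X.I) (f : ∀ j, X.X (φ j) ⟶ Y.X j)
    (h : ∀ {j' j : Y.I} (h : j' ≤ j), ∃ (i : X.I) (h1 : φ j ≤ i) (h2 : φ j' ≤ i),
      X.map h1 ≫ f j ≫ Y.map h = X.map h2 ≫ f j') :
    ∃ F : X ⟶ Y, ∀ j, Represents F (φ j) j (f j) :=
  ⟨PreHom.toHom ⟨φ, f, h⟩, fun j => represents_toHom ⟨φ, f, h⟩ j⟩

end Represents

/-! ### Transposes of pro-morphisms of completed symmetric algebras -/

section Truncated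

open SHLieRinehart.SymAlg

variable {k : Type u} [Field k] [CharZero k] {A : GAlg k} {M M' M'' : ProObj (GMod A)}

/-- The transition maps of the completed symmetric algebra. -/
abbrev symTr (M : ProObj (GMod A)) {i j : M.I × ℕ} (h : i ≤ j) :
    SymAlg (M.X j.1) j.2 →ₐ[k] SymAlg (M.X i.1) i.2 :=
  SymAlg.map (M.map (Prod.le_def.1 h).1) (by exact_mod_cast (Prod.le_def.1 h).2)

theorem symTr_symTr {i j l : M.I × ℕ} (h : i ≤ j) (h' : j ≤ l) (s : SymAlg (M.X l.1) l.2) :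
    symTr M h (symTr M h' s) = symTr M (h.trans h') s := by
  rw [symTr, symTr, map_map, M.map_comp]

theorem symTr_trc {i j : M.I × ℕ} (h : i ≤ j) (s : SymAlg (M.X j.1) ⊤) :
    symTr M h (trc (M.X j.1) j.2 s)
      = trc (M.X i.1) i.2 (map (M.map (Prod.le_def.1 h).1) (le_refl ⊤) s) := by
  rw [symTr, trc, trc, map_map, map_map, Category.id_comp, Category.comp_id]

/-- The class of a functional on a truncated symmetric algebra. -/
def clsT (M : ProObj (GMod A)) (i : M.I × ℕ) : (SymAlg (M.X i.1) i.2 →ₗ[k] A) →ₗ[k] Wfun M where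
  toFun g := cls M i.1 ⟨g ∘ₗ (trc (M.X i.1) i.2).toLinearMap, i.2, contAt_trc g⟩
  map_add' g g' := by rw [← map_add]; rfl
  map_smul' c g := by rw [RingHom.id_apply, ← map_smul]; rfl

theorem clsT_of_eq {i : M.I × ℕ} {g : SymAlg (M.X i.1) i.2 →ₗ[k] A} {g' : contFun (M.X i.1)}
    (h : g ∘ₗ (trc (M.X i.1) i.2).toLinearMap = g'.1) : clsT M i g = cls M i.1 g' :=
  congrArg (cls M i.1) (Subtype.ext h)

theorem clsT_symTr {i j : M.I × ℕ} (h : i ≤ j) (g : SymAlg (M.X i.1) i.2 →ₗ[k] A) :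
    clsT M j (g ∘ₗ (symTr M h).toLinearMap) = clsT M i g := by
  rw [clsT_of_eq (g' := cpull (M.map (Prod.le_def.1 h).1)
    ⟨g ∘ₗ (trc (M.X i.1) i.2).toLinearMap, i.2, contAt_trc g⟩), cls_cpull]
  · rfl
  · exact LinearMap.ext fun s => congrArg g (symTr_trc h s)

theorem exists_clsT_cls (α : M.I) (g : contFun (M.X α)) :
    ∃ (n : ℕ) (g' : SymAlg (M.X α) n →ₗ[k] A), clsT M (α, n) g' = cls M α g := by
  obtain ⟨n, hn⟩ := g.2
  obtain ⟨g', h⟩ := hn.factor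
  exact ⟨n, g', clsT_of_eq h⟩

theorem exists_clsT (w : Wfun M) : ∃ i g, clsT M i g = w := by
  obtain ⟨α, g, rfl⟩ := exists_cls w
  obtain ⟨n, g', h⟩ := exists_clsT_cls α g
  exact ⟨(α, n), g', h⟩

theorem exists_of_clsT_eq_zero {i : M.I × ℕ} {g : SymAlg (M.X i.1) i.2 →ₗ[k] A}
    (h : clsT M i g = 0) : ∃ (j : M.I × ℕ) (h : i ≤ j), g ∘ₗ (symTr M h).toLinearMap = 0 := by
  obtain ⟨β, hβ, e⟩ := exists_of_cls_eq_zero h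
  have hij : i ≤ (β, i.2) := ⟨hβ, le_refl _⟩
  refine ⟨(β, i.2), hij, LinearMap.ext fun s => ?_⟩
  obtain ⟨t, rfl⟩ := map_surjective (M := M.X β) (N := ⊤) (N' := (i.2 : ℕ)) le_top s
  have := DFunLike.congr_fun (congrArg Subtype.val e) t
  exact (congrArg g (symTr_trc hij t)).trans this

theorem exists_of_clsT_eq {i j : M.I × ℕ} {g : SymAlg (M.X i.1) i.2 →ₗ[k] A}
    {h : SymAlg (M.X j.1) j.2 →ₗ[k] A} (e : clsT M i g = clsT M j h) (m : M.I × ℕ) :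
    ∃ (l : M.I × ℕ) (hi : i ≤ l) (hj : j ≤ l), m ≤ l ∧
      g ∘ₗ (symTr M hi).toLinearMap = h ∘ₗ (symTr M hj).toLinearMap := by
  obtain ⟨c, h1, h2⟩ := (symPro M).directed.directed i j
  obtain ⟨c', h3, h4⟩ := (symPro M).directed.directed c m
  have h0 : clsT M c' (g ∘ₗ (symTr M (h1.trans h3)).toLinearMap
      - h ∘ₗ (symTr M (h2.trans h3)).toLinearMap) = 0 := by
    rw [map_sub, clsT_symTr, clsT_symTr, e, sub_self]
  obtain ⟨l, hl, e2⟩ := exists_of_clsT_eq_zero h0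
  refine ⟨l, (h1.trans h3).trans hl, (h2.trans h3).trans hl, h4.trans hl, LinearMap.ext fun s => ?_⟩
  have := DFunLike.congr_fun e2 s
  simp only [LinearMap.comp_apply, LinearMap.sub_apply, AlgHom.toLinearMap_apply, symTr_symTr,
    LinearMap.zero_apply, sub_eq_zero] at this
  exact this

theorem postW_clsT (θ : A →ₗ[k] A) (i : M.I × ℕ) (g : SymAlg (M.X i.1) i.2 →ₗ[k] A) :
    postW θ (clsT M i g) = clsT M i (θ ∘ₗ g) := postW_cls θ _ _

/-- A linear map represents a pro-morphism of completed symmetric algebras. -/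
abbrev Rep (F : (toProMod k).obj (symPro M) ⟶ (toProMod k).obj (symPro M')) (i : M.I × ℕ)
    (j : M'.I × ℕ) (D : SymAlg (M.X i.1) i.2 →ₗ[k] SymAlg (M'.X j.1) j.2) : Prop :=
  Represents F i j (ModuleCat.ofHom D)

section

variable {F G : (toProMod k).obj (symPro M) ⟶ (toProMod k).obj (symPro M')}

theorem exists_rep (F : (toProMod k).obj (symPro M) ⟶ (toProMod k).obj (symPro M'))
    (j : M'.I × ℕ) : ∃ i D, Rep F i j D := by
  obtain ⟨i, g, h⟩ := exists_represents F j
  exact ⟨i, g.hom, h⟩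

theorem Rep.restrict {i i' : M.I × ℕ} {j : M'.I × ℕ}
    {D : SymAlg (M.X i.1) i.2 →ₗ[k] SymAlg (M'.X j.1) j.2} (h : Rep F i j D) (hi : i ≤ i') :
    Rep F i' j (D ∘ₗ (symTr M hi).toLinearMap) := Represents.restrict h hi

theorem Rep.post {i : M.I × ℕ} {j j' : M'.I × ℕ}
    {D : SymAlg (M.X i.1) i.2 →ₗ[k] SymAlg (M'.X j.1) j.2} (h : Rep F i j D) (hj : j' ≤ j) :
    Rep F i j' ((symTr M' hj).toLinearMap ∘ₗ D) := Represents.post h hj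

theorem Rep.eq {i i' : M.I × ℕ} {j : M'.I × ℕ}
    {D : SymAlg (M.X i.1) i.2 →ₗ[k] SymAlg (M'.X j.1) j.2}
    {D' : SymAlg (M.X i'.1) i'.2 →ₗ[k] SymAlg (M'.X j.1) j.2} (h : Rep F i j D)
    (h' : Rep F i' j D') : ∃ (l : M.I × ℕ) (hi : i ≤ l) (hi' : i' ≤ l),
      D ∘ₗ (symTr M hi).toLinearMap = D' ∘ₗ (symTr M hi').toLinearMap := by
  obtain ⟨l, hi, hi', e⟩ := Represents.eq h h'
  exact ⟨l, hi, hi', congrArg ModuleCat.Hom.hom e⟩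

theorem Rep.comp {F : (toProMod k).obj (symPro M) ⟶ (toProMod k).obj (symPro M')}
    {G : (toProMod k).obj (symPro M') ⟶ (toProMod k).obj (symPro M'')}
    {i : M.I × ℕ} {j : M'.I × ℕ} {l : M''.I × ℕ}
    {D : SymAlg (M.X i.1) i.2 →ₗ[k] SymAlg (M'.X j.1) j.2}
    {E : SymAlg (M'.X j.1) j.2 →ₗ[k] SymAlg (M''.X l.1) l.2} (h : Rep F i j D) (h' : Rep G j l E) :
    Rep (F ≫ G) i l (E ∘ₗ D) := Represents.comp h h'

/-- Both sides are compared with a representative into a later stage at which the two functionals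
agree. This makes the transpose well defined. -/
theorem clsT_rep_eq {i i' : M.I × ℕ} {j j' : M'.I × ℕ}
    {D : SymAlg (M.X i.1) i.2 →ₗ[k] SymAlg (M'.X j.1) j.2}
    {D' : SymAlg (M.X i'.1) i'.2 →ₗ[k] SymAlg (M'.X j'.1) j'.2} (h : Rep F i j D)
    (h' : Rep F i' j' D') {g : SymAlg (M'.X j.1) j.2 →ₗ[k] A} {g' : SymAlg (M'.X j'.1) j'.2 →ₗ[k] A}
    (e : clsT M' j g = clsT M' j' g') : clsT M i (g ∘ₗ D) = clsT M i' (g' ∘ₗ D') := by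
  obtain ⟨l, h1, h2, -, e2⟩ := exists_of_clsT_eq e j
  obtain ⟨m, E, hE⟩ := exists_rep F l
  obtain ⟨n, n1, n2, e3⟩ := Rep.eq h (hE.post h1)
  obtain ⟨n', n1', n2', e3'⟩ := Rep.eq h' (hE.post h2)
  have key : ∀ {i : M.I × ℕ} {j : M'.I × ℕ} {D : SymAlg (M.X i.1) i.2 →ₗ[k] SymAlg (M'.X j.1) j.2}
      {n : M.I × ℕ} {n1 : i ≤ n} {n2 : m ≤ n} {h1 : j ≤ l} (g : SymAlg (M'.X j.1) j.2 →ₗ[k] A),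
      D ∘ₗ (symTr M n1).toLinearMap
        = ((symTr M' h1).toLinearMap ∘ₗ E) ∘ₗ (symTr M n2).toLinearMap →
      clsT M i (g ∘ₗ D) = clsT M m ((g ∘ₗ (symTr M' h1).toLinearMap) ∘ₗ E) := by
    intro i j D n n1 n2 h1 g e
    rw [← clsT_symTr n1, ← clsT_symTr n2, LinearMap.comp_assoc, e]
    rfl
  rw [key g e3, key g' e3', e2]

variable (F) in
/-- The value of the transpose of a pro-morphism of completed symmetric algebras. -/
def actFun (w : Wfun M') : Wfun M :=
  clsT M _ ((exists_clsT w).choose_spec.choose ∘ₗ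
    (exists_rep F (exists_clsT w).choose).choose_spec.choose)

theorem actFun_clsT {i : M.I × ℕ} {j : M'.I × ℕ}
    {D : SymAlg (M.X i.1) i.2 →ₗ[k] SymAlg (M'.X j.1) j.2} (h : Rep F i j D)
    (g : SymAlg (M'.X j.1) j.2 →ₗ[k] A) : actFun F (clsT M' j g) = clsT M i (g ∘ₗ D) :=
  clsT_rep_eq (exists_rep F _).choose_spec.choose_spec h
    (exists_clsT (clsT M' j g)).choose_spec.choose_spec

variable (F) in
/-- The transpose of a pro-morphism of completed symmetric algebras. -/
def act : Wfun M' →ₗ[k] Wfun M where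
  toFun := actFun F
  map_add' v w := by
    obtain ⟨i, g, rfl⟩ := exists_clsT v
    obtain ⟨j, h, rfl⟩ := exists_clsT w
    obtain ⟨c, h1, h2⟩ := (symPro M').directed.directed i j
    obtain ⟨m, E, hE⟩ := exists_rep F c
    rw [← clsT_symTr h1, ← clsT_symTr h2, ← map_add, actFun_clsT hE, actFun_clsT hE,
      actFun_clsT hE, ← map_add]
    rfl
  map_smul' c v := by
    obtain ⟨i, g, rfl⟩ := exists_clsT v
    obtain ⟨m, E, hE⟩ := exists_rep F i
    rw [← map_smul, actFun_clsT hE, actFun_clsT hE, RingHom.id_apply, ← map_smul]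
    rfl

theorem act_clsT {i : M.I × ℕ} {j : M'.I × ℕ}
    {D : SymAlg (M.X i.1) i.2 →ₗ[k] SymAlg (M'.X j.1) j.2} (h : Rep F i j D)
    (g : SymAlg (M'.X j.1) j.2 →ₗ[k] A) : act F (clsT M' j g) = clsT M i (g ∘ₗ D) :=
  actFun_clsT h g

theorem act_postW (θ : A →ₗ[k] A) (w : Wfun M') : act F (postW θ w) = postW θ (act F w) := by
  obtain ⟨i, g, rfl⟩ := exists_clsT w
  obtain ⟨m, E, hE⟩ := exists_rep F i
  rw [postW_clsT, act_clsT hE, act_clsT hE, postW_clsT]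
  rfl

end

theorem act_comp (F : (toProMod k).obj (symPro M) ⟶ (toProMod k).obj (symPro M'))
    (G : (toProMod k).obj (symPro M') ⟶ (toProMod k).obj (symPro M'')) (w : Wfun M'') :
    act (F ≫ G) w = act F (act G w) := by
  obtain ⟨l, g, rfl⟩ := exists_clsT w
  obtain ⟨j, E, hE⟩ := exists_rep G l
  obtain ⟨i, D, hD⟩ := exists_rep F j
  rw [act_clsT hE, act_clsT hD, act_clsT (hD.comp hE)]
  rfl

theorem act_proZero (w : Wfun M') :
    act (proZero ((toProMod k).obj (symPro M)) ((toProMod k).obj (symPro M'))) w = 0 := by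
  obtain ⟨l, g, rfl⟩ := exists_clsT w
  have h : Rep (proZero ((toProMod k).obj (symPro M)) ((toProMod k).obj (symPro M')))
    (Classical.arbitrary _) l 0 := represents_proZero _ _
  rw [act_clsT h, LinearMap.comp_zero, map_zero]

/-- The functional given by a word of contractions. -/
def HBasis.wordC {M : GMod A} (b : HBasis M) (u : List (Fin b.n)) : contFun M :=
  u.foldr (fun i g => cctr (b.ε i) g) (cproj M)

theorem HBasis.wordC_cons {M : GMod A} (b : HBasis M) (i : Fin b.n) (u : List (Fin b.n)) :
    b.wordC (i :: u) = cctr (b.ε i) (b.wordC u) := rfl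

theorem HBasis.wordC_val {M : GMod A} (b : HBasis M) (u : List (Fin b.n)) :
    (b.wordC u).1 = b.word u := by
  induction u with
  | nil => rfl
  | cons i u ih =>
    rw [HBasis.wordC_cons]
    change (b.wordC u).1 ∘ₗ ctr (b.ε i) = b.word u ∘ₗ ctr (b.ε i)
    rw [ih]

theorem HBasis.contAt_word {M : GMod A} (b : HBasis M) (u : List (Fin b.n)) :
    ContAt u.length (b.word u) := by
  induction u with
  | nil => exact contAt_proj
  | cons i u ih => exact ih.comp_ctr (b.ε i)

theorem exists_upper_bound {I : Type*} [Preorder I] [IsDirectedOrder I] [Nonempty I] {T : Type*} (s : Set T)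
    (hs : s.Finite) (f : T → I) (i₀ : I) : ∃ i, i₀ ≤ i ∧ ∀ t ∈ s, f t ≤ i := by
  induction s, hs using Set.Finite.induction_on with
  | empty => exact ⟨i₀, le_refl _, by simp⟩
  | @insert a s _ _ ih =>
    obtain ⟨i, h1, h2⟩ := ih
    obtain ⟨j, h3, h4⟩ := exists_ge_ge i (f a)
    refine ⟨j, h1.trans h3, fun t ht => ?_⟩
    rcases Set.mem_insert_iff.1 ht with rfl | ht
    · exact h4
    · exact (h2 t ht).trans h3

/-- Maps into a truncated symmetric algebra are detected by words of contractions. -/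
theorem exists_comp_symTr_eq {i i' : M.I × ℕ} {j : M'.I × ℕ} (b : HBasis (M'.X j.1))
    (D : SymAlg (M.X i.1) i.2 →ₗ[k] SymAlg (M'.X j.1) j.2)
    (D' : SymAlg (M.X i'.1) i'.2 →ₗ[k] SymAlg (M'.X j.1) j.2)
    (h : ∀ u : List (Fin b.n), u.length ≤ j.2 → ∀ g : SymAlg (M'.X j.1) j.2 →ₗ[k] A,
      g ∘ₗ (trc (M'.X j.1) j.2).toLinearMap = b.word u →
        clsT M i (g ∘ₗ D) = clsT M i' (g ∘ₗ D')) :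
    ∃ (l : M.I × ℕ) (hi : i ≤ l) (hi' : i' ≤ l),
      D ∘ₗ (symTr M hi).toLinearMap = D' ∘ₗ (symTr M hi').toLinearMap := by
  -- For each word a stage is chosen at which the two functionals agree; words longer than the
  -- truncation order impose nothing.
  have h1 : ∀ u : List (Fin b.n), ∃ (l : M.I × ℕ) (hi : i ≤ l) (hi' : i' ≤ l),
      u.length ≤ j.2 → ∃ g : SymAlg (M'.X j.1) j.2 →ₗ[k] A,
      g ∘ₗ (trc (M'.X j.1) j.2).toLinearMap = b.word u ∧
        (g ∘ₗ D) ∘ₗ (symTr M hi).toLinearMap = (g ∘ₗ D') ∘ₗ (symTr M hi').toLinearMap := by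
    intro u
    by_cases hu : u.length ≤ j.2
    · obtain ⟨g, hg⟩ := ((b.contAt_word u).mono hu).factor
      obtain ⟨l, hi, hi', -, e⟩ := exists_of_clsT_eq
        (h u hu g hg) i
      exact ⟨l, hi, hi', fun _ => ⟨g, hg, e⟩⟩
    · obtain ⟨l, hi, hi'⟩ := (symPro M).directed.directed i i'
      exact ⟨l, hi, hi', fun h => absurd h hu⟩
  choose f hf hf' hg using h1
  have : IsDirectedOrder (M.I × ℕ) := (symPro M).directed
  -- There are only finitely many words of length ≤ `j.2` in a finite basis, hence one stage that
  -- serves them all.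
  obtain ⟨l, -, hl⟩ := exists_upper_bound (I := M.I × ℕ) {u : List (Fin b.n) | u.length ≤ j.2}
    (List.finite_length_le _ _) f i
  have hnil := hl [] (by simp)
  refine ⟨l, (hf []).trans hnil, (hf' []).trans hnil, LinearMap.ext fun s => ?_⟩
  obtain ⟨t, ht⟩ := map_surjective (M := M'.X j.1) (N := ⊤) (N' := (j.2 : ℕ)) le_top
    ((D ∘ₗ (symTr M ((hf []).trans hnil)).toLinearMap) s
      - (D' ∘ₗ (symTr M ((hf' []).trans hnil)).toLinearMap) s)
  -- All these words vanish on the lift `t` of the difference, so `t` has weight > `j.2` by the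
  -- Taylor formula, and its truncation is zero.
  have ht' : trc (M'.X j.1) j.2 t = 0 := by
    refine (trc_eq_zero_iff _ _).2 ?_
    refine b.mem_weightGE_of_word _ _ fun u hu => ?_
    obtain ⟨g, hg1, hg2⟩ := hg u hu
    rw [← hg1]
    have e := DFunLike.congr_fun hg2 (symTr M (hl u hu) s)
    simp only [LinearMap.comp_apply, AlgHom.toLinearMap_apply, symTr_symTr] at e
    refine (congrArg g ht).trans ?_
    rw [map_sub, sub_eq_zero]
    exact e
  exact sub_eq_zero.1 (ht.symm.trans ht')

/-- Since the modules of the target system are finite free, contraction words applied to π detect a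
pro-morphism through its transpose. Uniqueness statements are used in this form. -/
theorem rep_hom_ext {F G : (toProMod k).obj (symPro M) ⟶ (toProMod k).obj (symPro M')}
    (hM' : IsProFinite M') (h : ∀ (α : M'.I) (b : HBasis (M'.X α)) (u : List (Fin b.n)),
      act F (cls M' α (b.wordC u)) = act G (cls M' α (b.wordC u))) : F = G := by
  refine Represents.hom_ext fun j => ?_
  obtain ⟨i, D, hD⟩ := exists_rep F j
  obtain ⟨i', D', hD'⟩ := exists_rep G j
  obtain ⟨b⟩ := (hM' j.1).nonempty_hbasis
  obtain ⟨l, hi, hi', e⟩ := exists_comp_symTr_eq b D D' (fun u _ g hg => by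
    rw [← act_clsT hD, ← act_clsT hD', clsT_of_eq (hg.trans (b.wordC_val u).symm), h])
  exact ⟨l, ModuleCat.ofHom (D ∘ₗ (symTr M hi).toLinearMap), hD.restrict hi, e ▸ hD'.restrict hi'⟩

end Truncated

/-! ### From adjacent exchanges to all permutations -/

section Permute

variable {Λ : Type*} {deg : Λ → ℤ} {G : Type*} [AddCommGroup G]

theorem swap_insert {F : List Λ → G}
    (h : ∀ v x y w, F (v ++ x :: y :: w) = sgn (deg x * deg y) • F (v ++ y :: x :: w))
    (v : List Λ) (x : Λ) (w : List Λ) :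
    F (v ++ x :: w) = sgn (deg x * wdeg deg v) • F (x :: (v ++ w)) := by
  induction v using List.reverseRecOn generalizing w with
  | nil => simp [sgn_zero]
  | append_singleton v y ih =>
    rw [List.append_assoc, List.singleton_append, h, ih, smul_smul, ← sgn_add, wdeg_append,
      wdeg_cons, wdeg_nil]
    congr 2
    · ring
    · simp

/-- The first letter is pulled to the front through the letters before it, and the remaining
permutation is treated by induction, in step with the recursion `koszul_insPerm` for the sign. -/
theorem swap_perm {n : ℕ} {F : List Λ → G}
    (h : ∀ v x y w, F (v ++ x :: y :: w) = sgn (deg x * deg y) • F (v ++ y :: x :: w))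
    (w : Fin n → Λ) (τ : Equiv.Perm (Fin n)) :
    F (List.ofFn fun i => w (τ i)) = koszul (fun i => deg (w i)) τ • F (List.ofFn w) := by
  induction n generalizing F with
  | zero => simp [koszul]
  | succ n ih =>
    obtain ⟨⟨a, τ⟩, rfl⟩ := insPerm_bijective.surjective τ
    obtain ⟨x, w, rfl⟩ : ∃ x v, w = Fin.cons x v := ⟨w 0, Fin.tail w, (Fin.cons_self_tail w).symm⟩
    rw [ofFn_insPerm, swap_insert h, List.take_append_drop,
      ih (F := fun l => F (x :: l)) (fun v y z w => h (x :: v) y z w), koszul_insPerm,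
      wdeg_take_ofFn, List.ofFn_cons, smul_smul]
    simp only [Fin.cons_zero, Fin.cons_succ, prod_sgn_ite]

end Permute

/-! ### Multilinear maps given on homogeneous arguments -/

section MultilinearExtension

variable {k : Type u} [Field k] {V : Type u} [AddCommGroup V] [Module k V]
  {gr : ℤ → Submodule k V} (h : DirectSum.IsInternal gr) {U : Type*} [AddCommGroup U] [Module k U]

/-- The multilinear map with given restrictions to the homogeneous parts. -/
def multiExt {l : ℕ} (f : ∀ p : Fin l → ℤ, MultilinearMap k (fun i => gr (p i)) U) :
    MultilinearMap k (fun _ : Fin l => V) U :=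
  (MultilinearMap.fromDirectSumEquiv (ι := Fin l) (κ := fun _ => ℤ) (M := fun _ j => gr j)
    (R := k) (M' := U) f).compLinearMap
    (fun _ => (LinearEquiv.ofBijective (DirectSum.coeLinearMap gr) h).symm.toLinearMap)

theorem multiExt_apply {l : ℕ} (f : ∀ p : Fin l → ℤ, MultilinearMap k (fun i => gr (p i)) U)
    (p : Fin l → ℤ) (m : ∀ i, gr (p i)) : multiExt h f (fun i => (m i).1) = f p m := by
  have h1 : ∀ i, (LinearEquiv.ofBijective (DirectSum.coeLinearMap gr) h).symm (m i).1
      = DirectSum.lof k ℤ (fun i => gr i) (p i) (m i) := by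
    intro i
    rw [LinearEquiv.symm_apply_eq]
    exact (DirectSum.coeLinearMap_lof gr (p i) (m i)).symm
  rw [multiExt, MultilinearMap.compLinearMap_apply]
  simp only [LinearEquiv.coe_coe, h1]
  exact MultilinearMap.fromDirectSumEquiv_lof (R := k) (ι := Fin l) (κ := fun _ => ℤ)
    (M := fun _ j => gr j) (M' := U) f p m

include h in
theorem multilinear_ext_hom {l : ℕ} {f g : MultilinearMap k (fun _ : Fin l => V) U}
    (hfg : ∀ (p : Fin l → ℤ) (m : Fin l → V), (∀ i, m i ∈ gr (p i)) → f m = g m) : f = g := by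
  -- The set `s` collects the slots whose entries need not be homogeneous; they are decomposed one
  -- after the other.
  have key : ∀ (s : Finset (Fin l)) (m : Fin l → V), (∀ i ∉ s, ∃ p, m i ∈ gr p) → f m = g m := by
    intro s
    induction s using Finset.induction_on with
    | empty =>
      intro m hm
      choose p hp using fun i => hm i (Finset.notMem_empty i)
      exact hfg p m hp
    | insert i s hi ih =>
      intro m hm
      have h2 : ∀ v : V, f (Function.update m i v) = g (Function.update m i v) := by
        intro v
        induction v using graded_induction h with
        | add x y hx hy => rw [f.map_update_add, g.map_update_add, hx, hy]
        | hom p v hv =>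
          refine ih _ fun j hj => ?_
          by_cases hji : j = i
          · subst hji; exact ⟨p, by simpa using hv⟩
          · rw [Function.update_of_ne hji]
            exact hm j (by simp [hji, hj])
      simpa using h2 (m i)
  exact MultilinearMap.ext fun m => key Finset.univ m (by simp)

end MultilinearExtension

/-! ### Brackets at the projection and their Leibniz rule -/

section Letters

open SHLieRinehart.SymAlg

variable {k : Type u} [Field k] {A : GAlg k} {V : GMod A}

/-- Homogeneous elements of a graded module, with their degree. -/
def Letter (V : GMod A) : Type u := Σ p : ℤ, V.gr p

/-- The homogeneous element `m` as a letter. -/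
def letter {p : ℤ} {m : V} (hm : m ∈ V.gr p) : Letter V := ⟨p, ⟨m, hm⟩⟩

/-- The degree of a letter. -/
def ldeg (x : Letter V) : ℤ := x.1

/-- The underlying element of a letter. -/
def Letter.val (x : Letter V) : V := x.2.1

theorem Letter.mem (x : Letter V) : x.val ∈ V.gr (ldeg x) := x.2.2

@[simp] theorem ldeg_letter {p : ℤ} {m : V} (hm : m ∈ V.gr p) : ldeg (letter hm) = p := rfl

@[simp] theorem letter_val {p : ℤ} {m : V} (hm : m ∈ V.gr p) : (letter hm).val = m := rfl

theorem letter_congr {x : Letter V} {v : V} (h : v = x.val) (hv : v ∈ V.gr (ldeg x)) :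
    letter hv = x := by
  subst h; rfl

variable [CharZero k] {M : ProObj (GMod A)} (J : Duality M V)

/-- The contraction with a letter. -/
def lctr (x : Letter V) : Wfun M →ₗ[k] Wfun M := ctrW J x.val

theorem lctr_letter {p : ℤ} {m : V} (hm : m ∈ V.gr p) : lctr J (letter hm) = ctrW J m := rfl

theorem gComm_lctr : GComm ldeg (lctr J) := fun x y s => ctrW_comm J x.mem y.mem s

/-- Left multiplication by an element. -/
abbrev lmulA (a : A) : A →ₗ[k] A := LinearMap.mulLeft k a

/-- Since π is multiplicative, π ι_{am} = a π ι_m. For a general k-linear functional in place of π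
this fails; for functionals π ι_v + θ π the defect is computed in `ctrW_smul_kap`. -/
theorem ctrW_smul_projW (a : A) (m : V) :
    ctrW J (a • m) (projW M) = postW (lmulA a) (ctrW J m (projW M)) := by
  induction a using graded_induction A.internal with
  | add a b ha hb =>
    have : lmulA (a + b) = lmulA a + lmulA b := by ext; simp [add_mul]
    rw [add_smul, map_add, LinearMap.add_apply, ha, hb, this, map_add, LinearMap.add_apply]
  | hom i a ha =>
    induction m using graded_induction V.internal with
    | add x y hx hy => simp only [smul_add, map_add, LinearMap.add_apply, hx, hy]
    | hom p m hm =>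
      obtain ⟨α, x, rfl⟩ := J.surj p m hm
      rw [← J.j_smul α i p a ha x (GMod.dualMul ha rfl x) (fun m => by simp), ctrW_j_proj,
        ctrW_j_proj, postW_cls]
      congr 1
      refine Subtype.ext (LinearMap.ext fun s => ?_)
      rw [cctr_apply, cpost_apply, cctr_apply, cproj_apply, cproj_apply]
      rw [ctr, contr_mul_left x (GMod.dualMul ha rfl x) ha (add_comm p i) (fun m => by simp), map_mul,
        proj_ofA]
      rfl

theorem postW_lmulA_kap (a : A) (v : V) (θ : A →ₗ[k] A) :
    postW (lmulA a) (kap J v θ) = kap J (a • v) (lmulA a ∘ₗ θ) := by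
  rw [kap, kap, map_add, ctrW_smul_projW, postW_postW]

/-- In π ι_v the scalar a is moved out by commuting the two contractions. In θ π it is
differentiated: θ(a π ι_m) = θ(a) π ι_m ± a θ π ι_m. The extra term θ(a) m becomes the anchor term
of the Leibniz rule. -/
theorem ctrW_smul_kap {i p e : ℤ} {a : A} (ha : a ∈ A.gr i) {m : V} (hm : m ∈ V.gr p) {v : V}
    (hv : v ∈ V.gr e) {θ : A →ₗ[k] A} (hθ : IsDerOver e (𝟙 A) θ) :
    ctrW J (a • m) (kap J v θ) = kap J (θ a • m) 0
      + sgn (e * i) • postW (lmulA a) (ctrW J m (kap J v θ)) := by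
  have h1 : ctrW J (a • m) (ctrW J v (projW M))
      = sgn (e * i) • postW (lmulA a) (ctrW J m (ctrW J v (projW M))) := by
    rw [ctrW_comm J (V.smul_mem ha hm) hv, ctrW_smul_projW, ctrW_postW, ctrW_comm J hv hm, map_zsmul,
      smul_smul, ← sgn_add]
    congr 1
    apply sgn_congr; exact ⟨p * e, by ring⟩
  have h2 : θ ∘ₗ lmulA a = lmulA (θ a) + sgn (e * i) • (lmulA a ∘ₗ θ) := by
    ext b; exact hθ.2 i a b ha
  rw [kap, map_add, h1, ctrW_postW, ctrW_smul_projW, postW_postW, h2, map_add, map_zsmul, kap,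
    ctrW_smul_projW, map_zero, LinearMap.zero_apply, add_zero, map_add, map_add, ctrW_postW,
    postW_postW, smul_add, LinearMap.add_apply, LinearMap.smul_apply]
  abel

/-- Contractions commute with postcomposition, so brackets with them preserve the property of
commuting with all endomorphisms of A. -/
theorem brL_postW {e : ℤ} {Q : Wfun M →ₗ[k] Wfun M}
    (hQ : ∀ θ s, Q (postW θ s) = postW θ (Q s)) (w : List (Letter V)) (θ : A →ₗ[k] A) (s : Wfun M) :
    brL ldeg (lctr J) (lctr J) e Q w (postW θ s) = postW θ (brL ldeg (lctr J) (lctr J) e Q w s) := by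
  induction w generalizing e Q with
  | nil => exact hQ θ s
  | cons x w ih =>
    rw [brL_cons]
    refine ih fun θ s => ?_
    simp only [brk_apply, lctr, hQ, ctrW_postW, map_sub, map_zsmul]

/-- The value of the iterated commutator of `Q` with the letters of `w` at the projection. -/
def brP (Q : Wfun M →ₗ[k] Wfun M) (w : List (Letter V)) : Wfun M :=
  brL ldeg (lctr J) (lctr J) 1 Q w (projW M)

theorem brP_swap (Q : Wfun M →ₗ[k] Wfun M) (v : List (Letter V)) (x y : Letter V)
    (w : List (Letter V)) :
    brP J Q (v ++ x :: y :: w) = sgn (ldeg x * ldeg y) • brP J Q (v ++ y :: x :: w) := by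
  rw [brP, brL_swap (gComm_lctr J) (gComm_lctr J)]; rfl

/-- The bracket with am has two terms. The term ι_{am}(kap v θ) contributes the defect θ(a) m of
`ctrW_smul_kap`; in the term where the operator is applied to π ι_{am}, the factor a comes out
because the operator commutes with postcomposition. -/
theorem brP_concat_smul {Q : Wfun M →ₗ[k] Wfun M} (hQ : ∀ θ s, Q (postW θ s) = postW θ (Q s))
    {w : List (Letter V)} {v : V} {θ : A →ₗ[k] A} (hv : v ∈ V.gr (1 + wdeg ldeg w))
    (hθ : IsDerOver (1 + wdeg ldeg w) (𝟙 A) θ) (h : brP J Q w = kap J v θ)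
    {i p : ℤ} {a : A} (ha : a ∈ A.gr i) {m : V} (hm : m ∈ V.gr p) :
    brP J Q (w ++ [letter (V.smul_mem ha hm)]) = kap J (θ a • m) 0
      + sgn (i * (1 + wdeg ldeg w)) • postW (lmulA a) (brP J Q (w ++ [letter hm])) := by
  have h' : brL ldeg (lctr J) (lctr J) 1 Q w (projW M) = kap J v θ := h
  rw [brP, brP, brL_concat, brL_concat, brk_apply, brk_apply, h', lctr_letter, lctr_letter,
    ctrW_smul_kap J ha hm hv hθ, ctrW_smul_projW, brL_postW J hQ, ldeg_letter, ldeg_letter, map_sub,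
    map_zsmul, smul_sub, smul_smul, ← sgn_add, mul_comm i, add_sub_assoc]
  congr 4
  ring

end Letters

/-! ### Derivations over the projection -/

section DerivationsIntoBase

open SHLieRinehart.SymAlg

variable {k : Type u} [Field k] [CharZero k] {A : GAlg k} {M : GMod A}

/-- The restriction to `M` of a derivation of the symmetric algebra over the projection. -/
def derDual {e : ℤ} {E : SymAlg M ⊤ →ₗ[k] A} (h : IsDerOver e (Sym.proj M ⊤) E) : M.dual e :=
  ⟨E ∘ₗ ofM M ⊤, fun i m hm => h.1 i _ (ofM_mem hm), fun i a m ha => by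
    have h1 := h.2 i (ofA M ⊤ a) (ofM M ⊤ m) (ofA_mem ha)
    have h2 : (Sym.proj M ⊤).toAlgHom (ofM M ⊤ m) = 0 := proj_ofM m
    have h3 : (Sym.proj M ⊤).toAlgHom (ofA M ⊤ a) = a := proj_ofA a
    rw [h2, h3, mul_zero, zero_add] at h1
    rw [LinearMap.comp_apply, ofM_smul]
    exact h1⟩

theorem isDerOver_comp_ofA {e : ℤ} {E : SymAlg M ⊤ →ₗ[k] A} (h : IsDerOver e (Sym.proj M ⊤) E) :
    IsDerOver e (𝟙 A) (E ∘ₗ (ofA M ⊤).toLinearMap) :=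
  ⟨fun i a ha => h.1 i _ (ofA_mem ha), fun i a b ha => by
    have h1 := h.2 i (ofA M ⊤ a) (ofA M ⊤ b) (ofA_mem ha)
    have h3 : ∀ a, (Sym.proj M ⊤).toAlgHom (ofA M ⊤ a) = a := proj_ofA
    rw [h3, h3] at h1
    rw [LinearMap.comp_apply, AlgHom.toLinearMap_apply, map_mul]
    exact h1⟩

/-- A derivation over π is determined by its restrictions to A and to M, and the restriction to M
lies in the dual because π kills M. -/
theorem eq_of_isDerOver_proj {e : ℤ} {E : SymAlg M ⊤ →ₗ[k] A}
    (h : IsDerOver e (Sym.proj M ⊤) E) : E = (proj M ⊤).toLinearMap ∘ₗ ctr (derDual h)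
      + (E ∘ₗ (ofA M ⊤).toLinearMap) ∘ₗ (proj M ⊤).toLinearMap := by
  have h1 := (isDerOver_ctr (derDual h)).comp_left (Sym.proj M ⊤)
  have h2 := (isDerOver_comp_ofA h).comp_right (Sym.proj M ⊤)
  rw [Category.id_comp] at h1
  rw [Category.comp_id] at h2
  refine h.ext_sym (h1.add h2) (fun a => ?_) (fun m => ?_)
  · change E (ofA M ⊤ a) = proj M ⊤ (ctr (derDual h) (ofA M ⊤ a)) + E (ofA M ⊤ (proj M ⊤ (ofA M ⊤ a)))
    rw [contr_ofA, map_zero, zero_add, proj_ofA]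
  · change E (ofM M ⊤ m) = proj M ⊤ (ctr (derDual h) (ofM M ⊤ m)) + E (ofA M ⊤ (proj M ⊤ (ofM M ⊤ m)))
    rw [contr_ofM, proj_ofM, map_zero, map_zero, add_zero, proj_ofA]
    rfl

theorem isDerOver_iteratedCommutator {M' : GMod A} (f : M ⟶ M') (l : ℕ) (e : ℤ) (p : Fin l → ℤ)
    (x : ∀ i, M'.dual (p i)) (D : SymAlg M ⊤ →ₗ[k] SymAlg M' (l : ℕ))
    (hD : IsDerOver e (Sym.map f (N := ⊤) (N' := (l : ℕ)) le_top) D) :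
    IsDerOver (e + ∑ i, p i) (Sym.map f (N := ⊤) (N' := (0 : ℕ)) le_top)
      (iteratedCommutator f l e p x D) := by
  induction l generalizing e with
  | zero => simpa [iteratedCommutator] using hD
  | succ l ih =>
    have hl : ((l : ℕ) : ℕ∞) + 1 ≤ ((l + 1 : ℕ) : ℕ∞) := by norm_cast
    have hl' : ((l : ℕ) : ℕ∞) ≤ ((l + 1 : ℕ) : ℕ∞) := by exact_mod_cast Nat.le_succ l
    have h := hD.commutator (isDerOver_ctr (GMod.dualMap f (p 0) (x 0))) (isDerOver_contr (x 0) hl)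
      (fun s => by
        change contr (x 0) hl (map f le_top s) = map (𝟙 M') hl' (map f le_top _)
        rw [contr_map (x 0) f le_top hl le_top le_top, map_map, Category.comp_id])
    rw [Sym.map_comp, Category.comp_id] at h
    have := ih _ (fun i => p i.succ) (fun i => x i.succ) _ h
    rw [Fin.sum_univ_succ, ← add_assoc]
    exact this

end DerivationsIntoBase

/-! ### Iterated commutators and brackets of the transpose -/

section Link

open SHLieRinehart.SymAlg

variable {k : Type u} [Field k] [CharZero k] {A : GAlg k} {M : ProObj (GMod A)} {V : GMod A}
  (J : Duality M V)

/-- The word of letters given by elements of a dual. -/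
def jword {α : M.I} {l : ℕ} (p : Fin l → ℤ) (x : ∀ i, (M.X α).dual (p i)) : List (Letter V) :=
  List.ofFn fun i => letter (J.j_mem α (p i) (x i))

theorem wdeg_jword {α : M.I} {l : ℕ} (p : Fin l → ℤ) (x : ∀ i, (M.X α).dual (p i)) :
    wdeg ldeg (jword J p x) = ∑ i, p i := by
  simp [wdeg, jword, List.sum_ofFn]

theorem exists_lift_word {l : ℕ} (w : Fin l → Letter V) (α₀ : M.I) :
    ∃ (α : M.I) (x : ∀ i, (M.X α).dual (ldeg (w i))), α₀ ≤ α ∧ ∀ i, J.j α _ (x i) = (w i).val := by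
  choose β y hy using fun i => J.surj _ _ (w i).mem
  obtain ⟨α, h0, h⟩ := exists_upper_bound (Set.univ : Set (Fin l)) Set.finite_univ β α₀
  exact ⟨α, fun i => GMod.dualMap (M.map (h i trivial)) _ (y i), h0, fun i =>
    (J.compat (h i trivial) _ (y i)).trans (hy i)⟩

theorem exists_jword (w : List (Letter V)) (α₀ : M.I) : ∃ (α : M.I) (l : ℕ) (p : Fin l → ℤ)
    (x : ∀ i, (M.X α).dual (p i)), α₀ ≤ α ∧ jword J p x = w := by
  obtain ⟨α, x, h0, hx⟩ := exists_lift_word J w.get α₀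
  refine ⟨α, w.length, _, x, h0, ?_⟩
  rw [jword]
  conv_rhs => rw [← List.ofFn_get w]
  congr 1
  funext i
  exact letter_congr (hx i) _

/-- `Q` extends the transpose of `D`. -/
def RelT (Q : Wfun M →ₗ[k] Wfun M) {β α : M.I} {l : ℕ}
    (D : SymAlg (M.X β) ⊤ →ₗ[k] SymAlg (M.X α) l) : Prop :=
  ∃ n, ContAt n D ∧ ∀ (g : SymAlg (M.X α) l →ₗ[k] A) (G : contFun (M.X β)), G.1 = g ∘ₗ D →
    Q (clsT M (α, l) g) = cls M β G

theorem clsT_proj (i : M.I × ℕ) : clsT M i (proj (M.X i.1) i.2).toLinearMap = projW M := by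
  rw [← cls_cproj i.1]
  exact clsT_of_eq (LinearMap.ext fun s => proj_map (𝟙 (M.X i.1)) _ s)

theorem Rep.relT {F : (toProMod k).obj (symPro M) ⟶ (toProMod k).obj (symPro M)} {β α : M.I}
    {n l : ℕ} {D : SymAlg (M.X β) n →ₗ[k] SymAlg (M.X α) l} (h : Rep F (β, n) (α, l) D) :
    RelT (act F) (D ∘ₗ (trc (M.X β) n).toLinearMap) := by
  refine ⟨n, contAt_trc D, fun g G hG => ?_⟩
  rw [act_clsT h]
  exact clsT_of_eq hG.symm

/-- Transposition reverses composition, so D ι_x - ± ι_x D becomes ι_x Q - ± Q ι_x. A contraction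
loses one weight, hence the truncation of the target falls from `l + 1` to `l`. -/
theorem RelT.brk {Q : Wfun M →ₗ[k] Wfun M} {β α : M.I} (h : α ≤ β) {l : ℕ}
    {D : SymAlg (M.X β) ⊤ →ₗ[k] SymAlg (M.X α) (l + 1 : ℕ)} (hD : RelT Q D) (e p : ℤ)
    (x : (M.X α).dual p) (h1 : ((l : ℕ) : ℕ∞) ≤ ((l + 1 : ℕ) : ℕ∞))
    (h2 : ((l : ℕ) : ℕ∞) + 1 ≤ ((l + 1 : ℕ) : ℕ∞)) :
    RelT (brk e p (ctrW J (J.j α p x)) (ctrW J (J.j α p x)) Q)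
      ((SymAlg.map (𝟙 _) h1).toLinearMap ∘ₗ D ∘ₗ contr (GMod.dualMap (M.map h) p x) le_top
        - sgn (e * p) • (contr x h2 ∘ₗ D)) := by
  obtain ⟨n, hn, hD⟩ := hD
  have c1 : ContAt (n + 1) ((SymAlg.map (𝟙 _) h1).toLinearMap ∘ₗ D
      ∘ₗ contr (GMod.dualMap (M.map h) p x) le_top) := by
    intro s hs
    have := hn.comp_ctr (GMod.dualMap (M.map h) p x) s hs
    rw [LinearMap.comp_apply, this, map_zero]
  have c2 : ContAt (n + 1) (sgn (e * p) • (contr x h2 ∘ₗ D)) := by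
    intro s hs
    rw [LinearMap.smul_apply, LinearMap.comp_apply, hn.mono (Nat.le_succ n) s hs, map_zero, smul_zero]
  refine ⟨n + 1, fun s hs => by rw [LinearMap.sub_apply, c1 s hs, c2 s hs, sub_zero],
    fun g G hG => ?_⟩
  have e1 : clsT M (α, l) g = clsT M (α, l + 1) (g ∘ₗ (SymAlg.map (𝟙 _) h1).toLinearMap) := by
    refine clsT_of_eq (LinearMap.ext fun s => congrArg g ?_)
    change trc _ _ s = map (𝟙 _) h1 (trc _ _ s)
    rw [trc, trc, map_map, Category.comp_id]
  have e2 : ctrW J (J.j α p x) (clsT M (α, l) g) = clsT M (α, l + 1) (g ∘ₗ contr x h2) := by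
    rw [clsT_of_eq (i := (α, l)) (g' := ⟨g ∘ₗ (trc (M.X α) l).toLinearMap, l, contAt_trc g⟩) rfl,
      ctrW_j_self]
    refine (clsT_of_eq (i := (α, l + 1)) (g := g ∘ₗ contr x h2)
      (LinearMap.ext fun s => congrArg g ?_)).symm
    change contr x h2 (trc _ _ s) = trc _ _ (ctr x s)
    rw [trc, trc, contr_map x (𝟙 _) le_top h2 le_top le_top, GMod.dualMap_id]
  have a1 : ∃ n, ContAt n ((g ∘ₗ (SymAlg.map (𝟙 _) h1).toLinearMap) ∘ₗ D) :=
    ⟨n, fun s hs => by rw [LinearMap.comp_apply, hn s hs, map_zero]⟩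
  have a2 : ∃ n, ContAt n ((g ∘ₗ contr x h2) ∘ₗ D) :=
    ⟨n, fun s hs => by rw [LinearMap.comp_apply, hn s hs, map_zero]⟩
  rw [brk_apply, e2, e1, hD _ ⟨_, a1⟩ rfl, hD _ ⟨_, a2⟩ rfl, ← J.compat h, ctrW_j_self, ← map_zsmul,
    ← map_sub]
  congr 1
  refine Subtype.ext (LinearMap.ext fun s => ?_)
  rw [hG]
  simp only [LinearMap.comp_apply, LinearMap.sub_apply, LinearMap.smul_apply, map_sub, map_zsmul]
  rfl

theorem RelT.iteratedCommutator {β α : M.I} (h : α ≤ β) {l : ℕ} (p : Fin l → ℤ)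
    (x : ∀ i, (M.X α).dual (p i)) {Q : Wfun M →ₗ[k] Wfun M}
    {D : SymAlg (M.X β) ⊤ →ₗ[k] SymAlg (M.X α) (l : ℕ)} (hD : RelT Q D) (e : ℤ) :
    RelT (brL ldeg (lctr J) (lctr J) e Q (jword J p x))
      (iteratedCommutator (M.map h) l e p x D) := by
  induction l generalizing Q e with
  | zero =>
    rw [jword, List.ofFn_zero, brL_nil]
    exact hD
  | succ l ih =>
    have h1 := RelT.brk J h hD e (p 0) (x 0) (by exact_mod_cast Nat.le_succ l) (by norm_cast)
    have h2 := ih (fun i => p i.succ) (fun i => x i.succ) h1 (e + p 0)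
    rw [jword, List.ofFn_succ, brL_cons]
    exact h2

theorem RelT.projW {Q : Wfun M →ₗ[k] Wfun M} {β α : M.I} {l : ℕ}
    {D : SymAlg (M.X β) ⊤ →ₗ[k] SymAlg (M.X α) l} (h : RelT Q D) :
    ∃ hc, Q (projW M) = cls M β ⟨(proj (M.X α) l).toLinearMap ∘ₗ D, hc⟩ := by
  obtain ⟨n, hn, hD⟩ := h
  refine ⟨⟨n, fun s hs => by rw [LinearMap.comp_apply, hn s hs, map_zero]⟩, ?_⟩
  rw [← clsT_proj (α, l)]
  exact hD _ _ rfl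

/-- The bracket of a represented operator at the projection. -/
theorem brP_jword {F : (toProMod k).obj (symPro M) ⟶ (toProMod k).obj (symPro M)} {β α : M.I}
    (h : α ≤ β) {n l : ℕ} {D : SymAlg (M.X β) n →ₗ[k] SymAlg (M.X α) l}
    (hF : Rep F (β, n) (α, l) D) (p : Fin l → ℤ) (x : ∀ i, (M.X α).dual (p i)) :
    ∃ hc, brP J (act F) (jword J p x) = cls M β ⟨(proj (M.X α) (0 : ℕ)).toLinearMap ∘ₗ
      iteratedCommutator (M.map h) l 1 p x (D ∘ₗ (trc (M.X β) n).toLinearMap), hc⟩ :=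
  (RelT.iteratedCommutator J h p x hF.relT 1).projW

theorem cls_eq_kap {β : M.I} {e : ℤ} {E : SymAlg (M.X β) ⊤ →ₗ[k] A}
    (h : IsDerOver e (Sym.proj (M.X β) ⊤) E) (hc : E ∈ contFun (M.X β)) :
    cls M β ⟨E, hc⟩ = kap J (J.j β e (derDual h)) (E ∘ₗ (ofA (M.X β) ⊤).toLinearMap) := by
  rw [kap, ctrW_j_proj, ← cls_cproj β, postW_cls, ← map_add]
  exact congrArg (cls M β) (Subtype.ext (eq_of_isDerOver_proj h))

/-- A derivation of the completed symmetric algebra has derivations as brackets. -/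
theorem brP_jword_of_derivation
    {F : (toProMod k).obj (symPro M) ⟶ (toProMod k).obj (symPro M)} {β α : M.I}
    (h : α ≤ β) {n l : ℕ} (hn : l ≤ n) {D : SymAlg (M.X β) n →ₗ[k] SymAlg (M.X α) l}
    (hF : Rep F (β, n) (α, l) D)
    (hD : IsDerivationOver (Sym.map (M.map h) (N := (n : ℕ)) (N' := (l : ℕ)) (by exact_mod_cast hn)) D)
    (p : Fin l → ℤ) (x : ∀ i, (M.X α).dual (p i)) :
    ∃ hE : IsDerOver (1 + ∑ i, p i) (Sym.proj (M.X β) ⊤) ((proj (M.X α) (0 : ℕ)).toLinearMap ∘ₗ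
      iteratedCommutator (M.map h) l 1 p x (D ∘ₗ (trc (M.X β) n).toLinearMap)),
    brP J (act F) (jword J p x) = kap J (J.j β _ (derDual hE))
      (((proj (M.X α) (0 : ℕ)).toLinearMap ∘ₗ iteratedCommutator (M.map h) l 1 p x
        (D ∘ₗ (trc (M.X β) n).toLinearMap)) ∘ₗ (ofA (M.X β) ⊤).toLinearMap) := by
  have h1 := (isDerivationOver_iff.1 hD).comp_right (Sym.map (𝟙 (M.X β)) (N := ⊤) (N' := (n : ℕ)) le_top)
  rw [Sym.map_comp, Category.id_comp] at h1
  have h2 := (isDerOver_iteratedCommutator (M.map h) l 1 p x _ h1).comp_left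
    (Sym.proj (M.X α) (0 : ℕ))
  rw [Sym.map_proj] at h2
  obtain ⟨hc, e⟩ := brP_jword J h hF p x
  exact ⟨h2, e.trans (cls_eq_kap J h2 hc)⟩

theorem IsProDerivation.exists_rep {F : (toProMod k).obj (symPro M) ⟶ (toProMod k).obj (symPro M)}
    (hF : IsProDerivation (symPro M) F) (α : M.I) (l : ℕ) :
    ∃ (β : M.I) (h : α ≤ β) (n : ℕ) (hn : l ≤ n) (D : SymAlg (M.X β) n →ₗ[k] SymAlg (M.X α) l),
      Rep F (β, n) (α, l) D ∧
      IsDerivationOver (Sym.map (M.map h) (N := (n : ℕ)) (N' := (l : ℕ)) (by exact_mod_cast hn)) D := by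
  obtain ⟨φ, hφ, D, h1, h2⟩ := hF
  exact ⟨(φ (α, l)).1, (Prod.le_def.1 (hφ (α, l))).1, (φ (α, l)).2, (Prod.le_def.1 (hφ (α, l))).2,
    D (α, l), h2 (α, l), h1 (α, l)⟩

/-- Iterated commutators of a derivation are derivations over the transition maps. Followed by the
projection they are derivations into A over π, which all have the form `kap`. -/
theorem exists_brP_eq_kap {F : (toProMod k).obj (symPro M) ⟶ (toProMod k).obj (symPro M)}
    (hF : IsProDerivation (symPro M) F) (w : List (Letter V)) :
    ∃ v θ, v ∈ V.gr (1 + wdeg ldeg w) ∧ IsDerOver (1 + wdeg ldeg w) (𝟙 A) θ ∧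
      brP J (act F) w = kap J v θ := by
  obtain ⟨α, l, p, x, -, rfl⟩ := exists_jword J w (Classical.arbitrary _)
  obtain ⟨β, h, n, hn, D, hD, hder⟩ := hF.exists_rep α l
  obtain ⟨hE, e⟩ := brP_jword_of_derivation J h hn hD hder p x
  rw [wdeg_jword]
  exact ⟨_, _, J.j_mem _ _ _, isDerOver_comp_ofA hE, e⟩

end Link

/-! ### The multiderivation given by the brackets of an operator -/

section BrLinear

variable {k : Type u} [Field k] {Λ : Type*} {deg : Λ → ℤ}
  {W₁ W₂ : Type*} [AddCommGroup W₁] [Module k W₁] [AddCommGroup W₂] [Module k W₂]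
  {ι₁ : Λ → W₁ →ₗ[k] W₁} {ι₂ : Λ → W₂ →ₗ[k] W₂}

theorem brk_smul (e p : ℤ) (I₁ : W₁ →ₗ[k] W₁) (I₂ : W₂ →ₗ[k] W₂) (c : k) (Q : W₁ →ₗ[k] W₂) :
    brk e p I₁ I₂ (c • Q) = c • brk e p I₁ I₂ Q := by
  ext s
  simp only [brk_apply, LinearMap.smul_apply, map_smul, smul_sub, smul_comm c]

theorem brL_smul (e : ℤ) (c : k) (Q : W₁ →ₗ[k] W₂) (w : List Λ) :
    brL deg ι₁ ι₂ e (c • Q) w = c • brL deg ι₁ ι₂ e Q w := by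
  induction w generalizing e Q with
  | nil => rfl
  | cons x w ih => simp only [brL_cons, brk_smul, ih]

end BrLinear

section Letters

variable {k : Type u} [Field k] [CharZero k] {A : GAlg k} {V : GMod A} {M : ProObj (GMod A)}
  (J : Duality M V)

theorem brP_append_add (Q : Wfun M →ₗ[k] Wfun M) (u w : List (Letter V)) {p : ℤ} {m m' : V}
    (hm : m ∈ V.gr p) (hm' : m' ∈ V.gr p) :
    brP J Q (u ++ letter (Submodule.add_mem _ hm hm') :: w)
      = brP J Q (u ++ letter hm :: w) + brP J Q (u ++ letter hm' :: w) := by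
  simp only [brP, brL_append, brL_cons, lctr_letter, ldeg_letter]
  rw [← LinearMap.add_apply, ← brL_add]
  congr 2
  ext s
  simp only [brk_apply, map_add, LinearMap.add_apply, smul_add]
  abel

theorem brP_append_smul (Q : Wfun M →ₗ[k] Wfun M) (u w : List (Letter V)) {p : ℤ} {m : V}
    (hm : m ∈ V.gr p) (c : k) :
    brP J Q (u ++ letter (Submodule.smul_mem _ c hm) :: w) = c • brP J Q (u ++ letter hm :: w) := by
  simp only [brP, brL_append, brL_cons, lctr_letter, ldeg_letter]
  rw [← LinearMap.smul_apply, ← brL_smul]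
  congr 2
  ext s
  simp only [brk_apply, map_smul, LinearMap.smul_apply, smul_sub, smul_comm c]

theorem ofFn_update {Λ : Type*} {l : ℕ} (w : Fin l → Λ) (i : Fin l) (x : Λ) :
    List.ofFn (Function.update w i x)
      = (List.ofFn w).take i ++ x :: (List.ofFn w).drop (i + 1) := by
  have h := List.set_eq_take_append_cons_drop (l := List.ofFn w) (i := i) (a := x)
  rw [if_pos (by simp)] at h
  rw [← h]
  refine List.ext_getElem (by simp) fun j h1 h2 => ?_
  rw [List.getElem_ofFn, List.getElem_set, Function.update_apply]
  simp only [Fin.ext_iff, List.getElem_ofFn, eq_comm]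

/-- The iterated bracket as a multilinear map. -/
def brMulti (Q : Wfun M →ₗ[k] Wfun M) {l : ℕ} (p : Fin l → ℤ) :
    MultilinearMap k (fun i => V.gr (p i)) (Wfun M) :=
  MultilinearMap.mk' (fun m => brP J Q (List.ofFn fun i => letter (m i).2))
    (fun m i x y => by
      have h : ∀ x, (fun j => letter (Function.update m i x j).2 : Fin l → Letter V)
          = Function.update (fun j => letter (m j).2) i (letter x.2) := by
        intro x
        funext j
        exact Function.apply_update (fun j (y : V.gr (p j)) => letter y.2) m i x j
      rw [h, h, h, ofFn_update, ofFn_update, ofFn_update]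
      exact brP_append_add J Q _ _ x.2 y.2)
    (fun m i c x => by
      have h : ∀ x, (fun j => letter (Function.update m i x j).2 : Fin l → Letter V)
          = Function.update (fun j => letter (m j).2) i (letter x.2) := by
        intro x
        funext j
        exact Function.apply_update (fun j (y : V.gr (p j)) => letter y.2) m i x j
      rw [h, h, ofFn_update, ofFn_update]
      exact brP_append_smul J Q _ _ x.2 c)

theorem multiExt_brMulti (Q : Wfun M →ₗ[k] Wfun M) {l : ℕ} (w : Fin l → Letter V) :
    multiExt V.internal (fun p => brMulti J Q p) (fun i => (w i).val) = brP J Q (List.ofFn w) :=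
  multiExt_apply V.internal (fun p => brMulti J Q p) (fun i => ldeg (w i)) (fun i => (w i).2)

/-- Elements of the form `π ι_v + θ π`. -/
def kapₗ : (V × (A →ₗ[k] A)) →ₗ[k] Wfun M where
  toFun x := kap J x.1 x.2
  map_add' x y := kap_add J _ _ _ _
  map_smul' c x := kap_smul J c _ _

/-- The left inverse comes from a choice of complement and is linear over k only; it is evaluated
only at vectors in the image of `kap`. -/
theorem exists_kap_inverse : ∃ f : Wfun M →ₗ[k] (V × (A →ₗ[k] A)), ∀ v θ, f (kap J v θ) = (v, θ) := by
  obtain ⟨f, hf⟩ := (kapₗ J).exists_leftInverse_of_injective (by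
    rw [LinearMap.ker_eq_bot]
    intro x y h
    obtain ⟨h1, h2⟩ := kap_injective J h
    exact Prod.ext h1 h2)
  exact ⟨f, fun v θ => DFunLike.congr_fun hf (v, θ)⟩

/-- A left inverse of `(v, θ) ↦ π ι_v + θ π`. -/
def kinv : Wfun M →ₗ[k] (V × (A →ₗ[k] A)) := (exists_kap_inverse J).choose

theorem kinv_kap (v : V) (θ : A →ₗ[k] A) : kinv J (kap J v θ) = (v, θ) :=
  (exists_kap_inverse J).choose_spec v θ

/-- The iterated brackets of `Q` at the projection are derivations. -/
def BracketsDer (Q : Wfun M →ₗ[k] Wfun M) : Prop :=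
  (∀ θ s, Q (postW θ s) = postW θ (Q s)) ∧
  ∀ w : List (Letter V), ∃ v θ, v ∈ V.gr (1 + wdeg ldeg w) ∧
    IsDerOver (1 + wdeg ldeg w) (𝟙 A) θ ∧ brP J Q w = kap J v θ

namespace BracketsDer

variable {J} {Q : Wfun M →ₗ[k] Wfun M} (hQ : BracketsDer J Q)
include hQ

theorem brP_eq (w : List (Letter V)) :
    brP J Q w = kap J (kinv J (brP J Q w)).1 (kinv J (brP J Q w)).2 := by
  obtain ⟨v, θ, -, -, h⟩ := hQ.2 w
  rw [h, kinv_kap]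

theorem fst_mem (w : List (Letter V)) : (kinv J (brP J Q w)).1 ∈ V.gr (1 + wdeg ldeg w) := by
  obtain ⟨v, θ, hv, -, h⟩ := hQ.2 w
  rwa [h, kinv_kap]

theorem snd_der (w : List (Letter V)) :
    IsDerOver (1 + wdeg ldeg w) (𝟙 A) (kinv J (brP J Q w)).2 := by
  obtain ⟨v, θ, -, hθ, h⟩ := hQ.2 w
  rwa [h, kinv_kap]

theorem concat_smul (w : List (Letter V)) {i p : ℤ} {a : A} (ha : a ∈ A.gr i) {m : V}
    (hm : m ∈ V.gr p) :
    kinv J (brP J Q (w ++ [letter (V.smul_mem ha hm)]))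
      = ((kinv J (brP J Q w)).2 a • m + sgn (i * (1 + wdeg ldeg w)) • (a •
          (kinv J (brP J Q (w ++ [letter hm]))).1),
        sgn (i * (1 + wdeg ldeg w)) • (lmulA a ∘ₗ (kinv J (brP J Q (w ++ [letter hm]))).2)) := by
  rw [brP_concat_smul J hQ.1 (hQ.fst_mem w) (hQ.snd_der w) (hQ.brP_eq w) ha hm,
    hQ.brP_eq (w ++ [letter hm]), postW_lmulA_kap, ← kap_zsmul, ← kap_add, kinv_kap, kinv_kap, zero_add]

/-- Graded symmetry moves the letter to the end of the word, where `concat_smul` applies, and back.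
The extra term θ(a) m has no anchor component. -/
theorem snd_smul (u w : List (Letter V)) {i p : ℤ} {a : A} (ha : a ∈ A.gr i) {m : V}
    (hm : m ∈ V.gr p) :
    (kinv J (brP J Q (u ++ letter (V.smul_mem ha hm) :: w))).2
      = sgn (i * (1 + wdeg ldeg u)) • (lmulA a ∘ₗ (kinv J (brP J Q (u ++ letter hm :: w))).2) := by
  have h : ∀ x : Letter V, brP J Q (u ++ x :: w)
      = sgn (ldeg x * wdeg ldeg w) • brP J Q ((u ++ w) ++ [x]) := by
    intro x
    rw [swap_insert (brP_swap J Q), swap_insert (brP_swap J Q) (u ++ w), List.append_nil, smul_smul,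
      ← sgn_add, wdeg_append]
    congr 1
    apply sgn_congr
    exact ⟨-(ldeg x * wdeg ldeg w), by ring⟩
  rw [h, h, map_zsmul, map_zsmul, hQ.concat_smul (u ++ w) ha hm, Prod.smul_snd, Prod.smul_snd, smul_smul, ← sgn_add,
    ldeg_letter, ldeg_letter, LinearMap.comp_smul, smul_smul, ← sgn_add, wdeg_append]
  congr 1
  apply sgn_congr
  exact ⟨i * wdeg ldeg w, by ring⟩

/-- The multiderivation given by iterated brackets. -/
def multiDer : MultiDer V :=
  have key : ∀ {l : ℕ} {d : Fin l → ℤ} {m : Fin l → V} (hm : ∀ i, m i ∈ V.gr (d i)),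
      multiExt V.internal (fun p => brMulti J Q p) m
        = brP J Q (List.ofFn fun i => letter (hm i)) :=
    fun hm => multiExt_brMulti J Q (fun i => letter (hm i))
  have hdeg : ∀ {l : ℕ} {d : Fin l → ℤ} {m : Fin l → V} (hm : ∀ i, m i ∈ V.gr (d i)),
      wdeg ldeg (List.ofFn fun i => letter (hm i)) = ∑ i, d i := fun hm => by
    simp [wdeg, List.sum_ofFn]
  have symm : ∀ {l : ℕ} {d : Fin l → ℤ} {m : Fin l → V} (hm : ∀ i, m i ∈ V.gr (d i))
      (τ : Equiv.Perm (Fin l)), multiExt V.internal (fun p => brMulti J Q p) (fun i => m (τ i))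
        = koszul d τ • multiExt V.internal (fun p => brMulti J Q p) m := fun hm τ => by
    rw [key hm, key (fun i => hm (τ i))]
    exact swap_perm (brP_swap J Q) (fun i => letter (hm i)) τ
  { X := fun l => ((LinearMap.fst k V (A →ₗ[k] A)) ∘ₗ kinv J).compMultilinearMap
      (multiExt V.internal (fun p => brMulti J Q p))
    σ := fun l => ((LinearMap.snd k V (A →ₗ[k] A)) ∘ₗ kinv J).compMultilinearMap
      (multiExt V.internal (fun p => brMulti J Q p))
    X_mem := fun l d m hm => by
      simp only [LinearMap.compMultilinearMap_apply, LinearMap.comp_apply, key hm]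
      rw [← hdeg hm]
      exact hQ.fst_mem _
    X_symm := fun l d m hm τ => by
      simp only [LinearMap.compMultilinearMap_apply, symm hm, map_zsmul]
    σ_mem := fun l d m hm j a ha => by
      simp only [LinearMap.compMultilinearMap_apply, LinearMap.comp_apply, key hm]
      rw [← hdeg hm]
      exact (hQ.snd_der _).1 j a ha
    σ_der := fun l d m hm j a b ha => by
      simp only [LinearMap.compMultilinearMap_apply, LinearMap.comp_apply, key hm]
      rw [← hdeg hm]
      exact (hQ.snd_der _).2 j a b ha
    σ_symm := fun l d m hm τ => by
      simp only [LinearMap.compMultilinearMap_apply, symm hm, map_zsmul]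
    σ_smul := fun l d m hm j a ha i b => by
      have h1 : multiExt V.internal (fun p => brMulti J Q p) (Function.update m i (a • m i))
          = brP J Q (List.ofFn (Function.update (fun i => letter (hm i)) i
            (letter (V.smul_mem ha (hm i))))) := by
        rw [← multiExt_brMulti]
        congr 1
        funext i'
        rw [Function.apply_update (f := fun _ (x : Letter V) => x.val)]
        rfl
      have h2 := hQ.snd_smul ((List.ofFn fun i => letter (hm i)).take i)
        ((List.ofFn fun i => letter (hm i)).drop (i + 1)) ha (hm i)
      rw [← ofFn_update, ← ofFn_update] at h2
      have h3 : Function.update (fun i => letter (hm i)) i (letter (hm i)) = fun i => letter (hm i) :=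
        Function.update_eq_self i (fun i => letter (hm i))
      rw [h3] at h2
      simp only [LinearMap.compMultilinearMap_apply, LinearMap.comp_apply, h1, key hm]
      refine (DFunLike.congr_fun h2 b).trans ?_
      rw [wdeg_take_ofFn, Finset.sum_filter]
      rfl
    leibniz := fun l d m hm j a ha x => by
      simp only [LinearMap.compMultilinearMap_apply, LinearMap.comp_apply]
      -- The axiom allows an arbitrary last argument; by additivity it is reduced to a homogeneous
      -- one.
      induction x using graded_induction V.internal with
      | add x y hx hy =>
        have hs : ∀ x, (Fin.snoc (α := fun _ => V) m x : Fin (l + 1) → V)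
            = Function.update (Fin.snoc (α := fun _ => V) m 0 : Fin (l + 1) → V) (Fin.last l) x :=
          fun x => by rw [Fin.update_snoc_last]
        rw [smul_add a, hs (a • x + a • y), hs (x + y), MultilinearMap.map_update_add,
          MultilinearMap.map_update_add, ← hs, ← hs, ← hs, ← hs, map_add, map_add, map_add, map_add, hx, hy]
        simp only [smul_add]
        abel
      | hom p x hx =>
        have hs : ∀ {q : ℤ} {x : V} (hx : x ∈ V.gr q), multiExt V.internal (fun p => brMulti J Q p)
            (Fin.snoc (α := fun _ => V) m x : Fin (l + 1) → V)
            = brP J Q ((List.ofFn fun i => letter (hm i)) ++ [letter hx]) := by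
          intro q x hx
          have h1 : (Fin.snoc (α := fun _ => V) m x : Fin (l + 1) → V) = fun i =>
              (Fin.snoc (α := fun _ => Letter V) (fun i => letter (hm i)) (letter hx) : 
                Fin (l + 1) → Letter V) i |>.val := by
            funext i
            induction i using Fin.lastCases <;> simp
          rw [h1, multiExt_brMulti, List.ofFn_succ', List.concat_eq_append]
          simp
        rw [hs (V.smul_mem ha hx), hs hx, key hm, hQ.concat_smul _ ha hx, hdeg hm]
        rfl }

theorem multiDer_X {l : ℕ} (w : Fin (l + 1) → Letter V) :
    hQ.multiDer.X l (fun i => (w i).val) = (kinv J (brP J Q (List.ofFn w))).1 := by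
  rw [← multiExt_brMulti]; rfl

theorem multiDer_σ {l : ℕ} (w : Fin l → Letter V) :
    hQ.multiDer.σ l (fun i => (w i).val) = (kinv J (brP J Q (List.ofFn w))).2 := by
  rw [← multiExt_brMulti]; rfl

end BracketsDer

end Letters

/-! ### Multiderivations evaluated on words -/

section Words

variable {k : Type u} [Field k] {A : GAlg k} {V : GMod A}

namespace MultiDer

variable (X : MultiDer V)

/-- The value of `X` on a word of homogeneous elements. -/
def XL : List (Letter V) → V
  | [] => 0
  | x :: w => X.X w.length (fun i => ((x :: w).get i).val)

/-- The value of `σ` on a word of homogeneous elements. -/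
def σL (w : List (Letter V)) : A →ₗ[k] A := X.σ w.length (fun i => (w.get i).val)

theorem X_cast {l l' : ℕ} (h : l' = l) (m : Fin (l + 1) → V) :
    X.X l' (fun i => m (i.cast (by rw [h]))) = X.X l m := by subst h; rfl

theorem σ_cast {l l' : ℕ} (h : l' = l) (m : Fin l → V) :
    X.σ l' (fun i => m (i.cast h)) = X.σ l m := by subst h; rfl

theorem XL_nil : X.XL [] = 0 := rfl

theorem XL_ofFn {l : ℕ} (w : Fin (l + 1) → Letter V) :
    X.XL (List.ofFn w) = X.X l (fun i => (w i).val) := by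
  rw [← X.X_cast (l' := (List.ofFn fun i : Fin l => w i.succ).length) (by simp)
    (fun i => (w i).val)]
  have : List.ofFn w = w 0 :: List.ofFn (fun i : Fin l => w i.succ) := List.ofFn_succ
  rw [this, XL]
  congr 1
  funext i
  have h2 : ∀ (L : List (Letter V)) (hL : List.ofFn w = L) (i : Fin L.length), L.get i = w (i.cast (by rw [← hL]; simp)) := by
    rintro L rfl i
    rw [List.get_eq_getElem, List.getElem_ofFn]
    rfl
  exact congrArg Letter.val (h2 _ this i)

theorem σL_ofFn {l : ℕ} (w : Fin l → Letter V) :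
    X.σL (List.ofFn w) = X.σ l (fun i => (w i).val) := by
  rw [← X.σ_cast (l' := (List.ofFn w).length) (by simp) (fun i => (w i).val), σL]
  congr 1
  funext i
  simp
  rfl

theorem exists_ofFn (w : List (Letter V)) : ∃ (l : ℕ) (v : Fin l → Letter V), w = List.ofFn v :=
  ⟨w.length, w.get, (List.ofFn_get w).symm⟩

theorem wdeg_ofFn {l : ℕ} (w : Fin l → Letter V) :
    wdeg ldeg (List.ofFn w) = ∑ i, ldeg (w i) := by
  simp [wdeg, List.sum_ofFn]

theorem XL_mem (w : List (Letter V)) : X.XL w ∈ V.gr (1 + wdeg ldeg w) := by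
  obtain ⟨l, v, rfl⟩ := exists_ofFn w
  cases l with
  | zero => exact Submodule.zero_mem _
  | succ l =>
    rw [XL_ofFn, wdeg_ofFn]
    exact X.X_mem l _ _ fun i => (v i).mem

theorem σL_der (w : List (Letter V)) : IsDerOver (1 + wdeg ldeg w) (𝟙 A) (X.σL w) := by
  obtain ⟨l, v, rfl⟩ := exists_ofFn w
  rw [σL_ofFn, wdeg_ofFn]
  exact ⟨X.σ_mem l _ _ fun i => (v i).mem, X.σ_der l _ _ fun i => (v i).mem⟩

theorem ext_words {X Y : MultiDer V} (hX : ∀ w, X.XL w = Y.XL w) (hσ : ∀ w, X.σL w = Y.σL w) :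
    X = Y := by
  have h1 : X.X = Y.X := by
    funext l
    refine multilinear_ext_hom V.internal fun p m hm => ?_
    have := hX (List.ofFn fun i => letter (hm i))
    rw [XL_ofFn, XL_ofFn] at this
    exact this
  have h2 : X.σ = Y.σ := by
    funext l
    refine multilinear_ext_hom V.internal fun p m hm => ?_
    have := hσ (List.ofFn fun i => letter (hm i))
    rw [σL_ofFn, σL_ofFn] at this
    exact this
  cases X; cases Y
  cases h1; cases h2
  rfl

end MultiDer

variable [CharZero k] {M : ProObj (GMod A)} (J : Duality M V)

/-- The multiderivation `X` is given by the iterated brackets of the operator `Q`. -/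
def Star (X : MultiDer V) (Q : Wfun M →ₗ[k] Wfun M) : Prop :=
  ∀ w : List (Letter V), brP J Q w = kap J (X.XL w) (X.σL w)

variable {J}

theorem Star.unique {X Y : MultiDer V} {Q : Wfun M →ₗ[k] Wfun M} (hX : Star J X Q)
    (hY : Star J Y Q) : X = Y :=
  MultiDer.ext_words (fun w => (kap_injective J ((hX w).symm.trans (hY w))).1)
    (fun w => (kap_injective J ((hX w).symm.trans (hY w))).2)

/-- The value of X on the empty word is 0 by convention, so the identity for the empty word requires
that Qπ has no contraction part. This is `h0`. -/
theorem BracketsDer.exists_star {Q : Wfun M →ₗ[k] Wfun M} (hQ : BracketsDer J Q) (θ : A →ₗ[k] A)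
    (h0 : Q (projW M) = postW θ (projW M)) : ∃ X : MultiDer V, Star J X Q := by
  refine ⟨hQ.multiDer, fun w => ?_⟩
  obtain ⟨l, v, rfl⟩ := MultiDer.exists_ofFn w
  rw [hQ.brP_eq, MultiDer.σL_ofFn, hQ.multiDer_σ]
  congr 1
  cases l with
  | zero =>
    have : brP J Q (List.ofFn v) = kap J 0 θ := by
      rw [List.ofFn_zero, brP, brL_nil, h0, kap, map_zero, LinearMap.zero_apply, zero_add]
    rw [this, kinv_kap]
    rfl
  | succ l => rw [MultiDer.XL_ofFn, hQ.multiDer_X]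

theorem bracketsDer_act {F : (toProMod k).obj (symPro M) ⟶ (toProMod k).obj (symPro M)}
    (hF : IsProDerivation (symPro M) F) : BracketsDer J (act F) :=
  ⟨fun θ s => act_postW θ s, exists_brP_eq_kap J hF⟩

end Words

/-! ### The correspondence as a family of bracket identities -/

section Differentials

open SHLieRinehart.SymAlg

variable {k : Type u} [Field k] [CharZero k] {A : DGCA k} {M : ProObj (GMod A.toGAlg)}

/-- Compatibility with the projections is an equality of pro-morphisms to a constant object.
Evaluated on π it is the bracket identity for the empty word. -/
theorem act_projW_iff {F : (toProMod k).obj (symPro M) ⟶ (toProMod k).obj (symPro M)} :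
    (toProMod k).map (symProj M) ≫ A.proD = F ≫ (toProMod k).map (symProj M) ↔
      act F (projW M) = postW A.d (projW M) := by
  have hp : ∀ i, Represents ((toProMod k).map (symProj M)) i PUnit.unit
      (ModuleCat.ofHom (proj (M.X i.1) i.2).toLinearMap) := by
    intro i
    have h : symProj M = toConst (symPro M) i (Sym.proj (M.X i.1) i.2) :=
      toConst_eq (symPro M) (fun i => Sym.proj (M.X i.1) i.2) (fun h => Sym.map_proj _ _) _ i
    rw [h]
    exact Represents.map (X := symPro M) (Y := (proConst _).obj A.toGAlg) (GAlg.forget k)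
      (represents_toConst (X := symPro M) i (Sym.proj (M.X i.1) i.2) PUnit.unit)
  have hd : Represents A.proD PUnit.unit PUnit.unit (ModuleCat.ofHom A.d) :=
    represents_proConst _ _ _
  obtain ⟨i, D, hD⟩ := exists_rep F (Classical.arbitrary (M.I × ℕ))
  have h1 := (hp i).comp hd
  have h2 := Represents.comp hD (hp _)
  have e1 : act F (projW M) = clsT M i ((proj _ _).toLinearMap ∘ₗ D) := by
    rw [← clsT_proj (Classical.arbitrary (M.I × ℕ)), act_clsT hD]
  have e2 : postW A.d (projW M) = clsT M i (A.d ∘ₗ (proj _ _).toLinearMap) := by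
    rw [← clsT_proj i, postW_clsT]
  constructor
  · intro h
    rw [h] at h1
    obtain ⟨l, h3, h4, e⟩ := h1.eq h2
    have e := congrArg ModuleCat.Hom.hom e
    rw [e1, e2, ← clsT_symTr h3, ← clsT_symTr h4]
    exact congrArg (clsT M l) e.symm
  · intro h
    rw [e1, e2] at h
    obtain ⟨l, h3, h4, -, e⟩ := exists_of_clsT_eq h.symm i
    refine Represents.hom_ext fun j => ⟨l, _, h1.restrict h3, ?_⟩
    have := h2.restrict h4
    have e' : ModuleCat.ofHom (A.d ∘ₗ (proj (M.X i.1) i.2).toLinearMap ∘ₗ (symTr M h3).toLinearMap)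
      = ModuleCat.ofHom (((proj _ _).toLinearMap ∘ₗ D) ∘ₗ (symTr M h4).toLinearMap) :=
        congrArg ModuleCat.ofHom e
    refine Eq.mp ?_ this
    exact congrArg _ e'.symm

variable {V : GMod A.toGAlg} {J : Duality M V}

theorem Star.corresponds {X : MultiDer V} {d : CEDiff A M} (h : Star J X (act d.d)) :
    Corresponds J X d := by
  constructor
  · intro α l
    obtain ⟨β, hβ, n, hn, D, hD, hder⟩ := d.der.exists_rep α l
    refine ⟨β, hβ, n, D, hD, fun p x a => ?_⟩
    obtain ⟨hE, e⟩ := brP_jword_of_derivation J hβ hn hD hder p x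
    rw [h] at e
    have := (kap_injective J e).2
    rw [jword, MultiDer.σL_ofFn] at this
    exact (DFunLike.congr_fun this a).symm
  · intro α l
    obtain ⟨β, hβ, n, hn, D, hD, hder⟩ := d.der.exists_rep α (l + 1)
    refine ⟨β, hβ, n, D, hD, fun p x => ?_⟩
    obtain ⟨hE, e⟩ := brP_jword_of_derivation J hβ hn hD hder p x
    rw [h] at e
    have := (kap_injective J e).1
    rw [jword, MultiDer.XL_ofFn] at this
    exact ⟨derDual hE, this.symm, fun ψ => rfl⟩

/-- In weight one the functional π ι_v + θ π is given by v alone, so its values on the generators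
from M_β determine v after passing to a later stage. -/
theorem cls_eq_kap_imp {β : M.I} {e : ℤ} {G : contFun (M.X β)} {v : V} (hv : v ∈ V.gr e)
    {θ : A.toGAlg →ₗ[k] A.toGAlg} (h : cls M β G = kap J v θ) {y : (M.X β).dual e}
    (hy : ∀ ψ, G.1 (ofM _ _ ψ) = y.1 ψ) : J.j β e y = v := by
  obtain ⟨γ, z, rfl⟩ := J.surj e v hv
  obtain ⟨δ, h1, h2⟩ := exists_ge_ge β γ
  rw [← J.compat h2, kap, ctrW_j_proj, ← cls_cproj δ, postW_cls, ← map_add, ← cls_cpull h1,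
    ← sub_eq_zero, ← map_sub] at h
  obtain ⟨ε, h3, h4⟩ := exists_of_cls_eq_zero h
  rw [← J.compat h2, ← J.compat h1, ← J.compat h3, ← J.compat h3]
  congr 1
  refine GMod.dual_ext fun m => ?_
  have h5 := DFunLike.congr_fun (congrArg Subtype.val h4) (ofM _ _ m)
  rw [cpull_apply, map_ofM, AddSubgroupClass.coe_sub, LinearMap.sub_apply, cpull_apply, map_ofM, hy] at h5
  have h6 : ((cctr (GMod.dualMap (M.map h2) e z) (cproj (M.X δ)) + cpost θ (cproj (M.X δ)) :
      contFun (M.X δ))).1 (ofM _ _ ((M.map h3).toLin m))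
      = (GMod.dualMap (M.map h2) e z).1 ((M.map h3).toLin m) := by
    rw [Submodule.coe_add, LinearMap.add_apply, cctr_apply, cproj_apply, cpost_apply, cproj_apply,
      proj_ofM, map_zero, add_zero, contr_ofM, proj_ofA]
  rw [h6] at h5
  exact sub_eq_zero.1 h5

/-- The correspondence prescribes the brackets through their values on A and on M only. Since the
brackets of d are known to be of the form `kap`, these values determine them. -/
theorem Corresponds.star {X : MultiDer V} {d : CEDiff A M} (h : Corresponds J X d) :
    Star J X (act d.d) := by
  intro w
  obtain ⟨α, l, p, x, -, rfl⟩ := exists_jword J w (Classical.arbitrary _)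
  obtain ⟨v, θ, hv, hθ, e⟩ := exists_brP_eq_kap J d.der (jword J p x)
  rw [e]
  congr 1
  · cases l with
    | zero =>
      -- For the empty word the correspondence says nothing about the part in V; it vanishes because
      -- d is intertwined with d_A.
      have h0 : brP J (act d.d) (jword J p x) = kap J 0 A.d := by
        rw [jword, List.ofFn_zero, brP, brL_nil, act_projW_iff.1 d.comm, kap, map_zero,
          LinearMap.zero_apply, zero_add]
      exact (kap_injective J (e.symm.trans h0)).1
    | succ l =>
      obtain ⟨β, hβ, n, D, hD, hX⟩ := h.2 α l
      obtain ⟨y, hy, hy'⟩ := hX p x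
      obtain ⟨hc, e'⟩ := brP_jword J hβ hD p x
      rw [wdeg_jword] at hv
      rw [jword, MultiDer.XL_ofFn]
      refine Eq.trans ?_ hy
      exact (cls_eq_kap_imp hv (e'.symm.trans e) hy').symm
  · obtain ⟨β, hβ, n, D, hD, hX⟩ := h.1 α l
    obtain ⟨hc, e'⟩ := brP_jword J hβ hD p x
    rw [← resA_kap J v θ, ← e, e', jword, MultiDer.σL_ofFn]
    ext a
    rw [resA_cls]
    exact hX p x a

theorem CEDiff.exists_star (d : CEDiff A M) (J : Duality M V) : ∃ X : MultiDer V, Star J X (act d.d) :=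
  (bracketsDer_act d.der).exists_star A.d (act_projW_iff.1 d.comm)

theorem Star.σ_zero {X : MultiDer V} {F : (toProMod k).obj (symPro M) ⟶ (toProMod k).obj (symPro M)}
    (h : Star J X (act F)) : X.σ 0 Fin.elim0 = A.d ↔ act F (projW M) = postW A.d (projW M) := by
  have h0 := h []
  rw [brP, brL_nil, MultiDer.XL_nil] at h0
  have h1 : X.σL [] = X.σ 0 Fin.elim0 := congrArg (X.σ 0) (Subsingleton.elim _ _)
  have h2 : postW A.d (projW M) = kap J 0 A.d := by
    rw [kap, map_zero, LinearMap.zero_apply, zero_add]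
  rw [h0, h1, h2]
  exact ⟨fun h => by rw [h], fun h => (kap_injective J h).2⟩

end Differentials

/-! ### The square of a differential and the Jacobi expressions -/

section Square

variable {k : Type u} [Field k] {A : GAlg k} {V : GMod A}

namespace MultiDer

variable (X : MultiDer V)

/-- The value of `X` on a word, as a homogeneous element. -/
def Xlet (a : List (Letter V)) : Letter V := letter (X.XL_mem a)

theorem ldeg_Xlet (a : List (Letter V)) : ldeg (X.Xlet a) = 1 + wdeg ldeg a := rfl

theorem XL_cons_ofFn (x : Letter V) {l : ℕ} (w : Fin l → Letter V) : X.XL (x :: List.ofFn w)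
    = X.X l (Fin.cons (α := fun _ => V) x.val (fun i => (w i).val)) := by
  have h : x :: List.ofFn w = List.ofFn (Fin.cons (α := fun _ => Letter V) x w) := by
    rw [List.ofFn_succ]; simp
  rw [h, XL_ofFn]
  congr 1
  funext i
  induction i using Fin.cases <;> simp

theorem σL_cons_ofFn (x : Letter V) {l : ℕ} (w : Fin l → Letter V) : X.σL (x :: List.ofFn w)
    = X.σ (l + 1) (Fin.cons (α := fun _ => V) x.val (fun i => (w i).val)) := by
  have h : x :: List.ofFn w = List.ofFn (Fin.cons (α := fun _ => Letter V) x w) := by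
    rw [List.ofFn_succ]; simp
  rw [h, σL_ofFn]
  congr 1
  funext i
  induction i using Fin.cases <;> simp

theorem XL_cons_of_val_eq_zero {x : Letter V} (hx : x.val = 0) (w : List (Letter V)) :
    X.XL (x :: w) = 0 := by
  obtain ⟨l, w, rfl⟩ := exists_ofFn w
  rw [XL_cons_ofFn, hx]
  exact (X.X l).map_coord_zero 0 rfl

theorem σL_cons_of_val_eq_zero {x : Letter V} (hx : x.val = 0) (w : List (Letter V)) :
    X.σL (x :: w) = 0 := by
  obtain ⟨l, w, rfl⟩ := exists_ofFn w
  rw [σL_cons_ofFn, hx]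
  exact (X.σ (l + 1)).map_coord_zero 0 rfl

/-- The first component of the square of `X` on words. -/
def jacL (w : List (Letter V)) : V := shSum ldeg w fun a b => X.XL (X.Xlet a :: b)

/-- The second component of the square of `X` on words. -/
def anchorL (w : List (Letter V)) : A →ₗ[k] A := shSum ldeg w fun a b =>
  X.σL (X.Xlet a :: b) + sgn (wdeg ldeg a) • (X.σL a ∘ₗ X.σL b)

theorem take_ofFn_eq {Λ : Type*} {n p : ℕ} (hp : p ≤ n) (w : Fin n → Λ) :
    (List.ofFn w).take p = List.ofFn fun i : Fin p => w ⟨i, by omega⟩ := by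
  refine List.ext_getElem (by simp [hp]) fun i h1 h2 => ?_
  simp

theorem drop_ofFn_eq {Λ : Type*} {n p q : ℕ} (hp : p + q = n) (w : Fin n → Λ) :
    (List.ofFn w).drop p = List.ofFn fun i : Fin q => w ⟨p + i, by omega⟩ := by
  refine List.ext_getElem (by simp; omega) fun i h1 h2 => ?_
  simp

theorem jacL_ofFn {n : ℕ} (w : Fin (n + 1) → Letter V) :
    X.jacL (List.ofFn w) = X.jacobiator n (fun i => ldeg (w i)) (fun i => (w i).val) := by
  rw [jacL, shSum_ofFn, Finset.sum_range, Fin.sum_univ_succ, jacobiator]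
  -- The splitting with empty first subword contributes nothing, because its inner value is 0. The
  -- remaining first subwords have length `l + 1`, the number of inner arguments.
  rw [Finset.sum_eq_zero, zero_add]
  · refine Finset.sum_congr rfl fun l _ => ?_
    have hl := l.2
    rw [Fin.val_succ]
    refine Finset.sum_congr rfl fun τ _ => ?_
    rw [take_ofFn_eq (by omega), drop_ofFn_eq (q := n - l) (by omega), XL_cons_ofFn, Xlet, letter_val,
      XL_ofFn]
  · intro τ _
    rw [XL_cons_of_val_eq_zero, smul_zero]
    rw [Fin.val_zero, List.take_zero]
    rfl

theorem anchorL_ofFn {n : ℕ} (w : Fin n → Letter V) :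
    X.anchorL (List.ofFn w) = X.anchorJacobiator n (fun i => ldeg (w i)) (fun i => (w i).val) := by
  rw [anchorL, shSum_add, shSum_ofFn, shSum_ofFn, anchorJacobiator]
  congr 1
  · rw [Finset.sum_range, Fin.sum_univ_succ, Finset.sum_eq_zero, zero_add]
    · refine Finset.sum_congr rfl fun l _ => ?_
      have hl := l.2
      rw [Fin.val_succ]
      refine Finset.sum_congr rfl fun τ _ => ?_
      rw [take_ofFn_eq (by omega), drop_ofFn_eq (q := n - 1 - l) (by omega), σL_cons_ofFn, Xlet,
        letter_val, XL_ofFn]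
    · intro τ _
      rw [σL_cons_of_val_eq_zero, smul_zero]
      rw [Fin.val_zero, List.take_zero]
      rfl
  · rw [Finset.sum_range]
    refine Finset.sum_congr rfl fun l _ => ?_
    have hl := l.2
    refine Finset.sum_congr rfl fun τ _ => ?_
    rw [take_ofFn_eq (by omega), drop_ofFn_eq (q := n - l) (by omega), σL_ofFn, σL_ofFn, wdeg_ofFn,
      smul_smul]

theorem squareZero_iff :
    X.SquareZero ↔ (∀ w, X.jacL w = 0) ∧ ∀ w, X.anchorL w = 0 := by
  constructor
  · rintro ⟨h1, h2⟩
    constructor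
    · intro w
      obtain ⟨l, v, rfl⟩ := exists_ofFn w
      cases l with
      | zero => 
        rw [List.ofFn_zero]
        exact X.XL_cons_of_val_eq_zero rfl _
      | succ l =>
        rw [jacL_ofFn]
        exact h1 l _ _ fun i => (v i).mem
    · intro w
      obtain ⟨l, v, rfl⟩ := exists_ofFn w
      rw [anchorL_ofFn]
      exact h2 l _ _ fun i => (v i).mem
  · rintro ⟨h1, h2⟩
    constructor
    · intro n d m hm
      have := h1 (List.ofFn fun i => letter (hm i))
      rwa [jacL_ofFn] at this
    · intro n d m hm
      have := h2 (List.ofFn fun i => letter (hm i))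
      rwa [anchorL_ofFn] at this

/-- The axioms state graded symmetry for all permutations; the permutation `insPerm`, with the
identity on the other letters, yields the rule for moving a single letter. -/
theorem insert_of_perm {Λ : Type*} {deg : Λ → ℤ} {G : Type*} [AddCommGroup G] {F : List Λ → G}
    (h : ∀ (n : ℕ) (w : Fin n → Λ) (τ : Equiv.Perm (Fin n)),
      F (List.ofFn fun i => w (τ i)) = koszul (fun i => deg (w i)) τ • F (List.ofFn w))
    (v : List Λ) (x : Λ) (w : List Λ) :
    F (v ++ x :: w) = sgn (deg x * wdeg deg v) • F (x :: (v ++ w)) := by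
  obtain ⟨n, u, hu⟩ : ∃ (n : ℕ) (u : Fin n → Λ), v ++ w = List.ofFn u :=
    ⟨_, _, (List.ofFn_get (v ++ w)).symm⟩
  have hn : n = v.length + w.length := by
    rw [← List.length_append, hu, List.length_ofFn]
  have hv : (List.ofFn u).take v.length = v := by rw [← hu, List.take_left]
  have hw : (List.ofFn u).drop v.length = w := by rw [← hu, List.drop_left]
  have h1 := ofFn_insPerm x u ⟨v.length, by omega⟩ 1
  simp only [Equiv.Perm.one_apply, hv, hw] at h1
  rw [← h1, h, koszul_insPerm, hu, List.ofFn_cons]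
  congr 1
  simp only [Fin.cons_zero, Fin.cons_succ, prod_sgn_ite, Equiv.Perm.one_apply]
  have h2 := wdeg_take_ofFn (deg := deg) v.length u
  rw [hv] at h2
  rw [h2]
  have h3 : koszul (fun i => deg (u i)) 1 = 1 := by
    rw [koszul]
    refine Finset.prod_eq_one fun i _ => Finset.prod_eq_one fun j _ => if_neg ?_
    rintro ⟨h1, h2⟩
    exact lt_asymm h1 h2
  rw [h3, mul_one]

theorem swap_of_insert {Λ : Type*} {deg : Λ → ℤ} {G : Type*} [AddCommGroup G] {F : List Λ → G}
    (h : ∀ v x w, F (v ++ x :: w) = sgn (deg x * wdeg deg v) • F (x :: (v ++ w)))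
    (v : List Λ) (x y : Λ) (w : List Λ) :
    F (v ++ x :: y :: w) = sgn (deg x * deg y) • F (v ++ y :: x :: w) := by
  have h3 := h (v ++ [y]) x w
  rw [List.append_assoc, List.singleton_append, List.append_assoc, List.singleton_append] at h3
  rw [h v x (y :: w), h3, smul_smul, ← sgn_add, wdeg_append, wdeg_cons, wdeg_nil]
  congr 1
  exact sgn_congr ⟨-(deg x * deg y), by ring⟩

theorem XL_perm (n : ℕ) (w : Fin n → Letter V) (τ : Equiv.Perm (Fin n)) :
    X.XL (List.ofFn fun i => w (τ i)) = koszul (fun i => ldeg (w i)) τ • X.XL (List.ofFn w) := by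
  cases n with
  | zero => simp [XL_nil]
  | succ n =>
    rw [XL_ofFn, XL_ofFn]
    exact X.X_symm n _ _ (fun i => (w i).mem) τ

theorem σL_perm (n : ℕ) (w : Fin n → Letter V) (τ : Equiv.Perm (Fin n)) :
    X.σL (List.ofFn fun i => w (τ i)) = koszul (fun i => ldeg (w i)) τ • X.σL (List.ofFn w) := by
  rw [σL_ofFn, σL_ofFn]
  exact X.σ_symm n _ _ (fun i => (w i).mem) τ

theorem XL_swap (v : List (Letter V)) (x y : Letter V) (w : List (Letter V)) :
    X.XL (v ++ x :: y :: w) = sgn (ldeg x * ldeg y) • X.XL (v ++ y :: x :: w) :=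
  swap_of_insert (insert_of_perm X.XL_perm) v x y w

theorem σL_swap (v : List (Letter V)) (x y : Letter V) (w : List (Letter V)) :
    X.σL (v ++ x :: y :: w) = sgn (ldeg x * ldeg y) • X.σL (v ++ y :: x :: w) :=
  swap_of_insert (insert_of_perm X.σL_perm) v x y w

theorem XL_concat (x : Letter V) (w : List (Letter V)) :
    X.XL (w ++ [x]) = sgn (ldeg x * wdeg ldeg w) • X.XL (x :: w) := by
  rw [insert_of_perm X.XL_perm, List.append_nil]

theorem σL_concat (x : Letter V) (w : List (Letter V)) :
    X.σL (w ++ [x]) = sgn (ldeg x * wdeg ldeg w) • X.σL (x :: w) := by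
  rw [insert_of_perm X.σL_perm, List.append_nil]

end MultiDer

variable [CharZero k] {M : ProObj (GMod A)} {J : Duality M V} {X : MultiDer V}
  {Q : Wfun M →ₗ[k] Wfun M}

theorem shSum_add_eq {Λ : Type*} {deg : Λ → ℤ} {G : Type*} [AddCommGroup G] {w : List Λ}
    (F : List Λ → List Λ → G) {F₁ F₂ : List Λ → List Λ → G} (h₁ : shSum deg w F₁ = 0)
    (h₂ : shSum deg w F₂ = 0) :
    shSum deg w (fun a b => F a b + F₁ a b + F₂ a b) = shSum deg w F := by
  rw [shSum_add, shSum_add, h₁, h₂, add_zero, add_zero]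

/-- This is the bracket identity for the word b ++ [x], solved for the term in which the operator is
applied to π ι_x. -/
theorem Star.brL_apply_ctrW (h : Star J X Q) (b : List (Letter V)) (x : Letter V) :
    brL ldeg (lctr J) (lctr J) 1 Q b (ctrW J x.val (projW M))
      = sgn ((1 + wdeg ldeg b) * ldeg x) • (ctrW J x.val (kap J (X.XL b) (X.σL b))
        - kap J (X.XL (b ++ [x])) (X.σL (b ++ [x]))) := by
  have h1 := h (b ++ [x])
  have h2 : brL ldeg (lctr J) (lctr J) 1 Q b (projW M) = _ := h b
  rw [brP, brL_concat, brk_apply, h2] at h1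
  rw [← h1, lctr, sub_sub_cancel, sgn_smul_sgn_smul]

/-- The brackets of Q∘Q are a sum over splittings (a, b) of [Q, b] applied to π ι_{X(a)} + σ(a) π.
By `Star.brL_apply_ctrW` the first part gives X(X(a), b) and its anchor, up to a contraction of [Q,
b]π; the second part is σ(a) [Q, b]π. Besides the terms of the square of X there remain mixed terms
`P` and double contractions `C`, and both cancel in the sum by exchanging a and b. -/
theorem Star.square (h : Star J X Q) (hQ : ∀ θ s, Q (postW θ s) = postW θ (Q s))
    (w : List (Letter V)) :
    brL ldeg (lctr J) (lctr J) (1 + 1) (Q ∘ₗ Q) w (projW M) = kap J (X.jacL w) (X.anchorL w) := by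
  have e0 : brL ldeg (lctr J) (lctr J) (1 + 1) (Q ∘ₗ Q) w (projW M)
      = shSum ldeg w (fun a b => sgn (1 * wdeg ldeg a) • brL ldeg (lctr J) (lctr J) 1 Q b
        (kap J (X.XL a) (X.σL a))) := by
    rw [brL_comp (lctr J) (lctr J) (lctr J)]
    refine (shSum_map ldeg (AddMonoidHom.mk' (fun f : Wfun M →ₗ[k] Wfun M => f (projW M))
      (fun _ _ => rfl)) w _).trans ?_
    congr 1
    funext a b
    have h2 : brL ldeg (lctr J) (lctr J) 1 Q a (projW M) = _ := h a
    rw [← h2]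
    rfl
  have e1 : kap J (X.jacL w) (X.anchorL w) = shSum ldeg w (fun a b =>
      kap J (X.XL (X.Xlet a :: b)) (X.σL (X.Xlet a :: b) + sgn (wdeg ldeg a) • (X.σL a ∘ₗ X.σL b))) := by
    have h1 := shSum_map ldeg (LinearMap.toAddMonoidHom (LinearMap.fst k V (A →ₗ[k] A))) w (fun a b =>
      (X.XL (X.Xlet a :: b), X.σL (X.Xlet a :: b) + sgn (wdeg ldeg a) • (X.σL a ∘ₗ X.σL b)))
    have h2 := shSum_map ldeg (LinearMap.toAddMonoidHom (LinearMap.snd k V (A →ₗ[k] A))) w (fun a b =>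
      (X.XL (X.Xlet a :: b), X.σL (X.Xlet a :: b) + sgn (wdeg ldeg a) • (X.σL a ∘ₗ X.σL b)))
    have h3 := shSum_map ldeg (LinearMap.toAddMonoidHom (kapₗ J)) w (fun a b =>
      (X.XL (X.Xlet a :: b), X.σL (X.Xlet a :: b) + sgn (wdeg ldeg a) • (X.σL a ∘ₗ X.σL b)))
    refine Eq.trans ?_ h3
    rw [MultiDer.jacL, MultiDer.anchorL]
    exact congrArg₂ (kap J) h1.symm h2.symm
  let P : List (Letter V) → List (Letter V) → Wfun M := fun a b =>
    sgn (wdeg ldeg a) • postW (X.σL a) (ctrW J (X.XL b) (projW M))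
  let C : List (Letter V) → List (Letter V) → Wfun M := fun a b =>
    sgn (wdeg ldeg a) • ctrW J (X.XL b) (ctrW J (X.XL a) (projW M))
  have hcomm : ∀ a b s, ctrW J (X.XL a) (ctrW J (X.XL b) s)
      = sgn ((1 + wdeg ldeg a) * (1 + wdeg ldeg b)) • ctrW J (X.XL b) (ctrW J (X.XL a) s) :=
    fun a b s => ctrW_comm J (X.XL_mem a) (X.XL_mem b) s
  -- Terms with one anchor and one contraction arise from (a, b) and from (b, a) with opposite
  -- signs.
  have hP : shSum ldeg w (fun a b => P a b - sgn (wdeg ldeg a * wdeg ldeg b) • P b a) = 0 := by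
    simp only [sub_eq_add_neg]
    rw [shSum_add, shSum_neg, ← shSum_swap, add_neg_cancel]
  have hC : shSum ldeg w C = 0 := by
    have h2 : shSum ldeg w C = - shSum ldeg w C := by
      conv_lhs => rw [shSum_swap]
      rw [← shSum_neg]
      congr 1
      funext a b
      simp only [C]
      rw [hcomm a b, smul_smul, smul_smul, ← sgn_add, ← sgn_add, ← neg_smul]
      congr 1
      rw [← neg_one_mul, ← sgn_one, ← sgn_add]
      apply sgn_congr
      exact ⟨wdeg ldeg a * wdeg ldeg b + wdeg ldeg b, by ring⟩
    -- The double contractions are antisymmetric under the exchange, which only shows that twice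
    -- their sum is zero; 2 is invertible in k.
    have h3 : (2 : k) • shSum ldeg w C = 0 := by
      rw [two_smul]
      nth_rewrite 2 [h2]
      exact add_neg_cancel _
    exact (smul_eq_zero.1 h3).resolve_left two_ne_zero
  rw [e0, e1, ← shSum_add_eq (fun a b => kap J _ _) hP hC]
  congr 1
  funext a b
  have hx := h.brL_apply_ctrW b (X.Xlet a)
  have hv : (X.Xlet a).val = X.XL a := rfl
  have hb : brL ldeg (lctr J) (lctr J) 1 Q b (projW M) = _ := h b
  rw [hv, X.XL_concat, X.σL_concat, kap_zsmul, X.ldeg_Xlet] at hx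
  have hk : kap J (X.XL (X.Xlet a :: b)) (X.σL (X.Xlet a :: b) + sgn (wdeg ldeg a) • (X.σL a ∘ₗ X.σL b))
      = kap J (X.XL (X.Xlet a :: b)) (X.σL (X.Xlet a :: b))
        + sgn (wdeg ldeg a) • postW (X.σL a ∘ₗ X.σL b) (projW M) := by
    rw [kap, kap, map_add, LinearMap.add_apply, map_zsmul, LinearMap.smul_apply, add_assoc]
  rw [hk]
  nth_rewrite 1 [kap]
  rw [map_add, brL_postW J hQ, hb, hx]
  generalize kap J (X.XL (X.Xlet a :: b)) (X.σL (X.Xlet a :: b)) = K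
  simp only [kap, map_add, P, C, ctrW_postW, postW_postW, smul_add, smul_sub, smul_smul, ← sgn_add,
    one_mul]
  rw [hcomm a b, smul_smul, ← sgn_add]
  have s1 : sgn (wdeg ldeg a + (1 + wdeg ldeg b) * (1 + wdeg ldeg a)
      + (1 + wdeg ldeg a) * (1 + wdeg ldeg b)) = sgn (wdeg ldeg a) :=
    sgn_congr ⟨(1 + wdeg ldeg b) * (1 + wdeg ldeg a), by ring⟩
  have s2 : sgn (wdeg ldeg a + ((1 + wdeg ldeg b) * (1 + wdeg ldeg a)
      + (1 + wdeg ldeg a) * wdeg ldeg b)) = -1 := by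
    rw [← sgn_one]
    exact sgn_congr ⟨wdeg ldeg a + wdeg ldeg b + wdeg ldeg a * wdeg ldeg b, by ring⟩
  have s3 : sgn (wdeg ldeg a + (1 + wdeg ldeg b) * (1 + wdeg ldeg a))
      = - sgn (wdeg ldeg a * wdeg ldeg b + wdeg ldeg b) := by
    rw [← neg_one_mul, ← sgn_one, ← sgn_add]
    exact sgn_congr ⟨wdeg ldeg a, by ring⟩
  have s1' : sgn (wdeg ldeg a + ((1 + wdeg ldeg b) * (1 + wdeg ldeg a)
      + (1 + wdeg ldeg a) * (1 + wdeg ldeg b))) = sgn (wdeg ldeg a) := by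
    rw [← add_assoc, s1]
  simp only [s1', s2, s3, add_assoc]
  simp only [neg_smul, one_smul]
  abel

end Square

/-! ### Derivations of the symmetric algebra from their values on generators -/

section SymDerivations

open SHLieRinehart.SymAlg

theorem IsDerOver.cast {k : Type u} [Field k] {Y X : GAlg k} {e e' : ℤ} {φ : X ⟶ Y} {D : X →ₗ[k] Y} (h : IsDerOver e φ D)
    (he : e = e') : IsDerOver e' φ D := he ▸ h

variable {k : Type u} [Field k] [CharZero k] {A : GAlg k} {M : GMod A} {Y : GAlg k}

theorem fin_two_entry {R : Type*} (a b c d : R) : (!![a, b; c, d] : Matrix (Fin 2) (Fin 2) R) 0 1 = b := rfl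

theorem fin_two_add {R : Type*} [Ring R] (a b d a' b' d' : R) :
    (!![a, b; 0, d] + !![a', b'; 0, d'] : Matrix (Fin 2) (Fin 2) R)
      = !![a + a', b + b'; 0, d + d'] := by
  ext i j; fin_cases i <;> fin_cases j <;> simp

theorem fin_two_smul {K R : Type*} [Field K] [Ring R] [Algebra K R] (c : K) (a b d : R) :
    (c • !![a, b; 0, d] : Matrix (Fin 2) (Fin 2) R) = !![c • a, c • b; 0, c • d] := by
  ext i j; fin_cases i <;> fin_cases j <;> simp

-- The operator D is the corner entry of upper triangular matrices with diagonal entries (-1)^{e|s|}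
-- φ(s) and φ(s): multiplicativity of the matrix is the Leibniz rule. The universal property of Sym
-- then produces D, and relations have to be checked on generators only.
set_option maxHeartbeats 400000 in
theorem exists_twisted_derivation {e : ℤ} (φ : Sym M ⊤ ⟶ Y) (dA : A →ₗ[k] Y) (dM : M →ₗ[k] Y)
    (hA : ∀ i a, a ∈ A.gr i → dA a ∈ Y.gr (i + e))
    (hM : ∀ i m, m ∈ M.gr i → dM m ∈ Y.gr (i + e))
    (hmul : ∀ i a b, a ∈ A.gr i → dA (a * b) = dA a * φ.toAlgHom (ofA M ⊤ b)
      + sgn (e * i) • (φ.toAlgHom (ofA M ⊤ a) * dA b))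
    (hsmul : ∀ i a m, a ∈ A.gr i → dM (a • m) = dA a * φ.toAlgHom (ofM M ⊤ m)
      + sgn (e * i) • (φ.toAlgHom (ofA M ⊤ a) * dM m)) :
    ∃ D : SymAlg M ⊤ →ₗ[k] Y, (∀ s t, D (s * t) = Y.parity e (φ.toAlgHom s) * D t
      + D s * φ.toAlgHom t) ∧ (∀ a, D (ofA M ⊤ a) = dA a) ∧ ∀ m, D (ofM M ⊤ m) = dM m := by
  have hφA : ∀ i a, a ∈ A.gr i → φ.toAlgHom (ofA M ⊤ a) ∈ Y.gr i :=
    fun i a ha => φ.map_mem i _ (ofA_mem ha)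
  have hφM : ∀ i m, m ∈ M.gr i → φ.toAlgHom (ofM M ⊤ m) ∈ Y.gr i :=
    fun i m hm => φ.map_mem i _ (ofM_mem hm)
  have hA1 : dA 1 = 0 := by
    have h := hmul 0 1 1 A.one_mem
    simpa [sgn_zero] using h
  have hA' : ∀ a b, dA (a * b) = dA a * φ.toAlgHom (ofA M ⊤ b)
      + Y.parity e (φ.toAlgHom (ofA M ⊤ a)) * dA b := by
    intro a b
    induction a using graded_induction A.internal with
    | hom i a ha => rw [hmul i a b ha, Y.parity_of_mem e (hφA i a ha), smul_mul_assoc]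
    | add x y hx hy => simp only [add_mul, map_add, hx, hy]; abel
  have hM' : ∀ a m, dM (a • m) = dA a * φ.toAlgHom (ofM M ⊤ m)
      + Y.parity e (φ.toAlgHom (ofA M ⊤ a)) * dM m := by
    intro a m
    induction a using graded_induction A.internal with
    | hom i a ha => rw [hsmul i a m ha, Y.parity_of_mem e (hφA i a ha), smul_mul_assoc]
    | add x y hx hy => simp only [add_smul, add_mul, map_add, hx, hy]; abel
  -- This is the corner entry of the graded commutativity relation between two such matrices.
  have key : ∀ {i j : ℤ} {x y dx dy : Y}, x ∈ Y.gr i → y ∈ Y.gr j → dx ∈ Y.gr (i + e) →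
      dy ∈ Y.gr (j + e) → Y.parity e x * dy + dx * y
        = sgn (i * j) • (Y.parity e y * dx + dy * x) := by
    intro i j x y dx dy hx hy hdx hdy
    rw [Y.parity_of_mem e hx, Y.parity_of_mem e hy, Y.comm hdx hy, smul_mul_assoc, smul_mul_assoc,
      Y.comm hx hdy, smul_add, smul_smul, smul_smul, ← sgn_add, ← sgn_add, add_comm]
    congr 2
    · apply sgn_congr; exact ⟨0, by ring⟩
    · apply sgn_congr; exact ⟨i * e, by ring⟩
  let fA : A →ₐ[k] Matrix (Fin 2) (Fin 2) Y := AlgHom.ofLinearMap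
    { toFun := fun a => !![Y.parity e (φ.toAlgHom (ofA M ⊤ a)), dA a; 0, φ.toAlgHom (ofA M ⊤ a)]
      map_add' := fun a b => by ext i j; fin_cases i <;> fin_cases j <;> simp
      map_smul' := fun c a => by ext i j; fin_cases i <;> fin_cases j <;> simp }
    (by ext i j; fin_cases i <;> fin_cases j <;> simp [hA1])
    (fun a b => by
      simp only [LinearMap.coe_mk, AddHom.coe_mk, Matrix.mul_fin_two, hA']
      ext i j; fin_cases i <;> fin_cases j <;> simp [add_comm])
  let fM : M →ₗ[k] Matrix (Fin 2) (Fin 2) Y :=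
    { toFun := fun m => !![Y.parity e (φ.toAlgHom (ofM M ⊤ m)), dM m; 0, φ.toAlgHom (ofM M ⊤ m)]
      map_add' := fun a b => by ext i j; fin_cases i <;> fin_cases j <;> simp
      map_smul' := fun c a => by ext i j; fin_cases i <;> fin_cases j <;> simp }
  have hfA : ∀ a, fA a = !![Y.parity e (φ.toAlgHom (ofA M ⊤ a)), dA a; 0, φ.toAlgHom (ofA M ⊤ a)] :=
    fun a => rfl
  have hfM : ∀ m, fM m = !![Y.parity e (φ.toAlgHom (ofM M ⊤ m)), dM m; 0, φ.toAlgHom (ofM M ⊤ m)] :=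
    fun m => rfl
  obtain ⟨F, hFA, hFM⟩ : ∃ F : SymAlg M ⊤ →ₐ[k] Matrix (Fin 2) (Fin 2) Y,
      (∀ a, F (ofA M ⊤ a) = fA a) ∧ ∀ m, F (ofM M ⊤ m) = fM m := by
    refine ⟨lift fA fM ?_ ?_ ?_ ?_, fun a => lift_ofA _ _ _ _ _ _ _,
      fun m => lift_ofM _ _ _ _ _ _ _⟩
    · intro a m
      rw [hfA, hfM, hfM, Matrix.mul_fin_two, hM', ofM_smul, map_mul, map_mul]
      ext i j; fin_cases i <;> fin_cases j <;> simp [add_comm]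
    · intro i j m a hm ha
      have h1 := congrArg φ.toAlgHom (comm_MA M ⊤ hm ha)
      have h2 := congrArg (Y.parity e) h1
      simp only [map_mul, map_zsmul] at h1 h2
      have h3 := key (hφM i m hm) (hφA j a ha) (hM i m hm) (hA j a ha)
      rw [hfA, hfM, Matrix.mul_fin_two, Matrix.mul_fin_two]
      ext i j; fin_cases i <;> fin_cases j <;> simp [h1, h2, h3]
    · intro i j m m' hm hm'
      have h1 := congrArg φ.toAlgHom (comm_MM M ⊤ hm hm')
      have h2 := congrArg (Y.parity e) h1
      simp only [map_mul, map_zsmul] at h1 h2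
      have h3 := key (hφM i m hm) (hφM j m' hm') (hM i m hm) (hM j m' hm')
      rw [hfM, hfM, Matrix.mul_fin_two, Matrix.mul_fin_two]
      ext i j; fin_cases i <;> fin_cases j <;> simp [h1, h2, h3]
    · exact fun l hl => absurd hl (not_lt.2 le_top)
  obtain ⟨D, hD⟩ : ∃ D : SymAlg M ⊤ →ₗ[k] Y, ∀ s, D s = F s 0 1 :=
    ⟨Matrix.entryLinearMap k Y (0 : Fin 2) (1 : Fin 2) ∘ₗ F.toLinearMap, fun _ => rfl⟩
  have hF : ∀ s, F s = !![Y.parity e (φ.toAlgHom s), D s; 0, φ.toAlgHom s] := by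
    intro s
    induction s using mul_induction with
    | one =>
      have h2 : D 1 = 0 := by rw [hD, map_one]; simp
      rw [h2, map_one, map_one, map_one, Matrix.one_fin_two]
    | add s t hs ht =>
      rw [map_add, hs, ht, fin_two_add, map_add, map_add, map_add]
    | base c s hs =>
      rw [map_smul, hs, fin_two_smul, map_smul, map_smul, map_smul]
    | mulA a s hs =>
      have h1 := map_mul F (ofA M ⊤ a) s
      rw [hs, hFA, hfA, Matrix.mul_fin_two] at h1
      have h2 := hD (ofA M ⊤ a * s)
      rw [h1, fin_two_entry] at h2
      rw [h2, h1, map_mul, map_mul]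
      simp only [mul_zero, zero_mul, add_zero, zero_add]
    | mulM m s hs =>
      have h1 := map_mul F (ofM M ⊤ m) s
      rw [hs, hFM, hfM, Matrix.mul_fin_two] at h1
      have h2 := hD (ofM M ⊤ m * s)
      rw [h1, fin_two_entry] at h2
      rw [h2, h1, map_mul, map_mul]
      simp only [mul_zero, zero_mul, add_zero, zero_add]
  have hDA : ∀ a, D (ofA M ⊤ a) = dA a := fun a => by rw [hD, hFA, hfA, fin_two_entry]
  have hDM : ∀ m, D (ofM M ⊤ m) = dM m := fun m => by rw [hD, hFM, hfM, fin_two_entry]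
  have hmulD : ∀ s t, D (s * t) = Y.parity e (φ.toAlgHom s) * D t + D s * φ.toAlgHom t := by
    intro s t
    have h1 := hF (s * t)
    rw [map_mul, hF s, hF t, Matrix.mul_fin_two] at h1
    have h2 := congrFun (congrFun h1 0) 1
    rw [fin_two_entry, fin_two_entry] at h2
    exact h2.symm
  exact ⟨D, hmulD, hDA, hDM⟩

/-- Derivations of the symmetric algebra are given by their values on generators. -/
theorem exists_isDerOver {e : ℤ} (φ : Sym M ⊤ ⟶ Y) (dA : A →ₗ[k] Y) (dM : M →ₗ[k] Y)
    (hA : ∀ i a, a ∈ A.gr i → dA a ∈ Y.gr (i + e))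
    (hM : ∀ i m, m ∈ M.gr i → dM m ∈ Y.gr (i + e))
    (hmul : ∀ i a b, a ∈ A.gr i → dA (a * b) = dA a * φ.toAlgHom (ofA M ⊤ b)
      + sgn (e * i) • (φ.toAlgHom (ofA M ⊤ a) * dA b))
    (hsmul : ∀ i a m, a ∈ A.gr i → dM (a • m) = dA a * φ.toAlgHom (ofM M ⊤ m)
      + sgn (e * i) • (φ.toAlgHom (ofA M ⊤ a) * dM m)) :
    ∃ D : SymAlg M ⊤ →ₗ[k] Y, IsDerOver e φ D ∧ (∀ a, D (ofA M ⊤ a) = dA a) ∧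
      ∀ m, D (ofM M ⊤ m) = dM m := by
  obtain ⟨D, hmulD, hDA, hDM⟩ := exists_twisted_derivation φ dA dM hA hM hmul hsmul
  have hφA : ∀ i a, a ∈ A.gr i → φ.toAlgHom (ofA M ⊤ a) ∈ Y.gr i :=
    fun i a ha => φ.map_mem i _ (ofA_mem ha)
  have hφM : ∀ i m, m ∈ M.gr i → φ.toAlgHom (ofM M ⊤ m) ∈ Y.gr i :=
    fun i m hm => φ.map_mem i _ (ofM_mem hm)
  refine ⟨D, ⟨fun i s hs => ?_, fun i s t hs => ?_⟩, hDA, hDM⟩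
  · change s ∈ gr M ⊤ i at hs
    induction hs using Submodule.span_induction with
    | mem s hs =>
      induction hs with
      | one =>
        have h1 := hmulD 1 1
        have h2 : D 1 = 0 := by simpa using h1
        rw [h2]; exact Submodule.zero_mem _
      | @mulA i j a s ha hs ih =>
        rw [hmulD, hDA, Y.parity_of_mem e (hφA i a ha), smul_mul_assoc]
        refine Submodule.add_mem _ (zsmul_mem ?_ _) ?_
        · rw [add_assoc]; exact Y.mul_mem (hφA i a ha) ih
        · rw [add_right_comm]
          exact Y.mul_mem (hA i a ha) (φ.map_mem j s (Submodule.subset_span hs))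
      | @mulM i j m s hm hs ih =>
        rw [hmulD, hDM, Y.parity_of_mem e (hφM i m hm), smul_mul_assoc]
        refine Submodule.add_mem _ (zsmul_mem ?_ _) ?_
        · rw [add_assoc]; exact Y.mul_mem (hφM i m hm) ih
        · rw [add_right_comm]
          exact Y.mul_mem (hM i m hm) (φ.map_mem j s (Submodule.subset_span hs))
    | zero => simp
    | add s t _ _ hs ht => rw [map_add]; exact Submodule.add_mem _ hs ht
    | smul c s _ hs => rw [map_smul]; exact Submodule.smul_mem _ _ hs
  · rw [hmulD, Y.parity_of_mem e (φ.map_mem i s hs), smul_mul_assoc, add_comm]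

/-- Derivations lower the weight by at most one. -/
theorem IsDerOver.mem_weightGE {M' : GMod A} {N' : ℕ∞} {e : ℤ} {f : M ⟶ M'}
    {D : SymAlg M ⊤ →ₗ[k] SymAlg M' N'}
    (hD : IsDerOver e (Sym.map f (N := ⊤) (N' := N') le_top) D) {j : ℕ} {s : SymAlg M ⊤}
    (hs : s ∈ weightGE M ⊤ (j + 1)) : D s ∈ weightGE M' N' j := by
  have hφ : ∀ s, (Sym.map f (N := ⊤) (N' := N') le_top).toAlgHom s = map f le_top s := fun _ => rfl
  have h1 : ∀ l : List M, D (l.map (ofM M ⊤)).prod ∈ weightGE M' N' (l.length - 1) := by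
    intro l
    induction l with
    | nil => exact mem_weightGE_zero _
    | cons m l ih =>
      rw [List.map_cons, List.prod_cons]
      induction m using graded_induction M.internal with
      | add x y hx hy => rw [map_add, add_mul, map_add]; exact Submodule.add_mem _ hx hy
      | hom i m hm =>
        rw [hD.2 i _ _ (ofM_mem hm), hφ, hφ, map_ofM]
        refine Submodule.add_mem _ ?_ (zsmul_mem ?_ _)
        · have h2 : map f (le_top : N' ≤ ⊤) (l.map (ofM M ⊤)).prod ∈ weightGE M' N' l.length :=
            map_mem_weightGE f le_top (Submodule.subset_span ⟨1, l, le_refl _, by simp⟩)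
          have h3 := mul_weightGE (mem_weightGE_zero (D (ofM M ⊤ m))) h2
          simpa using h3
        · cases l with
          | nil => exact mem_weightGE_zero _
          | cons m' l => exact ofM_mul_weightGE _ ih
  induction hs using Submodule.span_induction with
  | mem s hs =>
    obtain ⟨a, l, hl, rfl⟩ := hs
    induction a using graded_induction A.internal with
    | add x y hx hy => rw [map_add, add_mul, map_add]; exact Submodule.add_mem _ hx hy
    | hom i a ha =>
      rw [hD.2 i _ _ (ofA_mem ha), hφ, hφ, map_ofA]
      refine Submodule.add_mem _ ?_ (zsmul_mem ?_ _)
      · have h2 : map f (le_top : N' ≤ ⊤) (l.map (ofM M ⊤)).prod ∈ weightGE M' N' l.length :=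
          map_mem_weightGE f le_top (Submodule.subset_span ⟨1, l, le_refl _, by simp⟩)
        have h3 := mul_weightGE (mem_weightGE_zero (D (ofA M ⊤ a))) h2
        exact weightGE_mono (by omega) h3
      · exact ofA_mul_weightGE _ (weightGE_mono (by omega) (h1 l))
  | zero => simp
  | add s t _ _ hs ht => rw [map_add]; exact Submodule.add_mem _ hs ht
  | smul c s _ hs => rw [map_smul]; exact Submodule.smul_mem _ _ hs

/-- The truncation of a derivation. -/
theorem IsDerOver.exists_truncation {M' : GMod A} {e : ℤ} {f : M ⟶ M'}
    {D : SymAlg M ⊤ →ₗ[k] SymAlg M' ⊤}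
    (hD : IsDerOver e (Sym.map f (le_refl ⊤)) D) (N : ℕ) :
    ∃ D' : SymAlg M (N + 1 : ℕ) →ₗ[k] SymAlg M' N,
      D' ∘ₗ (trc M (N + 1 : ℕ)).toLinearMap = (trc M' N).toLinearMap ∘ₗ D ∧
      IsDerOver e (Sym.map f (N := (N + 1 : ℕ)) (N' := (N : ℕ)) (by exact_mod_cast Nat.le_succ N)) D' := by
  have hN : ((N : ℕ) : ℕ∞) ≤ ((N + 1 : ℕ) : ℕ∞) := by exact_mod_cast Nat.le_succ N
  -- A derivation may lower the weight by one, so values modulo weight > N require the source modulo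
  -- weight > N + 1.
  have hc : ContAt (N + 1) ((trc M' N).toLinearMap ∘ₗ D) := fun s hs =>
    (trc_eq_zero_iff N _).2 (hD.mem_weightGE hs)
  obtain ⟨D', hD'⟩ := hc.factor
  have hD1 : ∀ s, D' (trc M (N + 1 : ℕ) s) = trc M' N (D s) := fun s => DFunLike.congr_fun hD' s
  have hφ : ∀ s, (Sym.map f hN).toAlgHom (trc M (N + 1 : ℕ) s) = trc M' N (map f (le_refl ⊤) s) := by
    intro s
    change map f hN (map _ _ s) = map _ _ (map f _ s)
    rw [map_map, map_map, Category.id_comp, Category.comp_id]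
  -- Homogeneous elements have homogeneous lifts, so the signs in the Leibniz rule descend to the
  -- truncation.
  have hsurj : ∀ {i : ℤ} {s : SymAlg M (N + 1 : ℕ)}, s ∈ gr M (N + 1 : ℕ) i →
      ∃ t ∈ gr M ⊤ i, trc M (N + 1 : ℕ) t = s := by
    intro i s hs
    induction hs using Submodule.span_induction with
    | mem s hs =>
      induction hs with
      | one => exact ⟨1, one_mem_gr, _root_.map_one _⟩
      | @mulA i j a s ha hs ih =>
        obtain ⟨t, ht, rfl⟩ := ih
        exact ⟨ofA M ⊤ a * t, ofA_mul_mem ha ht, by rw [map_mul, map_ofA]⟩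
      | @mulM i j a s ha hs ih =>
        obtain ⟨t, ht, rfl⟩ := ih
        exact ⟨ofM M ⊤ a * t, ofM_mul_mem ha ht, by rw [map_mul, map_ofM]; rfl⟩
    | zero => exact ⟨0, Submodule.zero_mem _, map_zero _⟩
    | add s t _ _ hs ht =>
      obtain ⟨s, hs, rfl⟩ := hs
      obtain ⟨t, ht, rfl⟩ := ht
      exact ⟨s + t, Submodule.add_mem _ hs ht, map_add _ _ _⟩
    | smul c s _ hs =>
      obtain ⟨s, hs, rfl⟩ := hs
      exact ⟨c • s, Submodule.smul_mem _ _ hs, map_smul _ _ _⟩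
  refine ⟨D', hD', fun i s hs => ?_, fun i s t hs => ?_⟩
  · obtain ⟨s, hs', rfl⟩ := hsurj hs
    rw [hD1]
    exact (Sym.map (𝟙 M') (N := ⊤) (N' := (N : ℕ)) le_top).map_mem _ _ (hD.1 i s hs')
  · obtain ⟨s, hs', rfl⟩ := hsurj hs
    obtain ⟨t, rfl⟩ := map_surjective (M := M) (le_top : ((N + 1 : ℕ) : ℕ∞) ≤ ⊤) t
    rw [← map_mul, hD1, hD1, hD.2 i s t hs', map_add, map_zsmul, map_mul, map_mul, hD1, hφ, hφ]
    rfl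

end SymDerivations

/-! ### Operators with prescribed iterated commutators -/

section Expansion

open SHLieRinehart.SymAlg

variable {k : Type u} [Field k] [CharZero k] {A : GAlg k} {M M' : GMod A} (f : M ⟶ M')

/-- The commutator with the contraction with `x`. -/
def dcom (e : ℤ) {p : ℤ} (x : M'.dual p) (D : SymAlg M ⊤ →ₗ[k] SymAlg M' ⊤) :
    SymAlg M ⊤ →ₗ[k] SymAlg M' ⊤ :=
  D ∘ₗ ctr (GMod.dualMap f p x) - sgn (e * p) • (ctr x ∘ₗ D)

theorem dcom_apply (e : ℤ) {p : ℤ} (x : M'.dual p) (D : SymAlg M ⊤ →ₗ[k] SymAlg M' ⊤)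
    (s : SymAlg M ⊤) : dcom f e x D s = D (ctr (GMod.dualMap f p x) s) - sgn (e * p) • ctr x (D s) :=
  rfl

theorem dcom_sum_smul (e : ℤ) {p : ℤ} (x : M'.dual p) {ι : Type*} (t : Finset ι) (c : ι → k)
    (D : ι → SymAlg M ⊤ →ₗ[k] SymAlg M' ⊤) :
    dcom f e x (∑ i ∈ t, c i • D i) = ∑ i ∈ t, c i • dcom f e x (D i) := by
  ext s
  simp only [dcom_apply, LinearMap.sum_apply, LinearMap.smul_apply, map_sum, map_smul, smul_sub,
    Finset.sum_sub_distrib, Finset.smul_sum, smul_comm (sgn (e * p))]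

theorem isDerOver_dcom {e p : ℤ} {x : M'.dual p} {D : SymAlg M ⊤ →ₗ[k] SymAlg M' ⊤}
    (hD : IsDerOver e (Sym.map f (le_refl ⊤)) D) :
    IsDerOver (e + p) (Sym.map f (le_refl ⊤)) (dcom f e x D) := by
  have h := hD.commutator (isDerOver_ctr (GMod.dualMap f p x)) (isDerOver_ctr x)
    (fun s => by
      change contr x le_top (map f (le_refl ⊤) s) = map f (le_refl ⊤) _
      rw [contr_map x f (le_refl ⊤) le_top le_top (le_refl ⊤)])
  exact h

variable (b : HBasis M') (E : List (Fin b.n) → SymAlg M ⊤ →ₗ[k] SymAlg M' ⊤)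

/-- The degree of a word in the dual basis. -/
abbrev HBasis.wd (y : List (Fin b.n)) : ℤ := wdeg (fun i => - b.q i) y

/-- The part of weight `l` of the operator whose iterated commutators are given by `E`. -/
def expand : ℕ → List (Fin b.n) → SymAlg M ⊤ →ₗ[k] SymAlg M' ⊤
  | 0, y => E y
  | l + 1, y => - ∑ i, sgn (b.q i * (1 + b.wd y)) •
      (LinearMap.mulLeft k (ofM M' ⊤ (b.b i)) ∘ₗ expand l (y ++ [i]))

theorem expand_succ_apply (l : ℕ) (y : List (Fin b.n)) (s : SymAlg M ⊤) :
    expand b E (l + 1) y s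
      = - ∑ i, sgn (b.q i * (1 + b.wd y)) • (ofM M' ⊤ (b.b i) * expand b E l (y ++ [i]) s) := by
  simp [expand]

variable {f b E}

theorem isDerOver_expand (hE : ∀ y, IsDerOver (1 + b.wd y) (Sym.map f (le_refl ⊤)) (E y)) (l : ℕ)
    (y : List (Fin b.n)) : IsDerOver (1 + b.wd y) (Sym.map f (le_refl ⊤)) (expand b E l y) := by
  induction l generalizing y with
  | zero => exact hE y
  | succ l ih =>
    rw [expand, ← neg_one_zsmul]
    refine IsDerOver.zsmul _ (IsDerOver.sum _ fun i _ => IsDerOver.zsmul _ ?_)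
    refine ((ih (y ++ [i])).mul_left (Y := Sym M' ⊤) (ofM_mem (b.mem i))).cast ?_
    simp
    ring

theorem expand_swap (hsw : ∀ v i j w, E (v ++ i :: j :: w)
      = sgn (b.q i * b.q j) • E (v ++ j :: i :: w)) (l : ℕ) (v : List (Fin b.n)) (i j : Fin b.n)
    (w : List (Fin b.n)) : expand b E l (v ++ i :: j :: w)
      = sgn (b.q i * b.q j) • expand b E l (v ++ j :: i :: w) := by
  induction l generalizing w with
  | zero => exact hsw v i j w
  | succ l ih =>
    ext s
    rw [LinearMap.smul_apply, expand_succ_apply, expand_succ_apply, smul_neg, Finset.smul_sum]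
    congr 1
    refine Finset.sum_congr rfl fun t _ => ?_
    rw [List.append_assoc, List.cons_append, List.cons_append, ih, LinearMap.smul_apply,
      mul_smul_comm, smul_comm]
    congr 2
    · congr 3
      simp only [HBasis.wd, wdeg_append, wdeg_cons]
      ring
    · simp

/-- This is the analogue of `ctr_recon` for operators. E itself commutes with the contractions, so
the commutator only sees the l factors b_i, and by the graded symmetry of E each gives the same
term. The minus sign in `expand` compensates the one in front of ι_x D in the commutator. -/
theorem dcom_expand (hsw : ∀ v i j w, E (v ++ i :: j :: w)
      = sgn (b.q i * b.q j) • E (v ++ j :: i :: w))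
    (hcomm : ∀ y j, dcom f (1 + b.wd y) (b.ε j) (E y) = 0) (l : ℕ) (y : List (Fin b.n))
    (j : Fin b.n) : dcom f (1 + b.wd y) (b.ε j) (expand b E l y)
      = (l : k) • expand b E (l - 1) (y ++ [j]) := by
  induction l generalizing y with
  | zero => rw [Nat.cast_zero, zero_smul]; exact hcomm y j
  | succ l ih =>
    ext s
    have h1 : ∀ i, expand b E l (y ++ [i]) (ctr (GMod.dualMap f _ (b.ε j)) s)
        = sgn ((1 + b.wd (y ++ [i])) * - b.q j) • ctr (b.ε j) (expand b E l (y ++ [i]) s)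
          + (l : k) • expand b E (l - 1) (y ++ [i] ++ [j]) s := by
      intro i
      have h := DFunLike.congr_fun (ih (y ++ [i])) s
      rw [dcom_apply, sub_eq_iff_eq_add, LinearMap.smul_apply, add_comm] at h
      exact h
    have h2 : ctr (b.ε j) (∑ i, sgn (b.q i * (1 + b.wd y)) •
        (ofM M' ⊤ (b.b i) * expand b E l (y ++ [i]) s))
        = sgn (b.q j * (1 + b.wd y)) • expand b E l (y ++ [j]) s
          + ∑ i, sgn (b.q i * (1 + b.wd y)) • sgn (b.q i * b.q j) •
            (ofM M' ⊤ (b.b i) * ctr (b.ε j) (expand b E l (y ++ [i]) s)) := by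
      simp only [map_sum, map_zsmul, b.ctr_b_mul, smul_add, Finset.sum_add_distrib, smul_ite,
        smul_zero, Finset.sum_ite_eq', Finset.mem_univ, if_true]
    -- One step of the recursion of `expand`, with the letters i and j exchanged by symmetry; for l
    -- = 0 both sides vanish.
    have h3 : (l : k) • expand b E l (y ++ [j]) s = - ∑ i, sgn (b.q i * (1 + b.wd y)) •
        (ofM M' ⊤ (b.b i) * (l : k) • expand b E (l - 1) (y ++ [i] ++ [j]) s) := by
      cases l with
      | zero => simp
      | succ l =>
        rw [expand_succ_apply, smul_neg, Finset.smul_sum]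
        congr 1
        refine Finset.sum_congr rfl fun i _ => ?_
        have h4 := DFunLike.congr_fun (expand_swap hsw l y i j []) s
        rw [LinearMap.smul_apply] at h4
        rw [Nat.add_sub_cancel, List.append_assoc, List.append_assoc, List.singleton_append,
          List.singleton_append, h4, smul_comm _ (sgn _), mul_smul_comm, mul_smul_comm,
          smul_comm ((l + 1 : ℕ) : k) (sgn (b.q i * b.q j)), smul_smul, ← sgn_add]
        congr 1
        apply sgn_congr
        simp only [HBasis.wd, wdeg_append, wdeg_cons, wdeg_nil]
        exact ⟨- (b.q i * b.q j), by ring⟩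
    have h5 : ∀ i, sgn (b.q i * (1 + b.wd y)) • (ofM M' ⊤ (b.b i) *
        (sgn ((1 + b.wd (y ++ [i])) * - b.q j) • ctr (b.ε j) (expand b E l (y ++ [i]) s)))
        = sgn ((1 + b.wd y) * - b.q j) • sgn (b.q i * (1 + b.wd y)) • sgn (b.q i * b.q j) •
            (ofM M' ⊤ (b.b i) * ctr (b.ε j) (expand b E l (y ++ [i]) s)) := by
      intro i
      rw [mul_smul_comm, smul_smul, smul_smul, smul_smul, ← sgn_add, ← sgn_add, ← sgn_add]
      congr 1
      apply sgn_congr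
      simp only [HBasis.wd, wdeg_append, wdeg_cons, wdeg_nil]
      exact ⟨0, by ring⟩
    rw [dcom_apply, expand_succ_apply, expand_succ_apply, map_neg, h2, Nat.add_sub_cancel,
      LinearMap.smul_apply, Nat.cast_succ, add_smul, one_smul, h3]
    have h7 : ∀ i, sgn (b.q i * (1 + b.wd y)) • (ofM M' ⊤ (b.b i) *
        (sgn ((1 + b.wd (y ++ [i])) * - b.q j) • ctr (b.ε j) (expand b E l (y ++ [i]) s)
          + (l : k) • expand b E (l - 1) (y ++ [i] ++ [j]) s))
        = sgn ((1 + b.wd y) * - b.q j) • sgn (b.q i * (1 + b.wd y)) • sgn (b.q i * b.q j) •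
            (ofM M' ⊤ (b.b i) * ctr (b.ε j) (expand b E l (y ++ [i]) s))
          + sgn (b.q i * (1 + b.wd y)) • (ofM M' ⊤ (b.b i) *
            (l : k) • expand b E (l - 1) (y ++ [i] ++ [j]) s) := by
      intro i
      rw [mul_add (ofM M' ⊤ (b.b i)), smul_add, h5]
    simp only [h1, h7, smul_add, Finset.sum_add_distrib, ← Finset.smul_sum, smul_neg]
    have h6 : sgn ((1 + b.wd y) * - b.q j) • sgn (b.q j * (1 + b.wd y)) • expand b E l (y ++ [j]) s
        = expand b E l (y ++ [j]) s := by
      rw [mul_neg, sgn_neg, mul_comm (b.q j), sgn_smul_sgn_smul]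
    rw [h6]
    abel

theorem proj_expand_succ (l : ℕ) (y : List (Fin b.n)) (s : SymAlg M ⊤) :
    proj M' ⊤ (expand b E (l + 1) y s) = 0 := by
  rw [expand_succ_apply, map_neg, map_sum, neg_eq_zero]
  refine Finset.sum_eq_zero fun i _ => ?_
  rw [map_zsmul, map_mul, proj_ofM, zero_mul, smul_zero]

variable (b E) in
/-- The operator whose iterated commutators are given by `E`, up to weight `N`. -/
def expSeries (N : ℕ) (y : List (Fin b.n)) : SymAlg M ⊤ →ₗ[k] SymAlg M' ⊤ :=
  ∑ l ∈ Finset.range (N + 1), (l.factorial : k)⁻¹ • expand b E l y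

theorem proj_expSeries (N : ℕ) (y : List (Fin b.n)) (s : SymAlg M ⊤) :
    proj M' ⊤ (expSeries b E N y s) = proj M' ⊤ (E y s) := by
  rw [expSeries, LinearMap.sum_apply, map_sum, Finset.sum_range_succ']
  simp only [LinearMap.smul_apply, map_smul, proj_expand_succ, smul_zero, Finset.sum_const_zero,
    zero_add]
  simp [expand]

theorem isDerOver_expSeries (hE : ∀ y, IsDerOver (1 + b.wd y) (Sym.map f (le_refl ⊤)) (E y))
    (N : ℕ) (y : List (Fin b.n)) :
    IsDerOver (1 + b.wd y) (Sym.map f (le_refl ⊤)) (expSeries b E N y) :=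
  IsDerOver.sum _ fun l _ => (isDerOver_expand hE l y).smul _

/-- Each commutator consumes one order of the series and appends one letter. Iterated along a word y
it leaves a series with the same projection as E y (`proj_expSeries`), so E prescribes all iterated
commutators at once. -/
theorem dcom_expSeries (hsw : ∀ v i j w, E (v ++ i :: j :: w)
      = sgn (b.q i * b.q j) • E (v ++ j :: i :: w))
    (hcomm : ∀ y j, dcom f (1 + b.wd y) (b.ε j) (E y) = 0) (N : ℕ) (y : List (Fin b.n))
    (j : Fin b.n) : dcom f (1 + b.wd y) (b.ε j) (expSeries b E (N + 1) y)
      = expSeries b E N (y ++ [j]) := by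
  rw [expSeries, dcom_sum_smul, Finset.sum_range_succ', dcom_expand hsw hcomm, Nat.cast_zero,
    zero_smul, smul_zero, add_zero, expSeries]
  refine Finset.sum_congr rfl fun l _ => ?_
  rw [dcom_expand hsw hcomm, Nat.add_sub_cancel, smul_smul]
  congr 1
  have h1 : ((l + 1 : ℕ) : k) ≠ 0 := Nat.cast_ne_zero.2 (Nat.succ_ne_zero l)
  rw [Nat.factorial_succ, Nat.cast_mul, mul_inv, mul_comm, ← mul_assoc, mul_inv_cancel₀ h1, one_mul]

end Expansion

/-! ### Derivations that treat a basis as constant -/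

section BasicDerivation

open SHLieRinehart.SymAlg

variable {k : Type u} [Field k] [CharZero k] {A : GAlg k} {M M' : GMod A} (f : M ⟶ M')

/-- The derivation given by an element of the dual and a derivation of the base, extended to be
constant on a basis. -/
theorem exists_basic_derivation (b : HBasis M') {e : ℤ} (x : M.dual e) {θ : A →ₗ[k] A}
    (hθ : IsDerOver e (𝟙 A) θ) : ∃ D : SymAlg M ⊤ →ₗ[k] SymAlg M' ⊤,
      IsDerOver e (Sym.map f (le_refl ⊤)) D ∧ (∀ a, D (ofA M ⊤ a) = ofA M' ⊤ (θ a)) ∧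
      ∀ m, D (ofM M ⊤ m) = ofA M' ⊤ (x.1 m)
        + ∑ i, ofA M' ⊤ (θ (b.b.repr (f.toLin m) i)) * ofM M' ⊤ (b.b i) := by
  have hφA : ∀ a, (Sym.map f (le_refl ⊤)).toAlgHom (ofA M ⊤ a) = ofA M' ⊤ a :=
    map_ofA f (le_refl ⊤)
  have hφM : ∀ m, (Sym.map f (le_refl ⊤)).toAlgHom (ofM M ⊤ m) = ofM M' ⊤ (f.toLin m) :=
    map_ofM f (le_refl ⊤)
  obtain ⟨D, h1, h2, h3⟩ := exists_isDerOver (e := e) (Y := Sym M' ⊤) (Sym.map f (le_refl ⊤))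
    ((ofA M' ⊤).toLinearMap ∘ₗ θ)
    ((ofA M' ⊤).toLinearMap ∘ₗ x.1 + ∑ i, LinearMap.mulRight k (ofM M' ⊤ (b.b i)) ∘ₗ
      (ofA M' ⊤).toLinearMap ∘ₗ θ ∘ₗ ((b.b.coord i) ∘ₗ f.toLin).restrictScalars k)
    (fun i a ha => ofA_mem (hθ.1 i a ha))
    (fun i m hm => by
      rw [LinearMap.add_apply, LinearMap.sum_apply]
      refine Submodule.add_mem _ (ofA_mem (x.2.1 i m hm)) (Submodule.sum_mem _ fun t _ => ?_)
      have := mul_mem (ofA_mem (N := ⊤) (M := M') (hθ.1 _ _ (b.repr_mem (f.map_mem i m hm) t)))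
        (ofM_mem (N := ⊤) (b.mem t))
      have e1 : i - b.q t + e + b.q t = i + e := by ring
      rw [e1] at this
      exact this)
    (fun i a c ha => by
      rw [hφA, hφA]
      change ofA M' ⊤ (θ (a * c)) = ofA M' ⊤ (θ a) * _ + sgn (e * i) • (_ * ofA M' ⊤ (θ c))
      rw [hθ.2 i a c ha, map_add, map_zsmul, map_mul, map_mul]
      rfl)
    (fun i a m ha => by
      rw [hφA, hφM]
      simp only [LinearMap.add_apply, LinearMap.sum_apply, LinearMap.comp_apply,
        LinearMap.restrictScalars_apply, LinearMap.mulRight_apply, AlgHom.toLinearMap_apply,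
        Module.Basis.coord_apply, map_smul, Finsupp.smul_apply, smul_eq_mul]
      have h1 : ∀ c, θ (a * c) = θ a * c + sgn (e * i) • (a * θ c) := fun c => hθ.2 i a c ha
      have h2 : ofM M' ⊤ (f.toLin m) = ∑ t, ofA M' ⊤ (b.b.repr (f.toLin m) t) * ofM M' ⊤ (b.b t) := by
        conv_lhs => rw [← b.sum_repr (f.toLin m)]
        rw [map_sum]
        simp only [ofM_smul]
      rw [x.2.2 i a m ha, h2]
      simp only [h1, map_add, map_zsmul, map_mul, add_mul, smul_mul_assoc, Finset.sum_add_distrib,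
        mul_add, smul_add, Finset.mul_sum, Finset.smul_sum, mul_assoc]
      abel)
  refine ⟨D, h1, h2, fun m => (h3 m).trans ?_⟩
  rw [LinearMap.add_apply, LinearMap.sum_apply]
  rfl

/-- Apart from the scalar x(m), the derivation acts on generators from M through the coordinates
only, and ε_j reads off one coordinate; so the two operations commute up to sign. -/
theorem dcom_basic_derivation {b : HBasis M'} {e : ℤ} {x : M.dual e} {θ : A →ₗ[k] A}
    (hθ : IsDerOver e (𝟙 A) θ) {D : SymAlg M ⊤ →ₗ[k] SymAlg M' ⊤}
    (hD : IsDerOver e (Sym.map f (le_refl ⊤)) D) (hA : ∀ a, D (ofA M ⊤ a) = ofA M' ⊤ (θ a))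
    (hM : ∀ m, D (ofM M ⊤ m) = ofA M' ⊤ (x.1 m)
        + ∑ i, ofA M' ⊤ (θ (b.b.repr (f.toLin m) i)) * ofM M' ⊤ (b.b i)) (j : Fin b.n) :
    dcom f e (b.ε j) D = 0 := by
  refine (isDerOver_dcom f hD).ext_sym IsDerOver.zero (fun a => ?_) (fun m => ?_)
  · rw [dcom_apply, contr_ofA, map_zero, hA, contr_ofA, smul_zero, sub_zero]
    rfl
  · have hpar : ∀ c, θ (A.parity (b.q j) c) = sgn (e * b.q j) • A.parity (b.q j) (θ c) := by
      intro c
      induction c using graded_induction A.internal with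
      | add x y hx hy => simp only [map_add, smul_add, hx, hy]
      | hom i c hc =>
        rw [A.parity_of_mem _ hc, A.parity_of_mem _ (hθ.1 i c hc), map_zsmul, smul_smul, ← sgn_add]
        congr 1
        apply sgn_congr
        exact ⟨- (e * b.q j), by ring⟩
    have h1 : ∀ (c : A) i, ctr (b.ε j) (ofA M' ⊤ c * ofM M' ⊤ (b.b i))
        = if j = i then ofA M' ⊤ (A.parity (b.q j) c) else 0 := by
      intro c i
      rw [← ofM_smul, contr_ofM, b.ε_apply, map_smul, Finsupp.smul_apply, Module.Basis.repr_self,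
        Finsupp.single_apply, smul_eq_mul]
      by_cases h : j = i
      · rw [if_pos h, if_pos h.symm, mul_one]
      · rw [if_neg h, if_neg (fun e => h e.symm), mul_zero, map_zero, map_zero]
    rw [dcom_apply, contr_ofM, hA, hM, map_add, contr_ofA, zero_add, map_sum]
    simp only [h1, Finset.sum_ite_eq, Finset.mem_univ, if_true]
    have h2 : (GMod.dualMap f (- b.q j) (b.ε j)).1 m = A.parity (b.q j) (b.b.repr (f.toLin m) j) := rfl
    rw [h2, hpar, map_zsmul, mul_neg, sgn_neg, sub_self]
    rfl

end BasicDerivation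

/-! ### Reduction to words in a dual basis -/

section DualLetters

variable {k : Type u} [Field k] {A : GAlg k} {M M' : GMod A}

/-- Homogeneous elements of the dual, as letters. -/
def DLetter (M : GMod A) : Type u := Σ p : ℤ, M.dual p

/-- The letter given by an element of the dual. -/
def dlet {p : ℤ} (x : M.dual p) : DLetter M := ⟨p, x⟩

/-- The degree of a letter. -/
def dldeg (x : DLetter M) : ℤ := x.1

/-- The elements of the dual basis, as letters. -/
def HBasis.dl (b : HBasis M) (i : Fin b.n) : DLetter M := ⟨- b.q i, b.ε i⟩

/-- The transpose on letters. -/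
def DLetter.map (f : M ⟶ M') (x : DLetter M') : DLetter M := ⟨x.1, GMod.dualMap f x.1 x.2⟩

/-- A property of words of dual elements which is symmetric and linear (in a weak sense) holds if it
holds for words in a dual basis. -/
theorem ext_dual_words (b : HBasis M) (G : List (DLetter M) → Prop) (N : ℕ)
    (hS : ∀ v x y w, G (v ++ x :: y :: w) → G (v ++ y :: x :: w))
    (hZ : ∀ u p, G (u ++ [dlet (0 : M.dual p)]))
    (hA : ∀ u p (x y : M.dual p), G (u ++ [dlet x]) → G (u ++ [dlet y]) → G (u ++ [dlet (x + y)]))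
    (hL : ∀ u (i p q : ℤ) (a : A) (ha : a ∈ A.gr i) (h : i + p = q) (x : M.dual p), G u →
      G (u ++ [dlet x]) → G (u ++ [dlet (GMod.dualMul ha h x)]))
    (hB : ∀ v : List (Fin b.n), v.length ≤ N → G (v.map b.dl)) (u : List (DLetter M))
    (hu : u.length ≤ N) : G u := by
  -- By adjacent exchanges the last letter may be moved to any earlier place.
  have hR : ∀ (u v : List (DLetter M)) (x : DLetter M), G (v ++ u ++ [x]) → G (v ++ x :: u) := by
    intro u
    induction u with
    | nil => intro v x h; simpa using h
    | cons y u ih =>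
      intro v x h
      refine hS v y x u ?_
      have := ih (v ++ [y]) x (by simpa using h)
      simpa using this
  -- Induction on the length, and inside it on the number of letters not yet in the basis. The outer
  -- induction is needed because the rule `hL` for multiples refers to the shorter word as well.
  have key : ∀ l, l ≤ N → ∀ (u : List (DLetter M)) (v : List (Fin b.n)), u.length + v.length = l →
      G (u ++ v.map b.dl) := by
    intro l
    induction l with
    | zero =>
      intro _ u v h
      obtain rfl : u = [] := List.length_eq_zero_iff.1 (by omega)
      exact hB v (by omega)
    | succ l ihl =>
      intro hl u
      induction u with
      | nil => intro v h; exact hB v (by simp at h; omega)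
      | cons x u ihu =>
        intro v h
        have hlen : u.length + v.length = l := by simp at h; omega
        refine hR (u ++ v.map b.dl) [] x ?_
        rw [List.nil_append]
        obtain ⟨p, x⟩ := x
        change G (u ++ v.map b.dl ++ [dlet x])
        rw [b.dual_eq_sum x]
        generalize (Finset.univ : Finset (Fin b.n)) = s
        induction s using Finset.induction_on with
        | empty => exact hZ _ _
        | insert i s hi ih =>
          rw [Finset.sum_insert hi]
          refine hA _ _ _ _ (hL _ _ _ _ _ _ _ _ (ihl (by omega) u v hlen) ?_) ih
          have := ihu (v ++ [i]) (by simp; omega)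
          rw [List.map_append, ← List.append_assoc] at this
          exact this
  simpa using key u.length hu u [] (by simp)

end DualLetters

/-! ### Naturality of iterated brackets -/

section Natural

variable {k : Type u} [Field k] {Λ Λ' : Type*} {deg : Λ → ℤ} {deg' : Λ' → ℤ}
  {W₀ W₁ W₂ : Type*} [AddCommGroup W₀] [Module k W₀] [AddCommGroup W₁] [Module k W₁]
  [AddCommGroup W₂] [Module k W₂]
  {ι₀ : Λ → W₀ →ₗ[k] W₀} {ι₁ : Λ' → W₁ →ₗ[k] W₁} {ι₂ : Λ' → W₂ →ₗ[k] W₂}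

theorem brL_natural (π : Λ → Λ') (hπ : ∀ x, deg' (π x) = deg x) (P : W₀ →ₗ[k] W₁)
    (hP : ∀ x s, ι₁ (π x) (P s) = P (ι₀ x s)) (e : ℤ) (Q : W₁ →ₗ[k] W₂) (w : List Λ) (s : W₀) :
    brL deg ι₀ (fun x => ι₂ (π x)) e (Q ∘ₗ P) w s = brL deg' ι₁ ι₂ e Q (w.map π) (P s) := by
  induction w generalizing e Q with
  | nil => rfl
  | cons x w ih =>
    rw [List.map_cons, brL_cons, brL_cons, hπ, ← ih]
    congr 2
    ext s
    simp only [brk_apply, LinearMap.comp_apply, hP]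

theorem brL_comm {e : ℤ} {Q : W₀ →ₗ[k] W₂} {ι₀ : Λ → W₀ →ₗ[k] W₀} {ι₂ : Λ → W₂ →ₗ[k] W₂}
    {P₀ : W₀ →ₗ[k] W₀} {P₂ : W₂ →ₗ[k] W₂}
    (h₀ : ∀ x s, ι₀ x (P₀ s) = P₀ (ι₀ x s)) (h₂ : ∀ x s, ι₂ x (P₂ s) = P₂ (ι₂ x s))
    (hQ : ∀ s, Q (P₀ s) = P₂ (Q s)) (w : List Λ) (s : W₀) :
    brL deg ι₀ ι₂ e Q w (P₀ s) = P₂ (brL deg ι₀ ι₂ e Q w s) := by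
  induction w generalizing e Q with
  | nil => exact hQ s
  | cons x w ih =>
    rw [brL_cons]
    refine ih fun s => ?_
    simp only [brk_apply, hQ, h₀, h₂, map_sub, map_zsmul]

end Natural

/-! ### The Leibniz rule of a multiderivation on words -/

section Leibniz

variable {k : Type u} [Field k] {A : GAlg k} {V : GMod A} (X : MultiDer V)

namespace MultiDer

theorem ofFn_concat {Λ : Type*} {l : ℕ} (v : Fin l → Λ) (x : Λ) :
    List.ofFn v ++ [x] = List.ofFn (Fin.snoc (α := fun _ => Λ) v x) := by
  rw [List.ofFn_succ']
  simp

theorem val_snoc {l : ℕ} (v : Fin l → Letter V) (x : Letter V) :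
    (fun i => ((Fin.snoc (α := fun _ => Letter V) v x : Fin (l + 1) → Letter V) i).val)
      = Fin.snoc (α := fun _ => V) (fun i => (v i).val) x.val := by
  funext i
  induction i using Fin.lastCases <;> simp

theorem XL_concat_smul (w : List (Letter V)) {i p : ℤ} {a : A} (ha : a ∈ A.gr i) {m : V}
    (hm : m ∈ V.gr p) : X.XL (w ++ [letter (V.smul_mem ha hm)])
      = X.σL w a • m + sgn (i * (1 + wdeg ldeg w)) • (a • X.XL (w ++ [letter hm])) := by
  obtain ⟨l, v, rfl⟩ := exists_ofFn w
  rw [ofFn_concat, ofFn_concat, XL_ofFn, XL_ofFn, val_snoc, val_snoc, σL_ofFn, wdeg_ofFn]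
  exact X.leibniz l _ _ (fun i => (v i).mem) i a ha m

theorem σL_concat_smul (w : List (Letter V)) {i p : ℤ} {a : A} (ha : a ∈ A.gr i) {m : V}
    (hm : m ∈ V.gr p) : X.σL (w ++ [letter (V.smul_mem ha hm)])
      = sgn (i * (1 + wdeg ldeg w)) • (lmulA a ∘ₗ X.σL (w ++ [letter hm])) := by
  obtain ⟨l, v, rfl⟩ := exists_ofFn w
  rw [ofFn_concat, ofFn_concat, σL_ofFn, σL_ofFn, val_snoc, val_snoc, wdeg_ofFn]
  ext c
  have h := X.σ_smul (l + 1) (Fin.snoc (α := fun _ => ℤ) (fun i => ldeg (v i)) p)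
    (Fin.snoc (α := fun _ => V) (fun i => (v i).val) m)
    (fun j => by
      induction j using Fin.lastCases with
      | last => simpa using hm
      | cast j => simpa using (v j).mem) i a ha (Fin.last l) c
  have h1 : Function.update (Fin.snoc (α := fun _ => V) (fun i => (v i).val) m : Fin (l + 1) → V)
      (Fin.last l) (a • (Fin.snoc (α := fun _ => V) (fun i => (v i).val) m : Fin (l + 1) → V)
        (Fin.last l)) = Fin.snoc (α := fun _ => V) (fun i => (v i).val) (a • m) := by
    rw [Fin.snoc_last, Fin.update_snoc_last]
  have h2 : ∑ j ∈ Finset.univ.filter (· < Fin.last l),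
      (Fin.snoc (α := fun _ => ℤ) (fun i => ldeg (v i)) p : Fin (l + 1) → ℤ) j
      = ∑ i, ldeg (v i) := by
    rw [Finset.sum_filter, Fin.sum_univ_castSucc]
    simp [Fin.castSucc_lt_last]
  rw [h1, h2] at h
  exact h

end MultiDer

variable [CharZero k] {M : ProObj (GMod A)} (J : Duality M V)

theorem kap_concat_smul (w : List (Letter V)) {i p : ℤ} {a : A} (ha : a ∈ A.gr i) {m : V}
    (hm : m ∈ V.gr p) :
    kap J (X.XL (w ++ [letter (V.smul_mem ha hm)])) (X.σL (w ++ [letter (V.smul_mem ha hm)]))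
      = kap J (X.σL w a • m) 0 + sgn (i * (1 + wdeg ldeg w)) •
        postW (lmulA a) (kap J (X.XL (w ++ [letter hm])) (X.σL (w ++ [letter hm]))) := by
  rw [X.XL_concat_smul w ha hm, X.σL_concat_smul w ha hm, postW_lmulA_kap, ← kap_zsmul,
    ← kap_add, zero_add]

end Leibniz

/-! ### Brackets of operators defined on the functionals of one stage -/

section Mixed

open SHLieRinehart.SymAlg

variable {k : Type u} [Field k] [CharZero k] {A : GAlg k} {M : ProObj (GMod A)} {V : GMod A}
  (J : Duality M V)

/-- The letter of `V` given by an element of a dual. -/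
def jl (α : M.I) (x : DLetter (M.X α)) : Letter V := letter (J.j_mem α x.1 x.2)

theorem jl_val {α : M.I} {p : ℤ} (x : (M.X α).dual p) : (jl J α (dlet x)).val = J.j α p x := rfl

theorem jl_map {α β : M.I} (h : α ≤ β) (x : DLetter (M.X α)) : jl J β (x.map (M.map h)) = jl J α x :=
  letter_congr (x := jl J α x) (J.compat h x.1 x.2) _

/-- Contraction of functionals with a letter. -/
def dctr {M : GMod A} (x : DLetter M) : contFun M →ₗ[k] contFun M := cctr x.2

theorem dctr_comm {M : GMod A} :
    GComm (k := k) (W₁ := contFun M) dldeg (dctr (M := M)) := fun x y g => by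
  refine Subtype.ext (LinearMap.ext fun s => ?_)
  change g.1 (ctr _ (ctr _ s)) = (sgn (x.1 * y.1) • (g.1 ∘ₗ ctr _ ∘ₗ ctr _)) s
  rw [ctr_comm, map_zsmul, mul_comm]
  rfl

theorem wdeg_map_jl (α : M.I) (w : List (DLetter (M.X α))) :
    wdeg ldeg (w.map (jl J α)) = wdeg dldeg w := by
  rw [wdeg, wdeg, List.map_map]; rfl

/-- Iterated brackets of an operator on the functionals on one of the symmetric algebras. -/
def brM (α : M.I) (e : ℤ) (Q : contFun (M.X α) →ₗ[k] Wfun M) (w : List (DLetter (M.X α))) :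
    contFun (M.X α) →ₗ[k] Wfun M :=
  brL (k := k) (W₁ := contFun (M.X α)) dldeg dctr (fun x => lctr J (jl J α x)) e Q w

theorem brM_concat (α : M.I) (e : ℤ) (Q : contFun (M.X α) →ₗ[k] Wfun M)
    (w : List (DLetter (M.X α))) (x : DLetter (M.X α)) (s : contFun (M.X α)) :
    brM J α e Q (w ++ [x]) s = lctr J (jl J α x) (brM J α e Q w s)
      - sgn ((e + wdeg dldeg w) * dldeg x) • brM J α e Q w (dctr x s) := by
  rw [brM, brL_concat, brk_apply]; rfl

theorem brM_swap (α : M.I) (e : ℤ) (Q : contFun (M.X α) →ₗ[k] Wfun M)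
    (v : List (DLetter (M.X α))) (x y : DLetter (M.X α)) (w : List (DLetter (M.X α))) :
    brM J α e Q (v ++ x :: y :: w) = sgn (dldeg x * dldeg y) • brM J α e Q (v ++ y :: x :: w) :=
  brL_swap (W₁ := contFun (M.X α)) dctr_comm (fun x y s => gComm_lctr J (jl J α x) (jl J α y) s) e Q v x y w

/-- The multiderivation `X` is given by the iterated brackets of `Q` along words `w`. -/
def StarM (X : MultiDer V) {α : M.I} (Q : contFun (M.X α) →ₗ[k] Wfun M)
    (w : List (DLetter (M.X α))) : Prop :=
  brM J α 1 Q w (cproj _) = kap J (X.XL (w.map (jl J α))) (X.σL (w.map (jl J α)))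

/-- Both sides are graded symmetric, additive in the last letter, and obey the same rule for a
multiple am: the bracket by `ctrW_smul_kap`, the multiderivation by its Leibniz axiom. So the
identity spreads from words in a dual basis to all words of length ≤ N. -/
theorem starM_of_basis (X : MultiDer V) {α : M.I} {Q : contFun (M.X α) →ₗ[k] Wfun M}
    (hQ : ∀ θ s, Q (cpost θ s) = postW θ (Q s)) (b : HBasis (M.X α)) (N : ℕ)
    (h : ∀ u : List (Fin b.n), u.length ≤ N → StarM J X Q (u.map b.dl))
    (w : List (DLetter (M.X α))) (hw : w.length ≤ N) : StarM J X Q w := by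
  have hadd : ∀ u p (x y : (M.X α).dual p), brM J α 1 Q (u ++ [dlet (x + y)])
      = brM J α 1 Q (u ++ [dlet x]) + brM J α 1 Q (u ++ [dlet y]) := by
    intro u p x y
    ext s
    have h1 : lctr J (jl J α (dlet (x + y))) = lctr J (jl J α (dlet x)) + lctr J (jl J α (dlet y)) := by
      exact (congrArg (ctrW J) (map_add (J.j α p) x y)).trans (map_add _ _ _)
    have h2 : dctr (dlet (x + y)) = dctr (dlet x) + dctr (dlet y) := map_add _ _ _
    rw [LinearMap.add_apply, brM_concat, brM_concat, brM_concat, h1, h2, LinearMap.add_apply,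
      LinearMap.add_apply, map_add, smul_add, add_sub_add_comm]
    rfl
  have hXadd : ∀ (u : List (Letter V)) p (x y : (M.X α).dual p),
      kap J (X.XL (u ++ [jl J α (dlet (x + y))])) (X.σL (u ++ [jl J α (dlet (x + y))]))
        = kap J (X.XL (u ++ [jl J α (dlet x)])) (X.σL (u ++ [jl J α (dlet x)]))
          + kap J (X.XL (u ++ [jl J α (dlet y)])) (X.σL (u ++ [jl J α (dlet y)])) := by
    intro u p x y
    obtain ⟨l, v, rfl⟩ := MultiDer.exists_ofFn u
    rw [← kap_add]
    simp only [MultiDer.ofFn_concat, MultiDer.XL_ofFn, MultiDer.σL_ofFn, MultiDer.val_snoc, jl_val]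
    rw [map_add]
    have hs : ∀ z : V, (Fin.snoc (α := fun _ => V) (fun i => (v i).val) z : Fin (l + 1) → V)
        = Function.update (Fin.snoc (α := fun _ => V) (fun i => (v i).val) 0) (Fin.last l) z := by
      intro z; rw [Fin.update_snoc_last]
    rw [hs (_ + _), MultilinearMap.map_update_add, MultilinearMap.map_update_add, ← hs, ← hs]
  have hzero : ∀ u p, StarM J X Q (u ++ [dlet (0 : (M.X α).dual p)]) := by
    intro u p
    have h1 := hadd u p 0 0
    have h2 := hXadd (u.map (jl J α)) p 0 0
    rw [add_zero] at h1 h2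
    rw [left_eq_add] at h1 h2
    rw [StarM, List.map_append, List.map_singleton, h1, h2]
    rfl
  refine ext_dual_words b (StarM J X Q) N ?_ hzero ?_ ?_ h w hw
  · intro v x y w h
    rw [StarM] at h ⊢
    rw [brM_swap] at h
    rw [List.map_append, List.map_cons, List.map_cons] at h ⊢
    rw [X.XL_swap, X.σL_swap, kap_zsmul] at h
    have := congrArg (fun t => sgn (dldeg x * dldeg y) • t) h
    simp only [LinearMap.smul_apply] at this
    rw [sgn_smul_sgn_smul] at this
    refine this.trans ?_
    exact sgn_smul_sgn_smul _ _
  · intro u p x y hx hy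
    rw [StarM, List.map_append, List.map_singleton] at hx hy ⊢
    rw [hadd, hXadd, LinearMap.add_apply, hx, hy]
  · rintro u i p q a ha rfl x hu hx
    have hjl : jl J α (dlet (GMod.dualMul ha rfl x)) = letter (V.smul_mem ha (J.j_mem α p x)) :=
      (letter_congr (x := letter (V.smul_mem ha (J.j_mem α p x)))
        (J.j_smul α i p a ha x (GMod.dualMul ha rfl x) (fun m => by simp)) _)
    have hc : dctr (dlet (GMod.dualMul ha rfl x)) (cproj _)
        = cpost (lmulA a) (dctr (dlet x) (cproj _)) := by
      refine Subtype.ext (LinearMap.ext fun s => ?_)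
      change proj _ _ (ctr (GMod.dualMul ha rfl x) s) = lmulA a (proj _ _ (ctr x s))
      rw [ctr, contr_mul_left x (GMod.dualMul ha rfl x) ha (add_comm p i) (fun m => by simp), map_mul,
        proj_ofA]
      rfl
    have hcomm : ∀ s, brM J α 1 Q u (cpost (lmulA a) s) = postW (lmulA a) (brM J α 1 Q u s) :=
      fun s => brL_comm (W₀ := contFun (M.X α)) (P₀ := cpost (lmulA a)) (P₂ := postW (lmulA a)) (ι₀ := dctr) (ι₂ := fun x => lctr J (jl J α x)) (fun x s => rfl) (fun x s => ctrW_postW J _ _ s) (hQ _) u s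
    rw [StarM] at hu hx ⊢
    rw [List.map_append, List.map_singleton] at hx ⊢
    rw [hjl, kap_concat_smul X J _ ha (J.j_mem α p x)]
    have hx' : brM J α 1 Q (u ++ [dlet x]) (cproj _) = kap J (X.XL (u.map (jl J α) ++ [letter (J.j_mem α p x)]))
      (X.σL (u.map (jl J α) ++ [letter (J.j_mem α p x)])) := hx
    rw [← hx', brM_concat, brM_concat]
    rw [hc, hcomm, hjl, hu, lctr_letter, ctrW_smul_kap J ha (J.j_mem α p x)
      (X.XL_mem _) (X.σL_der _), wdeg_map_jl, map_sub, map_zsmul, smul_sub, smul_smul, ← sgn_add,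
      mul_comm i, add_sub_assoc]
    congr 3
    change sgn ((1 + wdeg dldeg u) * (i + p)) = sgn _
    congr 1
    change (1 + wdeg dldeg u) * (i + p) = (1 + wdeg dldeg u) * i + (1 + wdeg dldeg u) * p
    ring

end Mixed

/-! ### Lifting finite families with their sign relations -/

section Lifts

variable {k : Type u} [Field k] {A : GAlg k} {M : ProObj (GMod A)} {V : GMod A}

theorem GMod.dualMap_add {M M' : GMod A} (f : M ⟶ M') (p : ℤ) (x y : M'.dual p) :
    GMod.dualMap f p (x + y) = GMod.dualMap f p x + GMod.dualMap f p y := rfl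

/-- Finitely many homogeneous elements lift to a common stage, and so do the relations
`v = ± v'` between them. -/
theorem Duality.exists_lifts (J : Duality M V) {T : Type*} [Finite T] (p : T → ℤ) (v : T → V)
    (hv : ∀ t, v t ∈ V.gr (p t)) (α₀ : M.I) : ∃ β, α₀ ≤ β ∧ ∃ x : ∀ t, (M.X β).dual (p t),
      (∀ t, J.j β _ (x t) = v t) ∧ ∀ (t t' : T) (n : ℤ), p t = p t' → v t = sgn n • v t' →
        ∀ m, (x t).1 m = sgn n • (x t').1 m := by
  choose γ z hz using fun t => J.surj (p t) (v t) (hv t)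
  obtain ⟨β, hβ, hγ⟩ := exists_upper_bound Set.univ Set.finite_univ γ α₀
  let z' : ∀ t, (M.X β).dual (p t) := fun t => GMod.dualMap (M.map (hγ t trivial)) _ (z t)
  have hz' : ∀ t, J.j β _ (z' t) = v t := fun t => (J.compat _ _ _).trans (hz t)
  -- A relation v_t = ± v_{t'} in V holds between the lifts from some stage on, and false relations
  -- impose nothing. There are finitely many triples (t, t', sign), so one stage serves all.
  have key : ∀ s : T × T × Bool, ∃ (δ : M.I) (h : β ≤ δ), p s.1 = p s.2.1 →
      v s.1 = (if s.2.2 then (1 : ℤ) else -1) • v s.2.1 →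
      ∀ m, (GMod.dualMap (M.map h) _ (z' s.1)).1 m
        = (if s.2.2 then (1 : ℤ) else -1) • (GMod.dualMap (M.map h) _ (z' s.2.1)).1 m := by
    rintro ⟨t, t', c⟩
    by_cases hp : p t = p t'
    swap
    · exact ⟨β, le_refl _, fun h => absurd h hp⟩
    by_cases hc : v t = (if c then (1 : ℤ) else -1) • v t'
    swap
    · exact ⟨β, le_refl _, fun _ h => absurd h hc⟩
    set s : ℤ := if c then (1 : ℤ) else -1
    obtain ⟨δ, h, e⟩ := J.inj β (p t) (z' t + (-(s : k)) • (hp ▸ z' t' : (M.X β).dual (p t))) (by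
      have h1 : J.j β (p t) (hp ▸ z' t') = J.j β (p t') (z' t') := by
        generalize z' t' = y at *
        clear hc
        revert y
        generalize p t' = q at *
        subst hp
        intros; rfl
      rw [map_add, map_smul, h1, hz', hz', hc, neg_smul, Int.cast_smul_eq_zsmul, add_neg_cancel])
    refine ⟨δ, h, fun _ _ m => ?_⟩
    have := congrArg (fun y : (M.X δ).dual (p t) => y.1 m) e
    change (z' t).1 ((M.map h).toLin m) + (-(s : k)) • (hp ▸ z' t' : (M.X β).dual (p t)).1 ((M.map h).toLin m)
      = 0 at this
    rw [GMod.dual_cast_apply, neg_smul, add_neg_eq_zero, Int.cast_smul_eq_zsmul] at this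
    exact this
  choose δ hδ hrel using key
  obtain ⟨ε, hε, hub⟩ := exists_upper_bound Set.univ Set.finite_univ δ β
  refine ⟨ε, hβ.trans hε, fun t => GMod.dualMap (M.map hε) _ (z' t),
    fun t => (J.compat _ _ _).trans (hz' t), fun t t' n hp hvt m => ?_⟩
  obtain ⟨c, hc⟩ : ∃ c : Bool, sgn n = if c then (1 : ℤ) else -1 := by
    rcases sgn_eq_or n with h | h
    · exact ⟨true, h⟩
    · exact ⟨false, h⟩
  rw [hc] at hvt ⊢
  have := hrel (t, t', c) hp hvt ((M.map (hub _ trivial)).toLin m)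
  have e : ∀ y : (M.X β).dual (p t), (GMod.dualMap (M.map (hδ (t, t', c))) _ y).1
      ((M.map (hub (t, t', c) trivial)).toLin m) = (GMod.dualMap (M.map hε) _ y).1 m := by
    intro y
    rw [← M.map_comp (hδ (t, t', c)) (hub (t, t', c) trivial)]; rfl
  have e' : ∀ y : (M.X β).dual (p t'), (GMod.dualMap (M.map (hδ (t, t', c))) _ y).1
      ((M.map (hub (t, t', c) trivial)).toLin m) = (GMod.dualMap (M.map hε) _ y).1 m := by
    intro y
    rw [← M.map_comp (hδ (t, t', c)) (hub (t, t', c) trivial)]; rfl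
  rw [← e, ← e']
  exact this

end Lifts

/-! ### Local construction of the derivation of a multiderivation -/

section Push

open SHLieRinehart.SymAlg

variable {k : Type u} [Field k] [CharZero k] {A : GAlg k}

/-- Operators lowering weights by at most one. -/
def LowersWeight {M M' : GMod A} (D : SymAlg M ⊤ →ₗ[k] SymAlg M' ⊤) : Prop :=
  ∀ (j : ℕ) (s : SymAlg M ⊤), s ∈ weightGE M ⊤ (j + 1) → D s ∈ weightGE M' ⊤ j

theorem IsDerOver.lowersWeight {M M' : GMod A} {e : ℤ} {f : M ⟶ M'}
    {D : SymAlg M ⊤ →ₗ[k] SymAlg M' ⊤} (hD : IsDerOver e (Sym.map f (le_refl ⊤)) D) :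
    LowersWeight D := fun _ _ hs => IsDerOver.mem_weightGE (N' := ⊤) hD hs

/-- Composition of functionals with an operator. -/
def cpush {M M' : GMod A} (D : SymAlg M ⊤ →ₗ[k] SymAlg M' ⊤) (hD : LowersWeight D) :
    contFun M' →ₗ[k] contFun M where
  toFun g := ⟨g.1 ∘ₗ D, g.2.imp' Nat.succ fun _ h _ hs => h _ (hD _ _ hs)⟩
  map_add' _ _ := rfl
  map_smul' _ _ := rfl

variable {M : ProObj (GMod A)}

/-- The operator on functionals given by composition with `D`. -/
def pushW {β α : M.I} (D : SymAlg (M.X β) ⊤ →ₗ[k] SymAlg (M.X α) ⊤) (hD : LowersWeight D) :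
    contFun (M.X α) →ₗ[k] Wfun M := cls M β ∘ₗ cpush D hD

theorem pushW_cpost {β α : M.I} {D : SymAlg (M.X β) ⊤ →ₗ[k] SymAlg (M.X α) ⊤}
    (hD : LowersWeight D) (θ : A →ₗ[k] A) (s : contFun (M.X α)) :
    pushW D hD (cpost θ s) = postW θ (pushW D hD s) :=
  (postW_cls θ β (cpush D hD s)).symm

variable {V : GMod A} (J : Duality M V)

theorem brk_pushW {β α : M.I} (h : α ≤ β) {e : ℤ}
    {D : SymAlg (M.X β) ⊤ →ₗ[k] SymAlg (M.X α) ⊤} (hD : LowersWeight D) {p : ℤ}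
    (x : (M.X α).dual p) (hD' : LowersWeight (dcom (M.map h) e x D)) :
    brk (k := k) (W₁ := contFun (M.X α)) e p (dctr (dlet x)) (lctr J (jl J α (dlet x))) (pushW D hD)
      = pushW (dcom (M.map h) e x D) hD' := by
  ext g
  rw [brk_apply]
  change ctrW J (J.j α p x) (cls M β (cpush D hD g)) - sgn (e * p) • cls M β _ = cls M β _
  rw [← J.compat h, ctrW_j_self, ← map_zsmul, ← map_sub]
  congr 1
  refine Subtype.ext (LinearMap.ext fun s => ?_)
  change g.1 (D _) - (sgn (e * p) • (g.1 ∘ₗ ctr x ∘ₗ D)) s = g.1 (dcom _ _ _ _ s)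
  rw [dcom_apply, map_sub, map_zsmul]
  rfl

/-- By `dcom_expSeries` each letter turns the series along y into the series along a longer word at
the cost of one order; the order n + |u| allows for all letters of u. -/
theorem brM_pushW {β α : M.I} (h : α ≤ β) {b : HBasis (M.X α)}
    {E : List (Fin b.n) → SymAlg (M.X β) ⊤ →ₗ[k] SymAlg (M.X α) ⊤}
    (hE : ∀ y, IsDerOver (1 + b.wd y) (Sym.map (M.map h) (le_refl ⊤)) (E y))
    (hsw : ∀ v i j w, E (v ++ i :: j :: w) = sgn (b.q i * b.q j) • E (v ++ j :: i :: w))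
    (hcomm : ∀ y j, dcom (M.map h) (1 + b.wd y) (b.ε j) (E y) = 0) (n : ℕ)
    (u y : List (Fin b.n)) :
    brM J α (1 + b.wd y) (pushW (expSeries b E (n + u.length) y)
      (isDerOver_expSeries hE _ y).lowersWeight) (u.map b.dl)
      = pushW (expSeries b E n (y ++ u)) (isDerOver_expSeries hE _ _).lowersWeight := by
  induction u generalizing y with
  | nil =>
    simp only [List.length_nil, List.map_nil, List.append_nil, add_zero]
    rfl
  | cons i u ih =>
    have h1 : y ++ i :: u = (y ++ [i]) ++ u := by simp
    have h2 : 1 + b.wd y + - b.q i = 1 + b.wd (y ++ [i]) := by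
      simp [HBasis.wd, wdeg_append, add_assoc]
    have hd := dcom_expSeries hsw hcomm (n + u.length) y i
    have h3 : brM J α (1 + b.wd y) (pushW (expSeries b E (n + (i :: u).length) y)
      (isDerOver_expSeries hE _ y).lowersWeight) ((i :: u).map b.dl)
        = brM J α (1 + b.wd y + - b.q i) (brk (k := k) (W₁ := contFun (M.X α)) (1 + b.wd y) (- b.q i)
          (dctr (dlet (b.ε i))) (lctr J (jl J α (dlet (b.ε i))))
          (pushW (expSeries b E (n + u.length + 1) y) (isDerOver_expSeries hE _ y).lowersWeight))
          (u.map b.dl) := rfl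
    rw [h3, brk_pushW J h _ (b.ε i) (by rw [hd]; exact (isDerOver_expSeries hE _ _).lowersWeight), h2]
    simp only [hd]
    rw [ih]
    simp only [h1]

variable (X : MultiDer V)

theorem jl_wdeg (α : M.I) (b : HBasis (M.X α)) (y : List (Fin b.n)) :
    wdeg ldeg (y.map (fun i => jl J α (b.dl i))) = b.wd y := by
  rw [wdeg, List.map_map]; rfl

/-- The values X(y) for the finitely many words y of length ≤ N are lifted to one stage β together
with their symmetry relations. The derivations E(y) are therefore graded symmetric exactly, and not
only in the limit. Longer words get E(y) = 0. -/
theorem exists_generators (α : M.I) (b : HBasis (M.X α)) (N : ℕ) : ∃ (β : M.I) (h : α ≤ β)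
    (E : List (Fin b.n) → SymAlg (M.X β) ⊤ →ₗ[k] SymAlg (M.X α) ⊤),
      (∀ y, IsDerOver (1 + b.wd y) (Sym.map (M.map h) (le_refl ⊤)) (E y)) ∧
      (∀ v i j w, E (v ++ i :: j :: w) = sgn (b.q i * b.q j) • E (v ++ j :: i :: w)) ∧
      (∀ y j, dcom (M.map h) (1 + b.wd y) (b.ε j) (E y) = 0) ∧
      ∀ y, y.length ≤ N → ∀ hc, cls M β ⟨(proj (M.X α) ⊤).toLinearMap ∘ₗ E y, hc⟩
        = kap J (X.XL (y.map fun i => jl J α (b.dl i))) (X.σL (y.map fun i => jl J α (b.dl i))) := by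
  have : Finite {y : List (Fin b.n) // y.length ≤ N} :=
    (List.finite_length_le (Fin b.n) N).to_subtype
  let W : List (Fin b.n) → List (Letter V) := fun y => y.map fun i => jl J α (b.dl i)
  have hW : ∀ y, wdeg ldeg (W y) = b.wd y := jl_wdeg J α b
  obtain ⟨β, h, x, hx, hrel⟩ := J.exists_lifts
    (T := {y : List (Fin b.n) // y.length ≤ N}) (fun y => 1 + b.wd y.1) (fun y => X.XL (W y.1))
    (fun y => by have := X.XL_mem (W y.1); rwa [hW] at this) α
  have hσ : ∀ y, IsDerOver (1 + b.wd y) (𝟙 A) (X.σL (W y)) := fun y => by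
    have := X.σL_der (W y); rwa [hW] at this
  have hex : ∀ y : List (Fin b.n), ∃ D : SymAlg (M.X β) ⊤ →ₗ[k] SymAlg (M.X α) ⊤,
      IsDerOver (1 + b.wd y) (Sym.map (M.map h) (le_refl ⊤)) D ∧
      (∀ hy : y.length ≤ N, (∀ a, D (ofA _ ⊤ a) = ofA _ ⊤ (X.σL (W y) a)) ∧
        ∀ m, D (ofM _ ⊤ m) = ofA _ ⊤ ((x ⟨y, hy⟩).1 m)
        + ∑ i, ofA _ ⊤ (X.σL (W y) (b.b.repr ((M.map h).toLin m) i)) * ofM _ ⊤ (b.b i)) ∧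
      (N < y.length → D = 0) := by
    intro y
    by_cases hy : y.length ≤ N
    · obtain ⟨D, h1, h2, h3⟩ := exists_basic_derivation (M.map h) b (x ⟨y, hy⟩) (hσ y)
      exact ⟨D, h1, fun _ => ⟨h2, h3⟩, fun h => absurd hy (by omega)⟩
    · exact ⟨0, IsDerOver.zero, fun h => absurd h hy, fun _ => rfl⟩
  choose E hE hEv hE0 using hex
  refine ⟨β, h, E, hE, fun v i j w => ?_, fun y j => ?_, fun y hy hc => ?_⟩
  · by_cases hy : (v ++ i :: j :: w).length ≤ N
    · have hy' : (v ++ j :: i :: w).length ≤ N := by simpa using hy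
      have hwd : b.wd (v ++ j :: i :: w) = b.wd (v ++ i :: j :: w) := by
        simp [HBasis.wd]; ring
      have e1 : X.XL (W (v ++ i :: j :: w)) = sgn (b.q i * b.q j) • X.XL (W (v ++ j :: i :: w)) := by
        simp only [W, List.map_append, List.map_cons]
        rw [X.XL_swap]
        congr 2
        exact neg_mul_neg _ _
      have e2 : X.σL (W (v ++ i :: j :: w)) = sgn (b.q i * b.q j) • X.σL (W (v ++ j :: i :: w)) := by
        simp only [W, List.map_append, List.map_cons]
        rw [X.σL_swap]
        congr 2
        exact neg_mul_neg _ _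
      have e3 := hrel ⟨_, hy⟩ ⟨_, hy'⟩ _ (congrArg (1 + ·) hwd.symm) e1
      refine IsDerOver.ext_sym (hE _) (((hE (v ++ j :: i :: w)).zsmul _).cast (by rw [hwd]))
        (fun a => ?_) (fun m => ?_)
      · rw [(hEv _ hy).1, e2, LinearMap.smul_apply, LinearMap.smul_apply, (hEv _ hy').1, map_zsmul]
      · rw [(hEv _ hy).2, e2, e3, LinearMap.smul_apply, (hEv _ hy').2, map_zsmul, smul_add,
          Finset.smul_sum]
        congr 1
        refine Finset.sum_congr rfl fun l _ => ?_
        rw [LinearMap.smul_apply, map_zsmul, smul_mul_assoc]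
    · have hy' : N < (v ++ j :: i :: w).length := by simp at hy ⊢; omega
      rw [hE0 _ (by omega), hE0 _ hy', smul_zero]
  · by_cases hy : y.length ≤ N
    · exact dcom_basic_derivation (M.map h) (hσ y) (hE y) (hEv y hy).1 (hEv y hy).2 j
    · rw [hE0 y (by omega)]
      ext s
      rw [dcom_apply]
      simp
  · have hd : IsDerOver (1 + b.wd y) (Sym.proj (M.X β) ⊤) ((proj (M.X α) ⊤).toLinearMap ∘ₗ E y) := by
      have := (hE y).comp_left (Sym.proj (M.X α) ⊤)
      rw [Sym.map_proj] at this
      exact this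
    rw [cls_eq_kap J hd hc]
    have e1 : derDual hd = x ⟨y, hy⟩ := GMod.dual_ext fun m => by
      change proj _ _ (E y (ofM _ _ m)) = _
      rw [(hEv y hy).2, map_add, proj_ofA, map_sum]
      simp
    have e2 : ((proj (M.X α) ⊤).toLinearMap ∘ₗ E y) ∘ₗ (ofA (M.X β) ⊤).toLinearMap = X.σL (W y) := by
      ext a
      change proj _ _ (E y (ofA _ _ a)) = _
      rw [(hEv y hy).1, proj_ofA]
    rw [e1, e2]
    exact congrArg (kap J · _) (hx ⟨y, hy⟩)

/-- Locally, a multiderivation is given by the iterated brackets of a derivation. -/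
theorem exists_local_derivation (hM : IsProFinite M) (α : M.I) (N : ℕ) :
    ∃ (β : M.I) (h : α ≤ β) (D : SymAlg (M.X β) ⊤ →ₗ[k] SymAlg (M.X α) ⊤)
      (hD : IsDerOver 1 (Sym.map (M.map h) (le_refl ⊤)) D),
      ∀ w, w.length ≤ N → StarM J X (pushW D hD.lowersWeight) w := by
  obtain ⟨b⟩ := (hM α).nonempty_hbasis
  obtain ⟨β, h, E, hE, hsw, hcomm, hv⟩ := exists_generators J X α b N
  have h0 : 1 + b.wd [] = 1 := by simp [HBasis.wd]
  refine ⟨β, h, expSeries b E N [], (isDerOver_expSeries hE N []).cast h0,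
    starM_of_basis J X (fun θ s => pushW_cpost _ θ s) b N fun u hu => ?_⟩
  -- The order `n` left after the letters of `u` is irrelevant, because the projection only sees the
  -- leading term `E u`.
  obtain ⟨n, rfl⟩ := Nat.exists_eq_add_of_le' hu
  have h1 := brM_pushW J h hE hsw hcomm n u []
  refine (LinearMap.congr_fun ((congrArg (fun e => brM J α e _ _) h0.symm).trans h1) _).trans ?_
  rw [List.map_map]
  have h2 : cpush (expSeries b E n ([] ++ u)) (isDerOver_expSeries hE _ _).lowersWeight
      (cproj (M.X α)) = ⟨(proj (M.X α) ⊤).toLinearMap ∘ₗ E u, 1, fun s hs => contAt_proj _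
        ((hE u).lowersWeight _ _ hs)⟩ := by
    refine Subtype.ext (LinearMap.ext fun s => ?_)
    exact proj_expSeries n u s
  exact (congrArg (cls M β) h2).trans (hv u hu _)

end Push

/-! ### Uniqueness, squares and global existence -/

section Existence

open SHLieRinehart.SymAlg

variable {k : Type u} [Field k] [CharZero k] {A : GAlg k} {M : ProObj (GMod A)} {V : GMod A}
  (J : Duality M V)

theorem cls_wordC {α : M.I} (b : HBasis (M.X α)) (u : List (Fin b.n)) :
    cls M α (b.wordC u)
      = (u.map fun i => jl J α (b.dl i)).foldr (fun x s => lctr J x s) (projW M) := by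
  induction u with
  | nil => exact cls_cproj α
  | cons i u ih =>
    rw [b.wordC_cons, List.map_cons, List.foldr_cons, ← ih]
    exact (ctrW_j_self J (b.ε i) (b.wordC u)).symm

/-- Contractions are moved one by one from the vector into the bracket, as in `word_brL_eq_zero`, so
brackets at π control R on all contraction words. -/
theorem eq_zero_of_brL {e : ℤ} {R : Wfun M →ₗ[k] Wfun M}
    (h : ∀ w, brL ldeg (lctr J) (lctr J) e R w (projW M) = 0) {α : M.I} (b : HBasis (M.X α))
    (u : List (Fin b.n)) : R (cls M α (b.wordC u)) = 0 := by
  rw [cls_wordC J]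
  exact word_brL_eq_zero Set.univ _ (projW M) e R (fun w _ _ => h w)
    (u.map fun i => jl J α (b.dl i)) [] (fun _ _ => trivial) (fun _ _ => trivial) (le_refl _)

/-- The difference of the two transposes has zero brackets at π, hence vanishes on contraction
words, and these detect pro-morphisms. -/
theorem Star.eq_of_star (hM : IsProFinite M) {X : MultiDer V}
    {F G : (toProMod k).obj (symPro M) ⟶ (toProMod k).obj (symPro M)}
    (hF : Star J X (act F)) (hG : Star J X (act G)) : F = G := by
  refine rep_hom_ext hM fun α b u => ?_
  rw [← sub_eq_zero, ← LinearMap.sub_apply]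
  refine eq_zero_of_brL J (e := 1) (fun w => ?_) b u
  rw [brL_sub, LinearMap.sub_apply, sub_eq_zero]
  exact (hF w).trans (hG w).symm

theorem brL_zero {Λ W₁ W₂ : Type*} {deg : Λ → ℤ} [AddCommGroup W₁] [Module k W₁] [AddCommGroup W₂]
    [Module k W₂] {ι₁ : Λ → W₁ →ₗ[k] W₁} {ι₂ : Λ → W₂ →ₗ[k] W₂} (e : ℤ) (w : List Λ) :
    brL deg ι₁ ι₂ e (0 : W₁ →ₗ[k] W₂) w = 0 := by
  have := brL_sub (deg := deg) (ι₁ := ι₁) (ι₂ := ι₂) e (0 : W₁ →ₗ[k] W₂) 0 w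
  rwa [sub_self, sub_self] at this

/-- By `Star.square` the brackets of F∘F at π are the Jacobi expressions of X, which `kap` recovers.
If they vanish, the transpose of F∘F vanishes on contraction words, so F∘F = 0. -/
theorem Star.comp_eq_zero_iff (hM : IsProFinite M) {X : MultiDer V}
    {F : (toProMod k).obj (symPro M) ⟶ (toProMod k).obj (symPro M)} (hF : Star J X (act F)) :
    F ≫ F = proZero _ _ ↔ X.SquareZero := by
  have hsq := hF.square (fun θ s => act_postW θ s)
  rw [X.squareZero_iff]
  constructor
  · intro h
    have h0 : act F ∘ₗ act F = 0 := by
      ext w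
      rw [LinearMap.comp_apply, ← act_comp, h, act_proZero]; rfl
    have h1 : ∀ w, X.jacL w = 0 ∧ X.anchorL w = 0 := by
      intro w
      have := hsq w
      rw [h0, brL_zero, LinearMap.zero_apply, ← kap_zero J] at this
      obtain ⟨h1, h2⟩ := kap_injective J this
      exact ⟨h1.symm, h2.symm⟩
    exact ⟨fun w => (h1 w).1, fun w => (h1 w).2⟩
  · rintro ⟨h1, h2⟩
    refine rep_hom_ext hM fun α b u => ?_
    rw [act_comp, act_proZero, ← LinearMap.comp_apply]
    refine eq_zero_of_brL J (e := 1 + 1) (fun w => ?_) b u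
    rw [hsq, h1, h2, kap_zero]

variable {J}

theorem clsT_comp_truncation {β α : M.I} {N : ℕ} {D : SymAlg (M.X β) ⊤ →ₗ[k] SymAlg (M.X α) ⊤}
    (hD : LowersWeight D) {D' : SymAlg (M.X β) (N + 1 : ℕ) →ₗ[k] SymAlg (M.X α) N}
    (h : D' ∘ₗ (trc (M.X β) (N + 1 : ℕ)).toLinearMap = (trc (M.X α) N).toLinearMap ∘ₗ D)
    {g : SymAlg (M.X α) N →ₗ[k] A} {s : contFun (M.X α)}
    (hs : g ∘ₗ (trc (M.X α) N).toLinearMap = s.1) :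
    clsT M (β, N + 1) (g ∘ₗ D') = pushW D hD s := by
  refine clsT_of_eq (i := (β, N + 1)) (g' := cpush D hD s) ?_
  change (g ∘ₗ D') ∘ₗ (trc (M.X β) (N + 1 : ℕ)).toLinearMap = s.1 ∘ₗ D
  rw [LinearMap.comp_assoc, h, ← hs, LinearMap.comp_assoc]

/-- Each contraction raises the order of a functional by at most one, so the brackets along w of a
functional of order m involve R only on functionals of order at most m + |w|. -/
theorem brM_eq_zero_of_contAt {α : M.I} {N m : ℕ} {e : ℤ} {R : contFun (M.X α) →ₗ[k] Wfun M}
    (hR : ∀ g : contFun (M.X α), ContAt N g.1 → R g = 0) (w : List (DLetter (M.X α)))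
    (hw : m + w.length ≤ N) {s : contFun (M.X α)} (hs : ContAt m s.1) : brM J α e R w s = 0 := by
  induction w generalizing N e R with
  | nil => exact hR s (hs.mono (by simpa using hw))
  | cons x w ih =>
    obtain ⟨n, rfl⟩ : ∃ n, N = n + 1 := ⟨N - 1, by simp at hw; omega⟩
    refine ih (N := n) (e := e + dldeg x) (R := brk (k := k) (W₁ := contFun (M.X α)) e (dldeg x)
      (dctr x) (lctr J (jl J α x)) R) (fun g hg => ?_) (by simp at hw; omega)
    rw [brk_apply, hR g (hg.mono (Nat.le_succ n)), map_zero, hR (dctr x g) (hg.comp_ctr x.2),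
      smul_zero, sub_zero]

theorem brP_map_jl {α : M.I} (Q : Wfun M →ₗ[k] Wfun M) (w : List (DLetter (M.X α))) :
    brP J Q (w.map (jl J α)) = brM J α 1 (Q ∘ₗ cls M α) w (cproj _) := by
  rw [brP, ← cls_cproj α]
  exact (brL_natural (W₀ := contFun (M.X α)) (deg := dldeg) (deg' := ldeg) (ι₀ := dctr) (ι₁ := lctr J) (ι₂ := lctr J) (jl J α) (fun _ => rfl) (cls M α)
    (fun x s => ctrW_j_self J x.2 s) 1 Q w _).symm

theorem exists_map_jl (w : List (Letter V)) (α₀ : M.I) :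
    ∃ (α : M.I) (w' : List (DLetter (M.X α))), w'.map (jl J α) = w := by
  obtain ⟨α, l, p, x, _, rfl⟩ := exists_jword J w α₀
  exact ⟨α, List.ofFn fun i => dlet (x i), by rw [List.map_ofFn]; rfl⟩

/-- At the stage (α, |w|) the transpose of F agrees with the local operator on functionals of order
≤ |w|, and the brackets along w at π involve no others. -/
theorem star_act_of_local {X : MultiDer V}
    {F : (toProMod k).obj (symPro M) ⟶ (toProMod k).obj (symPro M)}
    (h : ∀ (α : M.I) (N : ℕ), ∃ (β : M.I) (D : SymAlg (M.X β) ⊤ →ₗ[k] SymAlg (M.X α) ⊤)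
      (hD : LowersWeight D) (D' : SymAlg (M.X β) (N + 1 : ℕ) →ₗ[k] SymAlg (M.X α) N),
      D' ∘ₗ (trc (M.X β) (N + 1 : ℕ)).toLinearMap = (trc (M.X α) N).toLinearMap ∘ₗ D ∧
      Rep F (β, N + 1) (α, N) D' ∧ ∀ w, w.length ≤ N → StarM J X (pushW D hD) w) :
    Star J X (act F) := by
  intro w
  obtain ⟨α, w, rfl⟩ := exists_map_jl (J := J) w (Classical.arbitrary _)
  obtain ⟨β, D, hD, D', hD', hF, hstar⟩ := h α w.length
  have h0 : brM J α 1 (act F ∘ₗ cls M α - pushW D hD) w (cproj _) = 0 := by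
    refine brM_eq_zero_of_contAt (N := w.length) (m := 0) (fun g hg => ?_) w (by simp) contAt_proj
    obtain ⟨g', hg'⟩ := hg.factor
    rw [LinearMap.sub_apply, LinearMap.comp_apply,
      ← clsT_of_eq (i := (α, w.length)) (g := g') hg', act_clsT hF,
      clsT_comp_truncation hD hD' hg', sub_self]
  have h1 : brM J α 1 (act F ∘ₗ cls M α - pushW D hD) w
      = brM J α 1 (act F ∘ₗ cls M α) w - brM J α 1 (pushW D hD) w :=
    brL_sub (W₁ := contFun (M.X α)) _ _ _ _ _ _ _
  rw [h1, LinearMap.sub_apply, sub_eq_zero] at h0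
  rw [brP_map_jl, h0]
  exact hstar w (le_refl _)

/-- A word over the earlier stage defines the same letters of V when pulled back to the later one,
and π restricts to π. -/
theorem starM_cpull {X : MultiDer V} {α α' : M.I} (h : α' ≤ α)
    {Q : contFun (M.X α) →ₗ[k] Wfun M} {N : ℕ} (hQ : ∀ w, w.length ≤ N → StarM J X Q w)
    (w : List (DLetter (M.X α'))) (hw : w.length ≤ N) :
    StarM J X (Q ∘ₗ cpull (M.map h)) w := by
  have h1 := hQ (w.map (DLetter.map (M.map h))) (by simpa using hw)
  have h2 : (w.map (DLetter.map (M.map h))).map (jl J α) = w.map (jl J α') := by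
    rw [List.map_map]
    exact List.map_congr_left fun x _ => jl_map J h x
  rw [StarM, h2] at h1
  rw [StarM, ← h1, ← cpull_cproj (M.map h)]
  have h3 : (fun x => lctr J (jl J α' x)) = fun x => lctr J (jl J α (DLetter.map (M.map h) x)) := by
    funext x; rw [jl_map]
  rw [brM, h3]
  exact brL_natural (W₀ := contFun (M.X α')) (W₁ := contFun (M.X α)) (deg := dldeg) (deg' := dldeg) (ι₀ := dctr) (ι₁ := dctr)
    (ι₂ := fun x => lctr J (jl J α x)) (DLetter.map (M.map h)) (fun _ => rfl)
    (cpull (M.map h)) (fun x s => (cpull_cctr (M.map h) x.2 s).symm) 1 Q w _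

/-- Brackets of length ≤ N at π determine an operator on contraction words of length ≤ N, again by
moving contractions into the bracket. -/
theorem apply_wordC_eq_of_starM {X : MultiDer V} {α : M.I} {Q Q' : contFun (M.X α) →ₗ[k] Wfun M}
    {N : ℕ} (hQ : ∀ w, w.length ≤ N → StarM J X Q w) (hQ' : ∀ w, w.length ≤ N → StarM J X Q' w)
    (b : HBasis (M.X α)) (u : List (Fin b.n)) (hu : u.length ≤ N) :
    Q (b.wordC u) = Q' (b.wordC u) := by
  have h := word_brL_eq_zero (k := k) (W₁ := contFun (M.X α)) (deg := dldeg) (ι₁ := dctr)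
    (ι₂ := fun x => lctr J (jl J α x)) Set.univ N (cproj _) 1 (Q - Q') (fun w _ hw => by
      rw [brL_sub, LinearMap.sub_apply, sub_eq_zero]
      exact (hQ w hw).trans (hQ' w hw).symm) (u.map b.dl) [] (fun _ _ => trivial)
      (fun _ _ => trivial) (by simpa using hu)
  rw [List.foldr_map] at h
  exact sub_eq_zero.1 h

/-- The local derivations depend on choices and need not be strictly compatible. They agree on
contraction words by `apply_wordC_eq_of_starM`, hence after enlarging the source by
`exists_comp_symTr_eq`, and a pro-morphism requires no more. -/
theorem exists_star_act (hM : IsProFinite M) (J : Duality M V) (X : MultiDer V) :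
    ∃ F : (toProMod k).obj (symPro M) ⟶ (toProMod k).obj (symPro M),
      IsProDerivation (symPro M) F ∧ Star J X (act F) := by
  choose β h D hD hstar using fun j : M.I × ℕ => exists_local_derivation J X hM j.1 j.2
  choose D' hD' hder using fun j : M.I × ℕ => (hD j).exists_truncation j.2
  obtain ⟨F, hF⟩ := exists_hom_of_family (X := (toProMod k).obj (symPro M))
    (Y := (toProMod k).obj (symPro M)) (fun j : M.I × ℕ => (β j, j.2 + 1))
    (fun j => ModuleCat.ofHom (D' j)) (by
      intro j' j hj
      obtain ⟨b⟩ := (hM j'.1).nonempty_hbasis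
      have hj1 : j'.1 ≤ j.1 := (Prod.le_def.1 hj).1
      have hj2 : j'.2 ≤ j.2 := (Prod.le_def.1 hj).2
      obtain ⟨l, h1, h2, e⟩ := exists_comp_symTr_eq (M := M) (M' := M) (i := (β j, j.2 + 1))
        (i' := (β j', j'.2 + 1)) (j := j') b ((symTr M hj).toLinearMap ∘ₗ D' j) (D' j') (by
          intro u hu g hg
          have e1 := clsT_comp_truncation (hD j').lowersWeight (hD' j') (g := g) (s := b.wordC u)
            (by rw [b.wordC_val]; exact hg)
          have e2 := clsT_comp_truncation (hD j).lowersWeight (hD' j)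
            (g := g ∘ₗ (symTr M hj).toLinearMap) (s := cpull (M.map hj1) (b.wordC u)) (by
              refine LinearMap.ext fun s => ?_
              rw [cpull_apply, b.wordC_val, ← hg]
              exact congrArg g (symTr_trc hj s))
          rw [e1]
          refine e2.trans ?_
          exact apply_wordC_eq_of_starM (Q := pushW (D j) (hD j).lowersWeight ∘ₗ cpull (M.map hj1))
            (N := j'.2)
            (fun w hw => starM_cpull hj1 (hstar j) w (hw.trans hj2)) (hstar j') b u hu)
      exact ⟨l, h1, h2, ModuleCat.hom_ext e⟩)
  refine ⟨F, ⟨fun j => (β j, j.2 + 1), fun j => ⟨h j, Nat.le_succ _⟩, D', fun j => ?_, hF⟩, ?_⟩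
  · exact isDerivationOver_iff.2 (hder j)
  · exact star_act_of_local fun α N => ⟨β (α, N), D (α, N), (hD _).lowersWeight, D' (α, N),
      hD' _, hF _, hstar (α, N)⟩

end Existence

/-! ### Square-zero multiderivations and differentials -/

section Bijection

variable {k : Type u} [Field k] [CharZero k] {A : DGCA k} {M : ProObj (GMod A.toGAlg)}
  {V : GMod A.toGAlg} {J : Duality M V}

theorem CEDiff.ext_d {d d' : CEDiff A M} (h : d.d = d'.d) : d = d' := by
  cases d
  cases d'
  cases h
  rfl

/-- The pro-derivation exists by `exists_star_act` and is unique by `Star.eq_of_star`. The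
conditions on X become d² = 0 and, for the empty word, compatibility with d_A. -/
theorem exists_unique_corresponds (hM : IsProFinite M) (J : Duality M V) {X : MultiDer V}
    (h0 : X.σ 0 Fin.elim0 = A.d) (hX : X.SquareZero) : ∃! d : CEDiff A M, Corresponds J X d := by
  obtain ⟨F, hF, hs⟩ := exists_star_act hM J X
  have h1 := (Star.comp_eq_zero_iff J hM hs).2 hX
  have h2 := act_projW_iff.2 (hs.σ_zero.1 h0)
  have h3 : Star J X (act (CEDiff.mk F hF h1 h2).d) := hs
  exact ⟨⟨F, hF, h1, h2⟩, h3.corresponds, fun d hd => CEDiff.ext_d (Star.eq_of_star J hM hd.star hs)⟩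

theorem CEDiff.exists_unique_corresponds (J : Duality M V) (d : CEDiff A M) :
    ∃! X : MultiDer V, Corresponds J X d := by
  obtain ⟨X, hX⟩ := d.exists_star J
  exact ⟨X, hX.corresponds, fun Y hY => hY.star.unique hX⟩

theorem Corresponds.squareZero (hM : IsProFinite M) {X : MultiDer V} {d : CEDiff A M}
    (h : Corresponds J X d) : X.SquareZero := (Star.comp_eq_zero_iff J hM h.star).1 d.sq

theorem Corresponds.σ_zero {X : MultiDer V} {d : CEDiff A M} (h : Corresponds J X d) :
    X.σ 0 Fin.elim0 = A.d := h.star.σ_zero.2 (act_projW_iff.1 d.comm)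

end Bijection

/-! ### The linear part of a differential and the unary operation -/

section LinearPart

open SHLieRinehart.SymAlg

variable {k : Type u} [Field k] [CharZero k]

theorem GAlg.parity_parity {k : Type u} [Field k] (A : GAlg k) (p : ℤ) (a : A) :
    A.parity p (A.parity p a) = a := by
  induction a using graded_induction A.internal with
  | add x y hx hy => simp only [map_add, hx, hy]
  | hom i a ha =>
    rw [A.parity_of_mem p ha, map_zsmul, A.parity_of_mem p ha, sgn_smul_sgn_smul]

/-- The component of weight one of an element of `Sym_A(M) / Sym_A^{>1}(M)`. -/
def HBasis.linPart {A : GAlg k} {M : GMod A} (b : HBasis M) : SymAlg M (1 : ℕ) →ₗ[k] M :=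
  ∑ i, (LinearMap.toSpanSingleton A M (b.b i)).restrictScalars k ∘ₗ
    (A.parity (b.q i)).toLinearMap ∘ₗ (proj M (0 : ℕ)).toLinearMap ∘ₗ
      contr (N := (1 : ℕ)) (N' := (0 : ℕ)) (b.ε i) (by norm_cast)

theorem HBasis.linPart_ofM {A : GAlg k} {M : GMod A} (b : HBasis M) (m : M) :
    b.linPart (ofM M _ m) = m := by
  rw [HBasis.linPart, LinearMap.sum_apply]
  refine Eq.trans (Finset.sum_congr rfl fun i _ => ?_) (b.sum_repr m)
  change A.parity (b.q i) (proj M _ (contr _ _ (ofM M _ m))) • b.b i = _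
  rw [contr_ofM, proj_ofA, b.ε_apply, A.parity_parity]

theorem exists_ofM_of_proj_eq_zero {A : GAlg k} {M : GMod A} {s : SymAlg M (1 : ℕ)}
    (h : proj M _ s = 0) : ∃ m, s = ofM M _ m := by
  have h1 := sub_mem_weightGE s
  rw [h, map_zero, sub_zero] at h1
  have key : weightGE M (1 : ℕ) 1 ≤ LinearMap.range (ofM M (1 : ℕ)) := by
    refine Submodule.span_le.2 ?_
    rintro _ ⟨a, l, hl, rfl⟩
    match l, hl with
    | [m], _ => exact ⟨a • m, by rw [ofM_smul]; simp⟩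
    | m :: m' :: l, _ =>
      refine ⟨0, ?_⟩
      rw [trunc M _ (m :: m' :: l) (by exact_mod_cast (by simp : 1 < (m :: m' :: l).length))]
      simp
  obtain ⟨m, hm⟩ := key h1
  exact ⟨m, hm.symm⟩

theorem HBasis.ofM_linPart {A : GAlg k} {M : GMod A} (b : HBasis M) {s : SymAlg M (1 : ℕ)}
    (h : proj M _ s = 0) : ofM M _ (b.linPart s) = s := by
  obtain ⟨m, rfl⟩ := exists_ofM_of_proj_eq_zero h
  rw [b.linPart_ofM]

theorem symTr_ofM {A : GAlg k} {M : ProObj (GMod A)} {i j : M.I × ℕ} (h : i ≤ j) (m : M.X j.1) :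
    symTr M h (ofM _ _ m) = ofM _ _ ((M.map (Prod.le_def.1 h).1).toLin m) := map_ofM _ _ _

theorem symTr_ofA {A : GAlg k} {M : ProObj (GMod A)} {i j : M.I × ℕ} (h : i ≤ j) (a : A) :
    symTr M h (ofA _ _ a) = ofA _ _ a := map_ofA _ _ _

theorem proj_symTr {A : GAlg k} {M : ProObj (GMod A)} {i j : M.I × ℕ} (h : i ≤ j)
    (s : SymAlg (M.X j.1) j.2) : proj _ _ (symTr M h s) = proj _ _ s := proj_map _ _ _

variable {A : DGCA k} {M : ProObj (GMod A.toGAlg)}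

/-- The equality π d = d_A π of pro-morphisms holds for a given representative once its source is
enlarged. -/
theorem CEDiff.proj_comm (d : CEDiff A M) {i j : M.I × ℕ}
    {D : SymAlg (M.X i.1) i.2 →ₗ[k] SymAlg (M.X j.1) j.2} (h : Rep d.d i j D) :
    ∃ (l : M.I × ℕ) (hi : i ≤ l), ∀ s, proj _ _ (D (symTr M hi s)) = A.d (proj _ _ s) := by
  have h1 := act_projW_iff.1 d.comm
  rw [← clsT_proj j, act_clsT h, clsT_proj j, ← clsT_proj i, postW_clsT] at h1
  obtain ⟨l, hi, _, _, e⟩ := exists_of_clsT_eq h1 i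
  refine ⟨l, hi, fun s => (LinearMap.congr_fun e s).trans ?_⟩
  exact congrArg A.d (proj_symTr _ s)

/-- As π d = d_A π, the restriction of d to M lands in the kernel of the projection once the source
is large enough, and in the truncation at weight one this kernel is M_α. -/
theorem CEDiff.exists_isLinearPart (hM : IsProFinite M) (d : CEDiff A M) :
    ∃ dl, d.IsLinearPart dl := by
  have hex : ∀ α : M.I, ∃ (i : M.I × ℕ) (D : SymAlg (M.X i.1) i.2 →ₗ[k] SymAlg (M.X α) (1 : ℕ))
      (E : M.X i.1 →ₗ[k] M.X α), Rep d.d i (α, 1) D ∧ ∀ ψ, D (ofM _ _ ψ) = ofM _ _ (E ψ) := by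
    intro α
    obtain ⟨b⟩ := (hM α).nonempty_hbasis
    obtain ⟨i, D, hD⟩ := exists_rep d.d (α, 1)
    obtain ⟨l, hi, hl⟩ := d.proj_comm hD
    refine ⟨l, D ∘ₗ (symTr M hi).toLinearMap, b.linPart ∘ₗ D ∘ₗ (symTr M hi).toLinearMap ∘ₗ ofM _ _,
      hD.restrict hi, fun ψ => ?_⟩
    refine (b.ofM_linPart ?_).symm
    refine (hl _).trans ?_
    rw [proj_ofM, map_zero]
  choose i D E hD hE using hex
  -- M_α embeds in the truncation, with retraction `linPart`, so compatibility of the maps `E` can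
  -- be tested after the embedding.
  have hinj : ∀ α (m m' : M.X α), ofM (M.X α) (1 : ℕ) m = ofM _ _ m' → m = m' := by
    intro α m m' h
    obtain ⟨b⟩ := (hM α).nonempty_hbasis
    rw [← b.linPart_ofM m, h, b.linPart_ofM]
  obtain ⟨dl, hdl⟩ := exists_hom_of_family (X := (modToProMod A.toGAlg).obj M)
    (Y := (modToProMod A.toGAlg).obj M) (fun α : M.I => (i α).1) (fun α => ModuleCat.ofHom (E α)) (by
      intro (α' : M.I) (α : M.I) (h : α' ≤ α)
      have hj : ((α', 1) : M.I × ℕ) ≤ (α, 1) := ⟨h, le_refl _⟩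
      obtain ⟨l, h1, h2, e⟩ := ((hD α).post hj).eq (hD α')
      refine ⟨l.1, (Prod.le_def.1 h1).1, (Prod.le_def.1 h2).1, ?_⟩
      have key : ∀ ψ : M.X l.1, ofM (M.X α') (1 : ℕ) ((M.map h).toLin (E α ((M.map (Prod.le_def.1 h1).1).toLin ψ)))
          = ofM _ _ (E α' ((M.map (Prod.le_def.1 h2).1).toLin ψ)) := fun ψ => by
        have e1 : symTr M hj (D α (symTr M h1 (ofM _ _ ψ))) = D α' (symTr M h2 (ofM _ _ ψ)) :=
          LinearMap.congr_fun e (ofM _ _ ψ)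
        rw [symTr_ofM, symTr_ofM, hE, hE, symTr_ofM] at e1
        exact e1
      exact ModuleCat.hom_ext (LinearMap.ext fun ψ => hinj α' _ _ (key ψ)))
  exact ⟨dl, fun α => ⟨(i α).1, (i α).2, D α, E α, hD α, hdl α, hE α⟩⟩

variable {V : GMod A.toGAlg} {J : Duality M V} {X : MultiDer V} {d : CEDiff A M}
  {dl : (modToProMod A.toGAlg).obj M ⟶ (modToProMod A.toGAlg).obj M}

/-- For one letter the commutator is D ι_x - (-1)^{|x|} ι_x D. On ψ ∈ M, after projection, the first
term is d_A(x(ψ)), since D is applied to a scalar, and the second is (-1)^{|x|} x(d^l ψ): this is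
the formula for the dual differential. -/
theorem Corresponds.exists_dual (h : Corresponds J X d) (hdl : d.IsLinearPart dl) (α : M.I) (p : ℤ)
    (x : (M.X α).dual p) : ∃ (β : M.I) (h : α ≤ β) (E : M.X β →ₗ[k] M.X α)
      (y : (M.X β).dual (p + 1)), Represents dl β α (ModuleCat.ofHom E) ∧
      (∀ ψ, y.1 ψ = A.d (x.1 ((M.map h).toLin ψ)) - sgn p • x.1 (E ψ)) ∧
      X.X 0 (fun _ => J.j α p x) = J.j β (p + 1) y := by
  obtain ⟨β, hβ, n, D, hD, hX⟩ := h.2 α 0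
  obtain ⟨β', n', D', E, hD', hE, hDE⟩ := hdl α
  obtain ⟨y, hy, hy'⟩ := hX (fun _ => p) (fun _ => x)
  obtain ⟨l₀, hl₀, hcomm⟩ := d.proj_comm (i := (β, n)) (j := (α, 1)) hD
  obtain ⟨l₁, h1, h2, e⟩ := Rep.eq (i := (β, n)) (i' := (β', n')) (j := (α, 1)) hD hD'
  have : IsDirectedOrder (M.I × ℕ) := (symPro M).directed
  obtain ⟨l, hl, hl'⟩ := exists_ge_ge l₀ l₁
  have hb : β ≤ l.1 := (Prod.le_def.1 (hl₀.trans hl)).1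
  have hb' : β' ≤ l.1 := (Prod.le_def.1 (h2.trans hl')).1
  have hp : 1 + ∑ i : Fin (0 + 1), (fun _ => p) i = p + 1 := by simp [add_comm]
  refine ⟨l.1, hβ.trans hb, E ∘ₗ (M.map hb').toLin.restrictScalars k,
    hp ▸ GMod.dualMap (M.map hb) _ y, Represents.restrict hE hb', fun ψ => ?_, ?_⟩
  · rw [GMod.dual_cast_apply]
    refine (hy' ((M.map hb).toLin ψ)).symm.trans ?_
    have hD1 : D (map (𝟙 _) le_top (ofM _ ⊤ ((M.map hb).toLin ψ)))
        = ofM _ _ (E ((M.map hb').toLin ψ)) := by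
      have e1 : D (symTr M h1 (symTr M hl' (ofM _ _ ψ))) = D' (symTr M h2 (symTr M hl' (ofM _ _ ψ))) :=
        LinearMap.congr_fun e _
      rw [symTr_symTr, symTr_symTr, symTr_ofM, symTr_ofM] at e1
      rw [map_ofM]
      exact e1.trans (hDE _)
    have hD2 : ∀ a, proj _ _ (D (map (𝟙 _) le_top (ofA _ ⊤ a))) = A.d a := by
      intro a
      have := hcomm (ofA _ _ a)
      rw [symTr_ofA, proj_ofA] at this
      rw [map_ofA]
      exact this
    have hx : x.1 ((M.map hβ).toLin ((M.map hb).toLin ψ)) = x.1 ((M.map (hβ.trans hb)).toLin ψ) := by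
      rw [← M.map_comp hβ hb]; rfl
    simp only [iteratedCommutator, LinearMap.sub_apply, LinearMap.comp_apply, LinearMap.smul_apply,
      AlgHom.toLinearMap_apply, map_sub, map_zsmul, proj_map, one_mul]
    rw [hD1, contr_ofM, contr_ofM, proj_ofA]
    refine congrArg₂ (· - ·) ((hD2 _).trans (congrArg A.d hx)) rfl
  · have hc : ∀ {q q' : ℤ} (e : q = q') (z : (M.X l.1).dual q), J.j l.1 q' (e ▸ z) = J.j l.1 q z := by
      intro q q' e z; subst e; rfl
    rw [hc, J.compat, hy]

/-- `Corresponds.exists_dual` expresses X_0 by the duality formula. Two elements given by this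
formula at different stages agree at a later one, because the representatives of `dl` do; so the
formula pins down the differential of V. -/
theorem Corresponds.isDualDiff_iff (h : Corresponds J X d) (hdl : d.IsLinearPart dl)
    (dL : V →ₗ[k] V) : J.IsDualDiff dl dL ↔ ∀ m, X.X 0 (fun _ => m) = dL m := by
  constructor
  · intro hd m
    have hX : ∀ m, X.X 0 (fun _ => m)
      = (MultilinearMap.ofSubsingleton k V V (0 : Fin 1)).symm (X.X 0) m := fun _ => rfl
    rw [hX]
    induction m using graded_induction V.internal with
    | add x y hx hy => rw [map_add, map_add, hx, hy]
    | hom p m hm =>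
      obtain ⟨α, x, rfl⟩ := J.surj p m hm
      obtain ⟨β, hβ, E, y, hE, hy, e⟩ := h.exists_dual hdl α p x
      obtain ⟨β', hβ', E', y', hE', hy', e'⟩ := hd α p x
      rw [← hX, e, e']
      obtain ⟨γ, h1, h2, e2⟩ := hE.eq hE'
      have h1' : β ≤ γ := h1
      have h2' : β' ≤ γ := h2
      rw [← J.compat h1', ← J.compat h2']
      congr 1
      refine GMod.dual_ext fun ψ => ?_
      change y.1 ((M.map h1').toLin ψ) = y'.1 ((M.map h2').toLin ψ)
      rw [hy, hy']
      have e3 : E ((M.map h1').toLin ψ) = E' ((M.map h2').toLin ψ) :=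
        LinearMap.congr_fun (congrArg ModuleCat.Hom.hom e2) ψ
      have e4 : (M.map hβ).toLin ((M.map h1').toLin ψ) = (M.map hβ').toLin ((M.map h2').toLin ψ) := by
        have a1 := congrArg (fun f => f.toLin ψ) (M.map_comp hβ h1')
        have a2 := congrArg (fun f => f.toLin ψ) (M.map_comp hβ' h2')
        exact a1.trans a2.symm
      rw [e3, e4]
  · intro hd α p x
    obtain ⟨β, hβ, E, y, hE, hy, e⟩ := h.exists_dual hdl α p x
    exact ⟨β, hβ, E, y, hE, hy, (hd _).symm.trans e⟩

end LinearPart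

/-! ### The bijection for a fixed dg module -/

section Main

variable {k : Type u} [Field k] [CharZero k] {A : DGCA k}

theorem SHLR.toMultiDer_injective {L : DGMod A} {X Y : SHLR A L}
    (h : X.toMultiDer = Y.toMultiDer) : X = Y := by
  cases X
  cases Y
  cases h
  rfl

/-- Every structure has a unique differential. Conversely, a differential yields a square-zero
multiderivation, and duality of its linear part says precisely that the unary operation is d_L. -/
theorem exists_equiv_corresponds {L : DGMod A} {M : ProObj (GMod A.toGAlg)} (hM : IsProFinite M)
    (J : Duality M L.toGMod.shift) :
    ∃ Φ : SHLR A L ≃ {d : CEDiff A M // ∃ dl, d.IsLinearPart dl ∧ J.IsDualDiff dl L.d},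
      ∀ (X : SHLR A L) (d : CEDiff A M), Corresponds J X.toMultiDer d ↔ (Φ X : CEDiff A M) = d := by
  choose d hd huniq using fun X : SHLR A L => exists_unique_corresponds hM J X.σ_zero X.squareZero
  have hlin : ∀ X, ∃ dl, (d X).IsLinearPart dl ∧ J.IsDualDiff dl L.d := fun X => by
    obtain ⟨dl, hdl⟩ := (d X).exists_isLinearPart hM
    exact ⟨dl, hdl, ((hd X).isDualDiff_iff hdl L.d).2 X.X_zero⟩
  refine ⟨Equiv.ofBijective (fun X => ⟨d X, hlin X⟩) ⟨fun X Y h => ?_, ?_⟩, fun X d' => ⟨fun h => ?_, ?_⟩⟩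
  · have h' : d X = d Y := congrArg Subtype.val h
    refine SHLR.toMultiDer_injective ((hd X).star.unique ?_)
    rw [h']
    exact (hd Y).star
  · rintro ⟨d', dl, hdl, hdual⟩
    obtain ⟨X, hX, -⟩ := d'.exists_unique_corresponds J
    let X' : SHLR A L := ⟨X, (hX.isDualDiff_iff hdl L.d).1 hdual, hX.σ_zero, hX.squareZero hM⟩
    exact ⟨X', Subtype.ext (huniq X' d' hX).symm⟩
  · exact (huniq X d' h).symm
  · rintro rfl
    exact hd X

end Main

/-! ### The module dual to a given pro-module -/

section DualModule

open SHLieRinehart.SymAlg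

variable {k : Type u} [Field k] [CharZero k] {A : GAlg k} (M : ProObj (GMod A))

/-- The action of `A` on the space of functionals. -/
def Wfun.actHom : A →+* Module.End k (Wfun M) where
  toFun a := postW (lmulA a)
  map_one' := by
    refine Wfun.hom_ext fun α g => ?_
    rw [postW_cls]
    exact congrArg (cls M α) (Subtype.ext (LinearMap.ext fun s => one_mul _))
  map_mul' a b := by
    refine LinearMap.ext fun w => ?_
    rw [Module.End.mul_apply, postW_postW]
    exact congrArg (fun θ => postW θ w) (LinearMap.ext fun s => mul_assoc _ _ _)
  map_zero' := by
    rw [show lmulA (0 : A) = 0 from LinearMap.ext fun s => zero_mul s, map_zero]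
  map_add' a b := by
    rw [show lmulA (a + b) = lmulA a + lmulA b from LinearMap.ext fun s => add_mul a b s, map_add]

instance : Module A (Wfun M) := Module.compHom (Wfun M) (Wfun.actHom M)

theorem Wfun.smul_def (a : A) (w : Wfun M) : a • w = postW (lmulA a) w := rfl

instance : IsScalarTower k A (Wfun M) := ⟨fun c a w => by
  rw [Wfun.smul_def, Wfun.smul_def,
    show lmulA (c • a) = c • lmulA a from LinearMap.ext fun s => smul_mul_assoc c a s, map_smul]
  rfl⟩

/-- The functional `π ι_x`. -/
def dualCls (α : M.I) (p : ℤ) : (M.X α).dual p →ₗ[k] Wfun M :=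
  cls M α ∘ₗ LinearMap.flip cctr (cproj _)

variable {M}

theorem dualCls_compat {α β : M.I} (h : α ≤ β) {p : ℤ} (x : (M.X α).dual p) :
    dualCls M β p (GMod.dualMap (M.map h) p x) = dualCls M α p x := by
  change cls M β (cctr _ (cproj _)) = cls M α (cctr x (cproj _))
  rw [← cls_cpull h, cpull_cctr, cpull_cproj]

theorem smul_dualCls {α : M.I} {i p q : ℤ} {a : A} (ha : a ∈ A.gr i) (x : (M.X α).dual p)
    (hq : i + p = q) (y : (M.X α).dual q) (hy : ∀ m, y.1 m = a * x.1 m) :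
    dualCls M α q y = a • dualCls M α p x := by
  change cls M α (cctr y (cproj _)) = postW (lmulA a) (cls M α (cctr x (cproj _)))
  rw [postW_cls]
  refine congrArg (cls M α) (Subtype.ext (LinearMap.ext fun s => ?_))
  change proj _ _ (ctr y s) = lmulA a (proj _ _ (ctr x s))
  rw [ctr, contr_mul_left x y ha (by omega) hy, map_mul, proj_ofA]
  rfl

/-- Evaluation on homogeneous generators from M_β separates the summands by degree, as in the
injectivity of v ↦ π ι_v. -/
theorem exists_of_sum_dualCls_eq_zero {α : M.I} (s : Finset ℤ) (x : ∀ p, (M.X α).dual p)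
    (h : ∑ p ∈ s, dualCls M α p (x p) = 0) :
    ∃ (β : M.I) (h : α ≤ β), ∀ p ∈ s, GMod.dualMap (M.map h) p (x p) = 0 := by
  have h1 : cls M α (∑ p ∈ s, cctr (x p) (cproj _)) = 0 := by
    rw [map_sum]; exact h
  obtain ⟨β, hβ, e⟩ := exists_of_cls_eq_zero h1
  refine ⟨β, hβ, fun p hp => GMod.dual_ext fun m => ?_⟩
  rw [map_sum] at e
  simp only [cpull_cctr, cpull_cproj] at e
  have h2 : ∀ m : M.X β, ∑ p ∈ s, (GMod.dualMap (M.map hβ) p (x p)).1 m = 0 := by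
    intro m
    have := congrArg (fun g : contFun (M.X β) => g.1 (ofM _ ⊤ m)) e
    simp only [AddSubmonoidClass.coe_finsetSum, LinearMap.sum_apply] at this
    refine Eq.trans (Finset.sum_congr rfl fun p _ => ?_) this
    rw [cctr_apply, ctr, contr_ofM, cproj_apply, proj_ofA]
  induction m using graded_induction (M.X β).internal with
  | add a b ha hb => rw [map_add, ha, hb, map_add]
  | hom i m hm =>
    have h3 := congrArg (component A.internal (i + p)) (h2 m)
    rw [map_sum, map_zero, Finset.sum_eq_single p (fun q _ hq => ?_) (fun h => absurd hp h),
      component_of_mem _ ((GMod.dualMap (M.map hβ) p (x p)).2.1 i m hm)] at h3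
    · exact h3
    · exact component_of_mem_ne _ (by omega) ((GMod.dualMap (M.map hβ) q (x q)).2.1 i m hm)

variable (M)

/-- The functionals `π ι_x` with `x` of degree `p`. -/
def grW (p : ℤ) : Submodule k (Wfun M) where
  carrier := {w | ∃ α x, dualCls M α p x = w}
  zero_mem' := ⟨Classical.arbitrary _, 0, map_zero _⟩
  add_mem' := by
    rintro _ _ ⟨α, x, rfl⟩ ⟨β, y, rfl⟩
    obtain ⟨γ, h1, h2⟩ := exists_ge_ge α β
    exact ⟨γ, GMod.dualMap (M.map h1) p x + GMod.dualMap (M.map h2) p y, by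
      rw [map_add, dualCls_compat, dualCls_compat]⟩
  smul_mem' := by
    rintro c _ ⟨α, x, rfl⟩
    exact ⟨α, c • x, map_smul _ _ _⟩

theorem smul_mem_grW {i p q : ℤ} (hq : i + p = q) {a : A} (ha : a ∈ A.gr i) {w : Wfun M}
    (hw : w ∈ grW M p) : a • w ∈ grW M q := by
  obtain ⟨α, x, rfl⟩ := hw
  exact ⟨α, GMod.dualMul ha hq x, smul_dualCls ha x hq _ fun m => by simp⟩

theorem iSupIndep_grW : iSupIndep (grW M) := by
  rw [iSupIndep_iff_finsetSum_eq_zero_imp_eq_zero]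
  intro s v hv h
  choose! α x hx using hv
  obtain ⟨β, -, hβ⟩ := exists_upper_bound (s : Set ℤ) s.finite_toSet α (Classical.arbitrary _)
  let y : ∀ p, (M.X β).dual p := fun p =>
    if hp : p ∈ s then GMod.dualMap (M.map (hβ p hp)) p (x p) else 0
  have hy : ∀ p ∈ s, dualCls M β p (y p) = v p := by
    intro p hp
    simp only [y, dif_pos hp]
    rw [dualCls_compat, hx p hp]
  rw [← Finset.sum_congr rfl hy] at h
  obtain ⟨γ, hγ, e⟩ := exists_of_sum_dualCls_eq_zero s y h
  intro p hp
  rw [← hy p hp, ← dualCls_compat hγ, e p hp, map_zero]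

/-- The functionals `π ι_x`. -/
def dualSub : Submodule A (Wfun M) :=
  { (⨆ p, grW M p : Submodule k (Wfun M)) with
    smul_mem' := by
      intro a w hw
      change a • w ∈ (⨆ p, grW M p : Submodule k (Wfun M))
      induction a using graded_induction A.internal with
      | add x y hx hy => rw [add_smul]; exact Submodule.add_mem _ hx hy
      | hom i a ha =>
        refine Submodule.iSup_induction (grW M) (motive := fun w => a • w ∈ (⨆ p, grW M p)) hw
          (fun p w hw => Submodule.mem_iSup_of_mem _ (smul_mem_grW M rfl ha hw)) ?_ ?_
        · rw [smul_zero]; exact Submodule.zero_mem _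
        · intro x y hx hy; rw [smul_add]; exact Submodule.add_mem _ hx hy }

theorem mem_dualSub {w : Wfun M} {p : ℤ} (h : w ∈ grW M p) : w ∈ dualSub M :=
  Submodule.mem_iSup_of_mem p h

/-- The grading of `dualSub`. -/
def dualSubGr (p : ℤ) : Submodule k (dualSub M) :=
  (grW M p).comap ((dualSub M).subtype.restrictScalars k)

theorem dualSubGr_internal : DirectSum.IsInternal (dualSubGr M) := by
  rw [DirectSum.isInternal_submodule_iff_iSupIndep_and_iSup_eq_top]
  constructor
  · have h := iSupIndep_grW M
    rw [iSupIndep_iff_finsetSum_eq_zero_imp_eq_zero] at h ⊢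
    intro s v hv h0 p hp
    refine Subtype.ext (h s (fun p => (v p).1) hv ?_ p hp)
    have := congrArg Subtype.val h0
    rwa [AddSubmonoidClass.coe_finsetSum] at this
  · rw [eq_top_iff]
    rintro ⟨w, hw⟩ -
    exact Submodule.iSup_induction' (grW M)
      (motive := fun w hw => (⟨w, hw⟩ : dualSub M) ∈ ⨆ p, dualSubGr M p)
      (fun p w h => Submodule.mem_iSup_of_mem p h) (Submodule.zero_mem _)
      (fun x y hx hy h h' => Submodule.add_mem _ h h') hw

/-- The graded module `L` such that `M` is dual to `L[-1]`. -/
def dualModule : GMod A where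
  carrier := dualSub M
  -- Elements of degree p of the duals belong to L[-1]^p = L^{p+1}; hence the shift by one.
  gr i := dualSubGr M (i - 1)
  internal := isInternal_reindex (dualSubGr_internal M) (Equiv.subRight 1)
  smul_mem {i j a m} ha hm := smul_mem_grW M (by ring : i + (j - 1) = i + j - 1) ha hm

/-- The duality between `M` and the shift of `dualModule M`. -/
def dualModuleDuality : Duality M (dualModule M).shift where
  j α p := LinearMap.codRestrict ((dualSub M).restrictScalars k) (dualCls M α p)
    (fun x => mem_dualSub M ⟨α, x, rfl⟩)
  j_mem α p x := by
    change dualCls M α p x ∈ grW M (p + 1 - 1)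
    rw [add_sub_cancel_right]
    exact ⟨α, x, rfl⟩
  j_smul α i p a ha x y hy := Subtype.ext (smul_dualCls ha x rfl y hy)
  compat h p x := Subtype.ext (dualCls_compat h x)
  surj p z hz := by
    change z.1 ∈ grW M (p + 1 - 1) at hz
    rw [add_sub_cancel_right] at hz
    obtain ⟨α, x, h⟩ := hz
    exact ⟨α, x, Subtype.ext h⟩
  inj α p x h := by
    have h1 : dualCls M α p x = 0 := congrArg Subtype.val h
    -- A single functional is regarded as a family over the singleton {p}, extended by zero.
    obtain ⟨β, hβ, e⟩ := exists_of_sum_dualCls_eq_zero {p}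
      (fun q => if hq : p = q then hq ▸ x else 0) (by simpa using h1)
    exact ⟨β, hβ, by simpa using e p (by simp)⟩

end DualModule

/-! ### Modules dual to pro-finite modules are flat -/

section Flatness

open TensorProduct

open scoped Classical

variable {k : Type u} [Field k] {A : GAlg k}

/-- The linear map with given restrictions to the homogeneous parts. -/
def gradedLift {V Z : Type*} [AddCommGroup V] [Module k V] [AddCommGroup Z] [Module k Z]
    {gr : ℤ → Submodule k V} (h : DirectSum.IsInternal gr) (f : ∀ i, gr i →ₗ[k] Z) : V →ₗ[k] Z :=
  (DirectSum.toModule k ℤ Z f) ∘ₗ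
    (LinearEquiv.ofBijective (DirectSum.coeLinearMap gr) h).symm.toLinearMap

theorem gradedLift_of_mem {V Z : Type*} [AddCommGroup V] [Module k V] [AddCommGroup Z] [Module k Z]
    {gr : ℤ → Submodule k V} (h : DirectSum.IsInternal gr) (f : ∀ i, gr i →ₗ[k] Z) {i : ℤ} {v : V}
    (hv : v ∈ gr i) : gradedLift h f v = f i ⟨v, hv⟩ := by
  have : (LinearEquiv.ofBijective (DirectSum.coeLinearMap gr) h).symm v
      = DirectSum.lof k ℤ (fun i => gr i) i ⟨v, hv⟩ := by
    rw [LinearEquiv.symm_apply_eq]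
    exact (DirectSum.coeLinearMap_lof gr i (⟨v, hv⟩ : gr i)).symm
  simp [gradedLift, this]

/-- The right action `n·a = (-1)^{|a||n|} a·n`. -/
def GMod.rmul (N : GMod A) : N →ₗ[k] A →ₗ[k] N :=
  gradedLift N.internal fun j => LinearMap.mk₂ k (fun n a => A.parity j a • (n : N))
    (fun n n' a => smul_add _ _ _) (fun c n a => smul_comm _ _ _)
    (fun n a a' => by rw [map_add, add_smul]) (fun c n a => by rw [map_smul, smul_assoc])

theorem GMod.rmul_of_mem {N : GMod A} {j : ℤ} {n : N} (hn : n ∈ N.gr j) (a : A) :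
    N.rmul n a = A.parity j a • n := by
  rw [GMod.rmul, gradedLift_of_mem _ _ hn]; rfl

/-- This is the defining relation of the tensor product over A, read through the right action; it
makes the evaluation of tensors well defined. -/
theorem GMod.rmul_smul {N : GMod A} {i j : ℤ} {a : A} (ha : a ∈ A.gr i) {n : N} (hn : n ∈ N.gr j)
    (c : A) : N.rmul n (a * c) = sgn (i * j) • N.rmul (a • n) c := by
  rw [GMod.rmul_of_mem hn, GMod.rmul_of_mem (N.smul_mem ha hn), map_mul, A.parity_of_mem j ha,
    smul_mul_assoc, mul_comm j i, smul_assoc]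
  congr 1
  induction c using graded_induction A.internal with
  | add x y hx hy => simp only [map_add, mul_add, add_smul, hx, hy]
  | hom l c hc =>
    rw [A.parity_of_mem _ hc, A.parity_of_mem _ hc, smul_assoc, mul_smul_comm, smul_assoc, ← mul_smul,
      A.comm ha hc, smul_assoc, smul_smul, ← sgn_add]
    congr 1
    apply congrArg
    ring

theorem GMod.map_rmul {N N' : GMod A} (f : N ⟶ N') (n : N) (a : A) :
    f.toLin (N.rmul n a) = N'.rmul (f.toLin n) a := by
  induction n using graded_induction N.internal with
  | add x y hx hy => simp only [map_add, LinearMap.add_apply, hx, hy]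
  | hom j n hn => rw [GMod.rmul_of_mem hn, GMod.rmul_of_mem (f.map_mem _ _ hn), map_smul]

variable {N N' V : GMod A}

/-- Elementary tensors. -/
def GTensor.tmul (n : N) (v : V) : GTensor N V := Submodule.Quotient.mk (n ⊗ₜ[k] v)

theorem GTensor.map_tmul (f : N ⟶ N') (n : N) (v : V) :
    GTensor.map f V (GTensor.tmul n v) = GTensor.tmul (f.toLin n) v := rfl

theorem GTensor.induction {P : GTensor N V → Prop} (t : GTensor N V)
    (h : ∀ n (p : ℤ) (v : V), v ∈ V.gr p → P (GTensor.tmul n v))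
    (add : ∀ s t, P s → P t → P (s + t)) : P t := by
  obtain ⟨t, rfl⟩ := Submodule.mkQ_surjective _ t
  induction t using TensorProduct.induction_on with
  | zero =>
    have := h 0 0 0 (Submodule.zero_mem _)
    rw [GTensor.tmul, zero_tmul] at this
    exact this
  | add x y hx hy => rw [map_add]; exact add _ _ hx hy
  | tmul n v =>
    induction v using graded_induction V.internal with
    | hom p v hv => exact h n p v hv
    | add x y hx hy => rw [tmul_add, map_add]; exact add _ _ hx hy

theorem GTensor.tmul_smul {i : ℤ} {a : A} (ha : a ∈ A.gr i) (n : N) (v : V) :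
    GTensor.tmul n (a • v) = GTensor.tmul (N.rmul n a) v := by
  rw [GTensor.tmul, GTensor.tmul]
  induction n using graded_induction N.internal with
  | add x y hx hy =>
    simp only [add_tmul, map_add, LinearMap.add_apply, Submodule.Quotient.mk_add, hx, hy]
  | hom j n hn =>
    refine Eq.symm ((Submodule.Quotient.eq _).2 (Submodule.subset_span ⟨i, j, a, n, v, ha, hn, ?_⟩))
    rw [GMod.rmul_of_mem hn, A.parity_of_mem j ha, mul_comm i j, smul_assoc]

variable {M : ProObj (GMod A)}

variable (N M)

instance : DirectedSystem (fun β => (M.X β →ₗ[k] N))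
    (fun _ _ h => LinearMap.lcomp k N ((M.map h).toLin.restrictScalars k)) where
  map_self i φ := by
    rw [M.map_id]; rfl
  map_map i j l hij hjl φ := by
    rw [← M.map_comp hij hjl]; rfl

/-- The direct limit of the spaces of linear maps from the `M_β` to `N`. -/
def HomLim : Type u := Module.DirectLimit (R := k) (fun β => (M.X β →ₗ[k] N))
  (fun _ _ h => LinearMap.lcomp k N ((M.map h).toLin.restrictScalars k))

/-- The additive structure of the direct limit. -/
@[reducible] def HomLim.addCommMonoid : AddCommMonoid (HomLim N M) :=
  Module.DirectLimit.addCommMonoid (R := k) (fun β => (M.X β →ₗ[k] N))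
    (fun _ _ h => LinearMap.lcomp k N ((M.map h).toLin.restrictScalars k))

/-- The linear structure of the direct limit. -/
@[reducible] def HomLim.module : @Module k (HomLim N M) _ (HomLim.addCommMonoid N M) :=
  Module.DirectLimit.module (R := k) (fun β => (M.X β →ₗ[k] N))
    (fun _ _ h => LinearMap.lcomp k N ((M.map h).toLin.restrictScalars k))

instance : AddCommGroup (HomLim N M) :=
  @Module.addCommMonoidToAddCommGroup k (HomLim N M) _ (HomLim.addCommMonoid N M) (HomLim.module N M)

instance : Module k (HomLim N M) := HomLim.module N M

/-- The class of a linear map. -/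
def HomLim.of (β : M.I) : (M.X β →ₗ[k] N) →ₗ[k] HomLim N M :=
  Module.DirectLimit.of k M.I (fun β => (M.X β →ₗ[k] N))
    (fun _ _ h => LinearMap.lcomp k N ((M.map h).toLin.restrictScalars k)) β

theorem HomLim.of_comp {α β : M.I} (h : α ≤ β) (φ : M.X α →ₗ[k] N) :
    HomLim.of N M β (φ ∘ₗ (M.map h).toLin.restrictScalars k) = HomLim.of N M α φ :=
  Module.DirectLimit.of_f (f := fun _ _ h => LinearMap.lcomp k N ((M.map h).toLin.restrictScalars k))

theorem HomLim.exists_of_eq_zero {α : M.I} {φ : M.X α →ₗ[k] N} (h : HomLim.of N M α φ = 0) :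
    ∃ (β : M.I) (h : α ≤ β), φ ∘ₗ (M.map h).toLin.restrictScalars k = 0 :=
  Module.DirectLimit.of.zero_exact h

variable {M}

/-- `(n, x) ↦ (ψ ↦ n·x(ψ))`. -/
def evalPair (β : M.I) (p : ℤ) : (M.X β).dual p →ₗ[k] N →ₗ[k] HomLim N M :=
  LinearMap.mk₂ k (fun x n => HomLim.of N M β (N.rmul n ∘ₗ x.1))
    (fun x y n => by rw [← map_add, ← LinearMap.comp_add]; rfl)
    (fun c x n => by rw [← map_smul, ← LinearMap.comp_smul]; rfl)
    (fun x n n' => by rw [map_add, LinearMap.add_comp, map_add])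
    (fun c x n => by rw [map_smul, LinearMap.smul_comp, map_smul])

variable (J : Duality M V)

theorem evalPair_compat {α β : M.I} (h : α ≤ β) (p : ℤ) (x : (M.X α).dual p) :
    evalPair N β p (GMod.dualMap (M.map h) p x) = evalPair N α p x :=
  LinearMap.ext fun n => HomLim.of_comp N M h (N.rmul n ∘ₗ x.1)

/-- The evaluation of tensors on the pro-finite dual. -/
def evalTensor₀ : N ⊗[k] V →ₗ[k] HomLim N M :=
  TensorProduct.lift (LinearMap.flip (J.desc (evalPair N) (evalPair_compat N)))

theorem evalTensor₀_tmul (n : N) {β : M.I} {p : ℤ} (x : (M.X β).dual p) :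
    evalTensor₀ N J (n ⊗ₜ J.j β p x) = HomLim.of N M β (N.rmul n ∘ₗ x.1) := by
  rw [evalTensor₀, TensorProduct.lift.tmul, LinearMap.flip_apply,
    J.desc_j _ (evalPair_compat N)]
  rfl

/-- The evaluation of tensors on the pro-finite dual. -/
def evalTensor : GTensor N V →ₗ[k] HomLim N M :=
  (tensorRel N V).liftQ (evalTensor₀ N J) (by
    rw [tensorRel, Submodule.span_le]
    rintro _ ⟨i, j, a, n, v, ha, hn, rfl⟩
    rw [SetLike.mem_coe, LinearMap.mem_ker, map_sub, sub_eq_zero]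
    induction v using graded_induction V.internal with
    | add x y hx hy => rw [smul_add, tmul_add, tmul_add, map_add, map_add, hx, hy]
    | hom p v hv =>
      obtain ⟨β, x, rfl⟩ := J.surj p v hv
      rw [← J.j_smul β i p a ha x (GMod.dualMul ha rfl x) (fun m => by simp), evalTensor₀_tmul,
        evalTensor₀_tmul]
      congr 1
      refine LinearMap.ext fun ψ => ?_
      rw [LinearMap.comp_apply, LinearMap.comp_apply, GMod.dualMul_apply, GMod.rmul_smul ha hn,
        map_zsmul]
      rfl)

theorem evalTensor_tmul (n : N) {β : M.I} {p : ℤ} (x : (M.X β).dual p) :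
    evalTensor N J (GTensor.tmul n (J.j β p x)) = HomLim.of N M β (N.rmul n ∘ₗ x.1) :=
  evalTensor₀_tmul N J n x

/-- Representatives of tensors by linear maps. -/
def tensorRep (β : M.I) : Submodule k ((M.X β →ₗ[k] N) × GTensor N V) :=
  Submodule.span k {z | ∃ (n : N) (p : ℤ) (x : (M.X β).dual p),
    z = (N.rmul n ∘ₗ x.1, GTensor.tmul n (J.j β p x))}

variable {N J}

theorem evalTensor_of_mem {β : M.I} {φ : M.X β →ₗ[k] N} {t : GTensor N V}
    (h : (φ, t) ∈ tensorRep N J β) : evalTensor N J t = HomLim.of N M β φ := by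
  have : tensorRep N J β ≤ LinearMap.ker (evalTensor N J ∘ₗ LinearMap.snd k _ _
      - HomLim.of N M β ∘ₗ LinearMap.fst k _ _) := by
    refine Submodule.span_le.2 ?_
    rintro _ ⟨n, p, x, rfl⟩
    exact sub_eq_zero.2 (evalTensor_tmul N J n x)
  exact sub_eq_zero.1 (this h)

theorem tensorRep_restrict {α β : M.I} (hβ : α ≤ β) {φ : M.X α →ₗ[k] N} {t : GTensor N V}
    (h : (φ, t) ∈ tensorRep N J α) :
    (φ ∘ₗ (M.map hβ).toLin.restrictScalars k, t) ∈ tensorRep N J β := by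
  have : tensorRep N J α ≤ (tensorRep N J β).comap
      ((LinearMap.lcomp k N ((M.map hβ).toLin.restrictScalars k)).prodMap LinearMap.id) := by
    refine Submodule.span_le.2 ?_
    rintro _ ⟨n, p, x, rfl⟩
    refine Submodule.subset_span ⟨n, p, GMod.dualMap (M.map hβ) p x, ?_⟩
    rw [J.compat]
    rfl
  exact this h

theorem tensorRep_map (f : N ⟶ N') {β : M.I} {φ : M.X β →ₗ[k] N} {t : GTensor N V}
    (h : (φ, t) ∈ tensorRep N J β) :
    (f.toLin.restrictScalars k ∘ₗ φ, GTensor.map f V t) ∈ tensorRep N' J β := by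
  have : tensorRep N J β ≤ (tensorRep N' J β).comap
      ((LinearMap.compRight k (f.toLin.restrictScalars k)).prodMap (GTensor.map f V)) := by
    refine Submodule.span_le.2 ?_
    rintro _ ⟨n, p, x, rfl⟩
    refine Submodule.subset_span ⟨f.toLin n, p, x, ?_⟩
    refine Prod.ext (LinearMap.ext fun ψ => ?_) rfl
    exact GMod.map_rmul f n (x.1 ψ)
  exact this h

/-- Expanding x in the dual basis moves all coefficients to the left factor. Over a finite free
module a tensor is thus recovered from the linear map that represents it. -/
theorem eq_sum_of_mem_tensorRep {β : M.I} (b : HBasis (M.X β)) {φ : M.X β →ₗ[k] N} {t : GTensor N V}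
    (h : (φ, t) ∈ tensorRep N J β) : t = ∑ i, GTensor.tmul (φ (b.b i)) (J.j β _ (b.ε i)) := by
  have hadd : ∀ (v : V) (n n' : N), GTensor.tmul (n + n') v = GTensor.tmul n v + GTensor.tmul n' v :=
    fun v n n' => by rw [GTensor.tmul, add_tmul]; rfl
  let S : (M.X β →ₗ[k] N) →ₗ[k] GTensor N V :=
    ∑ i, (tensorRel N V).mkQ ∘ₗ (TensorProduct.mk k N V).flip (J.j β _ (b.ε i)) ∘ₗ
      LinearMap.applyₗ (b.b i)
  have hS : ∀ φ, S φ = ∑ i, GTensor.tmul (φ (b.b i)) (J.j β _ (b.ε i)) := fun φ => by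
    simp only [S, LinearMap.sum_apply]; rfl
  have : tensorRep N J β ≤ LinearMap.ker (LinearMap.snd k _ _ - S ∘ₗ LinearMap.fst k _ _) := by
    refine Submodule.span_le.2 ?_
    rintro _ ⟨n, p, x, rfl⟩
    refine LinearMap.mem_ker.2 (sub_eq_zero (a := GTensor.tmul n (J.j β p x)).2 ?_)
    change GTensor.tmul n (J.j β p x) = S _
    rw [hS]
    have htsum : ∀ (s : Finset (Fin b.n)) (v : Fin b.n → V),
        GTensor.tmul n (∑ i ∈ s, v i) = ∑ i ∈ s, GTensor.tmul n (v i) := fun s v => by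
      simp only [GTensor.tmul, tmul_sum]
      exact map_sum (tensorRel N V).mkQ _ _
    conv_lhs => rw [b.dual_eq_sum x, map_sum, htsum]
    refine Finset.sum_congr rfl fun i _ => ?_
    have ha := x.2.1 _ _ (b.mem i)
    have e : J.j β p (GMod.dualMul ha (by ring) (b.ε i)) = x.1 (b.b i) • J.j β _ (b.ε i) := by
      have hc : ∀ {q q' : ℤ} (e : q = q') (z : (M.X β).dual q), J.j β q' (e ▸ z) = J.j β q z := by
        intro q q' e z; subst e; rfl
      have e1 := J.j_smul β (b.q i + p) (- b.q i) _ ha (b.ε i) (GMod.dualMul ha rfl (b.ε i))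
        (fun m => by simp)
      rw [← e1, ← hc (by ring : b.q i + p + - b.q i = p)]
      congr 1
      refine GMod.dual_ext fun m => ?_
      rw [GMod.dual_cast_apply]
      simp
    rw [e, GTensor.tmul_smul ha]
    rfl
  exact (sub_eq_zero.1 (this h)).trans (hS φ)

theorem exists_mem_tensorRep (J : Duality M V) (t : GTensor N V) :
    ∃ β φ, (φ, t) ∈ tensorRep N J β := by
  induction t using GTensor.induction with
  | h n p v hv =>
    obtain ⟨β, x, rfl⟩ := J.surj p v hv
    exact ⟨β, _, Submodule.subset_span ⟨n, p, x, rfl⟩⟩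
  | add s t hs ht =>
    obtain ⟨α, φ, h⟩ := hs
    obtain ⟨β, φ', h'⟩ := ht
    obtain ⟨γ, h1, h2⟩ := exists_ge_ge α β
    exact ⟨γ, _, Submodule.add_mem _ (tensorRep_restrict h1 h) (tensorRep_restrict h2 h')⟩

/-- Modules dual to pro-finite modules are flat. -/
theorem Duality.isFlat (J : Duality M V) (hM : IsProFinite M) : V.IsFlat := by
  intro N₁ N₂ N₃ f g hfg t
  constructor
  · intro ht
    obtain ⟨β, φ, h⟩ := exists_mem_tensorRep J t
    have h1 := tensorRep_map g h
    rw [ht] at h1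
    have h2 := evalTensor_of_mem h1
    rw [map_zero] at h2
    -- Vanishing in the limit means vanishing at some stage γ: there g∘φ = 0.
    obtain ⟨γ, hγ, e⟩ := HomLim.exists_of_eq_zero _ _ h2.symm
    obtain ⟨b⟩ := (hM γ).nonempty_hbasis
    rw [eq_sum_of_mem_tensorRep b (tensorRep_restrict hγ h)]
    -- Exactness is applied to the finitely many values of φ on a basis, and the lifts serve as
    -- coefficients of a preimage.
    choose n hn using fun i => (hfg (φ ((M.map hγ).toLin (b.b i)))).1 (LinearMap.congr_fun e (b.b i))
    refine ⟨∑ i, GTensor.tmul (n i) (J.j γ _ (b.ε i)), ?_⟩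
    rw [map_sum]
    refine Finset.sum_congr rfl fun i _ => ?_
    rw [GTensor.map_tmul, hn]
    rfl
  · rintro ⟨s, rfl⟩
    induction s using GTensor.induction with
    | add x y hx hy => rw [map_add, map_add, hx, hy, add_zero]
    | h n p v hv =>
      rw [GTensor.map_tmul, GTensor.map_tmul, (hfg _).2 ⟨n, rfl⟩, GTensor.tmul, zero_tmul]
      rfl

end Flatness

/-! ### Recovering a flat pair from a Chevalley–Eilenberg complex -/

section Recover

variable {k : Type u} [Field k]

/-- The relations of the tensor product involve degrees in A and in the left factor only, so
shifting the module on the right changes nothing. -/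
theorem isFlat_of_shift {A : GAlg k} {L : GMod A} (h : L.shift.IsFlat) : L.IsFlat := h

variable {A : DGCA k} {L : GMod A.toGAlg}

/-- The unary operation as a linear map. -/
def MultiDer.unary (X : MultiDer L.shift) : L →ₗ[k] L :=
  (MultilinearMap.ofSubsingleton k L L (0 : Fin 1)).symm (X.X 0)

theorem MultiDer.unary_apply (X : MultiDer L.shift) (m : L) : X.unary m = X.X 0 (fun _ => m) := rfl

/-- The dg module underlying a square-zero multiderivation. -/
def MultiDer.dgMod (X : MultiDer L.shift) (h0 : X.σ 0 Fin.elim0 = A.d) (hX : X.SquareZero) :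
    DGMod A :=
  { L with
    d := X.unary
    d_mem := fun i m hm => by
      -- An element of degree i of L has degree i - 1 in the shifted module.
      have := X.X_mem 0 (fun _ => i - 1) (fun _ => m) (fun _ => by
        change m ∈ L.gr (i - 1 + 1)
        rwa [sub_add_cancel])
      rw [X.unary_apply]
      simpa using this
    leibniz := fun i a m ha => by
      have := X.leibniz 0 Fin.elim0 Fin.elim0 (fun i => i.elim0) i a ha m
      have e : ∀ m : L, Fin.snoc (α := fun _ : Fin 1 => L) Fin.elim0 m = fun _ => m := fun m => by
        funext j
        fin_cases j
        rfl
      rw [h0] at this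
      simpa [e, X.unary_apply] using this
    d_d := fun m => by
      induction m using graded_induction L.internal with
      | add x y hx hy => rw [map_add, map_add, hx, hy, add_zero]
      | hom i m hm =>
        -- The Jacobi identity with one argument consists of the single term X_0(X_0(m)).
        have := hX.1 0 (fun _ => i - 1) (fun _ => m) (fun _ => by
          change m ∈ L.gr (i - 1 + 1)
          rwa [sub_add_cancel])
        have hu : unshuffles 1 1 = {1} := by decide
        rw [MultiDer.jacobiator, Fin.sum_univ_one, Fin.val_zero, hu, Finset.sum_singleton] at this
        have e : Fin.cons (α := fun _ : Fin 1 => L) (X.X 0 (fun _ => m)) (fun i => i.elim0)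
            = fun _ => X.X 0 (fun _ => m) := by
          funext j
          fin_cases j
          rfl
        rw [X.unary_apply, X.unary_apply, ← e, ← this, koszul]
        simp
        congr 1
        funext j
        fin_cases j
        rfl }

/-- The module is the one of functionals π ι_x inside `Wfun M`, and its differential is the unary
operation of the multiderivation attached to d. Flatness comes from the duality. -/
theorem CEObj.exists_encodes [CharZero k] (C : CEObj k) : ∃ P : FlatSHLR k, Encodes P C := by
  obtain ⟨A, M, hM, d⟩ := C
  obtain ⟨X, hX, -⟩ := d.exists_unique_corresponds (dualModuleDuality M)
  have h0 : X.σ 0 Fin.elim0 = A.d := hX.σ_zero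
  have h2 := hX.squareZero hM
  exact ⟨_, Encodes.intro A (X.dgMod h0 h2)
    (isFlat_of_shift ((dualModuleDuality M).isFlat hM)) ⟨X, fun _ => rfl, h0, h2⟩ M hM d
    (dualModuleDuality M) hX⟩

end Recover

/-! ### Free modules and the equational criterion for flatness -/

section FreeMod

variable {k : Type u} [Field k]

theorem exists_sum_component {V : Type u} [AddCommGroup V] [Module k V] {gr : ℤ → Submodule k V}
    (h : DirectSum.IsInternal gr) (v : V) :
    ∃ s : Finset ℤ, ∀ t : Finset ℤ, s ⊆ t → ∑ i ∈ t, component h i v = v := by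
  induction v using graded_induction h with
  | hom i v hv =>
    refine ⟨{i}, fun t ht => ?_⟩
    rw [Finset.sum_eq_single i (fun j _ hj => component_of_mem_ne h hj.symm hv)
      (fun hi => absurd (ht (Finset.mem_singleton_self i)) hi), component_of_mem h hv]
  | add x y hx hy =>
    obtain ⟨s, hs⟩ := hx
    obtain ⟨s', hs'⟩ := hy
    refine ⟨s ∪ s', fun t ht => ?_⟩
    simp only [map_add, Finset.sum_add_distrib]
    rw [hs t (Finset.subset_union_left.trans ht), hs' t (Finset.subset_union_right.trans ht)]

theorem isInternal_comap {V W : Type u} [AddCommGroup V] [Module k V] [AddCommGroup W] [Module k W]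
    {gr : ℤ → Submodule k V} (h : DirectSum.IsInternal gr) (f : W →ₗ[k] V)
    (hf : Function.Injective f) (hc : ∀ w j, ∃ w', f w' = component h j (f w)) :
    DirectSum.IsInternal fun i => (gr i).comap f := by
  rw [DirectSum.isInternal_submodule_iff_iSupIndep_and_iSup_eq_top]
  constructor
  · have h1 := h.submodule_iSupIndep
    rw [iSupIndep_iff_finsetSum_eq_zero_imp_eq_zero] at h1 ⊢
    intro s v hv h0 p hp
    refine hf ((h1 s (fun p => f (v p)) hv ?_ p hp).trans (map_zero f).symm)
    rw [← map_sum, h0, map_zero]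
  · rw [eq_top_iff]
    rintro w -
    obtain ⟨s, hs⟩ := exists_sum_component h (f w)
    choose w' hw' using hc w
    have : w = ∑ i ∈ s, w' i := hf (by
      rw [map_sum, Finset.sum_congr rfl fun i _ => hw' i, hs s (le_refl _)])
    rw [this]
    refine Submodule.sum_mem _ fun i _ => Submodule.mem_iSup_of_mem i ?_
    rw [Submodule.mem_comap, hw']
    exact component_mem h i _

theorem component_map {V W : Type u} [AddCommGroup V] [Module k V] [AddCommGroup W] [Module k W]
    {gr : ℤ → Submodule k V} (h : DirectSum.IsInternal gr) {gr' : ℤ → Submodule k W}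
    (h' : DirectSum.IsInternal gr') (f : V →ₗ[k] W) (p : ℤ)
    (hf : ∀ i, ∀ v ∈ gr i, f v ∈ gr' (i + p)) (j : ℤ) (v : V) :
    component h' (j + p) (f v) = f (component h j v) := by
  induction v using graded_induction h with
  | add x y hx hy => simp only [map_add, hx, hy]
  | hom i v hv =>
    by_cases e : i = j
    · subst e
      rw [component_of_mem h hv, component_of_mem h' (hf i v hv)]
    · rw [component_of_mem_ne h e hv, component_of_mem_ne h' (by omega) (hf i v hv), map_zero]

variable [CharZero k] {A : GAlg k}

/-- The free graded module with basis elements of degrees `-q j`. -/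
def freeMod (A : GAlg k) {n : ℕ} (q : Fin n → ℤ) : GMod A where
  carrier := Fin n → A
  gr i :=
    { carrier := {v | ∀ j, v j ∈ A.gr (i + q j)}
      zero_mem' := fun _ => Submodule.zero_mem _
      add_mem' := fun hv hw j => Submodule.add_mem _ (hv j) (hw j)
      smul_mem' := fun c _ hv j => Submodule.smul_mem _ c (hv j) }
  internal := by
    refine isInternal_of_scale (LinearMap.pi fun j =>
      scale A.internal (fun i => (2 : k) ^ (i - q j)) ∘ₗ LinearMap.proj j) (fun i v hv => ?_) ?_
    · funext j
      rw [LinearMap.pi_apply, LinearMap.comp_apply, LinearMap.proj_apply,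
        scale_of_mem _ _ (hv j), add_sub_cancel_right]
      rfl
    · rw [eq_top_iff]
      rintro v -
      rw [← Finset.univ_sum_single v]
      refine Submodule.sum_mem _ fun j _ => ?_
      generalize v j = a
      induction a using graded_induction A.internal with
      | add x y hx hy => rw [Pi.single_add]; exact Submodule.add_mem _ hx hy
      | hom i a ha =>
        refine Submodule.mem_iSup_of_mem (i - q j) fun j' => ?_
        by_cases e : j' = j
        · subst e
          rwa [Pi.single_eq_same, sub_add_cancel]
        · rw [Pi.single_eq_of_ne e]
          exact Submodule.zero_mem _
  smul_mem {i j a m} ha hm l := by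
    have := A.mul_mem ha (hm l)
    rwa [← add_assoc] at this

namespace freeMod

variable {n : ℕ} {q : Fin n → ℤ}

theorem mem_gr {i : ℤ} {v : freeMod A q} : v ∈ (freeMod A q).gr i ↔ ∀ j, v j ∈ A.gr (i + q j) :=
  Iff.rfl

/-- The standard basis. -/
def basis : Module.Basis (Fin n) A (freeMod A q) := Pi.basisFun A (Fin n)

theorem basis_apply (i j : Fin n) :
    (basis i : freeMod A q) j = if j = i then 1 else 0 := by
  have : (basis i : freeMod A q) = Pi.single i (1 : A) := Pi.basisFun_apply A (Fin n) i
  rw [this, Pi.single_apply]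

theorem basis_mem (i : Fin n) : basis i ∈ (freeMod A q).gr (- q i) := by
  refine mem_gr.2 fun j => ?_
  rw [basis_apply]
  split_ifs with h
  · subst h
    rw [neg_add_cancel]
    exact A.one_mem
  · exact Submodule.zero_mem _

theorem isFinite : (freeMod A q).IsFinite := ⟨n, basis, fun i => ⟨_, basis_mem i⟩⟩

/-- The coordinates, as linear maps. -/
def proj (i : Fin n) : freeMod A q →ₗ[A] A := LinearMap.proj (φ := fun _ : Fin n => A.carrier) i

/-- The coordinate functionals. -/
def coord (i : Fin n) : (freeMod A q).dual (q i) :=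
  ⟨(A.parity (q i)).toLinearMap ∘ₗ (proj i).restrictScalars k,
    fun j m hm => HBasis.parity_mem _ (mem_gr.1 hm i), fun j a m ha => by
      simp only [LinearMap.comp_apply, LinearMap.coe_restrictScalars, map_smul, smul_eq_mul,
        AlgHom.toLinearMap_apply, map_mul, A.parity_of_mem _ ha, smul_mul_assoc]⟩

theorem coord_basis (i j : Fin n) :
    (coord i : (freeMod A q).dual (q i)).1 (basis j) = if i = j then 1 else 0 := by
  change A.parity (q i) ((basis j : freeMod A q) i) = _
  rw [basis_apply]
  split_ifs with h
  · rw [map_one]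
  · rw [map_zero]

theorem eq_of_coord {m m' : freeMod A q}
    (h : ∀ i, (coord i : (freeMod A q).dual (q i)).1 m = (coord i).1 m') : m = m' := by
  funext i
  have := congrArg (A.parity (q i)) (h i)
  exact (A.parity_parity (q i) _).symm.trans (this.trans (A.parity_parity (q i) _))

/-- The morphism with given values on the basis. -/
def desc {N : GMod A} (w : Fin n → N) (hw : ∀ j, w j ∈ N.gr (- q j)) : freeMod A q ⟶ N where
  toLin := Fintype.linearCombination A w
  map_mem i m hm := by
    change ∑ j, m j • w j ∈ _
    refine Submodule.sum_mem _ fun j _ => ?_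
    have := N.smul_mem (mem_gr.1 hm j) (hw j)
    rwa [add_neg_cancel_right] at this

theorem desc_apply {N : GMod A} (w : Fin n → N) (hw : ∀ j, w j ∈ N.gr (- q j)) (m : freeMod A q) :
    (desc w hw).toLin m = ∑ j, m j • w j := rfl

theorem desc_basis {N : GMod A} (w : Fin n → N) (hw : ∀ j, w j ∈ N.gr (- q j)) (j : Fin n) :
    (desc w hw).toLin (basis j) = w j := by
  rw [desc_apply, Finset.sum_eq_single j]
  · rw [basis_apply, if_pos rfl, one_smul]
  · intro i _ hi
    rw [basis_apply, if_neg hi, zero_smul]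
  · simp

/-- The pairing of functionals with vectors. -/
def ev {V : GMod A} (v : Fin n → V) (p : ℤ) : (freeMod A q).dual p →ₗ[k] V where
  toFun x := ∑ j, x.1 (basis j) • v j
  map_add' x y := by
    rw [← Finset.sum_add_distrib]
    exact Finset.sum_congr rfl fun j _ => add_smul _ _ _
  map_smul' c x := by
    rw [RingHom.id_apply, Finset.smul_sum]
    exact Finset.sum_congr rfl fun j _ => smul_assoc _ _ _

theorem ev_apply {V : GMod A} (v : Fin n → V) {p : ℤ} (x : (freeMod A q).dual p) :
    ev v p x = ∑ j, x.1 (basis j) • v j := rfl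

theorem ev_mem {V : GMod A} {v : Fin n → V} (hv : ∀ j, v j ∈ V.gr (q j)) {p : ℤ}
    (x : (freeMod A q).dual p) : ev v p x ∈ V.gr p := by
  change ∑ j, x.1 (basis j) • v j ∈ V.gr p
  refine Submodule.sum_mem _ fun j _ => ?_
  have := V.smul_mem (x.2.1 _ _ (basis_mem j)) (hv j)
  rwa [show -q j + p + q j = p by ring] at this

theorem ev_coord {V : GMod A} (v : Fin n → V) (i : Fin n) : ev v (q i) (coord i) = v i := by
  rw [ev_apply, Finset.sum_eq_single i]
  · rw [coord_basis, if_pos rfl, one_smul]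
  · intro j _ hj
    rw [coord_basis, if_neg hj.symm, zero_smul]
  · simp

end freeMod

/-- The base ring as a module. -/
def GAlg.selfMod (A : GAlg k) : GMod A where
  carrier := A
  gr := A.gr
  internal := A.internal
  smul_mem := A.mul_mem

theorem GMod.parity_smul_assoc (N : GMod A) (p : ℤ) (c : k) (a : A) (n : N) :
    A.parity p (c • a) • n = c • (A.parity p a • n) := by rw [map_smul, smul_assoc]

theorem GTensor.tmul_sum {N V : GMod A} (n : N) {ι : Type*} (s : Finset ι) (v : ι → V) :
    GTensor.tmul n (∑ i ∈ s, v i) = ∑ i ∈ s, GTensor.tmul n (v i) := by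
  simp only [GTensor.tmul, TensorProduct.tmul_sum]
  exact map_sum (tensorRel N V).mkQ _ _

theorem GTensor.tmul_zero {N V : GMod A} (n : N) : GTensor.tmul n (0 : V) = 0 := by
  rw [GTensor.tmul, TensorProduct.tmul_zero]; rfl

/-- The element `1` of the base ring, seen as a module. -/
def GAlg.selfOne (A : GAlg k) : A.selfMod := (1 : A)

theorem GTensor.tmul_selfOne {V : GMod A} {i : ℤ} {a : A} (ha : a ∈ A.gr i) (v : V) :
    GTensor.tmul A.selfOne (a • v) = GTensor.tmul (N := A.selfMod) a v := by
  rw [GTensor.tmul_smul ha, GMod.rmul_of_mem (j := 0) A.one_mem, A.parity_of_mem 0 ha, zero_mul,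
    sgn_zero, one_smul]
  exact congrArg (fun x => GTensor.tmul (N := A.selfMod) x v) (mul_one a)

/-- The twist of a module: the grading is shifted by `p`, and `a` acts as `(-1)^{p|a|} a`. -/
def GMod.twist (N : GMod A) (p : ℤ) : GMod A where
  carrier := N
  module := Module.compHom N (A.parity p : A →+* A)
  tower := @IsScalarTower.mk _ _ _ _ (_) _ (N.parity_smul_assoc p)
  gr i := N.gr (i - p)
  internal := isInternal_reindex N.internal (Equiv.subRight p)
  smul_mem {i j a m} ha hm := by
    have := N.smul_mem (HBasis.parity_mem p ha) hm
    rwa [← add_sub_assoc] at this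

/-- The identity, from the twist to the module. -/
def GMod.untwist (N : GMod A) (p : ℤ) : N.twist p →ₗ[k] N where
  toFun n := n
  map_add' _ _ := rfl
  map_smul' _ _ := rfl

theorem GMod.untwist_smul {N : GMod A} {p : ℤ} (a : A) (n : N.twist p) :
    N.untwist p (a • n) = A.parity p a • N.untwist p n := rfl

/-- A functional as a morphism from the twist. -/
def GMod.twistHom {N : GMod A} {p : ℤ} (y : N.dual p) : N.twist p ⟶ A.selfMod where
  toLin :=
    { toFun := fun n => y.1 (N.untwist p n)
      map_add' := fun a b => by rw [map_add, map_add]; rfl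
      map_smul' := fun a n => by
        change y.1 (N.untwist p (a • n)) = a * y.1 (N.untwist p n)
        rw [GMod.untwist_smul, GMod.dual_smul, ← GAlg.parity_apply, GAlg.parity_parity] }
  map_mem i n hn := by
    have := y.2.1 _ _ hn
    rwa [sub_add_cancel] at this

/-- The kernel of a morphism. -/
def GMod.ker {N N' : GMod A} (f : N ⟶ N') : GMod A where
  carrier := LinearMap.ker f.toLin
  gr i := (N.gr i).comap ((LinearMap.ker f.toLin).subtype.restrictScalars k)
  internal := isInternal_comap N.internal _ Subtype.val_injective fun w j =>
    ⟨⟨component N.internal j w.1, by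
      have h := component_map N.internal N'.internal (f.toLin.restrictScalars k) 0
        (fun i v hv => by rw [add_zero]; exact f.map_mem i v hv) j w.1
      rw [LinearMap.mem_ker]
      refine h.symm.trans ?_
      rw [show (f.toLin.restrictScalars k) w.1 = 0 from w.2, map_zero]⟩, rfl⟩
  smul_mem ha hm := N.smul_mem ha hm

/-- The inclusion of the kernel. -/
def GMod.kerι {N N' : GMod A} (f : N ⟶ N') : GMod.ker f ⟶ N where
  toLin := (LinearMap.ker f.toLin).subtype
  map_mem _ _ h := h

/-- The contraction of the tensor product with a functional. -/
def GMod.contrTensor {N : GMod A} (V : GMod A) (p : ℤ) {q : ℤ} (x : N.dual q) :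
    GTensor (N.twist p) V →ₗ[k] V :=
  (tensorRel (N.twist p) V).liftQ
    (TensorProduct.lift (LinearMap.mk₂ k (fun n (v : V) => x.1 (N.untwist p n) • v)
      (fun n n' v => by rw [map_add, map_add, add_smul]) (fun c n v => by rw [map_smul, map_smul, smul_assoc])
      (fun n v v' => smul_add _ _ _) (fun c n v => smul_comm _ _ _))) (by
    rw [tensorRel, Submodule.span_le]
    rintro _ ⟨i, j, a, n, v, ha, hn, rfl⟩
    rw [SetLike.mem_coe, LinearMap.mem_ker, map_sub, sub_eq_zero]
    change x.1 (N.untwist p (sgn (i * j) • a • n)) • v = x.1 (N.untwist p n) • a • v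
    have hn' : x.1 (N.untwist p n) ∈ A.gr (j - p + q) := x.2.1 _ _ hn
    rw [map_zsmul, GMod.untwist_smul, A.parity_of_mem p ha, smul_assoc, map_zsmul, map_zsmul,
      x.2.2 _ _ _ ha, A.comm ha hn', smul_smul, smul_smul, smul_smul, ← sgn_add, ← sgn_add,
      ← sgn_add, smul_smul]
    have : sgn (i * j + p * i + q * i + i * (j - p + q)) = 1 := by
      rw [show i * j + p * i + q * i + i * (j - p + q) = (i * (j + q)) + i * (j + q) by ring, sgn_add,
        sgn_mul_self]
    rw [this, one_smul])

theorem GMod.contrTensor_tmul {N V : GMod A} (p : ℤ) {q : ℤ} (x : N.dual q) (n : N.twist p)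
    (v : V) : GMod.contrTensor V p x (GTensor.tmul n v) = x.1 (N.untwist p n) • v := rfl

/-- The equational criterion: a relation `∑ y(b_j) v_j = 0` in a flat module is a consequence of
relations between the coefficients. -/
theorem GMod.IsFlat.exists_factorization {V : GMod A} (hV : V.IsFlat) {n : ℕ} {q : Fin n → ℤ}
    (v : Fin n → V) (hv : ∀ j, v j ∈ V.gr (q j)) {p : ℤ} (y : (freeMod A q).dual p)
    (hy : freeMod.ev v p y = 0) :
    ∃ (m : ℕ) (r : Fin m → ℤ) (w : Fin m → V) (c : Fin m → freeMod A q),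
      (∀ s, w s ∈ V.gr (r s)) ∧ (∀ s, c s ∈ (freeMod A q).gr (- r s)) ∧ (∀ s, y.1 (c s) = 0) ∧
      ∀ (p' : ℤ) (x : (freeMod A q).dual p'), freeMod.ev v p' x = ∑ s, x.1 (c s) • w s := by
  let N := freeMod A q
  let b : Fin n → N.twist p := (freeMod.basis : Module.Basis (Fin n) A (freeMod A q))
  -- Only on the twist by its degree p is y a morphism of degree zero. It sends ∑ b_j ⊗ v_j to 1 ⊗ ∑
  -- y(b_j) v_j, which vanishes by the given relation.
  have h1 : GTensor.map (GMod.twistHom y) V (∑ j, GTensor.tmul (b j) (v j)) = 0 := by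
    have : ∀ j, GTensor.map (GMod.twistHom y) V (GTensor.tmul (b j) (v j))
        = GTensor.tmul A.selfOne (y.1 (freeMod.basis j) • v j) := fun j =>
      (GTensor.tmul_selfOne (y.2.1 _ _ (freeMod.basis_mem j)) (v j)).symm
    rw [map_sum, Finset.sum_congr rfl fun j _ => this j, ← GTensor.tmul_sum, ← freeMod.ev_apply, hy,
      GTensor.tmul_zero]
  -- Flatness applied to the kernel of y: the tensor ∑ b_j ⊗ v_j comes from a tensor over the
  -- kernel.
  obtain ⟨t, ht⟩ := (hV _ _ _ (GMod.kerι (GMod.twistHom y)) (GMod.twistHom y)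
    (LinearMap.exact_subtype_ker_map _) _).1 h1
  -- Such a tensor is a finite sum of n ⊗ w with y(n) = 0 and w homogeneous; homogeneous components
  -- of the n serve as the new coefficients. For a general tensor the contraction with x need not be
  -- homogeneous, hence the component of degree p'.
  have key : ∀ t : GTensor (GMod.ker (GMod.twistHom y)) V,
      ∃ (m : ℕ) (r : Fin m → ℤ) (w : Fin m → V) (c : Fin m → freeMod A q),
      (∀ s, w s ∈ V.gr (r s)) ∧ (∀ s, c s ∈ (freeMod A q).gr (- r s)) ∧ (∀ s, y.1 (c s) = 0) ∧
      ∀ (p' : ℤ) (x : (freeMod A q).dual p'), component V.internal p'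
        (GMod.contrTensor V p x (GTensor.map (GMod.kerι (GMod.twistHom y)) V t))
          = ∑ s, x.1 (c s) • w s := by
    intro t
    induction t using GTensor.induction with
    | h n r w hw =>
      refine ⟨1, fun _ => r, fun _ => w, fun _ => component N.internal (-r) (N.untwist p n.1),
        fun _ => hw, fun _ => component_mem _ _ _, fun _ => ?_, fun p' x => ?_⟩
      · rw [← component_map N.internal A.internal y.1 p y.2.1]
        have : y.1 (N.untwist p n.1) = 0 := n.2
        rw [this, map_zero]
      · rw [GTensor.map_tmul, GMod.contrTensor_tmul, Fin.sum_univ_one,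
          ← component_map N.internal A.internal x.1 p' x.2.1, HBasis.component_smul hw,
          show p' - r = -r + p' by ring]
        rfl
    | add t t' h h' =>
      obtain ⟨m, r, w, c, h1, h2, h3, h4⟩ := h
      obtain ⟨m', r', w', c', h1', h2', h3', h4'⟩ := h'
      refine ⟨m + m', Fin.append r r', Fin.append w w', Fin.append c c', fun s => ?_, fun s => ?_,
        fun s => ?_, fun p' x => ?_⟩
      · refine Fin.addCases (fun s => ?_) (fun s => ?_) s
        · simpa using h1 s
        · simpa using h1' s
      · refine Fin.addCases (fun s => ?_) (fun s => ?_) s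
        · simpa using h2 s
        · simpa using h2' s
      · refine Fin.addCases (fun s => ?_) (fun s => ?_) s
        · simpa using h3 s
        · simpa using h3' s
      · rw [map_add, map_add, map_add, h4, h4', Fin.sum_univ_add]
        simp
  obtain ⟨m, r, w, c, h1, h2, h3, h4⟩ := key t
  refine ⟨m, r, w, c, h1, h2, h3, fun p' x => ?_⟩
  rw [← h4, ht, map_sum]
  have : ∑ j, GMod.contrTensor V p x (GTensor.tmul (b j) (v j)) = freeMod.ev v p' x := rfl
  rw [this, component_of_mem _ (freeMod.ev_mem hv x)]

end FreeMod

/-! ### Lazard's theorem: flat modules are dual to pro-finite modules -/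

section Lazard

variable {k : Type u} [Field k] [CharZero k] {A : GAlg k}

/-- Finite families of homogeneous elements of `V`. -/
structure FamilyIn (V : GMod A) : Type u where
  n : ℕ
  q : Fin n → ℤ
  v : Fin n → V
  mem : ∀ j, v j ∈ V.gr (q j)

namespace FamilyIn

variable {V : GMod A}

/-- The free module on (the dual of) a family. -/
abbrev free (Y : FamilyIn V) : GMod A := freeMod A Y.q

/-- Morphisms of families: maps of free modules, compatible with the evaluation. -/
@[ext]
structure Hom (Y Z : FamilyIn V) where
  map : Z.free ⟶ Y.free
  ev_map : ∀ (p : ℤ) (x : Y.free.dual p),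
    freeMod.ev Z.v p (GMod.dualMap map p x) = freeMod.ev Y.v p x

instance : SmallCategory (FamilyIn V) where
  Hom := Hom
  id Y := ⟨𝟙 _, fun _ _ => rfl⟩
  comp f g := ⟨g.map ≫ f.map, fun p x =>
    (g.ev_map p (GMod.dualMap f.map p x)).trans (f.ev_map p x)⟩

theorem comp_map {X Y Z : FamilyIn V} (f : X ⟶ Y) (g : Y ⟶ Z) : (f ≫ g).map = g.map ≫ f.map := rfl

theorem exists_hom {Y : FamilyIn V} {m : ℕ} {r : Fin m → ℤ} {w : Fin m → V} {c : Fin m → Y.free}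
    (hw : ∀ s, w s ∈ V.gr (r s)) (hc : ∀ s, c s ∈ Y.free.gr (- r s))
    (h : ∀ (p' : ℤ) (x : Y.free.dual p'), ∑ s, x.1 (c s) • w s = freeMod.ev Y.v p' x) :
    ∃ f : Y ⟶ ⟨m, r, w, hw⟩, ∀ s, f.map.toLin (freeMod.basis s) = c s :=
  ⟨⟨freeMod.desc c hc, fun p x => by
    rw [← h, freeMod.ev_apply]
    refine Finset.sum_congr rfl fun s _ => ?_
    rw [GMod.dualMap_apply, freeMod.desc_basis]⟩, freeMod.desc_basis c hc⟩

theorem dual_comp_eq_zero {q : ℤ} {N N' : GMod A} (f : N ⟶ N') {n : ℕ} (b : Module.Basis (Fin n) A N)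
    (y : N'.dual q) (h : ∀ s, y.1 (f.toLin (b s)) = 0) : GMod.dualMap f q y = 0 := by
  refine GMod.dual_ext fun m => ?_
  rw [← b.sum_repr m, map_sum]
  refine (Finset.sum_eq_zero fun i _ => ?_).trans rfl
  rw [GMod.dual_smul, GMod.dualMap_apply, h, mul_zero]

theorem exists_dualMap_eq_zero (hV : V.IsFlat) (Y : FamilyIn V) {p : ℤ} (y : Y.free.dual p)
    (hy : freeMod.ev Y.v p y = 0) : ∃ (Z : FamilyIn V) (f : Y ⟶ Z), GMod.dualMap f.map p y = 0 := by
  obtain ⟨m, r, w, c, h1, h2, h3, h4⟩ := hV.exists_factorization Y.v Y.mem y hy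
  obtain ⟨f, hf⟩ := exists_hom h1 h2 fun p' x => (h4 p' x).symm
  exact ⟨_, f, dual_comp_eq_zero _ freeMod.basis y fun s => by rw [hf, h3]⟩

theorem exists_hom_singleton {p : ℤ} {z : V} (hz : z ∈ V.gr p) :
    ∃ (Y : FamilyIn V) (x : Y.free.dual p), freeMod.ev Y.v p x = z :=
  ⟨⟨1, fun _ => p, fun _ => z, fun _ => hz⟩, freeMod.coord 0, freeMod.ev_coord (q := fun _ => p) _ _⟩

theorem exists_cocone (Y Y' : FamilyIn V) : ∃ Z : FamilyIn V, Nonempty (Y ⟶ Z) ∧ Nonempty (Y' ⟶ Z) := by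
  have hw : ∀ s, Fin.append Y.v Y'.v s ∈ V.gr (Fin.append Y.q Y'.q s) := fun s => by
    refine Fin.addCases (fun s => ?_) (fun s => ?_) s
    · simpa using Y.mem s
    · simpa using Y'.mem s
  refine ⟨⟨Y.n + Y'.n, Fin.append Y.q Y'.q, Fin.append Y.v Y'.v, hw⟩, ?_, ?_⟩
  · obtain ⟨f, -⟩ := exists_hom (Y := Y) (c := Fin.append (fun s => freeMod.basis s) fun _ => 0) hw
      (fun s => by
        refine Fin.addCases (fun s => ?_) (fun s => ?_) s
        · simpa using freeMod.basis_mem s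
        · simp) (fun p x => by simp [Fin.sum_univ_add, freeMod.ev_apply])
    exact ⟨f⟩
  · obtain ⟨f, -⟩ := exists_hom (Y := Y') (c := Fin.append (fun _ => 0) fun s => freeMod.basis s) hw
      (fun s => by
        refine Fin.addCases (fun s => ?_) (fun s => ?_) s
        · simp
        · simpa using freeMod.basis_mem s) (fun p x => by simp [Fin.sum_univ_add, freeMod.ev_apply])
    exact ⟨f⟩

/-- The two pullbacks of a coordinate functional of `Y.free` have the same value in V, so the
equational criterion kills their difference after a further morphism. The finitely many coordinates
are treated in turn, and they separate maps into `Y.free`. -/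
theorem exists_equalizing (hV : V.IsFlat) {Y Z : FamilyIn V} (f g : Y ⟶ Z) :
    ∃ (W : FamilyIn V) (h : Z ⟶ W), f ≫ h = g ≫ h := by
  have key : ∀ s : Finset (Fin Y.n), ∃ (W : FamilyIn V) (h : Z ⟶ W), ∀ i ∈ s,
      GMod.dualMap h.map _ (GMod.dualMap f.map _ (freeMod.coord i))
        = GMod.dualMap h.map _ (GMod.dualMap g.map _ (freeMod.coord i)) := by
    intro s
    induction s using Finset.induction_on with
    | empty => exact ⟨Z, 𝟙 _, fun i hi => absurd hi (Finset.notMem_empty i)⟩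
    | insert i s _ ih =>
      obtain ⟨W, h, hh⟩ := ih
      obtain ⟨W', h', e⟩ := exists_dualMap_eq_zero hV W
        (GMod.dualMap h.map _ (GMod.dualMap f.map _ (freeMod.coord i))
          + (-1 : k) • GMod.dualMap h.map _ (GMod.dualMap g.map _ (freeMod.coord i))) (by
          rw [map_add, map_smul, h.ev_map, h.ev_map, f.ev_map, g.ev_map, neg_one_smul,
            add_neg_cancel])
      refine ⟨W', h ≫ h', fun j hj => ?_⟩
      rcases Finset.mem_insert.1 hj with rfl | hj
      · refine GMod.dual_ext fun m => ?_
        have := LinearMap.congr_fun (congrArg Subtype.val e) m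
        refine sub_eq_zero.1 (Eq.trans ?_ this)
        rw [sub_eq_add_neg, ← neg_one_smul k]
        rfl
      · exact congrArg (GMod.dualMap h'.map _) (hh j hj)
  obtain ⟨W, h, hh⟩ := key Finset.univ
  refine ⟨W, h, Hom.ext (GMod.Hom.ext (LinearMap.ext fun m => freeMod.eq_of_coord fun i => ?_))⟩
  exact LinearMap.congr_fun (congrArg Subtype.val (hh i (Finset.mem_univ i))) m

theorem isFiltered (hV : V.IsFlat) : IsFiltered (FamilyIn V) where
  cocone_objs Y Z := by
    obtain ⟨W, ⟨f⟩, ⟨g⟩⟩ := exists_cocone Y Z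
    exact ⟨W, f, g, trivial⟩
  cocone_maps _ _ f g := exists_equalizing hV f g
  nonempty := ⟨⟨0, Fin.elim0, Fin.elim0, fun j => j.elim0⟩⟩

end FamilyIn

/-- Flat modules are dual to pro-finite modules. -/
theorem GMod.IsFlat.exists_duality {V : GMod A} (hV : V.IsFlat) :
    ∃ M : ProObj (GMod A), IsProFinite M ∧ Nonempty (Duality M V) := by
  have := FamilyIn.isFiltered hV
  -- The filtered category is replaced by a directed set with a final functor, because pro-objects
  -- are indexed by directed sets. Morphisms of families go against the maps of free modules, so an
  -- inverse system results.
  obtain ⟨I, _, _, _, F, hF⟩ := IsFiltered.exists_directed (FamilyIn V)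
  have hI : IsFiltered I := inferInstance
  obtain ⟨h1, h2⟩ := (Functor.final_iff_of_isFiltered F).1 hF
  let M : ProObj (GMod A) :=
    { I := I
      X := fun i => (F.obj i).free
      map := fun h => (F.map (homOfLE h)).map
      map_id := fun i => by
        rw [show homOfLE (le_refl i) = 𝟙 i from rfl, F.map_id]
        rfl
      map_comp := fun h h' => by
        rw [← FamilyIn.comp_map, ← F.map_comp]
        rfl }
  refine ⟨M, fun i => freeMod.isFinite, ⟨{
    j := fun α p => freeMod.ev (F.obj α).v p
    j_mem := fun α p x => freeMod.ev_mem (F.obj α).mem x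
    j_smul := fun α i p a _ x y h => ?_
    compat := fun h p x => (F.map (homOfLE h)).ev_map p x
    surj := fun p z hz => ?_
    inj := fun α p x hx => ?_ }⟩⟩
  · rw [freeMod.ev_apply, freeMod.ev_apply, Finset.smul_sum]
    exact Finset.sum_congr rfl fun s _ => by rw [h, mul_smul]
  · obtain ⟨Y, x, hx⟩ := FamilyIn.exists_hom_singleton hz
    obtain ⟨α, ⟨f⟩⟩ := h1 Y
    exact ⟨α, GMod.dualMap f.map p x, (f.ev_map p x).trans hx⟩
  -- The functional dies along a morphism to some family Z, which need not lie in the directed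
  -- system. Finality leads from Z back to the system and, at a still later index, identifies the
  -- resulting morphism with the transition map.
  · obtain ⟨Z, f, hf⟩ := FamilyIn.exists_dualMap_eq_zero hV (F.obj α) x hx
    obtain ⟨β, ⟨g⟩⟩ := h1 Z
    obtain ⟨γ, hα, hβ⟩ := exists_ge_ge α β
    obtain ⟨δ, t, ht⟩ := h2 (F.map (homOfLE hα)) (f ≫ g ≫ F.map (homOfLE hβ))
    refine ⟨δ, hα.trans (leOfHom t), ?_⟩
    have e : F.map (homOfLE (hα.trans (leOfHom t))) = f ≫ (g ≫ F.map (homOfLE hβ) ≫ F.map t) := by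
      have e1 : homOfLE (hα.trans (leOfHom t)) = homOfLE hα ≫ t := rfl
      rw [e1, F.map_comp, ht]
      simp only [Category.assoc]
    change GMod.dualMap (F.map (homOfLE (hα.trans (leOfHom t)))).map p x = 0
    rw [e]
    refine GMod.dual_ext fun m => ?_
    exact LinearMap.congr_fun (congrArg Subtype.val hf) _

end Lazard

/-! ### Comparison of two pro-finite modules dual to the same module -/

section Transport

variable {k : Type u} [Field k] {A : GAlg k} {V : GMod A}
  {M M' M'' : ProObj (GMod A)}

theorem HBasis.hom_ext {N N' : GMod A} (b : HBasis N') {f g : N ⟶ N'}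
    (h : ∀ i m, (b.ε i).1 (f.toLin m) = (b.ε i).1 (g.toLin m)) : f = g := by
  refine GMod.Hom.ext (LinearMap.ext fun m => b.b.repr.injective (Finsupp.ext fun i => ?_))
  have := congrArg (A.parity (b.q i)) (h i m)
  rw [b.ε_apply, b.ε_apply] at this
  exact (A.parity_parity _ _).symm.trans (this.trans (A.parity_parity _ _))

theorem HBasis.exists_hom {N N' : GMod A} (b : HBasis N') (y : ∀ i, N.dual (- b.q i)) :
    ∃ f : N ⟶ N', ∀ i, GMod.dualMap f _ (b.ε i) = y i := by
  have hp : ∀ i a, A.parity (- b.q i) a = A.parity (b.q i) a := fun i a => by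
    rw [A.parity_apply, A.parity_apply]
    simp only [neg_mul, sgn_neg]
  let f : N →ₗ[A] N' :=
    ∑ i, (({ toFun := fun m => A.parity (b.q i) ((y i).1 m)
             map_add' := fun m m' => by rw [map_add, map_add]
             map_smul' := fun a m => by
              rw [GMod.dual_smul, map_mul, ← GAlg.parity_apply, hp, GAlg.parity_parity]; rfl } :
              N →ₗ[A] A).smulRight (b.b i))
  have hf : ∀ m, f m = ∑ i, A.parity (b.q i) ((y i).1 m) • b.b i := fun m => by
    simp [f]
  refine ⟨⟨f, fun j m hm => ?_⟩, fun i => GMod.dual_ext fun m => ?_⟩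
  · rw [hf]
    refine Submodule.sum_mem _ fun i _ => ?_
    have := N'.smul_mem (HBasis.parity_mem (b.q i) ((y i).2.1 j m hm)) (b.mem i)
    rwa [neg_add_cancel_right] at this
  · change (b.ε i).1 (f m) = _
    rw [hf, b.ε_apply, b.b.repr_sum_self, GAlg.parity_parity]

variable (J : Duality M V) (J' : Duality M' V)

/-- A morphism `M_β ⟶ M'_α` compatible with the dualities. -/
def OverDual {β : M.I} {α : M'.I} (f : M.X β ⟶ M'.X α) : Prop :=
  ∀ (p : ℤ) (x : (M'.X α).dual p), J.j β p (GMod.dualMap f p x) = J'.j α p x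

variable {J J'}

theorem overDual_map {α β : M.I} (h : α ≤ β) : OverDual J J (M.map h) := J.compat h

theorem OverDual.comp {J'' : Duality M'' V} {γ : M.I} {β : M'.I} {α : M''.I} {f : M.X γ ⟶ M'.X β}
    {g : M'.X β ⟶ M''.X α} (hf : OverDual J J' f) (hg : OverDual J' J'' g) :
    OverDual J J'' (f ≫ g) := fun p x => (hf p (GMod.dualMap g p x)).trans (hg p x)

-- The elements of V given by the dual basis of M'_α lift to the dual of some M_β, and a map into a
-- finite free module amounts to its coordinates. The dualities respect multiplication by A, so
-- compatibility on the dual basis is enough.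
variable (J J') in
theorem exists_overDual (hM' : IsProFinite M') (α : M'.I) :
    ∃ (β : M.I) (f : M.X β ⟶ M'.X α), OverDual J J' f := by
  obtain ⟨b⟩ := (hM' α).nonempty_hbasis
  obtain ⟨β, -, y, hy, -⟩ := J.exists_lifts (fun i => - b.q i) (fun i => J'.j α _ (b.ε i))
    (fun i => J'.j_mem α _ _) (Classical.arbitrary _)
  obtain ⟨f, hf⟩ := b.exists_hom y
  refine ⟨β, f, fun p x => ?_⟩
  have hc : ∀ {q q' : ℤ} (e : q = q') {a : A} {i : ℤ} (ha : a ∈ A.gr i) {p : ℤ} (h : i + p = q)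
      (x : (M'.X α).dual p), J.j β q (GMod.dualMap f q (GMod.dualMul ha h x))
        = a • J.j β p (GMod.dualMap f p x) := by
    rintro q q' e a i ha p rfl x
    exact J.j_smul β i p a ha _ _ fun m => by simp
  have hc' : ∀ {q : ℤ} {a : A} {i : ℤ} (ha : a ∈ A.gr i) {p : ℤ} (h : i + p = q)
      (x : (M'.X α).dual p), J'.j α q (GMod.dualMul ha h x) = a • J'.j α p x := by
    rintro q a i ha p rfl x
    exact J'.j_smul α i p a ha _ _ fun m => by simp
  have hs : ∀ (s : Finset (Fin b.n)) (z : Fin b.n → (M'.X α).dual p),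
      J.j β p (GMod.dualMap f p (∑ i ∈ s, z i)) = ∑ i ∈ s, J.j β p (GMod.dualMap f p (z i)) := by
    intro s z
    induction s using Finset.induction_on with
    | empty => exact map_zero (J.j β p)
    | insert i s hi ih =>
      rw [Finset.sum_insert hi, Finset.sum_insert hi, GMod.dualMap_add, map_add, ih]
  rw [b.dual_eq_sum x, hs, map_sum]
  refine Finset.sum_congr rfl fun i _ => ?_
  rw [hc rfl, hc', hf, hy]

/-- The coordinates of f and g represent the same elements of V, so their differences die at a later
stage. -/
theorem OverDual.exists_eq (hM' : IsProFinite M') {β : M.I} {α : M'.I} {f g : M.X β ⟶ M'.X α}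
    (hf : OverDual J J' f) (hg : OverDual J J' g) :
    ∃ (γ : M.I) (h : β ≤ γ), M.map h ≫ f = M.map h ≫ g := by
  obtain ⟨b⟩ := (hM' α).nonempty_hbasis
  choose γ h e using fun i => J.inj β _
    (GMod.dualMap f _ (b.ε i) + (-1 : k) • GMod.dualMap g _ (b.ε i)) (by
      rw [map_add, map_smul, hf, hg, neg_one_smul, add_neg_cancel])
  obtain ⟨δ, hδ, hγ⟩ := exists_upper_bound Set.univ Set.finite_univ γ β
  refine ⟨δ, hδ, b.hom_ext fun i m => ?_⟩
  have h1 := LinearMap.congr_fun (congrArg Subtype.val (e i)) ((M.map (hγ i trivial)).toLin m)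
  have h2 : (M.map (h i)).toLin ((M.map (hγ i trivial)).toLin m) = (M.map hδ).toLin m := by
    rw [← M.map_comp (h i) (hγ i trivial)]; rfl
  change (b.ε i).1 (f.toLin ((M.map hδ).toLin m)) = (b.ε i).1 (g.toLin ((M.map hδ).toLin m))
  rw [← h2]
  refine sub_eq_zero.1 (Eq.trans ?_ h1)
  rw [sub_eq_add_neg]
  exact congrArg (_ + ·) (neg_one_smul k _).symm

theorem OverDual.exists_eq' (hM' : IsProFinite M') {β β' : M.I} {α : M'.I} {f : M.X β ⟶ M'.X α}
    {g : M.X β' ⟶ M'.X α} (hf : OverDual J J' f) (hg : OverDual J J' g) :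
    ∃ (γ : M.I) (h : β ≤ γ) (h' : β' ≤ γ), M.map h ≫ f = M.map h' ≫ g := by
  obtain ⟨γ, h, h'⟩ := exists_ge_ge β β'
  obtain ⟨δ, hδ, e⟩ := OverDual.exists_eq hM' ((overDual_map h).comp hf) ((overDual_map h').comp hg)
  refine ⟨δ, h.trans hδ, h'.trans hδ, ?_⟩
  rwa [← Category.assoc, ← Category.assoc, M.map_comp, M.map_comp] at e

theorem brL_postcomp {Λ W₀ W₁ W₂ : Type*} {deg : Λ → ℤ} [AddCommGroup W₀] [Module k W₀]
    [AddCommGroup W₁] [Module k W₁] [AddCommGroup W₂] [Module k W₂] {ι₀ : Λ → W₀ →ₗ[k] W₀}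
    {ι₁ : Λ → W₁ →ₗ[k] W₁} {ι₂ : Λ → W₂ →ₗ[k] W₂} (P : W₁ →ₗ[k] W₂)
    (hP : ∀ x s, P (ι₁ x s) = ι₂ x (P s)) (e : ℤ) (Q : W₀ →ₗ[k] W₁) (w : List Λ) :
    brL deg ι₀ ι₂ e (P ∘ₗ Q) w = P ∘ₗ brL deg ι₀ ι₁ e Q w := by
  induction w generalizing e Q with
  | nil => rfl
  | cons x w ih =>
    rw [brL_cons, brL_cons, ← ih]
    congr 1
    ext s
    simp only [brk_apply, LinearMap.comp_apply, hP, map_sub, map_zsmul]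

variable [CharZero k]

variable (J J') in
/-- A morphism of completed symmetric algebras is compatible with the dualities. -/
def SymOver (F : symPro M ⟶ symPro M') : Prop :=
  ∀ α : M'.I, ∃ (β : M.I) (f : M.X β ⟶ M'.X α), OverDual J J' f ∧
    ∀ n : ℕ, Represents F (β, n) (α, n) (Sym.map f (le_refl _))

-- Compatible maps exist stage by stage, and two of them agree after the source is enlarged; so they
-- form a pro-morphism.
variable (J J') in
theorem exists_symOver (hM' : IsProFinite M') : ∃ F : symPro M ⟶ symPro M', SymOver J J' F := by
  choose β f hf using fun α => exists_overDual J J' hM' α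
  obtain ⟨F, hF⟩ := exists_hom_of_family (X := symPro M) (Y := symPro M')
    (fun j : M'.I × ℕ => (β j.1, j.2)) (fun j => Sym.map (f j.1) (le_refl _)) (by
      intro j' j h
      have h1 : j'.1 ≤ j.1 := (Prod.le_def.1 h).1
      have h2 : j'.2 ≤ j.2 := (Prod.le_def.1 h).2
      obtain ⟨γ, h3, h4, e⟩ := OverDual.exists_eq' hM' ((hf j.1).comp (overDual_map h1)) (hf j'.1)
      refine ⟨(γ, j.2), ⟨h3, le_refl _⟩, ⟨h4, h2⟩, ?_⟩
      change Sym.map _ _ ≫ Sym.map _ _ ≫ Sym.map _ _ = Sym.map _ _ ≫ Sym.map _ _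
      rw [Sym.map_comp, Sym.map_comp, Sym.map_comp]
      congr 1)
  exact ⟨F, fun α => ⟨β α, f α, hf α, fun n => hF (α, n)⟩⟩

/-- The composite and the transition map are both compatible with the duality, so they coincide
after the source is enlarged. -/
theorem SymOver.comp_eq_id (hM : IsProFinite M) {F : symPro M ⟶ symPro M'} {G : symPro M' ⟶ symPro M}
    (hF : SymOver J J' F) (hG : SymOver J' J G) : F ≫ G = 𝟙 _ := by
  refine Represents.hom_ext fun j => ?_
  obtain ⟨α, n⟩ := j
  obtain ⟨β, g, hg, hg'⟩ := hG α
  obtain ⟨γ, f, hf, hf'⟩ := hF β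
  obtain ⟨δ, h, h', e⟩ := OverDual.exists_eq' hM (hf.comp hg) (overDual_map (J := J) (le_refl α))
  have hle : ((γ, n) : M.I × ℕ) ≤ (δ, n) := ⟨h, le_refl _⟩
  refine ⟨(δ, n), _, ((hf' n).comp (hg' n)).restrict (X := symPro M) (i' := (δ, n)) hle, ?_⟩
  have e1 : (symPro M).map hle ≫ Sym.map f (le_refl _) ≫ Sym.map g (le_refl _)
      = (symPro M).map (show ((α, n) : M.I × ℕ) ≤ (δ, n) from ⟨h', le_refl _⟩) := by
    change Sym.map _ _ ≫ Sym.map _ _ ≫ Sym.map _ _ = Sym.map _ _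
    rw [Sym.map_comp, Sym.map_comp]
    congr 1
    rw [e, M.map_comp]
  rw [e1]
  exact represents_id (X := symPro M) _

theorem SymOver.comp_symProj {F : symPro M ⟶ symPro M'} (hF : SymOver J J' F) :
    F ≫ symProj M' = symProj M := by
  have hp : ∀ {M : ProObj (GMod A)} (i : M.I × ℕ) (j), Represents (symProj M) i j
      (Sym.proj (M.X i.1) i.2) := by
    intro M i j
    have h : symProj M = toConst (symPro M) i (Sym.proj (M.X i.1) i.2) :=
      toConst_eq (symPro M) (fun i => Sym.proj (M.X i.1) i.2) (fun h => Sym.map_proj _ _) _ i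
    rw [h]
    exact represents_toConst (X := symPro M) i _ j
  refine Represents.hom_ext fun j => ?_
  obtain ⟨β, f, hf, hf'⟩ := hF (Classical.arbitrary _)
  have h := (hf' 0).comp (hp (M := M') _ j)
  exact ⟨(β, 0), _, Eq.subst (motive := fun g => Represents (F ≫ symProj M') (β, 0) j g)
    (Sym.map_proj f (le_refl ((0 : ℕ) : ℕ∞))) h, hp (β, 0) j⟩

open SHLieRinehart.SymAlg

theorem SymOver.act_cls {F : symPro M ⟶ symPro M'} (hF : SymOver J J' F) (α : M'.I) :
    ∃ (β : M.I) (f : M.X β ⟶ M'.X α), OverDual J J' f ∧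
      ∀ g : contFun (M'.X α), act ((toProMod k).map F) (cls M' α g) = cls M β (cpull f g) := by
  obtain ⟨β, f, hf, hf'⟩ := hF α
  refine ⟨β, f, hf, fun g => ?_⟩
  obtain ⟨n, hn⟩ := g.2
  obtain ⟨g', h⟩ := hn.factor
  rw [← clsT_of_eq (i := (α, n)) (g := g') h]
  have hr : Rep ((toProMod k).map F) (β, n) (α, n) (Sym.map f (le_refl _)).toAlgHom.toLinearMap :=
    (hf' n).map (GAlg.forget k)
  rw [act_clsT hr]
  refine clsT_of_eq (i := (β, n)) (g' := cpull f g) (LinearMap.ext fun s => ?_)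
  rw [cpull_apply, ← h]
  have e : SymAlg.map f (le_refl (n : ℕ∞)) (trc (M.X β) n s)
      = trc (M'.X α) n (SymAlg.map f (le_refl ⊤) s) := by
    rw [trc, trc, map_map, map_map, Category.id_comp, Category.comp_id]
  exact congrArg g' e

theorem SymOver.act_projW {F : symPro M ⟶ symPro M'} (hF : SymOver J J' F) :
    act ((toProMod k).map F) (projW M') = projW M := by
  obtain ⟨β, f, -, h⟩ := hF.act_cls (Classical.arbitrary _)
  rw [← cls_cproj (Classical.arbitrary _), h, cpull_cproj, cls_cproj]

theorem SymOver.act_ctrW {F : symPro M ⟶ symPro M'} (hF : SymOver J J' F) {p : ℤ} {v : V}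
    (hv : v ∈ V.gr p) (s : Wfun M') : act ((toProMod k).map F) (ctrW J' v s)
      = ctrW J v (act ((toProMod k).map F) s) := by
  obtain ⟨γ, x, rfl⟩ := J'.surj p v hv
  obtain ⟨α, g, rfl⟩ := exists_cls s
  obtain ⟨δ, h1, h2⟩ := exists_ge_ge γ α
  rw [← J'.compat h1, ← cls_cpull h2, ctrW_j_self]
  obtain ⟨β, f, hf, h⟩ := hF.act_cls δ
  rw [h, h, cpull_cctr, ← hf, ctrW_j_self]

theorem SymOver.act_kap {F : symPro M ⟶ symPro M'} (hF : SymOver J J' F) (v : V)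
    (θ : A →ₗ[k] A) : act ((toProMod k).map F) (kap J' v θ) = kap J v θ := by
  rw [kap, kap, map_add, act_postW, hF.act_projW]
  congr 1
  induction v using graded_induction V.internal with
  | add x y hx hy => rw [map_add, map_add, LinearMap.add_apply, LinearMap.add_apply, map_add, hx, hy]
  | hom p v hv => rw [hF.act_ctrW hv, hF.act_projW]

/-- The transpose Φ of F commutes with contractions and preserves π and `kap`. Hence the brackets at
π of Φ∘d' and of d∘Φ are both given by X, and the difference vanishes on contraction words. -/
theorem SymOver.comm (hM' : IsProFinite M') {F : symPro M ⟶ symPro M'} (hF : SymOver J J' F)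
    {X : MultiDer V} {d : (toProMod k).obj (symPro M) ⟶ (toProMod k).obj (symPro M)}
    {d' : (toProMod k).obj (symPro M') ⟶ (toProMod k).obj (symPro M')}
    (hd : Star J X (act d)) (hd' : Star J' X (act d')) :
    (toProMod k).map F ≫ d' = d ≫ (toProMod k).map F := by
  refine rep_hom_ext hM' fun α b u => ?_
  rw [act_comp, act_comp]
  let Φ := act ((toProMod k).map F)
  have hΦ : ∀ (x : Letter V) s, Φ (lctr J' x s) = lctr J x (Φ s) := fun x s => hF.act_ctrW x.mem s
  have h0 : ∀ w, brL ldeg (lctr J') (lctr J) 1 (Φ ∘ₗ act d' - act d ∘ₗ Φ) w (projW M') = 0 := by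
    intro w
    have h1 := brL_natural (deg := ldeg) (deg' := ldeg) (ι₀ := lctr J') (ι₁ := lctr J)
      (ι₂ := lctr J) id (fun _ => rfl) Φ (fun x s => (hΦ x s).symm) 1 (act d) w (projW M')
    rw [List.map_id] at h1
    rw [brL_sub, brL_postcomp Φ hΦ, LinearMap.sub_apply, LinearMap.comp_apply, sub_eq_zero]
    refine Eq.trans ?_ h1.symm
    have e1 : brL ldeg (lctr J') (lctr J') 1 (act d') w (projW M')
      = kap J' (X.XL w) (X.σL w) := hd' w
    have e2 : brL ldeg (lctr J) (lctr J) 1 (act d) w (projW M) = kap J (X.XL w) (X.σL w) := hd w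
    rw [e1, show Φ (projW M') = projW M from hF.act_projW, e2]
    exact hF.act_kap _ _
  rw [cls_wordC J', ← sub_eq_zero]
  exact word_brL_eq_zero Set.univ _ (projW M') 1 _ (fun w _ _ => h0 w)
    (u.map fun i => jl J' α (b.dl i)) [] (fun _ _ => trivial) (fun _ _ => trivial) (le_refl _)

end Transport

/-! ### Uniqueness of the Chevalley–Eilenberg complex of a pair -/

section Uniqueness

variable {k : Type u} [Field k] [CharZero k]

/-- Two Chevalley-Eilenberg complexes of the same pair are isomorphic. -/
theorem Encodes.nonempty_iso {P : FlatSHLR k} {C C' : CE k} (h : Encodes P C) (h' : Encodes P C') :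
    Nonempty (C ≅ C') := by
  cases h with
  | intro A L hL X M hM d J hJ =>
  cases h' with
  | intro _ _ _ _ M' hM' d' J' hJ' =>
  obtain ⟨F, hF⟩ := exists_symOver J J' hM'
  obtain ⟨G, hG⟩ := exists_symOver J' J hM
  let e : (DProAlg.mk (symPro M) d.d d.der d.sq) ≅ (DProAlg.mk (symPro M') d'.d d'.der d'.sq) :=
    { hom := ⟨F, hF.comm hM' hJ.star hJ'.star⟩
      inv := ⟨G, hG.comm hM hJ'.star hJ.star⟩
      hom_inv_id := DProAlg.Hom.ext (hF.comp_eq_id hM hG)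
      inv_hom_id := DProAlg.Hom.ext (hG.comp_eq_id hM' hF) }
  let C : CEObj k := ⟨A, M, hM, d⟩
  let C' : CEObj k := ⟨A, M', hM', d'⟩
  let i : C.toFcdga.obj ≅ C'.toFcdga.obj := Comma.isoMk e (Iso.refl A)
    (DProAlg.Hom.ext (hF.comp_symProj.trans (Category.comp_id _).symm))
  exact ⟨(fullyFaithfulInducedFunctor (CEObj.toFcdga (k := k))).preimageIso
    ((ObjectProperty.fullyFaithfulι _).preimageIso i)⟩

end Uniqueness

end

end SHLieRinehart

/-! ### The theorem -/

theorem mainTheorem3 (k : Type u) [Field k] [CharZero k] :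
    (∀ (A : DGCA k) (L : DGMod A), L.IsGradedFlat →
      (∃ M : ProObj (GMod A.toGAlg), IsProFinite M ∧ Nonempty (Duality M L.toGMod.shift)) ∧
      ∀ M : ProObj (GMod A.toGAlg), IsProFinite M → ∀ J : Duality M L.toGMod.shift,
        ∃ Φ : SHLR A L ≃ {d : CEDiff A M // ∃ dl, d.IsLinearPart dl ∧ J.IsDualDiff dl L.d},
          ∀ (X : SHLR A L) (d : CEDiff A M), Corresponds J X.toMultiDer d ↔ (Φ X : CEDiff A M) = d) ∧
    ((inducedFunctor (CEObj.toFcdga (k := k)) : CE k ⥤ Fcdga k).Full ∧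
      (inducedFunctor (CEObj.toFcdga (k := k)) : CE k ⥤ Fcdga k).Faithful) ∧
    (∀ P : FlatSHLR k, ∃ C : CE k, Encodes P C) ∧
    (∀ C : CE k, ∃ P : FlatSHLR k, Encodes P C) ∧
    (∀ (P : FlatSHLR k) (C C' : CE k), Encodes P C → Encodes P C' → Nonempty (C ≅ C')) ∧
    (∀ F : FlatSHLR k → CE k, (∀ P, Encodes P (F P)) →
      (inducedFunctor (fun P : FlatSHLR k => Opposite.op (F P))).IsEquivalence) := by
  have h4 : ∀ C : CE k, ∃ P : FlatSHLR k, Encodes P C := CEObj.exists_encodes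
  refine ⟨fun A L hL => ⟨GMod.IsFlat.exists_duality (V := L.toGMod.shift) hL,
    fun M hM J => exists_equiv_corresponds hM J⟩, ⟨inferInstance, inferInstance⟩, fun P => ?_, h4,
    fun P C C' => Encodes.nonempty_iso, fun F hF => ?_⟩
  · obtain ⟨A, L, hL, X⟩ := P
    obtain ⟨M, hM, ⟨J⟩⟩ := GMod.IsFlat.exists_duality (V := L.toGMod.shift) hL
    obtain ⟨d, hd, -⟩ := exists_unique_corresponds hM J X.σ_zero X.squareZero
    exact ⟨⟨A, M, hM, d⟩, Encodes.intro A L hL X M hM d J hd⟩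
  -- Morphisms of pairs are morphisms of the chosen complexes by definition, so the functor is full
  -- and faithful. For essential surjectivity, a complex encodes some pair P and is then isomorphic
  -- to the complex chosen for P.
  · have : (inducedFunctor (fun P : FlatSHLR k => Opposite.op (F P))).EssSurj := ⟨fun C => by
      obtain ⟨P, hP⟩ := h4 C.unop
      obtain ⟨e⟩ := Encodes.nonempty_iso hP (hF P)
      exact ⟨P, ⟨e.op⟩⟩⟩
    exact {}
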